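/- **Setting.** Let $g:\mathbb R\to\mathbb R$ be periodic with period one, bounded below by a positive constant, four times differentiable with bounded fourth derivative, and with $\int_0^1 g=1$; let $f(x)=g(x)I[0\le x\le 1]$. On $[0,1]$ put $d(x,y)=\min\{|x-y|,1-|x-y|\}$. Let $r_n\in[0,1/2]$ with $r_n\to0$. For each $n$ let $X_1,\dots,X_n$ be independent with density $f$, and let $A_{ij}=I[d(X_i,X_j)\le r_n]$ for $i\ne j$ and $A_{ii}=0$. The global clustering coefficient is $$\mathcal C_n=\frac{\sum_{i\ne j\ne k}A_{ij}A_{jk}A_{ki}}{\sum_{i\ne j\ne k}A_{ij}A_{jk}},$$ where the sums run over triples of pairwise distinct indices in $\{1,\dots,n\}$ (and $\mathcal C_n=0$ if the denominator vanishes). Let $X_1,X_2,X_3,X_4$ be independent with density $f$, with $A_{ij}$ built from them in the same way, and put $\mu_n=\mathbb E[A_{12}A_{13}A_{23}]/\mathbb E[A_{12}A_{13}]$ (with $0/0=0$), $$c_f=\frac{\mathbb E[(f'(X_1))^2]}{\mathbb E[f^2(X_1)]},\qquad \sigma_1^2=\mathbb E\Big[\big(-3c_ff^2(X_1)-2f(X_1)f''(X_1)-(f'(X_1))^2\big)^2\Big],$$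 $$h(X_i,X_j,X_k)=A_{ij}A_{ik}A_{jk}-\frac{\mu_n}{3}\big(A_{ij}A_{ik}+A_{ij}A_{jk}+A_{ik}A_{jk}\big),\qquad \sigma_{2n}^2=\mathbb E[h(X_1,X_2,X_3)h(X_1,X_2,X_4)].$$ **Theorem.** As $n\to\infty$, with $\Rightarrow$ denoting convergence in distribution: (I) If $nr_n^5\to\infty$ and $\sigma_1^2>0$, then $$\frac{16\sqrt n\,\mathbb E[f^2(X_1)]}{3r_n^2\sigma_1}\,(\mathcal C_n-\mu_n)\Rightarrow N(0,1).$$ (II) If $nr_n\to\infty$, then $\sigma_{2n}^2=\Theta(r_n^3)$. If in addition $nr_n^5\to0$ or $f$ is the uniform density on $[0,1]$, then $$\frac{2\sqrt2\,nr_n^2\,\mathbb E[f^2(X_1)]}{3\sigma_{2n}}\,(\mathcal C_n-\mu_n)\Rightarrow N(0,1).$$ (III) If $nr_n\to0$ and $n^3r_n^2\to\infty$, then $$\frac{8n\sqrt n\,r_n\sqrt{\mathbb E[f^2(X_1)]}}{3}\,(\mathcal C_n-\mu_n)\Rightarrow N(0,1).$$ Moreover, whenever $n^3r_n^2\to\infty$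 (in particular in each of the regimes (I), (II), (III)), $\mathcal C_n\to 3/4$ in probability. -/

import Mathlib

open MeasureTheory ProbabilityTheory Filter Asymptotics
open scoped Topology

namespace RGG

noncomputable section

/-- The probability density `f(x) = g(x) I[0 ≤ x ≤ 1]`. -/
def density (g : ℝ → ℝ) : ℝ → ℝ := (Set.Icc (0 : ℝ) 1).indicator g

/-- The law on `ℝ` of one vertex position: Lebesgue measure with density `f = g I[0 ≤ x ≤ 1]`. -/
def law (g : ℝ → ℝ) : Measure ℝ := volume.withDensity fun x => ENNReal.ofReal (density g x)

/-- `d(x, y) = min {|x - y|, 1 - |x - y|}`, the distance on the circle of circumference one. -/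
def circDist (x y : ℝ) : ℝ := min |x - y| (1 - |x - y|)

/-- The geometric graph with connectivity radius `r` on the points `x i`. -/
def graph {ι : Type*} (r : ℝ) (x : ι → ℝ) : SimpleGraph ι where
  Adj i j := i ≠ j ∧ circDist (x i) (x j) ≤ r
  symm := ⟨fun i j h => ⟨h.1.symm, by
    have := h.2
    simpa only [circDist, abs_sub_comm] using this⟩⟩
  loopless := ⟨fun _ h => h.1 rfl⟩

open Classical in
/-- The adjacency matrix `A` of the geometric graph. -/
def adj {ι : Type*} (r : ℝ) (x : ι → ℝ) : Matrix ι ι ℝ := (graph r x).adjMatrix ℝ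

/-- The global clustering coefficient of a graph with adjacency matrix `A`; the sums run over
the triples of pairwise distinct indices. -/
def clustering {ι : Type*} [Fintype ι] [DecidableEq ι] (A : Matrix ι ι ℝ) : ℝ :=
  (∑ i, ∑ j, ∑ k, if i ≠ j ∧ i ≠ k ∧ j ≠ k then A i j * A j k * A k i else 0) /
    (∑ i, ∑ j, ∑ k, if i ≠ j ∧ i ≠ k ∧ j ≠ k then A i j * A j k else 0)

/-- The joint law of `m` independent positions `X₁, …, Xₘ` (indexed from `0`). -/
def iidLaw (g : ℝ → ℝ) (m : ℕ) : Measure (Fin m → ℝ) := Measure.pi fun _ => law g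

/-- `μ = E[A₁₂ A₁₃ A₂₃] / E[A₁₂ A₁₃]` for connectivity radius `r`. -/
def mu (g : ℝ → ℝ) (r : ℝ) : ℝ :=
  (∫ x, adj r x 0 1 * adj r x 0 2 * adj r x 1 2 ∂(iidLaw g 3)) /
    (∫ x, adj r x 0 1 * adj r x 0 2 ∂(iidLaw g 3))

/-- `h(Xᵢ, Xⱼ, Xₖ) = Aᵢⱼ Aᵢₖ Aⱼₖ - (μ / 3) (Aᵢⱼ Aᵢₖ + Aᵢⱼ Aⱼₖ + Aᵢₖ Aⱼₖ)`. -/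
def hKernel (g : ℝ → ℝ) (r : ℝ) {ι : Type*} (x : ι → ℝ) (i j k : ι) : ℝ :=
  adj r x i j * adj r x i k * adj r x j k -
    mu g r / 3 *
      (adj r x i j * adj r x i k + adj r x i j * adj r x j k + adj r x i k * adj r x j k)

/-- `σ₂² = E[h(X₁, X₂, X₃) h(X₁, X₂, X₄)]` for connectivity radius `r`. -/
def sigma2Sq (g : ℝ → ℝ) (r : ℝ) : ℝ :=
  ∫ x, hKernel g r x 0 1 2 * hKernel g r x 0 1 3 ∂(iidLaw g 4)

/-- `E[f(X₁)²]`. -/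
def Ef2 (g : ℝ → ℝ) : ℝ := ∫ x, density g x ^ 2 ∂(law g)

/-- `c_f = E[f'(X₁)²] / E[f(X₁)²]`. Inside `(0, 1)` the derivatives of `f` are those of `g`. -/
def cf (g : ℝ → ℝ) : ℝ := (∫ x, deriv g x ^ 2 ∂(law g)) / Ef2 g

/-- `σ₁² = E[(-3 c_f f(X₁)² - 2 f(X₁) f''(X₁) - f'(X₁)²)²]`. -/
def sigma1Sq (g : ℝ → ℝ) : ℝ :=
  ∫ x, (-3 * cf g * density g x ^ 2 - 2 * density g x * iteratedDeriv 2 g x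
    - deriv g x ^ 2) ^ 2 ∂(law g)

end

end RGG

/-! The difference between the clustering coefficient and μ is a ratio. Its numerator is the sum
over ordered triples of h = tri − μ · path (`centKer`), which has mean zero by the choice of μ. Its
denominator is the sum of `path`, which concentrates at 4 n³ r² E f² once n³ r² → ∞. The limit 3/4
is a ratio of areas: given X₁ = x, the triangle and path means are, to leading order, f(x)² times
the area 3 r² of the hexagon |u|, |v|, |u − v| ≤ r and the area 4 r² of the square |u|, |v| ≤ r.

Hoeffding's decomposition (`distinctSum₃_hoeffding`) splits the numerator into a linear, a
degenerate quadratic and a degenerate cubic part, with variances of order n⁵ r⁸ (if σ₁ > 0), n⁴ r³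
and n³ r². The exponent 8 comes from a cancellation: the one-point projections of tri and path are
both of order r², but their leading terms cancel in h up to O(r⁴) because μ = 3/4 + O(r²). What
survives is r⁴/4 times the function inside σ₁ (`exists_abs_proj₁_centKer_sub_le`). Consecutive
variances have ratios n r⁵ and n r, so these two quantities decide which part dominates; this
produces the three regimes. For the uniform density the linear part vanishes by rotation invariance.

In every regime the dominating statistic W is shown to be asymptotically normal by the single
estimate `norm_charFun_sub_le`, a form of Stein's method for characteristic functions. Write W = d⁻¹
∑ Δᵢ with W − Δᵢ independent of the i-th point, where d = 1, 2, 3 is the degree of the statistic. If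
the Δᵢ are small with nearly vanishing conditional means and ∑ Δᵢ² is close to d, then φ' + tφ is
small, which pins φ to exp(−t²/2). The dense case has bounded summands (`norm_charFun_sum_le`). The
intermediate case needs small fourth moments and a small contraction of the quadratic kernel
(`norm_charFun_distinctSum₂_le`). The sparse case keeps the whole kernel h and uses that a vertex
rarely has more than two neighbours, measured by factorial moments (`norm_charFun_distinctSum₃_le`).

The passage from the numerator to the ratio is a quantitative Slutsky argument
(`norm_cexp_ratio_sub_le`), fed only with second moments. -/

namespace RGG

/-! ### Calculus of bounded measurable functions. -/

/-- Bounded measurable real functions. -/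
@[fun_prop]
structure BddMeas {α : Type*} [MeasurableSpace α] (f : α → ℝ) : Prop where
  measurable : Measurable f
  bdd : ∃ C, ∀ x, |f x| ≤ C

namespace BddMeas
variable {α β : Type*} [MeasurableSpace α] [MeasurableSpace β] {f g : α → ℝ}

@[fun_prop]
theorem const (c : ℝ) : BddMeas (fun _ : α => c) := ⟨measurable_const, |c|, fun _ => le_rfl⟩

@[fun_prop]
theorem add (hf : BddMeas f) (hg : BddMeas g) : BddMeas (fun x => f x + g x) := by
  obtain ⟨C, hC⟩ := hf.bdd
  obtain ⟨D, hD⟩ := hg.bdd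
  exact ⟨hf.1.add hg.1, C + D, fun x => (abs_add_le _ _).trans (add_le_add (hC x) (hD x))⟩

@[fun_prop]
theorem neg (hf : BddMeas f) : BddMeas (fun x => - f x) := by
  obtain ⟨C, hC⟩ := hf.bdd
  exact ⟨hf.1.neg, C, fun x => by simpa using hC x⟩

@[fun_prop]
theorem sub (hf : BddMeas f) (hg : BddMeas g) : BddMeas (fun x => f x - g x) := by
  simpa [sub_eq_add_neg] using hf.add hg.neg

@[fun_prop]
theorem mul (hf : BddMeas f) (hg : BddMeas g) : BddMeas (fun x => f x * g x) := by
  obtain ⟨C, hC⟩ := hf.bdd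
  obtain ⟨D, hD⟩ := hg.bdd
  refine ⟨hf.1.mul hg.1, C * D, fun x => ?_⟩
  rw [abs_mul]
  exact mul_le_mul (hC x) (hD x) (abs_nonneg _) ((abs_nonneg _).trans (hC x))

@[fun_prop]
theorem comp {f : β → ℝ} (hf : BddMeas f) {u : α → β} (hu : Measurable u) :
    BddMeas (fun x => f (u x)) := by
  obtain ⟨C, hC⟩ := hf.bdd
  exact ⟨hf.1.comp hu, C, fun x => hC _⟩

@[fun_prop]
theorem pow (hf : BddMeas f) (m : ℕ) : BddMeas (fun x => f x ^ m) := by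
  obtain ⟨C, hC⟩ := hf.bdd
  refine ⟨hf.1.pow_const m, C ^ m, fun x => ?_⟩
  rw [abs_pow]
  exact pow_le_pow_left₀ (abs_nonneg _) (hC x) m

@[fun_prop]
theorem abs (hf : BddMeas f) : BddMeas (fun x => |f x|) := by
  obtain ⟨C, hC⟩ := hf.bdd
  exact ⟨hf.1.abs, C, fun x => by simpa using hC x⟩

@[fun_prop]
theorem min (hf : BddMeas f) (hg : BddMeas g) : BddMeas (fun x => min (f x) (g x)) := by
  obtain ⟨C, hC⟩ := hf.bdd
  obtain ⟨D, hD⟩ := hg.bdd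
  refine ⟨hf.1.min hg.1, max C D, fun x => ?_⟩
  rcases min_choice (f x) (g x) with h | h <;> rw [h]
  · exact (hC x).trans (le_max_left _ _)
  · exact (hD x).trans (le_max_right _ _)

@[fun_prop]
theorem sum {τ : Type*} (T : Finset τ) {F : τ → α → ℝ} (hF : ∀ a, BddMeas (F a)) :
    BddMeas (fun x => ∑ a ∈ T, F a x) := by
  classical
  induction T using Finset.induction_on with
  | empty => simpa using const 0
  | insert a T ha ih =>
    simp only [Finset.sum_insert ha]
    exact (hF a).add ih

@[fun_prop]
theorem ite (p : Prop) [Decidable p] (hf : BddMeas f) (hg : BddMeas g) :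
    BddMeas (fun x => if p then f x else g x) := by
  by_cases h : p <;> simpa [h]

@[fun_prop]
theorem integral {F : α → β → ℝ} {ν : Measure β} [IsProbabilityMeasure ν]
    (hF : BddMeas (fun p : α × β => F p.1 p.2)) : BddMeas (fun x => ∫ y, F x y ∂ν) := by
  obtain ⟨C, hC⟩ := hF.bdd
  refine ⟨(hF.1.stronglyMeasurable.integral_prod_right' (ν := ν)).measurable, C, fun x => ?_⟩
  have := norm_integral_le_of_norm_le_const (μ := ν) (f := F x) (C := C)
    (ae_of_all _ fun y => hC (x, y))
  simpa using this

theorem integrable (hf : BddMeas f) (P : Measure α) [IsFiniteMeasure P] : Integrable f P := by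
  obtain ⟨C, hC⟩ := hf.bdd
  exact Integrable.of_bound hf.1.aestronglyMeasurable C (ae_of_all _ hC)

end BddMeas

/-! ### Product measures: resampling a coordinate, second moments of degenerate sums. -/

section Pi

variable {ι S : Type*} [Fintype ι] [DecidableEq ι] [MeasurableSpace S]
  (ν : Measure S) [IsProbabilityMeasure ν]

/-- Overwriting one coordinate by an independent copy does not change the product law: on a box, the
overwritten side is freed and the new value supplies its mass. Conditional expectation given the
other coordinates thus becomes an integral over `Function.update`, with no splitting of product
spaces. -/
theorem measurePreserving_update (i : ι) :
    MeasurePreserving (fun p : (ι → S) × S => Function.update p.1 i p.2)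
      ((Measure.pi fun _ => ν).prod ν) (Measure.pi fun _ => ν) := by
  refine ⟨measurable_update', (Measure.pi_eq fun s hs => ?_).symm⟩
  rw [Measure.map_apply measurable_update' (MeasurableSet.univ_pi hs)]
  have : (fun p : (ι → S) × S => Function.update p.1 i p.2) ⁻¹' (Set.univ.pi s)
      = (Set.univ.pi (Function.update s i Set.univ)) ×ˢ s i := by
    ext p
    simp only [Set.mem_preimage, Set.mem_pi, Set.mem_univ, forall_const, Set.mem_prod]
    constructor
    · intro h
      refine ⟨fun j => ?_, by simpa using h i⟩
      by_cases hj : j = i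
      · subst hj; simp
      · simpa [hj] using h j
    · rintro ⟨h, h'⟩ j
      by_cases hj : j = i
      · subst hj; simpa using h'
      · simpa [hj] using h j
  rw [this, Measure.prod_prod, Measure.pi_pi]
  rw [← Finset.mul_prod_erase _ _ (Finset.mem_univ i), ← Finset.mul_prod_erase _ _ (Finset.mem_univ i)]
  simp only [Function.update_self, measure_univ, one_mul]
  rw [mul_comm]
  congr 1
  refine Finset.prod_congr rfl fun j hj => ?_
  rw [Function.update_of_ne (Finset.ne_of_mem_erase hj)]

theorem integral_update {E : Type*} [NormedAddCommGroup E] [NormedSpace ℝ E]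
    (i : ι) {F : (ι → S) → E} (hF : Integrable F (Measure.pi fun _ => ν)) :
    ∫ x, F x ∂(Measure.pi fun _ => ν)
      = ∫ x, ∫ y, F (Function.update x i y) ∂ν ∂(Measure.pi fun _ => ν) := by
  have hm := measurePreserving_update (ι := ι) ν i
  have h1 : ∫ x, F x ∂(Measure.pi fun _ => ν) = ∫ p : (ι → S) × S, F (Function.update p.1 i p.2)
      ∂((Measure.pi fun _ => ν).prod ν) := by
    conv_lhs => rw [← hm.map_eq]
    refine integral_map hm.measurable.aemeasurable ?_
    rw [hm.map_eq]
    exact hF.aestronglyMeasurable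
  rw [h1, integral_prod]
  exact hm.integrable_comp_of_integrable hF

theorem integral_pi_one (i : ι) {f : S → ℝ} (hf : BddMeas f) :
    ∫ x : ι → S, f (x i) ∂(Measure.pi fun _ => ν) = ∫ y, f y ∂ν := by
  rw [integral_update ν i (BddMeas.integrable (by fun_prop) _)]
  simp

theorem integral_pi_two {i j : ι} (hij : i ≠ j) {f : S → S → ℝ}
    (hf : BddMeas (fun p : S × S => f p.1 p.2)) :
    ∫ x : ι → S, f (x i) (x j) ∂(Measure.pi fun _ => ν) = ∫ y, ∫ z, f y z ∂ν ∂ν := by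
  rw [integral_update ν j (BddMeas.integrable (by fun_prop) _)]
  simp only [Function.update_self, Function.update_of_ne hij]
  exact integral_pi_one ν i (f := fun y => ∫ z, f y z ∂ν) (by fun_prop)

theorem integral_pi_three {i j k : ι} (hij : i ≠ j) (hik : i ≠ k) (hjk : j ≠ k)
    {f : S → S → S → ℝ} (hf : BddMeas (fun p : S × S × S => f p.1 p.2.1 p.2.2)) :
    ∫ x : ι → S, f (x i) (x j) (x k) ∂(Measure.pi fun _ => ν)
      = ∫ y, ∫ z, ∫ w, f y z w ∂ν ∂ν ∂ν := by
  rw [integral_update ν k (BddMeas.integrable (by fun_prop) _)]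
  simp only [Function.update_self, Function.update_of_ne hik, Function.update_of_ne hjk]
  exact integral_pi_two ν hij (f := fun y z => ∫ w, f y z w ∂ν) (by fun_prop)

/-- Second moment of a sum of functions, each of which integrates to zero in every coordinate of
its support. -/
theorem integral_sq_sum_le_of_degenerate {τ : Type*} (T : Finset τ)
    (supp : τ → Finset ι) (F : τ → (ι → S) → ℝ) (hF : ∀ a, BddMeas (F a))
    (hdeg : ∀ a ∈ T, ∀ i ∈ supp a, ∀ x, ∫ y, F a (Function.update x i y) ∂ν = 0)
    (hindep : ∀ a ∈ T, ∀ b ∈ T, ∀ i ∈ supp a, i ∉ supp b → ∀ x y,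
      F b (Function.update x i y) = F b x)
    {V : ℝ} (hV : ∀ a ∈ T, ∫ x, F a x ^ 2 ∂(Measure.pi fun _ => ν) ≤ V)
    (L : ℕ) (hL : ∀ a ∈ T, (T.filter fun b => supp b = supp a).card ≤ L) :
    ∫ x, (∑ a ∈ T, F a x) ^ 2 ∂(Measure.pi fun _ => ν) ≤ T.card * (L * V) := by
  set π : Measure (ι → S) := Measure.pi fun _ => ν with hπ
  have hint : ∀ a b, Integrable (fun x => F a x * F b x) π := fun a b =>
    ((hF a).mul (hF b)).integrable _
  -- An index in one support but not the other kills the covariance: integrating it out treats `F b`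
  -- as a constant and annihilates `F a`. Two distinct supports always provide such an index on one
  -- side or the other.
  have key : ∀ a ∈ T, ∀ b ∈ T, ∀ i ∈ supp a, i ∉ supp b → ∫ x, F a x * F b x ∂π = 0 := by
    intro a ha b hb i hi hib
    rw [hπ, integral_update ν i (hint a b)]
    simp_rw [hindep a ha b hb i hi hib, integral_mul_const, hdeg a ha i hi]
    simp
  have hzero : ∀ a ∈ T, ∀ b ∈ T, supp b ≠ supp a → ∫ x, F a x * F b x ∂π = 0 := by
    intro a ha b hb hab
    by_cases h : supp a ⊆ supp b
    · obtain ⟨i, hi, hi'⟩ := Finset.exists_of_ssubset (lt_of_le_of_ne h (Ne.symm hab))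
      simp_rw [mul_comm (F a _)]
      exact key b hb a ha i hi hi'
    · obtain ⟨i, hi, hi'⟩ := Finset.not_subset.1 h
      exact key a ha b hb i hi hi'
  have hle : ∀ a ∈ T, ∀ b ∈ T, ∫ x, F a x * F b x ∂π ≤ V := by
    intro a ha b hb
    have h1 : ∫ x, F a x * F b x ∂π ≤ ∫ x, (F a x ^ 2 + F b x ^ 2) / 2 ∂π := by
      refine integral_mono (hint a b) ?_ fun x => ?_
      · exact ((((hF a).pow 2).add ((hF b).pow 2)).integrable _).div_const 2
      · have := sq_nonneg (F a x - F b x)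
        dsimp only
        linarith
    rw [integral_div, integral_add (((hF a).pow 2).integrable _) (((hF b).pow 2).integrable _)] at h1
    linarith [hV a ha, hV b hb]
  have hexp : ∫ x, (∑ a ∈ T, F a x) ^ 2 ∂π = ∑ a ∈ T, ∑ b ∈ T, ∫ x, F a x * F b x ∂π := by
    simp_rw [sq, Finset.sum_mul_sum]
    rw [integral_finsetSum _ fun a _ => integrable_finsetSum _ fun b _ => hint a b]
    exact Finset.sum_congr rfl fun a _ => integral_finsetSum _ fun b _ => hint a b
  rw [hexp, ← nsmul_eq_mul]
  refine Finset.sum_le_card_nsmul _ _ _ fun a ha => ?_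
  have hV0 : 0 ≤ V := (integral_nonneg fun x => sq_nonneg _).trans (hV a ha)
  calc ∑ b ∈ T, ∫ x, F a x * F b x ∂π
      = ∑ b ∈ T.filter (fun b => supp b = supp a), ∫ x, F a x * F b x ∂π := by
        rw [Finset.sum_filter]
        refine Finset.sum_congr rfl fun b hb => ?_
        split_ifs with h
        · rfl
        · exact hzero a ha b hb h
    _ ≤ (T.filter (fun b => supp b = supp a)).card • V :=
        Finset.sum_le_card_nsmul _ _ _ fun b hb => hle a ha b (Finset.mem_filter.1 hb).1
    _ ≤ L * V := by
        rw [nsmul_eq_mul]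
        exact mul_le_mul_of_nonneg_right (by exact_mod_cast hL a ha) hV0

end Pi

/-! ### Sums over distinct pairs and triples; the algebra of Hoeffding's decomposition. -/

section Sums

variable {ι S : Type*} [Fintype ι] [DecidableEq ι]

/-- Sum of `q (x i) (x j)` over ordered pairs of distinct indices. -/
def distinctSum₂ (q : S → S → ℝ) (x : ι → S) : ℝ :=
  ∑ i, ∑ j, if i ≠ j then q (x i) (x j) else 0

/-- Sum of `k (x i) (x j) (x l)` over ordered triples of distinct indices. -/
def distinctSum₃ (k : S → S → S → ℝ) (x : ι → S) : ℝ :=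
  ∑ i, ∑ j, ∑ l, if i ≠ j ∧ i ≠ l ∧ j ≠ l then k (x i) (x j) (x l) else 0

/-- The ordered pairs of distinct indices. -/
def distinctPairs (ι : Type*) [Fintype ι] [DecidableEq ι] : Finset (ι × ι) :=
  Finset.univ.filter fun p => p.1 ≠ p.2

/-- The ordered triples of distinct indices. -/
def distinctTriples (ι : Type*) [Fintype ι] [DecidableEq ι] : Finset (ι × ι × ι) :=
  Finset.univ.filter fun p => p.1 ≠ p.2.1 ∧ p.1 ≠ p.2.2 ∧ p.2.1 ≠ p.2.2

theorem distinctSum₂_eq (q : S → S → ℝ) (x : ι → S) :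
    distinctSum₂ q x = ∑ p ∈ distinctPairs ι, q (x p.1) (x p.2) := by
  rw [distinctPairs, Finset.sum_filter, Fintype.sum_prod_type, distinctSum₂]

theorem distinctSum₃_eq (k : S → S → S → ℝ) (x : ι → S) :
    distinctSum₃ k x = ∑ p ∈ distinctTriples ι, k (x p.1) (x p.2.1) (x p.2.2) := by
  rw [distinctTriples, Finset.sum_filter, Fintype.sum_prod_type, distinctSum₃]
  simp_rw [Fintype.sum_prod_type]

theorem card_distinctPairs_le : (distinctPairs ι).card ≤ Fintype.card ι ^ 2 := by
  refine (Finset.card_le_univ _).trans ?_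
  simp [Fintype.card_prod, sq]

theorem card_distinctTriples_le : (distinctTriples ι).card ≤ Fintype.card ι ^ 3 := by
  refine (Finset.card_le_univ _).trans ?_
  simp [Fintype.card_prod, pow_succ, mul_assoc]

theorem sum_ne_const (i : ι) (c : ℝ) :
    ∑ j, (if i ≠ j then c else 0) = ((Fintype.card ι : ℝ) - 1) * c := by
  have : ∀ j, (if i ≠ j then c else 0) = c - if i = j then c else 0 := fun j => by
    by_cases h : i = j <;> simp [h]
  simp_rw [this, Finset.sum_sub_distrib]
  simp [sub_mul]

theorem sum_ne_ne_const {i j : ι} (hij : i ≠ j) (c : ℝ) :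
    ∑ l, (if i ≠ l ∧ j ≠ l then c else 0) = ((Fintype.card ι : ℝ) - 2) * c := by
  have : ∀ l, (if i ≠ l ∧ j ≠ l then c else 0)
      = c - (if i = l then c else 0) - if j = l then c else 0 := fun l => by
    by_cases h : i = l
    · subst h; simp [hij.symm]
    · by_cases h' : j = l <;> simp [h, h']
  simp_rw [this, Finset.sum_sub_distrib]
  simp only [Finset.sum_const, Finset.card_univ, nsmul_eq_mul, Finset.sum_ite_eq,
    Finset.mem_univ, if_true]
  ring

theorem distinctSum₃_add (k k' : S → S → S → ℝ) (x : ι → S) :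
    distinctSum₃ (fun a b c => k a b c + k' a b c) x = distinctSum₃ k x + distinctSum₃ k' x := by
  simp only [distinctSum₃_eq, Finset.sum_add_distrib]

theorem distinctSum₂_add (q q' : S → S → ℝ) (x : ι → S) :
    distinctSum₂ (fun a b => q a b + q' a b) x = distinctSum₂ q x + distinctSum₂ q' x := by
  simp only [distinctSum₂_eq, Finset.sum_add_distrib]

theorem distinctSum₃_const_mul (c : ℝ) (k : S → S → S → ℝ) (x : ι → S) :
    distinctSum₃ (fun a b d => c * k a b d) x = c * distinctSum₃ k x := by
  simp only [distinctSum₃_eq, Finset.mul_sum]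

theorem distinctSum₃_swap (k : S → S → S → ℝ) (x : ι → S) :
    distinctSum₃ (fun a b c => k b a c) x = distinctSum₃ k x := by
  unfold distinctSum₃
  rw [Finset.sum_comm]
  refine Finset.sum_congr rfl fun i _ => Finset.sum_congr rfl fun j _ =>
    Finset.sum_congr rfl fun l _ => ?_
  refine if_congr ?_ rfl rfl
  tauto

theorem distinctSum₃_swap' (k : S → S → S → ℝ) (x : ι → S) :
    distinctSum₃ (fun a b c => k a c b) x = distinctSum₃ k x := by
  unfold distinctSum₃
  refine Finset.sum_congr rfl fun i _ => ?_
  rw [Finset.sum_comm]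
  refine Finset.sum_congr rfl fun j _ => Finset.sum_congr rfl fun l _ => ?_
  refine if_congr ?_ rfl rfl
  tauto

theorem distinctSum₂_swap (q : S → S → ℝ) (x : ι → S) :
    distinctSum₂ (fun a b => q b a) x = distinctSum₂ q x := by
  unfold distinctSum₂
  rw [Finset.sum_comm]
  refine Finset.sum_congr rfl fun i _ => Finset.sum_congr rfl fun j _ => ?_
  refine if_congr ?_ rfl rfl
  tauto

theorem distinctSum₃_pair (q : S → S → ℝ) (x : ι → S) :
    distinctSum₃ (fun a b _ => q a b) x = ((Fintype.card ι : ℝ) - 2) * distinctSum₂ q x := by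
  unfold distinctSum₃ distinctSum₂
  simp_rw [Finset.mul_sum]
  refine Finset.sum_congr rfl fun i _ => Finset.sum_congr rfl fun j _ => ?_
  by_cases h : i = j
  · simp [h]
  · rw [if_pos h, ← sum_ne_ne_const h]
    refine Finset.sum_congr rfl fun l _ => if_congr ?_ rfl rfl
    tauto

theorem distinctSum₂_single (p : S → ℝ) (x : ι → S) :
    distinctSum₂ (fun a _ => p a) x = ((Fintype.card ι : ℝ) - 1) * ∑ i, p (x i) := by
  unfold distinctSum₂
  simp_rw [sum_ne_const, Finset.mul_sum]

/-- Algebraic form of the Hoeffding decomposition of a sum over distinct triples. -/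
theorem distinctSum₃_decomp (k : S → S → S → ℝ) (p₂ : S → S → ℝ) (p₁ : S → ℝ) (m : ℝ)
    (x : ι → S) :
    distinctSum₃ k x =
      distinctSum₃ (fun a b c => k a b c - p₂ a b - p₂ a c - p₂ b c + p₁ a + p₁ b + p₁ c - m) x
      + 3 * ((Fintype.card ι : ℝ) - 2) * distinctSum₂ (fun a b => p₂ a b - p₁ a - p₁ b + m) x
      + 3 * ((Fintype.card ι : ℝ) - 1) * ((Fintype.card ι : ℝ) - 2) * ∑ i, (p₁ (x i) - m)
      + (Fintype.card ι : ℝ) * ((Fintype.card ι : ℝ) - 1) * ((Fintype.card ι : ℝ) - 2) * m := by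
  set q₃ : S → S → S → ℝ :=
    fun a b c => k a b c - p₂ a b - p₂ a c - p₂ b c + p₁ a + p₁ b + p₁ c - m with hq₃
  set q₂ : S → S → ℝ := fun a b => p₂ a b - p₁ a - p₁ b + m with hq₂
  -- The kernel is rebuilt from centred pieces of fewer variables. Summing a piece over the indices
  -- it ignores produces the factors n − 2 and n − 1.
  have e : k = fun a b c => q₃ a b c + (q₂ a b + (q₂ a c + (q₂ b c +
      ((p₁ a - m) + ((p₁ b - m) + ((p₁ c - m) + m)))))) := by
    funext a b c
    simp only [hq₃, hq₂]
    ring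
  have e1 : distinctSum₃ (fun a b _ => q₂ a b) x = ((Fintype.card ι : ℝ) - 2) * distinctSum₂ q₂ x :=
    distinctSum₃_pair q₂ x
  have e2 : distinctSum₃ (fun a _ c => q₂ a c) x = ((Fintype.card ι : ℝ) - 2) * distinctSum₂ q₂ x := by
    rw [← e1, ← distinctSum₃_swap']
  have e3 : distinctSum₃ (fun _ b c => q₂ b c) x = ((Fintype.card ι : ℝ) - 2) * distinctSum₂ q₂ x := by
    rw [← e2, ← distinctSum₃_swap]
  have f1 : distinctSum₃ (fun a _ _ => p₁ a - m) x = ((Fintype.card ι : ℝ) - 2) *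
      (((Fintype.card ι : ℝ) - 1) * ∑ i, (p₁ (x i) - m)) := by
    rw [distinctSum₃_pair (fun a _ => p₁ a - m), distinctSum₂_single (fun a => p₁ a - m)]
  have f2 : distinctSum₃ (fun _ b _ => p₁ b - m) x = ((Fintype.card ι : ℝ) - 2) *
      (((Fintype.card ι : ℝ) - 1) * ∑ i, (p₁ (x i) - m)) := by
    rw [← f1, ← distinctSum₃_swap]
  have f3 : distinctSum₃ (fun _ _ c => p₁ c - m) x = ((Fintype.card ι : ℝ) - 2) *
      (((Fintype.card ι : ℝ) - 1) * ∑ i, (p₁ (x i) - m)) := by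
    rw [← f2, ← distinctSum₃_swap']
  have g : distinctSum₃ (fun _ _ _ => m) x = ((Fintype.card ι : ℝ) - 2) *
      (((Fintype.card ι : ℝ) - 1) * ((Fintype.card ι : ℝ) * m)) := by
    rw [distinctSum₃_pair (fun _ _ => m), distinctSum₂_single (fun _ => m)]
    simp
  clear_value q₂ q₃
  conv_lhs => rw [e]
  rw [distinctSum₃_add, distinctSum₃_add, distinctSum₃_add, distinctSum₃_add, distinctSum₃_add,
    distinctSum₃_add, distinctSum₃_add, e1, e2, e3, f1, f2, f3, g]
  ring

end Sums

/-! ### Second moments of completely degenerate sums. -/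

section Moments

variable {ι S : Type*} [Fintype ι] [DecidableEq ι] [MeasurableSpace S]
  (ν : Measure S) [IsProbabilityMeasure ν]

@[fun_prop]
theorem BddMeas.distinctSum₂ {q : S → S → ℝ} (hq : BddMeas (fun p : S × S => q p.1 p.2)) :
    BddMeas (fun x : ι → S => distinctSum₂ q x) := by
  unfold RGG.distinctSum₂
  fun_prop

@[fun_prop]
theorem BddMeas.distinctSum₃ {k : S → S → S → ℝ}
    (hk : BddMeas (fun p : S × S × S => k p.1 p.2.1 p.2.2)) :
    BddMeas (fun x : ι → S => distinctSum₃ k x) := by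
  unfold RGG.distinctSum₃
  fun_prop

-- A tuple with support s is a map from `Fin d` into s, so there are at most d^d of them. This crude
-- count is the source of the multiplicities 27 and 4.
omit [Fintype ι] in
theorem card_filter_support_le {τ : Type*} (T : Finset τ) (supp : τ → Finset ι) (s : Finset ι)
    (d : ℕ) (e : τ → (Fin d → ι)) (he : Function.Injective e)
    (hs : ∀ a ∈ T, ∀ m, e a m ∈ supp a) (hd : s.card ≤ d) :
    (T.filter fun b => supp b = s).card ≤ d ^ d := by
  classical
  calc (T.filter fun b => supp b = s).card
      ≤ (Fintype.piFinset fun _ : Fin d => s).card := by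
        refine Finset.card_le_card_of_injOn e (fun b hb => ?_) he.injOn
        simp only [Finset.coe_filter, Set.mem_ofPred_eq] at hb
        simp only [Finset.mem_coe, Fintype.mem_piFinset]
        exact fun m => hb.2 ▸ hs b hb.1 m
    _ = s.card ^ d := by simp
    _ ≤ d ^ d := Nat.pow_le_pow_left hd d

omit [Fintype ι] in
theorem card_filter_triple_le (T : Finset (ι × ι × ι)) (a : ι × ι × ι) :
    (T.filter fun b => ({b.1, b.2.1, b.2.2} : Finset ι) = {a.1, a.2.1, a.2.2}).card ≤ 27 := by
  refine (card_filter_support_le T (fun b => {b.1, b.2.1, b.2.2}) _ 3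
    (fun b => ![b.1, b.2.1, b.2.2]) ?_ ?_ Finset.card_le_three).trans (by norm_num)
  · rintro ⟨a, b, c⟩ ⟨a', b', c'⟩ h
    have h0 := congrFun h 0
    have h1 := congrFun h 1
    have h2 := congrFun h 2
    simp at h0 h1 h2
    simp [h0, h1, h2]
  · intro b _ m
    fin_cases m <;> simp

omit [Fintype ι] in
theorem card_filter_pair_le (T : Finset (ι × ι)) (a : ι × ι) :
    (T.filter fun b => ({b.1, b.2} : Finset ι) = {a.1, a.2}).card ≤ 4 := by
  refine (card_filter_support_le T (fun b => {b.1, b.2}) _ 2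
    (fun b => ![b.1, b.2]) ?_ ?_ Finset.card_le_two).trans (by norm_num)
  · rintro ⟨a, b⟩ ⟨a', b'⟩ h
    have h0 := congrFun h 0
    have h1 := congrFun h 1
    simp at h0 h1
    simp [h0, h1]
  · intro b _ m
    fin_cases m <;> simp

theorem integral_sq_distinctSum₃_le {q : S → S → S → ℝ}
    (hq : BddMeas (fun p : S × S × S => q p.1 p.2.1 p.2.2))
    (h₁ : ∀ b c, ∫ a, q a b c ∂ν = 0) (h₂ : ∀ a c, ∫ b, q a b c ∂ν = 0)
    (h₃ : ∀ a b, ∫ c, q a b c ∂ν = 0) :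
    ∫ x : ι → S, distinctSum₃ q x ^ 2 ∂(Measure.pi fun _ => ν)
      ≤ 27 * (Fintype.card ι : ℝ) ^ 3 * ∫ a, ∫ b, ∫ c, q a b c ^ 2 ∂ν ∂ν ∂ν := by
  set V := ∫ a, ∫ b, ∫ c, q a b c ^ 2 ∂ν ∂ν ∂ν with hV
  have hV0 : 0 ≤ V := integral_nonneg fun _ => integral_nonneg fun _ => integral_nonneg fun _ =>
    sq_nonneg _
  simp_rw [distinctSum₃_eq]
  refine (integral_sq_sum_le_of_degenerate ν (distinctTriples ι)
    (fun p => {p.1, p.2.1, p.2.2}) (fun p x => q (x p.1) (x p.2.1) (x p.2.2))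
    (fun p => by fun_prop) ?_ ?_ (V := V) ?_ 27 fun a _ => card_filter_triple_le _ a).trans ?_
  · rintro ⟨i, j, l⟩ hp t ht x
    simp only [distinctTriples, Finset.mem_filter, Finset.mem_univ, true_and] at hp
    obtain ⟨hij, hil, hjl⟩ := hp
    simp only [Finset.mem_insert, Finset.mem_singleton] at ht
    rcases ht with rfl | rfl | rfl
    · simp [Function.update_of_ne hij.symm, Function.update_of_ne hil.symm, h₁]
    · simp [Function.update_of_ne hij, Function.update_of_ne hjl.symm, h₂]
    · simp [Function.update_of_ne hil, Function.update_of_ne hjl, h₃]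
  · rintro a _ ⟨i, j, l⟩ _ t _ ht x y
    simp only [Finset.mem_insert, Finset.mem_singleton, not_or] at ht
    simp [Function.update_of_ne (Ne.symm ht.1), Function.update_of_ne (Ne.symm ht.2.1),
      Function.update_of_ne (Ne.symm ht.2.2)]
  · rintro ⟨i, j, l⟩ hp
    simp only [distinctTriples, Finset.mem_filter, Finset.mem_univ, true_and] at hp
    exact (integral_pi_three ν hp.1 hp.2.1 hp.2.2 (f := fun a b c => q a b c ^ 2)
      (by fun_prop)).le
  · have : ((distinctTriples ι).card : ℝ) ≤ (Fintype.card ι : ℝ) ^ 3 := by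
      exact_mod_cast card_distinctTriples_le
    calc ((distinctTriples ι).card : ℝ) * (((27 : ℕ) : ℝ) * V)
        ≤ (Fintype.card ι : ℝ) ^ 3 * (((27 : ℕ) : ℝ) * V) := by gcongr
      _ = _ := by push_cast; ring

theorem integral_sq_distinctSum₂_le {q : S → S → ℝ}
    (hq : BddMeas (fun p : S × S => q p.1 p.2))
    (h₁ : ∀ b, ∫ a, q a b ∂ν = 0) (h₂ : ∀ a, ∫ b, q a b ∂ν = 0) :
    ∫ x : ι → S, distinctSum₂ q x ^ 2 ∂(Measure.pi fun _ => ν)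
      ≤ 4 * (Fintype.card ι : ℝ) ^ 2 * ∫ a, ∫ b, q a b ^ 2 ∂ν ∂ν := by
  set V := ∫ a, ∫ b, q a b ^ 2 ∂ν ∂ν with hV
  have hV0 : 0 ≤ V := integral_nonneg fun _ => integral_nonneg fun _ => sq_nonneg _
  simp_rw [distinctSum₂_eq]
  refine (integral_sq_sum_le_of_degenerate ν (distinctPairs ι)
    (fun p => {p.1, p.2}) (fun p x => q (x p.1) (x p.2))
    (fun p => by fun_prop) ?_ ?_ (V := V) ?_ 4 fun a _ => card_filter_pair_le _ a).trans ?_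
  · rintro ⟨i, j⟩ hp t ht x
    simp only [distinctPairs, Finset.mem_filter, Finset.mem_univ, true_and] at hp
    simp only [Finset.mem_insert, Finset.mem_singleton] at ht
    rcases ht with rfl | rfl
    · simp [Function.update_of_ne (Ne.symm hp), h₁]
    · simp [Function.update_of_ne hp, h₂]
  · rintro a _ ⟨i, j⟩ _ t _ ht x y
    simp only [Finset.mem_insert, Finset.mem_singleton, not_or] at ht
    simp [Function.update_of_ne (Ne.symm ht.1), Function.update_of_ne (Ne.symm ht.2)]
  · rintro ⟨i, j⟩ hp
    simp only [distinctPairs, Finset.mem_filter, Finset.mem_univ, true_and] at hp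
    exact (integral_pi_two ν hp (f := fun a b => q a b ^ 2) (by fun_prop)).le
  · have : ((distinctPairs ι).card : ℝ) ≤ (Fintype.card ι : ℝ) ^ 2 := by
      exact_mod_cast card_distinctPairs_le
    calc ((distinctPairs ι).card : ℝ) * (((4 : ℕ) : ℝ) * V)
        ≤ (Fintype.card ι : ℝ) ^ 2 * (((4 : ℕ) : ℝ) * V) := by gcongr
      _ = _ := by push_cast; ring

theorem integral_sq_sum_le_of_centered {q : S → ℝ} (hq : BddMeas q) (h : ∫ a, q a ∂ν = 0) :
    ∫ x : ι → S, (∑ i, q (x i)) ^ 2 ∂(Measure.pi fun _ => ν)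
      ≤ (Fintype.card ι : ℝ) * ∫ a, q a ^ 2 ∂ν := by
  refine (integral_sq_sum_le_of_degenerate ν Finset.univ (fun i => {i}) (fun i x => q (x i))
    (fun p => by fun_prop) ?_ ?_ (V := ∫ a, q a ^ 2 ∂ν) ?_ 1 ?_).trans ?_
  · intro i _ j hj x
    simp only [Finset.mem_singleton] at hj
    subst hj
    simp [h]
  · intro i _ j _ t _ ht x y
    simp only [Finset.mem_singleton] at ht
    simp [Function.update_of_ne (Ne.symm ht)]
  · exact fun i _ => (integral_pi_one ν i (f := fun a => q a ^ 2) (by fun_prop)).le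
  · exact fun i _ => Finset.card_le_one.2 fun a ha b hb => by simp_all
  · simp

end Moments

/-! ### Stein's method for characteristic functions. -/

section Stein

variable {ι S : Type*} [Fintype ι] [DecidableEq ι] [MeasurableSpace S]
  (ν : Measure S) [IsProbabilityMeasure ν]

/-- Taylor's bound for |s| ≤ 1 and the Lipschitz bound beyond. Keeping the minimum lets a truncated
third moment appear later instead of a third moment. -/
theorem norm_cexp_sub_one_add_le (s : ℝ) :
    ‖Complex.exp (((-s : ℝ) : ℂ) * Complex.I) - 1 + (s : ℂ) * Complex.I‖ ≤ 2 * (|s| * min 1 |s|) := by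
  set z : ℂ := ((-s : ℝ) : ℂ) * Complex.I with hz
  have hzn : ‖z‖ = |s| := by simp [hz]
  have e : Complex.exp z - 1 + (s : ℂ) * Complex.I = Complex.exp z - 1 - z := by
    rw [hz]; push_cast; ring
  rw [e]
  rcases le_total |s| 1 with h | h
  · have := Complex.norm_exp_sub_one_sub_id_le (x := z) (by rw [hzn]; exact h)
    rw [hzn] at this
    rw [min_eq_right h]
    nlinarith [abs_nonneg s]
  · rw [min_eq_left h]
    have h1 : ‖Complex.exp z - 1‖ ≤ ‖(-s)‖ := by
      rw [hz, mul_comm]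
      exact Real.norm_exp_I_mul_ofReal_sub_one_le
    calc ‖Complex.exp z - 1 - z‖ ≤ ‖Complex.exp z - 1‖ + ‖z‖ := norm_sub_le _ _
      _ ≤ |s| + |s| := by
        rw [hzn]
        simpa using h1
      _ = 2 * (|s| * 1) := by ring

theorem integrable_mul_cexp {α : Type*} [MeasurableSpace α] (P : Measure α) [IsFiniteMeasure P]
    {f W : α → ℝ} (hf : BddMeas f) (hW : BddMeas W) :
    Integrable (fun x => (f x : ℂ) * Complex.exp ((W x : ℂ) * Complex.I)) P := by
  obtain ⟨C, hC⟩ := hf.bdd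
  have := hf.measurable
  have := hW.measurable
  refine Integrable.of_bound (by fun_prop) C (ae_of_all _ fun x => ?_)
  rw [norm_mul, Complex.norm_exp_ofReal_mul_I, mul_one, Complex.norm_real]
  exact hC x

theorem norm_integral_mul_cexp_le {α : Type*} [MeasurableSpace α] (P : Measure α)
    [IsFiniteMeasure P] {f W : α → ℝ} :
    ‖∫ x, (f x : ℂ) * Complex.exp ((W x : ℂ) * Complex.I) ∂P‖ ≤ ∫ x, |f x| ∂P := by
  refine (norm_integral_le_integral_norm _).trans_eq (integral_congr_ae (ae_of_all _ fun x => ?_))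
  simp only [norm_mul, Complex.norm_exp_ofReal_mul_I, mul_one, Complex.norm_real, Real.norm_eq_abs]

theorem hasDerivAt_integral_cexp {α : Type*} [MeasurableSpace α] (P : Measure α)
    [IsFiniteMeasure P] {W : α → ℝ} (hW : BddMeas W) (t : ℝ) :
    HasDerivAt (fun t : ℝ => ∫ x, Complex.exp (((t * W x : ℝ) : ℂ) * Complex.I) ∂P)
      (∫ x, (W x : ℂ) * Complex.I * Complex.exp (((t * W x : ℝ) : ℂ) * Complex.I) ∂P) t := by
  obtain ⟨C, hC⟩ := hW.bdd
  have hWm := hW.measurable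
  refine (hasDerivAt_integral_of_dominated_loc_of_deriv_le (s := Set.univ) (bound := fun _ => C)
    (F := fun (t : ℝ) x => Complex.exp (((t * W x : ℝ) : ℂ) * Complex.I))
    (F' := fun (t : ℝ) x => (W x : ℂ) * Complex.I * Complex.exp (((t * W x : ℝ) : ℂ) * Complex.I))
    Filter.univ_mem (Eventually.of_forall fun s => ?_) ?_ ?_ ?_ (integrable_const _) ?_).2
  · exact (by fun_prop : Measurable _).aestronglyMeasurable
  · refine Integrable.of_bound (by fun_prop : Measurable _).aestronglyMeasurable 1
      (ae_of_all _ fun x => ?_)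
    rw [Complex.norm_exp_ofReal_mul_I]
  · exact (by fun_prop : Measurable _).aestronglyMeasurable
  · refine ae_of_all _ fun x s _ => ?_
    rw [norm_mul, Complex.norm_exp_ofReal_mul_I]
    simpa using hC x
  · refine ae_of_all _ fun x s _ => ?_
    have h1 : HasDerivAt (fun s : ℝ => ((s * W x : ℝ) : ℂ) * Complex.I) ((W x : ℂ) * Complex.I) s := by
      have : HasDerivAt (fun s : ℝ => s * W x) (W x) s := by
        simpa using (hasDerivAt_id s).mul_const (W x)
      exact this.ofReal_comp.mul_const Complex.I
    have := h1.cexp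
    rwa [mul_comm] at this

/-- One-coordinate step of the characteristic function form of Stein's method. -/
theorem norm_integral_increment_le (i : ι) {W Δ : (ι → S) → ℝ} (hWb : BddMeas W)
    (hΔb : BddMeas Δ)
    (hinv : ∀ x y, W (Function.update x i y) - Δ (Function.update x i y) = W x - Δ x) (t : ℝ) :
    ‖∫ x, (Δ x : ℂ) * Complex.exp (((t * W x : ℝ) : ℂ) * Complex.I) ∂(Measure.pi fun _ => ν)
      - (t : ℂ) * Complex.I * ∫ x, ((Δ x ^ 2 : ℝ) : ℂ) *
          Complex.exp (((t * W x : ℝ) : ℂ) * Complex.I) ∂(Measure.pi fun _ => ν)‖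
      ≤ ∫ x, |∫ y, Δ (Function.update x i y) ∂ν| ∂(Measure.pi fun _ => ν)
        + 2 * (|t| + t ^ 2) * ∫ x, Δ x ^ 2 * min 1 |Δ x| ∂(Measure.pi fun _ => ν) := by
  set π : Measure (ι → S) := Measure.pi fun _ => ν with hπ
  have hρb : BddMeas fun x => ∫ y, Δ (Function.update x i y) ∂ν := by
    refine BddMeas.integral (F := fun x y => Δ (Function.update x i y)) ?_
    exact hΔb.comp measurable_update'
  have hWΔ : BddMeas fun x => t * (W x - Δ x) := by fun_prop
  -- the part that only sees the conditional mean
  have h1 : ∫ x, (Δ x : ℂ) * Complex.exp (((t * (W x - Δ x) : ℝ) : ℂ) * Complex.I) ∂π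
      = ∫ x, ((∫ y, Δ (Function.update x i y) ∂ν : ℝ) : ℂ) *
          Complex.exp (((t * (W x - Δ x) : ℝ) : ℂ) * Complex.I) ∂π := by
    rw [hπ, integral_update ν i (integrable_mul_cexp _ hΔb hWΔ)]
    simp_rw [hinv, integral_mul_const, integral_complex_ofReal]
  have h1' := norm_integral_mul_cexp_le π (f := fun x => ∫ y, Δ (Function.update x i y) ∂ν)
    (W := fun x => t * (W x - Δ x))
  rw [← h1] at h1'
  -- `R` carries the second-order remainder of exp(−itΔ), the factor that turns exp(itW) into
  -- exp(it(W − Δ)).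
  set R : (ι → S) → ℂ := fun x => (Δ x : ℂ) * Complex.exp (((t * W x : ℝ) : ℂ) * Complex.I) *
    (Complex.exp (((-(t * Δ x) : ℝ) : ℂ) * Complex.I) - 1 + ((t * Δ x : ℝ) : ℂ) * Complex.I) with hR
  have hRn : ∀ x, ‖R x‖ ≤ 2 * (|t| + t ^ 2) * (Δ x ^ 2 * min 1 |Δ x|) := by
    intro x
    rw [hR]
    dsimp only
    rw [norm_mul, norm_mul, Complex.norm_exp_ofReal_mul_I, mul_one, Complex.norm_real,
      Real.norm_eq_abs]
    refine (mul_le_mul_of_nonneg_left (norm_cexp_sub_one_add_le (t * Δ x)) (abs_nonneg _)).trans ?_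
    have hm : min 1 |t * Δ x| ≤ (1 + |t|) * min 1 |Δ x| := by
      rw [abs_mul]
      rcases le_total 1 |Δ x| with h | h
      · rw [min_eq_left h]
        exact (min_le_left _ _).trans (by linarith [abs_nonneg t])
      · rw [min_eq_right h]
        refine (min_le_right _ _).trans ?_
        nlinarith [abs_nonneg t, abs_nonneg (Δ x)]
    calc |Δ x| * (2 * (|t * Δ x| * min 1 |t * Δ x|))
        ≤ |Δ x| * (2 * (|t * Δ x| * ((1 + |t|) * min 1 |Δ x|))) := by gcongr
      _ = 2 * (|t| + |t| ^ 2) * (|Δ x| ^ 2 * min 1 |Δ x|) := by rw [abs_mul]; ring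
      _ = _ := by rw [sq_abs, sq_abs]
  have hid : ∀ x, (Δ x : ℂ) * Complex.exp (((t * W x : ℝ) : ℂ) * Complex.I)
      = (Δ x : ℂ) * Complex.exp (((t * (W x - Δ x) : ℝ) : ℂ) * Complex.I)
        + (t : ℂ) * Complex.I * (((Δ x ^ 2 : ℝ) : ℂ) *
          Complex.exp (((t * W x : ℝ) : ℂ) * Complex.I)) - R x := by
    intro x
    have : Complex.exp (((t * (W x - Δ x) : ℝ) : ℂ) * Complex.I)
        = Complex.exp (((t * W x : ℝ) : ℂ) * Complex.I) *
          Complex.exp (((-(t * Δ x) : ℝ) : ℂ) * Complex.I) := by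
      rw [← Complex.exp_add]
      congr 1
      push_cast
      ring
    rw [this, hR]
    push_cast
    ring
  have hi1 := integrable_mul_cexp π hΔb hWΔ
  have hi2 := integrable_mul_cexp π (f := fun x => Δ x ^ 2) (W := fun x => t * W x)
    (by fun_prop) (by fun_prop)
  have hi0 := integrable_mul_cexp π (f := Δ) (W := fun x => t * W x) hΔb (by fun_prop)
  have hRi : Integrable R π := by
    have : R = fun x => ((Δ x : ℂ) * Complex.exp (((t * (W x - Δ x) : ℝ) : ℂ) * Complex.I)
        + (t : ℂ) * Complex.I * (((Δ x ^ 2 : ℝ) : ℂ) *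
          Complex.exp (((t * W x : ℝ) : ℂ) * Complex.I)))
          - (Δ x : ℂ) * Complex.exp (((t * W x : ℝ) : ℂ) * Complex.I) := by
      funext x
      rw [hid x]
      ring
    rw [this]
    exact (hi1.add (hi2.const_mul _)).sub hi0
  have hmain : ∫ x, (Δ x : ℂ) * Complex.exp (((t * W x : ℝ) : ℂ) * Complex.I) ∂π
      - (t : ℂ) * Complex.I * ∫ x, ((Δ x ^ 2 : ℝ) : ℂ) *
          Complex.exp (((t * W x : ℝ) : ℂ) * Complex.I) ∂π
      = ∫ x, (Δ x : ℂ) * Complex.exp (((t * (W x - Δ x) : ℝ) : ℂ) * Complex.I) ∂π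
        - ∫ x, R x ∂π := by
    have a1 := integral_add hi1 (hi2.const_mul ((t : ℂ) * Complex.I))
    have a2 := integral_sub (hi1.add (hi2.const_mul ((t : ℂ) * Complex.I))) hRi
    simp only [Pi.add_apply] at a2
    rw [a1, integral_const_mul] at a2
    rw [integral_congr_ae (ae_of_all _ hid), a2]
    ring
  rw [hmain]
  refine (norm_sub_le _ _).trans (add_le_add h1' ?_)
  rw [← integral_const_mul]
  refine (norm_integral_le_integral_norm _).trans (integral_mono hRi.norm ?_ hRn)
  exact BddMeas.integrable (by fun_prop) _

/-- Quantitative normal approximation of the characteristic function of `W = d⁻¹ ∑ᵢ Δᵢ`, where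
`W - Δᵢ` does not depend on the `i`-th coordinate. -/
theorem norm_charFun_sub_le {W : (ι → S) → ℝ} {Δ : ι → (ι → S) → ℝ} {d δ : ℝ} (hd : 0 < d)
    (hWb : BddMeas W) (hΔb : ∀ i, BddMeas (Δ i)) (hsum : ∀ x, d * W x = ∑ i, Δ i x)
    (hinv : ∀ i x y, W (Function.update x i y) - Δ i (Function.update x i y) = W x - Δ i x)
    (hδ : (∑ i, ∫ x, |∫ y, Δ i (Function.update x i y) ∂ν| ∂(Measure.pi fun _ => ν)) / d
      + ∫ x, |(∑ i, Δ i x ^ 2) / d - 1| ∂(Measure.pi fun _ => ν)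
      + (∑ i, ∫ x, Δ i x ^ 2 * min 1 |Δ i x| ∂(Measure.pi fun _ => ν)) / d ≤ δ) (t : ℝ) :
    ‖∫ x, Complex.exp (((t * W x : ℝ) : ℂ) * Complex.I) ∂(Measure.pi fun _ => ν)
      - Complex.exp (-(t : ℂ) ^ 2 / 2)‖ ≤ 2 * (1 + |t|) ^ 2 * |t| * Real.exp (t ^ 2 / 2) * δ := by
  set π : Measure (ι → S) := Measure.pi fun _ => ν with hπ
  set φ : ℝ → ℂ := fun t => ∫ x, Complex.exp (((t * W x : ℝ) : ℂ) * Complex.I) ∂π with hφ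
  set A := (∑ i, ∫ x, |∫ y, Δ i (Function.update x i y) ∂ν| ∂π) with hA
  set B := ∫ x, |(∑ i, Δ i x ^ 2) / d - 1| ∂π with hB
  set D := (∑ i, ∫ x, Δ i x ^ 2 * min 1 |Δ i x| ∂π) with hD
  have hA0 : 0 ≤ A := Finset.sum_nonneg fun i _ => integral_nonneg fun x => abs_nonneg _
  have hB0 : 0 ≤ B := integral_nonneg fun x => abs_nonneg _
  have hD0 : 0 ≤ D := Finset.sum_nonneg fun i _ => integral_nonneg fun x => by positivity
  have hAd : 0 ≤ A / d := by positivity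
  have hDd : 0 ≤ D / d := by positivity
  have hδ0 : 0 ≤ δ := le_trans (by positivity) hδ
  set φ' : ℝ → ℂ := fun t => ∫ x, (W x : ℂ) * Complex.I *
    Complex.exp (((t * W x : ℝ) : ℂ) * Complex.I) ∂π with hφ'
  have hder : ∀ t, HasDerivAt φ (φ' t) t := fun t => hasDerivAt_integral_cexp π hWb t
  -- Since φ' = (i/d) ∑ E[Δᵢ e^{isW}] and E[Δᵢ e^{isW}] ≈ is E[Δᵢ² e^{isW}], the approximation ∑ Δᵢ²
  -- ≈ d gives φ' ≈ −sφ, the equation solved by the Gaussian.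
  have hode : ∀ s : ℝ, ‖φ' s + (s : ℂ) * φ s‖ ≤ 2 * (1 + |s|) ^ 2 * δ := by
    intro s
    set e : (ι → S) → ℂ := fun x => Complex.exp (((s * W x : ℝ) : ℂ) * Complex.I) with he
    have hi1 : ∀ i, Integrable (fun x => (Δ i x : ℂ) * e x) π := fun i =>
      integrable_mul_cexp π (f := Δ i) (W := fun x => s * W x) (hΔb i) (by fun_prop)
    have hi2 : ∀ i, Integrable (fun x => ((Δ i x ^ 2 : ℝ) : ℂ) * e x) π := fun i =>
      integrable_mul_cexp π (f := fun x => Δ i x ^ 2) (W := fun x => s * W x)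
        (by fun_prop) (by fun_prop)
    have hie : Integrable e π := by
      have := integrable_mul_cexp π (f := fun _ => 1) (W := fun x => s * W x)
        (by fun_prop) (by fun_prop)
      simp only [Complex.ofReal_one, one_mul] at this
      exact this
    have hd' : (d : ℂ) ≠ 0 := by exact_mod_cast hd.ne'
    have e1 : φ' s = Complex.I / d * ∑ i, ∫ x, (Δ i x : ℂ) * e x ∂π := by
      rw [hφ', ← integral_finsetSum _ fun i _ => hi1 i, ← integral_const_mul]
      refine integral_congr_ae (ae_of_all _ fun x => ?_)
      dsimp only
      rw [← Finset.sum_mul, ← Complex.ofReal_sum, ← hsum x]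
      push_cast
      field_simp
      simp only [he]
      push_cast
      ring_nf
    have e2 : ∑ i, ∫ x, ((Δ i x ^ 2 : ℝ) : ℂ) * e x ∂π - d * φ s
        = d * ∫ x, (((∑ i, Δ i x ^ 2) / d - 1 : ℝ) : ℂ) * e x ∂π := by
      have hφs : (d : ℂ) * φ s = ∫ x, (d : ℂ) * e x ∂π := (integral_const_mul _ _).symm
      rw [← integral_finsetSum _ fun i _ => hi2 i, hφs, ← integral_const_mul,
        ← integral_sub (integrable_finsetSum _ fun i _ => hi2 i)
        (hie.const_mul _)]
      refine integral_congr_ae (ae_of_all _ fun x => ?_)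
      dsimp only
      rw [← Finset.sum_mul]
      push_cast
      field_simp
    have b2 : ‖∫ x, (((∑ i, Δ i x ^ 2) / d - 1 : ℝ) : ℂ) * e x ∂π‖ ≤ B :=
      norm_integral_mul_cexp_le π (f := fun x => (∑ i, Δ i x ^ 2) / d - 1)
        (W := fun x => s * W x)
    have b1 : ‖∑ i, (∫ x, (Δ i x : ℂ) * e x ∂π
        - (s : ℂ) * Complex.I * ∫ x, ((Δ i x ^ 2 : ℝ) : ℂ) * e x ∂π)‖
        ≤ A + 2 * (|s| + s ^ 2) * D := by
      refine (norm_sum_le _ _).trans ?_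
      rw [hA, hD, Finset.mul_sum, ← Finset.sum_add_distrib]
      exact Finset.sum_le_sum fun i _ =>
        norm_integral_increment_le ν i hWb (hΔb i) (hinv i) s
    have e3 : φ' s + (s : ℂ) * φ s
        = Complex.I / d * (∑ i, (∫ x, (Δ i x : ℂ) * e x ∂π
          - (s : ℂ) * Complex.I * ∫ x, ((Δ i x ^ 2 : ℝ) : ℂ) * e x ∂π))
          - (s : ℂ) * ∫ x, (((∑ i, Δ i x ^ 2) / d - 1 : ℝ) : ℂ) * e x ∂π := by
      have e2' : ∫ x, (((∑ i, Δ i x ^ 2) / d - 1 : ℝ) : ℂ) * e x ∂π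
          = (∑ i, ∫ x, ((Δ i x ^ 2 : ℝ) : ℂ) * e x ∂π - d * φ s) / d := by
        rw [e2]; field_simp
      rw [e2', e1, Finset.sum_sub_distrib, ← Finset.mul_sum]
      field_simp
      ring_nf
      rw [Complex.I_sq]
      ring
    rw [e3]
    refine (norm_sub_le _ _).trans ?_
    rw [norm_mul, norm_mul, norm_div, Complex.norm_I, Complex.norm_real, Complex.norm_real,
      Real.norm_eq_abs, Real.norm_eq_abs, abs_of_pos hd]
    have hs := abs_nonneg s
    calc 1 / d * ‖∑ i, (∫ x, (Δ i x : ℂ) * e x ∂π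
          - (s : ℂ) * Complex.I * ∫ x, ((Δ i x ^ 2 : ℝ) : ℂ) * e x ∂π)‖
        + |s| * ‖∫ x, (((∑ i, Δ i x ^ 2) / d - 1 : ℝ) : ℂ) * e x ∂π‖
        ≤ 1 / d * (A + 2 * (|s| + s ^ 2) * D) + |s| * B := by gcongr
      _ = A / d + |s| * B + 2 * (|s| + s ^ 2) * (D / d) := by ring
      _ ≤ 2 * (1 + |s|) ^ 2 * (A / d + B + D / d) := by
        rw [← sq_abs s]
        nlinarith [mul_nonneg hs hAd, mul_nonneg hs hB0, mul_nonneg hs hDd,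
          mul_nonneg (mul_nonneg hs hs) hAd, mul_nonneg (mul_nonneg hs hs) hB0]
      _ ≤ 2 * (1 + |s|) ^ 2 * δ := by gcongr
  -- integrate the differential inequality
  set ψ : ℝ → ℂ := fun s : ℝ => Complex.exp ((s : ℂ) ^ 2 / 2) * φ s with hψ
  have hψd : ∀ s : ℝ, HasDerivAt ψ (Complex.exp ((s : ℂ) ^ 2 / 2) * (φ' s + (s : ℂ) * φ s)) s := by
    intro s
    have h1 : HasDerivAt (fun s : ℝ => (s : ℂ) ^ 2 / 2) (s : ℂ) s := by
      have := ((hasDerivAt_id s).ofReal_comp.pow 2).div_const 2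
      convert! this using 1
      simp
    convert! h1.cexp.mul (hder s) using 1
    ring
  have hexp : ∀ s : ℝ, ‖Complex.exp ((s : ℂ) ^ 2 / 2)‖ = Real.exp (s ^ 2 / 2) := by
    intro s
    rw [Complex.norm_exp]
    norm_cast
  have hbound : ‖ψ t - ψ 0‖ ≤ (Real.exp (t ^ 2 / 2) * (2 * (1 + |t|) ^ 2 * δ)) * ‖t - 0‖ := by
    refine Convex.norm_image_sub_le_of_norm_hasDerivWithin_le (s := Set.uIcc 0 t)
      (fun s _ => (hψd s).hasDerivWithinAt) (fun s hs => ?_) (convex_uIcc 0 t)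
      Set.left_mem_uIcc Set.right_mem_uIcc
    have hst : |s| ≤ |t| := by
      have := Set.abs_sub_left_of_mem_uIcc hs
      simpa using this
    have hst2 : s ^ 2 ≤ t ^ 2 := sq_le_sq.2 hst
    rw [norm_mul, hexp]
    refine mul_le_mul (Real.exp_le_exp.2 (by linarith)) ((hode s).trans ?_) (norm_nonneg _)
      (Real.exp_pos _).le
    gcongr
  have hψ0 : ψ 0 = 1 := by simp [hψ, hφ]
  have hfin : φ t - Complex.exp (-(t : ℂ) ^ 2 / 2)
      = Complex.exp (-(t : ℂ) ^ 2 / 2) * (ψ t - ψ 0) := by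
    rw [hψ0, hψ]
    dsimp only
    rw [mul_sub, ← mul_assoc, ← Complex.exp_add]
    simp only [neg_div, neg_add_cancel, Complex.exp_zero]
    ring
  change ‖φ t - _‖ ≤ _
  rw [hfin, norm_mul]
  have hle1 : ‖Complex.exp (-(t : ℂ) ^ 2 / 2)‖ ≤ 1 := by
    rw [Complex.norm_exp]
    have : (-(t : ℂ) ^ 2 / 2).re = -(t ^ 2) / 2 := by norm_cast
    rw [this]
    exact Real.exp_le_one_iff.2 (by nlinarith [sq_nonneg t])
  calc ‖Complex.exp (-(t : ℂ) ^ 2 / 2)‖ * ‖ψ t - ψ 0‖ ≤ 1 * ‖ψ t - ψ 0‖ := by gcongr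
    _ ≤ _ := by
      rw [one_mul]
      refine hbound.trans_eq ?_
      rw [sub_zero, Real.norm_eq_abs]
      ring

end Stein

/-! ### Hoeffding projections of a symmetric kernel and variance bounds. -/

section Hoeffding

variable {ι S : Type*} [Fintype ι] [DecidableEq ι] [MeasurableSpace S]
  (ν : Measure S)

/-- The projection of a kernel of three arguments to two arguments. -/
noncomputable def proj₂ (k : S → S → S → ℝ) (a b : S) : ℝ := ∫ c, k a b c ∂ν

/-- The projection of a kernel of three arguments to one argument. -/
noncomputable def proj₁ (k : S → S → S → ℝ) (a : S) : ℝ := ∫ b, proj₂ ν k a b ∂ν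

/-- The mean of a kernel of three arguments. -/
noncomputable def kmean (k : S → S → S → ℝ) : ℝ := ∫ a, proj₁ ν k a ∂ν

/-- The completely degenerate part of order two in the Hoeffding decomposition. -/
noncomputable def deg₂ (k : S → S → S → ℝ) (a b : S) : ℝ :=
  proj₂ ν k a b - proj₁ ν k a - proj₁ ν k b + kmean ν k

/-- The completely degenerate part of order three in the Hoeffding decomposition. -/
noncomputable def deg₃ (k : S → S → S → ℝ) (a b c : S) : ℝ :=
  k a b c - proj₂ ν k a b - proj₂ ν k a c - proj₂ ν k b c
    + proj₁ ν k a + proj₁ ν k b + proj₁ ν k c - kmean ν k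

/-- A bounded measurable symmetric kernel of three arguments. -/
structure SymmKernel (k : S → S → S → ℝ) : Prop where
  bdd : BddMeas (fun p : S × S × S => k p.1 p.2.1 p.2.2)
  swap₁₂ : ∀ a b c, k b a c = k a b c
  swap₂₃ : ∀ a b c, k a c b = k a b c

theorem distinctSum₃_hoeffding (k : S → S → S → ℝ) (x : ι → S) :
    distinctSum₃ k x = distinctSum₃ (deg₃ ν k) x
      + 3 * ((Fintype.card ι : ℝ) - 2) * distinctSum₂ (deg₂ ν k) x
      + 3 * ((Fintype.card ι : ℝ) - 1) * ((Fintype.card ι : ℝ) - 2) *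
          ∑ i, (proj₁ ν k (x i) - kmean ν k)
      + (Fintype.card ι : ℝ) * ((Fintype.card ι : ℝ) - 1) * ((Fintype.card ι : ℝ) - 2) *
          kmean ν k :=
  distinctSum₃_decomp k (proj₂ ν k) (proj₁ ν k) (kmean ν k) x

theorem integral_proj₂ (k : S → S → S → ℝ) (a : S) : ∫ b, proj₂ ν k a b ∂ν = proj₁ ν k a := rfl

theorem integral_proj₁ (k : S → S → S → ℝ) : ∫ a, proj₁ ν k a ∂ν = kmean ν k := rfl

theorem integral_eq_proj₂ (k : S → S → S → ℝ) (a b : S) : ∫ c, k a b c ∂ν = proj₂ ν k a b := rfl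

variable {ν} [IsProbabilityMeasure ν] {k : S → S → S → ℝ}

theorem BddMeas.integral_add {α : Type*} [MeasurableSpace α] {P : Measure α} [IsFiniteMeasure P]
    {f g : α → ℝ} (hf : BddMeas f) (hg : BddMeas g) :
    ∫ x, (f x + g x) ∂P = ∫ x, f x ∂P + ∫ x, g x ∂P :=
  MeasureTheory.integral_add (hf.integrable P) (hg.integrable P)

theorem BddMeas.integral_sub {α : Type*} [MeasurableSpace α] {P : Measure α} [IsFiniteMeasure P]
    {f g : α → ℝ} (hf : BddMeas f) (hg : BddMeas g) :
    ∫ x, (f x - g x) ∂P = ∫ x, f x ∂P - ∫ x, g x ∂P :=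
  MeasureTheory.integral_sub (hf.integrable P) (hg.integrable P)

theorem BddMeas.integral_mono {α : Type*} [MeasurableSpace α] {P : Measure α} [IsFiniteMeasure P]
    {f g : α → ℝ} (hf : BddMeas f) (hg : BddMeas g) (h : ∀ x, f x ≤ g x) :
    ∫ x, f x ∂P ≤ ∫ x, g x ∂P :=
  MeasureTheory.integral_mono (hf.integrable P) (hg.integrable P) h

theorem BddMeas.integral_comm {α β : Type*} [MeasurableSpace α] [MeasurableSpace β]
    {P : Measure α} {Q : Measure β} [IsFiniteMeasure P] [IsFiniteMeasure Q] {F : α → β → ℝ}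
    (hF : BddMeas (fun p : α × β => F p.1 p.2)) :
    ∫ a, ∫ b, F a b ∂Q ∂P = ∫ b, ∫ a, F a b ∂P ∂Q :=
  integral_integral_swap (hF.integrable _)

theorem BddMeas.sq_integral_le {α : Type*} [MeasurableSpace α] {P : Measure α}
    [IsProbabilityMeasure P] {f : α → ℝ} (hf : BddMeas f) :
    (∫ x, f x ∂P) ^ 2 ≤ ∫ x, f x ^ 2 ∂P := by
  set m := ∫ x, f x ∂P with hm
  have h0 : 0 ≤ ∫ x, (f x - m) ^ 2 ∂P := integral_nonneg fun x => sq_nonneg _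
  have h1 : ∫ x, (f x - m) ^ 2 ∂P = ∫ x, f x ^ 2 ∂P - m ^ 2 := by
    have : ∀ x, (f x - m) ^ 2 = f x ^ 2 - 2 * m * f x + m ^ 2 := fun x => by ring
    simp_rw [this]
    rw [BddMeas.integral_add (by fun_prop) (by fun_prop),
      BddMeas.integral_sub (by fun_prop) (by fun_prop), integral_const_mul, ← hm]
    simp
    ring
  linarith

theorem BddMeas.integral_abs_le_sqrt {α : Type*} [MeasurableSpace α] {P : Measure α}
    [IsProbabilityMeasure P] {f : α → ℝ} (hf : BddMeas f) {V : ℝ} (hV : ∫ x, f x ^ 2 ∂P ≤ V) :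
    ∫ x, |f x| ∂P ≤ √V := by
  refine Real.le_sqrt_of_sq_le ((BddMeas.sq_integral_le (f := fun x => |f x|) (by fun_prop)).trans ?_)
  simpa only [sq_abs] using hV

theorem SymmKernel.bdd_proj₂ (hk : SymmKernel k) :
    BddMeas (fun p : S × S => proj₂ ν k p.1 p.2) := by
  have := hk.bdd
  exact BddMeas.integral (F := fun (p : S × S) c => k p.1 p.2 c) (by fun_prop)

theorem SymmKernel.bdd_proj₁ (hk : SymmKernel k) : BddMeas (proj₁ ν k) := by
  have := hk.bdd_proj₂ (ν := ν)
  exact BddMeas.integral (F := fun a b => proj₂ ν k a b) (by fun_prop)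

theorem SymmKernel.bdd_deg₂ (hk : SymmKernel k) :
    BddMeas (fun p : S × S => deg₂ ν k p.1 p.2) := by
  have := hk.bdd_proj₂ (ν := ν)
  have := hk.bdd_proj₁ (ν := ν)
  unfold deg₂
  fun_prop

theorem SymmKernel.bdd_deg₃ (hk : SymmKernel k) :
    BddMeas (fun p : S × S × S => deg₃ ν k p.1 p.2.1 p.2.2) := by
  have := hk.bdd
  have := hk.bdd_proj₂ (ν := ν)
  have := hk.bdd_proj₁ (ν := ν)
  unfold deg₃
  fun_prop

omit [IsProbabilityMeasure ν] in
theorem SymmKernel.proj₂_symm (hk : SymmKernel k) (a b : S) : proj₂ ν k b a = proj₂ ν k a b := by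
  simp only [proj₂, hk.swap₁₂ a b]

omit [IsProbabilityMeasure ν] in
theorem SymmKernel.deg₂_symm (hk : SymmKernel k) (a b : S) : deg₂ ν k b a = deg₂ ν k a b := by
  simp only [deg₂, hk.proj₂_symm a b]
  ring

theorem SymmKernel.integral_deg₂ (hk : SymmKernel k) (a : S) : ∫ b, deg₂ ν k a b ∂ν = 0 := by
  have := hk.bdd_proj₂ (ν := ν)
  have := hk.bdd_proj₁ (ν := ν)
  unfold deg₂
  rw [BddMeas.integral_add (by fun_prop) (by fun_prop),
    BddMeas.integral_sub (by fun_prop) (by fun_prop),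
    BddMeas.integral_sub (by fun_prop) (by fun_prop)]
  simp [integral_proj₁, integral_proj₂]

theorem SymmKernel.integral_deg₃ (hk : SymmKernel k) (a b : S) :
    ∫ c, deg₃ ν k a b c ∂ν = 0 := by
  have := hk.bdd
  have := hk.bdd_proj₂ (ν := ν)
  have := hk.bdd_proj₁ (ν := ν)
  unfold deg₃
  rw [BddMeas.integral_sub (by fun_prop) (by fun_prop),
    BddMeas.integral_add (by fun_prop) (by fun_prop),
    BddMeas.integral_add (by fun_prop) (by fun_prop),
    BddMeas.integral_add (by fun_prop) (by fun_prop),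
    BddMeas.integral_sub (by fun_prop) (by fun_prop),
    BddMeas.integral_sub (by fun_prop) (by fun_prop),
    BddMeas.integral_sub (by fun_prop) (by fun_prop)]
  simp [integral_proj₁, integral_proj₂, integral_eq_proj₂]
  ring

omit [IsProbabilityMeasure ν] in
theorem SymmKernel.deg₃_swap₁₂ (hk : SymmKernel k) (a b c : S) :
    deg₃ ν k b a c = deg₃ ν k a b c := by
  simp only [deg₃, hk.proj₂_symm a b, hk.swap₁₂ a b]
  ring

omit [IsProbabilityMeasure ν] in
theorem SymmKernel.deg₃_swap₂₃ (hk : SymmKernel k) (a b c : S) :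
    deg₃ ν k a c b = deg₃ ν k a b c := by
  simp only [deg₃, hk.proj₂_symm b c, hk.swap₂₃ a b]
  ring

/-- Orthogonality of the projections: by symmetry the cross term of `proj₂` with `proj₁` collapses
to the second moment of `proj₁`. An identity is needed, since it fixes the normalisation of the
quadratic part. -/
theorem SymmKernel.integral_sq_deg₂ (hk : SymmKernel k) :
    ∫ a, ∫ b, deg₂ ν k a b ^ 2 ∂ν ∂ν
      = ∫ a, ∫ b, proj₂ ν k a b ^ 2 ∂ν ∂ν - 2 * ∫ a, proj₁ ν k a ^ 2 ∂ν + kmean ν k ^ 2 := by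
  have h2 := hk.bdd_proj₂ (ν := ν)
  have h1 := hk.bdd_proj₁ (ν := ν)
  set p₂ := proj₂ ν k with hp₂
  set p₁ := proj₁ ν k with hp₁
  set m := kmean ν k with hm
  have hp : ∀ a, ∫ b, p₂ a b ∂ν = p₁ a := fun a => rfl
  have hpm : ∫ a, p₁ a ∂ν = m := rfl
  have inner : ∀ a, ∫ b, deg₂ ν k a b ^ 2 ∂ν = ∫ b, p₂ a b ^ 2 ∂ν - 2 * ∫ b, p₂ a b * p₁ b ∂ν
      + ∫ b, p₁ b ^ 2 ∂ν - (p₁ a - m) ^ 2 := by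
    intro a
    have : ∀ b, deg₂ ν k a b ^ 2 = p₂ a b ^ 2 - 2 * (p₂ a b * p₁ b) + p₁ b ^ 2
        - (2 * (p₁ a - m)) * p₂ a b + (2 * (p₁ a - m)) * p₁ b + (p₁ a - m) ^ 2 := fun b => by
      simp only [deg₂, ← hp₂, ← hp₁, ← hm]
      ring
    simp_rw [this]
    rw [BddMeas.integral_add (by fun_prop) (by fun_prop),
      BddMeas.integral_add (by fun_prop) (by fun_prop),
      BddMeas.integral_sub (by fun_prop) (by fun_prop),
      BddMeas.integral_add (by fun_prop) (by fun_prop),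
      BddMeas.integral_sub (by fun_prop) (by fun_prop), integral_const_mul, integral_const_mul,
      integral_const_mul, hp, hpm]
    simp
    ring
  simp_rw [inner]
  rw [BddMeas.integral_sub (by fun_prop) (by fun_prop),
    BddMeas.integral_add (by fun_prop) (by fun_prop),
    BddMeas.integral_sub (by fun_prop) (by fun_prop), integral_const_mul]
  have e1 : ∫ a, ∫ b, p₂ a b * p₁ b ∂ν ∂ν = ∫ a, p₁ a ^ 2 ∂ν := by
    rw [BddMeas.integral_comm (by fun_prop)]
    simp_rw [integral_mul_const, hp₂, fun b a => hk.proj₂_symm (ν := ν) b a, ← hp₂, hp, sq]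
  have e2 : ∫ a, (p₁ a - m) ^ 2 ∂ν = ∫ a, p₁ a ^ 2 ∂ν - m ^ 2 := by
    have : ∀ a, (p₁ a - m) ^ 2 = p₁ a ^ 2 - 2 * m * p₁ a + m ^ 2 := fun x => by ring
    simp_rw [this]
    rw [BddMeas.integral_add (by fun_prop) (by fun_prop),
      BddMeas.integral_sub (by fun_prop) (by fun_prop), integral_const_mul, hpm]
    simp
    ring
  rw [e1, e2]
  simp
  ring

theorem SymmKernel.integral_sq_deg₂_le (hk : SymmKernel k) :
    ∫ a, ∫ b, deg₂ ν k a b ^ 2 ∂ν ∂ν ≤ ∫ a, ∫ b, proj₂ ν k a b ^ 2 ∂ν ∂ν := by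
  rw [hk.integral_sq_deg₂]
  have h1 : kmean ν k ^ 2 ≤ ∫ a, proj₁ ν k a ^ 2 ∂ν := (hk.bdd_proj₁).sq_integral_le
  have h2 : 0 ≤ ∫ a, proj₁ ν k a ^ 2 ∂ν := integral_nonneg fun _ => sq_nonneg _
  linarith

theorem SymmKernel.integral_sq_proj₁_le (hk : SymmKernel k) :
    ∫ a, proj₁ ν k a ^ 2 ∂ν ≤ ∫ a, ∫ b, proj₂ ν k a b ^ 2 ∂ν ∂ν := by
  have h2 := hk.bdd_proj₂ (ν := ν)
  have h1 := hk.bdd_proj₁ (ν := ν)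
  refine BddMeas.integral_mono (by fun_prop) (by fun_prop) fun a => ?_
  exact BddMeas.sq_integral_le (f := fun b => proj₂ ν k a b) (by fun_prop)

theorem SymmKernel.integral_sq_proj₂_le (hk : SymmKernel k) :
    ∫ a, ∫ b, proj₂ ν k a b ^ 2 ∂ν ∂ν ≤ ∫ a, ∫ b, ∫ c, k a b c ^ 2 ∂ν ∂ν ∂ν := by
  have h2 := hk.bdd_proj₂ (ν := ν)
  have h1 := hk.bdd
  refine BddMeas.integral_mono (by fun_prop) (by fun_prop) fun a => ?_
  refine BddMeas.integral_mono (by fun_prop) (by fun_prop) fun b => ?_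
  exact BddMeas.sq_integral_le (f := fun c => k a b c) (by fun_prop)

/-- There are eight terms, each of second moment at most that of k by Jensen, so Cauchy–Schwarz
gives 8 · 8. Writing everything on `Fin 3 → S` makes the eight terms functions on one space. -/
theorem SymmKernel.integral_sq_deg₃_le (hk : SymmKernel k) :
    ∫ a, ∫ b, ∫ c, deg₃ ν k a b c ^ 2 ∂ν ∂ν ∂ν ≤ 64 * ∫ a, ∫ b, ∫ c, k a b c ^ 2 ∂ν ∂ν ∂ν := by
  have h3 := hk.bdd
  have h2 := hk.bdd_proj₂ (ν := ν)
  have h1 := hk.bdd_proj₁ (ν := ν)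
  have hd := hk.bdd_deg₃ (ν := ν)
  have i1 := hk.integral_sq_proj₁_le (ν := ν)
  have i2 := hk.integral_sq_proj₂_le (ν := ν)
  have i0 : kmean ν k ^ 2 ≤ ∫ a, proj₁ ν k a ^ 2 ∂ν := h1.sq_integral_le
  have n01 : (0 : Fin 3) ≠ 1 := by decide
  have n02 : (0 : Fin 3) ≠ 2 := by decide
  have n12 : (1 : Fin 3) ≠ 2 := by decide
  set V := ∫ a, ∫ b, ∫ c, k a b c ^ 2 ∂ν ∂ν ∂ν with hV
  have eV : ∫ x : Fin 3 → S, k (x 0) (x 1) (x 2) ^ 2 ∂(Measure.pi fun _ => ν) = V :=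
    integral_pi_three ν n01 n02 n12 (f := fun a b c => k a b c ^ 2) (by fun_prop)
  have e2 : ∀ i j : Fin 3, i ≠ j →
      ∫ x : Fin 3 → S, proj₂ ν k (x i) (x j) ^ 2 ∂(Measure.pi fun _ => ν) ≤ V := fun i j hij =>
    (integral_pi_two ν hij (f := fun a b => proj₂ ν k a b ^ 2) (by fun_prop)).trans_le i2
  have e1 : ∀ i : Fin 3,
      ∫ x : Fin 3 → S, proj₁ ν k (x i) ^ 2 ∂(Measure.pi fun _ => ν) ≤ V := fun i =>
    (integral_pi_one ν i (f := fun a => proj₁ ν k a ^ 2) (by fun_prop)).trans_le (i1.trans i2)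
  rw [← integral_pi_three ν n01 n02 n12 (f := fun a b c => deg₃ ν k a b c ^ 2) (by fun_prop)]
  calc ∫ x : Fin 3 → S, deg₃ ν k (x 0) (x 1) (x 2) ^ 2 ∂(Measure.pi fun _ => ν)
      ≤ ∫ x : Fin 3 → S, 8 * (k (x 0) (x 1) (x 2) ^ 2 + proj₂ ν k (x 0) (x 1) ^ 2
          + proj₂ ν k (x 0) (x 2) ^ 2 + proj₂ ν k (x 1) (x 2) ^ 2 + proj₁ ν k (x 0) ^ 2
          + proj₁ ν k (x 1) ^ 2 + proj₁ ν k (x 2) ^ 2 + kmean ν k ^ 2)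
          ∂(Measure.pi fun _ => ν) := by
        refine BddMeas.integral_mono (by fun_prop) (by fun_prop) fun x => ?_
        unfold deg₃
        generalize k (x 0) (x 1) (x 2) = a1
        generalize proj₂ ν k (x 0) (x 1) = a2
        generalize proj₂ ν k (x 0) (x 2) = a3
        generalize proj₂ ν k (x 1) (x 2) = a4
        generalize proj₁ ν k (x 0) = a5
        generalize proj₁ ν k (x 1) = a6
        generalize proj₁ ν k (x 2) = a7
        generalize kmean ν k = a8
        have b1 : ∀ u v : ℝ, (u - v) ^ 2 ≤ 2 * (u ^ 2 + v ^ 2) := fun u v => by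
          nlinarith [sq_nonneg (u + v)]
        have c1 := b1 (a1 - a2 - a3 - a4) (-(a5 + a6 + a7 - a8))
        have c2 := b1 (a1 - a2) (a3 + a4)
        have c3 := b1 (a5 + a6) (a8 - a7)
        have c4 := b1 a1 a2
        have c5 := b1 a3 (-a4)
        have c6 := b1 a5 (-a6)
        have c7 := b1 a8 a7
        nlinarith
    _ ≤ 64 * V := by
        rw [integral_const_mul, BddMeas.integral_add (by fun_prop) (by fun_prop),
          BddMeas.integral_add (by fun_prop) (by fun_prop),
          BddMeas.integral_add (by fun_prop) (by fun_prop),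
          BddMeas.integral_add (by fun_prop) (by fun_prop),
          BddMeas.integral_add (by fun_prop) (by fun_prop),
          BddMeas.integral_add (by fun_prop) (by fun_prop),
          BddMeas.integral_add (by fun_prop) (by fun_prop), eV]
        have := e2 0 1 n01
        have := e2 0 2 n02
        have := e2 1 2 n12
        have := e1 0
        have := e1 1
        have := e1 2
        simp only [integral_const, probReal_univ, smul_eq_mul, one_mul]
        linarith

theorem SymmKernel.integral_sq_distinctSum₃_deg₃_le (hk : SymmKernel k) :
    ∫ x : ι → S, distinctSum₃ (deg₃ ν k) x ^ 2 ∂(Measure.pi fun _ => ν)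
      ≤ 1728 * (Fintype.card ι : ℝ) ^ 3 * ∫ a, ∫ b, ∫ c, k a b c ^ 2 ∂ν ∂ν ∂ν := by
  have h3 := fun a b => hk.integral_deg₃ (ν := ν) a b
  have h2 : ∀ a c, ∫ b, deg₃ ν k a b c ∂ν = 0 := fun a c => by
    simp_rw [← hk.deg₃_swap₂₃ a _ c, h3]
  have h1 : ∀ b c, ∫ a, deg₃ ν k a b c ∂ν = 0 := fun b c => by
    simp_rw [← hk.deg₃_swap₁₂ _ b c, h2]
  refine (integral_sq_distinctSum₃_le ν hk.bdd_deg₃ h1 h2 h3).trans ?_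
  have := hk.integral_sq_deg₃_le (ν := ν)
  calc _ ≤ 27 * (Fintype.card ι : ℝ) ^ 3 * (64 * ∫ a, ∫ b, ∫ c, k a b c ^ 2 ∂ν ∂ν ∂ν) := by gcongr
    _ = _ := by ring

theorem SymmKernel.integral_sq_distinctSum₂_deg₂_le (hk : SymmKernel k) :
    ∫ x : ι → S, distinctSum₂ (deg₂ ν k) x ^ 2 ∂(Measure.pi fun _ => ν)
      ≤ 4 * (Fintype.card ι : ℝ) ^ 2 * ∫ a, ∫ b, proj₂ ν k a b ^ 2 ∂ν ∂ν := by
  have h2 := fun a => hk.integral_deg₂ (ν := ν) a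
  have h1 : ∀ b, ∫ a, deg₂ ν k a b ∂ν = 0 := fun b => by
    simp_rw [fun a => hk.deg₂_symm (ν := ν) b a, h2]
  refine (integral_sq_distinctSum₂_le ν hk.bdd_deg₂ h1 h2).trans ?_
  have := hk.integral_sq_deg₂_le (ν := ν)
  gcongr

theorem SymmKernel.integral_sq_sum_proj₁_le (hk : SymmKernel k) :
    ∫ x : ι → S, (∑ i, (proj₁ ν k (x i) - kmean ν k)) ^ 2 ∂(Measure.pi fun _ => ν)
      ≤ (Fintype.card ι : ℝ) * ∫ a, proj₁ ν k a ^ 2 ∂ν := by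
  have h1 := hk.bdd_proj₁ (ν := ν)
  have hm : ∫ a, proj₁ ν k a ∂ν = kmean ν k := rfl
  refine (integral_sq_sum_le_of_centered ν (q := fun a => proj₁ ν k a - kmean ν k)
    (by fun_prop) ?_).trans ?_
  · rw [BddMeas.integral_sub (by fun_prop) (by fun_prop), hm]
    simp
  · refine mul_le_mul_of_nonneg_left ?_ (Nat.cast_nonneg _)
    have : ∀ a, (proj₁ ν k a - kmean ν k) ^ 2
        = proj₁ ν k a ^ 2 - 2 * kmean ν k * proj₁ ν k a + kmean ν k ^ 2 := fun x => by ring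
    simp_rw [this]
    rw [BddMeas.integral_add (by fun_prop) (by fun_prop),
      BddMeas.integral_sub (by fun_prop) (by fun_prop), integral_const_mul, hm]
    simp only [integral_const, probReal_univ, smul_eq_mul, one_mul]
    nlinarith [sq_nonneg (kmean ν k)]

/-- Variance bound for a sum of a symmetric kernel over distinct triples. -/
theorem SymmKernel.integral_sq_distinctSum₃_sub_le [Nonempty ι] (hk : SymmKernel k) :
    ∫ x : ι → S, (distinctSum₃ k x - (Fintype.card ι : ℝ) * ((Fintype.card ι : ℝ) - 1) *
        ((Fintype.card ι : ℝ) - 2) * kmean ν k) ^ 2 ∂(Measure.pi fun _ => ν)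
      ≤ 6000 * ((Fintype.card ι : ℝ) ^ 3 * ∫ a, ∫ b, ∫ c, k a b c ^ 2 ∂ν ∂ν ∂ν
        + (Fintype.card ι : ℝ) ^ 4 * ∫ a, ∫ b, proj₂ ν k a b ^ 2 ∂ν ∂ν
        + (Fintype.card ι : ℝ) ^ 5 * ∫ a, proj₁ ν k a ^ 2 ∂ν) := by
  have h1 := hk.bdd_proj₁ (ν := ν)
  have h2 := hk.bdd_deg₂ (ν := ν)
  have h3 := hk.bdd_deg₃ (ν := ν)
  have h0 := hk.bdd
  have b1 := hk.integral_sq_sum_proj₁_le (ν := ν) (ι := ι)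
  have b2 := hk.integral_sq_distinctSum₂_deg₂_le (ν := ν) (ι := ι)
  have b3 := hk.integral_sq_distinctSum₃_deg₃_le (ν := ν) (ι := ι)
  have V1 : 0 ≤ ∫ a, proj₁ ν k a ^ 2 ∂ν := integral_nonneg fun _ => sq_nonneg _
  have V2 : 0 ≤ ∫ a, ∫ b, proj₂ ν k a b ^ 2 ∂ν ∂ν :=
    integral_nonneg fun _ => integral_nonneg fun _ => sq_nonneg _
  have V3 : 0 ≤ ∫ a, ∫ b, ∫ c, k a b c ^ 2 ∂ν ∂ν ∂ν :=
    integral_nonneg fun _ => integral_nonneg fun _ => integral_nonneg fun _ => sq_nonneg _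
  set n : ℝ := (Fintype.card ι : ℝ) with hn
  have hn1 : 1 ≤ n := by
    rw [hn]
    exact_mod_cast Fintype.card_pos
  have q1 : (n - 1) ^ 2 ≤ n ^ 2 := by nlinarith
  have q2 : (n - 2) ^ 2 ≤ n ^ 2 := by nlinarith
  have step : ∀ x : ι → S, (distinctSum₃ k x - n * (n - 1) * (n - 2) * kmean ν k) ^ 2
      ≤ 3 * (distinctSum₃ (deg₃ ν k) x ^ 2 + 9 * n ^ 2 * distinctSum₂ (deg₂ ν k) x ^ 2
        + 9 * n ^ 4 * (∑ i, (proj₁ ν k (x i) - kmean ν k)) ^ 2) := by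
    intro x
    rw [distinctSum₃_hoeffding ν k x, ← hn]
    generalize distinctSum₃ (deg₃ ν k) x = A
    generalize distinctSum₂ (deg₂ ν k) x = B
    generalize ∑ i, (proj₁ ν k (x i) - kmean ν k) = D
    have c : ∀ u v w : ℝ, (u + v + w) ^ 2 ≤ 3 * (u ^ 2 + v ^ 2 + w ^ 2) := fun u v w => by
      nlinarith [sq_nonneg (u - v), sq_nonneg (u - w), sq_nonneg (v - w)]
    calc _ = (A + 3 * (n - 2) * B + 3 * (n - 1) * (n - 2) * D) ^ 2 := by ring
      _ ≤ 3 * (A ^ 2 + (3 * (n - 2) * B) ^ 2 + (3 * (n - 1) * (n - 2) * D) ^ 2) := c _ _ _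
      _ = 3 * (A ^ 2 + 9 * (n - 2) ^ 2 * B ^ 2 + 9 * ((n - 1) ^ 2 * (n - 2) ^ 2) * D ^ 2) := by ring
      _ ≤ 3 * (A ^ 2 + 9 * n ^ 2 * B ^ 2 + 9 * (n ^ 2 * n ^ 2) * D ^ 2) := by gcongr
      _ = _ := by ring
  refine (BddMeas.integral_mono (by fun_prop) (by fun_prop) step).trans ?_
  rw [integral_const_mul, BddMeas.integral_add (by fun_prop) (by fun_prop),
    BddMeas.integral_add (by fun_prop) (by fun_prop), integral_const_mul, integral_const_mul]
  -- The three constants are 3 · 1728 = 5184, 3 · 9 · 4 = 108 and 27, all below 6000.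
  have c2 := mul_le_mul_of_nonneg_left b2 (by positivity : 0 ≤ 9 * n ^ 2)
  have c1 := mul_le_mul_of_nonneg_left b1 (by positivity : 0 ≤ 9 * n ^ 4)
  have p3 : 0 ≤ n ^ 3 * ∫ a, ∫ b, ∫ c, k a b c ^ 2 ∂ν ∂ν ∂ν := by positivity
  have p2 : 0 ≤ n ^ 4 * ∫ a, ∫ b, proj₂ ν k a b ^ 2 ∂ν ∂ν := by positivity
  have p1 : 0 ≤ n ^ 5 * ∫ a, proj₁ ν k a ^ 2 ∂ν := by positivity
  nlinarith

/-- Variance bound for a sum of a symmetric kernel over distinct pairs. -/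
theorem integral_sq_distinctSum₂_sub_le [Nonempty ι] {p : S → S → ℝ}
    (hp : BddMeas (fun z : S × S => p z.1 z.2)) (hsymm : ∀ a b, p b a = p a b) :
    ∫ x : ι → S, (distinctSum₂ p x - (Fintype.card ι : ℝ) * ((Fintype.card ι : ℝ) - 1) *
        ∫ a, ∫ b, p a b ∂ν ∂ν) ^ 2 ∂(Measure.pi fun _ => ν)
      ≤ 8 * ((Fintype.card ι : ℝ) ^ 2 * ∫ a, ∫ b, p a b ^ 2 ∂ν ∂ν
        + (Fintype.card ι : ℝ) ^ 3 * ∫ a, (∫ b, p a b ∂ν) ^ 2 ∂ν) := by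
  have hk : SymmKernel (fun a b c => p a b + p a c + p b c) :=
    ⟨by fun_prop, fun a b c => by rw [hsymm a b]; ring, fun a b c => by rw [hsymm b c]; ring⟩
  set p₁ : S → ℝ := fun a => ∫ b, p a b ∂ν with hp₁
  have h1 : BddMeas p₁ := BddMeas.integral hp
  set m := ∫ a, p₁ a ∂ν with hm
  set q₂ : S → S → ℝ := fun a b => p a b - p₁ a - p₁ b + m with hq₂
  have h2 : BddMeas (fun z : S × S => q₂ z.1 z.2) := by fun_prop
  have d2 : ∀ a, ∫ b, q₂ a b ∂ν = 0 := fun a => by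
    rw [hq₂, BddMeas.integral_add (by fun_prop) (by fun_prop),
      BddMeas.integral_sub (by fun_prop) (by fun_prop),
      BddMeas.integral_sub (by fun_prop) (by fun_prop)]
    simp [hp₁, hm]
  have d1 : ∀ b, ∫ a, q₂ a b ∂ν = 0 := fun b => by
    rw [← d2 b]
    refine integral_congr_ae (ae_of_all _ fun a => ?_)
    simp only [hq₂, hsymm a b]
    ring
  set n : ℝ := (Fintype.card ι : ℝ) with hn
  have hn1 : 1 ≤ n := by
    rw [hn]
    exact_mod_cast Fintype.card_pos
  have V1 : 0 ≤ ∫ a, p₁ a ^ 2 ∂ν := integral_nonneg fun _ => sq_nonneg _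
  have m1 : m ^ 2 ≤ ∫ a, p₁ a ^ 2 ∂ν := h1.sq_integral_le
  have b1 : ∫ x : ι → S, (∑ i, (p₁ (x i) - m)) ^ 2 ∂(Measure.pi fun _ => ν)
      ≤ n * ∫ a, p₁ a ^ 2 ∂ν := by
    refine (integral_sq_sum_le_of_centered ν (q := fun a => p₁ a - m) (by fun_prop) ?_).trans ?_
    · rw [BddMeas.integral_sub (by fun_prop) (by fun_prop)]
      simp [hm]
    · refine mul_le_mul_of_nonneg_left ?_ (by positivity)
      have : ∀ a, (p₁ a - m) ^ 2 = p₁ a ^ 2 - 2 * m * p₁ a + m ^ 2 := fun x => by ring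
      simp_rw [this]
      rw [BddMeas.integral_add (by fun_prop) (by fun_prop),
        BddMeas.integral_sub (by fun_prop) (by fun_prop), integral_const_mul, ← hm]
      simp only [integral_const, probReal_univ, smul_eq_mul, one_mul]
      nlinarith [sq_nonneg m]
  -- Centring is undone in two steps, p₁(a) − m first and p₁(b) second. Each time, integrating in
  -- the matching variable exhibits the difference as a nonnegative square, which is dropped.
  have v2 : ∫ a, ∫ b, q₂ a b ^ 2 ∂ν ∂ν ≤ ∫ a, ∫ b, p a b ^ 2 ∂ν ∂ν := by
    have inner : ∀ a, ∫ b, q₂ a b ^ 2 ∂ν = ∫ b, (p a b - p₁ b) ^ 2 ∂ν - (p₁ a - m) ^ 2 := by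
      intro a
      have : ∀ b, q₂ a b ^ 2 = (p a b - p₁ b) ^ 2 - (2 * (p₁ a - m)) * p a b
          + (2 * (p₁ a - m)) * p₁ b + (p₁ a - m) ^ 2 := fun b => by
        simp only [hq₂]
        ring
      simp_rw [this]
      rw [BddMeas.integral_add (by fun_prop) (by fun_prop),
        BddMeas.integral_add (by fun_prop) (by fun_prop),
        BddMeas.integral_sub (by fun_prop) (by fun_prop), integral_const_mul, integral_const_mul,
        ← hm]
      simp only [integral_const, probReal_univ, smul_eq_mul, one_mul]
      change _ - 2 * (p₁ a - m) * p₁ a + _ + _ = _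
      ring
    calc ∫ a, ∫ b, q₂ a b ^ 2 ∂ν ∂ν ≤ ∫ a, ∫ b, (p a b - p₁ b) ^ 2 ∂ν ∂ν := by
          refine BddMeas.integral_mono (by fun_prop) (by fun_prop) fun a => ?_
          rw [inner]
          linarith [sq_nonneg (p₁ a - m)]
      _ = ∫ b, ∫ a, (p a b - p₁ b) ^ 2 ∂ν ∂ν := BddMeas.integral_comm (by fun_prop)
      _ ≤ ∫ b, ∫ a, p b a ^ 2 ∂ν ∂ν := by
          refine BddMeas.integral_mono (by fun_prop) (by fun_prop) fun b => ?_
          have : ∀ a, (p a b - p₁ b) ^ 2 = p b a ^ 2 - 2 * p₁ b * p b a + p₁ b ^ 2 := fun a => by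
            rw [hsymm b a]
            ring
          simp_rw [this]
          rw [BddMeas.integral_add (by fun_prop) (by fun_prop),
            BddMeas.integral_sub (by fun_prop) (by fun_prop), integral_const_mul]
          simp only [integral_const, probReal_univ, smul_eq_mul, one_mul]
          change _ - 2 * p₁ b * p₁ b + _ ≤ _
          nlinarith [sq_nonneg (p₁ b)]
  have b2 : ∫ x : ι → S, distinctSum₂ q₂ x ^ 2 ∂(Measure.pi fun _ => ν)
      ≤ 4 * n ^ 2 * ∫ a, ∫ b, p a b ^ 2 ∂ν ∂ν := by
    refine (integral_sq_distinctSum₂_le ν h2 d1 d2).trans ?_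
    rw [← hn]
    gcongr
  have dec : ∀ x : ι → S, distinctSum₂ p x - n * (n - 1) * m
      = distinctSum₂ q₂ x + 2 * (n - 1) * ∑ i, (p₁ (x i) - m) := by
    intro x
    have e : p = fun a b => q₂ a b + ((p₁ a - m) + ((p₁ b - m) + m)) := by
      funext a b
      simp only [hq₂]
      ring
    have f1 : distinctSum₂ (fun a _ => p₁ a - m) x = (n - 1) * ∑ i, (p₁ (x i) - m) :=
      distinctSum₂_single (fun a => p₁ a - m) x
    have f2 : distinctSum₂ (fun _ b => p₁ b - m) x = (n - 1) * ∑ i, (p₁ (x i) - m) := by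
      rw [← f1, ← distinctSum₂_swap]
    have f3 : distinctSum₂ (fun _ _ => m) x = (n - 1) * (n * m) := by
      rw [distinctSum₂_single (fun _ => m)]
      simp [hn]
    clear_value q₂ p₁
    conv_lhs => rw [e]
    rw [distinctSum₂_add, distinctSum₂_add, distinctSum₂_add, f1, f2, f3]
    ring
  have step : ∀ x : ι → S, (distinctSum₂ p x - n * (n - 1) * m) ^ 2
      ≤ 2 * (distinctSum₂ q₂ x ^ 2 + 4 * n ^ 2 * (∑ i, (p₁ (x i) - m)) ^ 2) := by
    intro x
    rw [dec]
    generalize distinctSum₂ q₂ x = B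
    generalize ∑ i, (p₁ (x i) - m) = D
    have q1 : (n - 1) ^ 2 ≤ n ^ 2 := by nlinarith
    calc (B + 2 * (n - 1) * D) ^ 2 ≤ 2 * (B ^ 2 + 4 * (n - 1) ^ 2 * D ^ 2) := by
          nlinarith [sq_nonneg (B - 2 * (n - 1) * D)]
      _ ≤ _ := by gcongr
  refine (BddMeas.integral_mono (by fun_prop) (by fun_prop) step).trans ?_
  rw [integral_const_mul, BddMeas.integral_add (by fun_prop) (by fun_prop), integral_const_mul]
  have c1 := mul_le_mul_of_nonneg_left b1 (by positivity : 0 ≤ 4 * n ^ 2)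
  nlinarith

end Hoeffding

/-! ### Normal approximation for linear and degenerate quadratic statistics. -/

section LowOrder

variable {ι S : Type*} [Fintype ι] [DecidableEq ι] [MeasurableSpace S]
  {ν : Measure S} [IsProbabilityMeasure ν]

/-- From |x| ≤ ε + x²/ε. It trades the truncated third moment for second and fourth moments, which
degeneracy makes computable; ε is chosen only when the bound is applied. -/
theorem sq_mul_min_le {ε : ℝ} (hε : 0 < ε) (x : ℝ) :
    x ^ 2 * min 1 |x| ≤ ε * x ^ 2 + 1 / ε * x ^ 4 := by
  have h1 : min 1 |x| ≤ ε + 1 / ε * x ^ 2 := by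
    refine (min_le_right _ _).trans ?_
    rw [← sq_abs x]
    have : |x| * ε ≤ ε ^ 2 + |x| ^ 2 := by nlinarith [sq_nonneg (|x| - ε), sq_nonneg (|x|), sq_nonneg ε]
    calc |x| = |x| * ε / ε := by field_simp
      _ ≤ (ε ^ 2 + |x| ^ 2) / ε := by gcongr
      _ = _ := by field_simp
  calc x ^ 2 * min 1 |x| ≤ x ^ 2 * (ε + 1 / ε * x ^ 2) := by gcongr
    _ = _ := by ring

/-- Normal approximation for a centered sum. -/
theorem norm_charFun_sum_le {q : S → ℝ} (hq : BddMeas q) (hq0 : ∫ a, q a ∂ν = 0) {s η τ : ℝ}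
    (hη : ∀ a, |s * q a| ≤ η) (hτ : τ = (Fintype.card ι : ℝ) * s ^ 2 * ∫ a, q a ^ 2 ∂ν) (t : ℝ) :
    ‖∫ x : ι → S, Complex.exp (((t * (s * ∑ i, q (x i)) : ℝ) : ℂ) * Complex.I)
        ∂(Measure.pi fun _ => ν) - Complex.exp (-(t : ℂ) ^ 2 / 2)‖
      ≤ 2 * (1 + |t|) ^ 2 * |t| * Real.exp (t ^ 2 / 2) * (|τ - 1| + η * √τ + τ * η) := by
  have hη0 : 0 ≤ η := by
    have hne : Nonempty S := by
      by_contra h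
      rw [not_nonempty_iff] at h
      have := measure_univ (μ := ν)
      simp [Set.univ_eq_empty_iff.2 h] at this
    exact (abs_nonneg _).trans (hη hne.some)
  set v := ∫ a, q a ^ 2 ∂ν with hv
  have hv0 : 0 ≤ v := integral_nonneg fun _ => sq_nonneg _
  have hτ0 : 0 ≤ τ := by rw [hτ]; positivity
  refine norm_charFun_sub_le ν (W := fun x : ι → S => s * ∑ i, q (x i))
    (Δ := fun i x => s * q (x i)) (d := 1) one_pos (by fun_prop) (fun i => by fun_prop)
    (fun x => by rw [one_mul, Finset.mul_sum]) ?_ ?_ t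
  · intro i x y
    have e : ∀ z : ι → S, s * ∑ j, q (z j) - s * q (z i)
        = s * ∑ j ∈ Finset.univ.erase i, q (z j) := fun z => by
      rw [← Finset.add_sum_erase _ _ (Finset.mem_univ i)]
      ring
    rw [e, e]
    congr 1
    refine Finset.sum_congr rfl fun j hj => ?_
    rw [Function.update_of_ne (Finset.ne_of_mem_erase hj)]
  · have hA : ∀ i : ι, ∫ x : ι → S, |∫ y, s * q (Function.update x i y i) ∂ν|
        ∂(Measure.pi fun _ => ν) = 0 := fun i => by
      simp [integral_const_mul, hq0]
    -- The sum of squares has mean τ and fluctuates around it by a centred sum. Its variance is at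
    -- most η² τ, because |s q| ≤ η bounds the fourth moment by η² times the second.
    have hB : ∫ x : ι → S, |(∑ i, (s * q (x i)) ^ 2) / 1 - 1| ∂(Measure.pi fun _ => ν)
        ≤ |τ - 1| + η * √τ := by
      set u : S → ℝ := fun a => (s * q a) ^ 2 - s ^ 2 * v with hu
      have hub : BddMeas u := by fun_prop
      have hu0 : ∫ a, u a ∂ν = 0 := by
        rw [hu, BddMeas.integral_sub (by fun_prop) (by fun_prop)]
        simp [mul_pow, integral_const_mul, hv]
      have hu2 : ∫ a, u a ^ 2 ∂ν ≤ η ^ 2 * s ^ 2 * v := by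
        have e : ∀ a, u a ^ 2 = (s * q a) ^ 4 - 2 * s ^ 4 * v * q a ^ 2 + (s ^ 2 * v) ^ 2 :=
          fun a => by simp only [hu]; ring
        have h4 : ∫ a, (s * q a) ^ 4 ∂ν ≤ η ^ 2 * s ^ 2 * v := by
          rw [hv, ← integral_const_mul]
          refine BddMeas.integral_mono (by fun_prop) (by fun_prop) fun a => ?_
          have : (s * q a) ^ 2 ≤ η ^ 2 := by
            rw [← sq_abs]
            exact pow_le_pow_left₀ (abs_nonneg _) (hη a) 2
          calc (s * q a) ^ 4 = (s * q a) ^ 2 * (s * q a) ^ 2 := by ring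
            _ ≤ η ^ 2 * (s * q a) ^ 2 := by gcongr
            _ = _ := by ring
        simp_rw [e]
        rw [BddMeas.integral_add (by fun_prop) (by fun_prop),
          BddMeas.integral_sub (by fun_prop) (by fun_prop), integral_const_mul, ← hv]
        simp only [integral_const, probReal_univ, smul_eq_mul, one_mul]
        nlinarith [sq_nonneg (s ^ 2 * v)]
      have h2 := integral_sq_sum_le_of_centered (ι := ι) ν hub hu0
      have h3 : ∫ x : ι → S, |∑ i, u (x i)| ∂(Measure.pi fun _ => ν) ≤ η * √τ := by
        have : η * √τ = √(η ^ 2 * τ) := by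
          rw [Real.sqrt_mul (sq_nonneg η), Real.sqrt_sq hη0]
        rw [this]
        refine BddMeas.integral_abs_le_sqrt (by fun_prop) (h2.trans ?_)
        rw [hτ]
        calc _ ≤ (Fintype.card ι : ℝ) * (η ^ 2 * s ^ 2 * v) := by gcongr
          _ = _ := by ring
      calc _ ≤ ∫ x : ι → S, (|∑ i, u (x i)| + |τ - 1|) ∂(Measure.pi fun _ => ν) := by
            refine BddMeas.integral_mono (by simp only [div_one]; fun_prop) (by fun_prop)
              fun x => ?_
            have : (∑ i, (s * q (x i)) ^ 2) / 1 - 1 = ∑ i, u (x i) + (τ - 1) := by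
              simp only [hu, Finset.sum_sub_distrib]
              simp only [Finset.sum_const, Finset.card_univ, nsmul_eq_mul, hτ]
              ring
            rw [this]
            exact abs_add_le _ _
        _ = ∫ x : ι → S, |∑ i, u (x i)| ∂(Measure.pi fun _ => ν) + |τ - 1| := by
            rw [BddMeas.integral_add (by fun_prop) (by fun_prop)]
            simp
        _ ≤ _ := by linarith
    have hD : ∀ i : ι, ∫ x : ι → S, (s * q (x i)) ^ 2 * min 1 |s * q (x i)|
        ∂(Measure.pi fun _ => ν) ≤ η * (s ^ 2 * v) := fun i => by
      rw [integral_pi_one ν i (f := fun a => (s * q a) ^ 2 * min 1 |s * q a|) (by fun_prop), hv,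
        ← integral_const_mul, ← integral_const_mul]
      refine BddMeas.integral_mono (by fun_prop) (by fun_prop) fun a => ?_
      calc (s * q a) ^ 2 * min 1 |s * q a| ≤ (s * q a) ^ 2 * η := by
            gcongr
            exact (min_le_right _ _).trans (hη a)
        _ = _ := by ring
    have hD' := Finset.sum_le_sum fun i (_ : i ∈ Finset.univ) => hD i
    simp only [Finset.sum_const, Finset.card_univ, nsmul_eq_mul] at hD'
    have : (Fintype.card ι : ℝ) * (η * (s ^ 2 * v)) = τ * η := by rw [hτ]; ring
    rw [Finset.sum_congr rfl fun i _ => hA i]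
    simp only [Finset.sum_const_zero, zero_div, zero_add]
    rw [div_one (∑ i, _)]
    linarith

-- Isolates the dependence on coordinate j. The factor 2 counts the positions j can occupy, and is
-- the d of `norm_charFun_sub_le` for quadratic statistics.
omit [MeasurableSpace S] in
theorem distinctSum₂_eq_add {q : S → S → ℝ} (hq : ∀ a b, q b a = q a b) (j : ι) (x : ι → S) :
    distinctSum₂ q x = (∑ a, ∑ b, if a ≠ b ∧ a ≠ j ∧ b ≠ j then q (x a) (x b) else 0)
      + 2 * ∑ i, if i ≠ j then q (x i) (x j) else 0 := by
  have e : ∀ a b, (if a ≠ b then q (x a) (x b) else 0)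
      = (if a ≠ b ∧ a ≠ j ∧ b ≠ j then q (x a) (x b) else 0)
        + (if b = j then (if a ≠ j then q (x a) (x j) else 0) else 0)
        + (if a = j then (if b ≠ j then q (x b) (x j) else 0) else 0) := fun a b => by
    by_cases ha : a = j <;> by_cases hb : b = j
    · subst ha; subst hb; simp
    · subst ha
      rw [if_pos (Ne.symm hb), if_neg (by simp), if_neg hb, if_pos rfl, if_pos hb,
        hq (x b) (x a), zero_add, zero_add]
    · subst hb
      rw [if_pos ha, if_neg (by simp), if_pos rfl, if_neg ha, zero_add, add_zero]
    · simp only [ha, hb, ne_eq, not_false_eq_true, and_true, if_false, add_zero]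
  unfold distinctSum₂
  rw [Finset.sum_congr rfl fun a _ => Finset.sum_congr rfl fun b _ => e a b]
  simp_rw [Finset.sum_add_distrib]
  simp only [Finset.sum_ite_eq', Finset.mem_univ, if_true]
  rw [Finset.sum_comm (f := fun a b => if a = j then (if b ≠ j then q (x b) (x j) else 0) else 0)]
  simp only [Finset.sum_ite_eq', Finset.mem_univ, if_true]
  ring

omit [MeasurableSpace S] in
theorem sq_sum_ne_eq (q : S → S → ℝ) (j : ι) (x : ι → S) :
    (∑ i, if i ≠ j then q (x i) (x j) else 0) ^ 2
      = (∑ i, if i ≠ j then q (x i) (x j) ^ 2 else 0)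
        + ∑ i, ∑ l, if i ≠ l ∧ i ≠ j ∧ l ≠ j then q (x i) (x j) * q (x l) (x j) else 0 := by
  rw [sq, Finset.sum_mul_sum, ← Finset.sum_add_distrib]
  refine Finset.sum_congr rfl fun i _ => ?_
  have : (if i ≠ j then q (x i) (x j) ^ 2 else 0)
      = ∑ l, if i = l then (if i ≠ j then q (x i) (x j) ^ 2 else 0) else 0 := by simp
  rw [this, ← Finset.sum_add_distrib]
  refine Finset.sum_congr rfl fun l _ => ?_
  by_cases hil : i = l
  · subst hil
    by_cases hij : i = j <;> simp [hij, sq]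
  · by_cases hij : i = j <;> by_cases hlj : l = j <;> simp [hil, hij, hlj]

set_option maxHeartbeats 1000000 in
/-- Normal approximation for a completely degenerate sum over pairs. -/
theorem norm_charFun_distinctSum₂_le [Nonempty ι] {q : S → S → ℝ}
    (hq : BddMeas (fun p : S × S => q p.1 p.2)) (hsymm : ∀ a b, q b a = q a b)
    (hdeg : ∀ a, ∫ b, q a b ∂ν = 0) {w v₄ g₂ l ε : ℝ} (hw : ∀ a, ∫ b, q a b ^ 2 ∂ν ≤ w)
    (hv₄ : ∫ a, ∫ b, q a b ^ 4 ∂ν ∂ν ≤ v₄)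
    (hg₂ : ∫ a, ∫ b, (∫ c, q a c * q b c ∂ν) ^ 2 ∂ν ∂ν ≤ g₂) (hε : 0 < ε) (t : ℝ) :
    ‖∫ x : ι → S, Complex.exp (((t * (l * distinctSum₂ q x) : ℝ) : ℂ) * Complex.I)
        ∂(Measure.pi fun _ => ν) - Complex.exp (-(t : ℂ) ^ 2 / 2)‖
      ≤ 2 * (1 + |t|) ^ 2 * |t| * Real.exp (t ^ 2 / 2) *
        (|2 * l ^ 2 * (Fintype.card ι : ℝ) * ((Fintype.card ι : ℝ) - 1) *
            ∫ a, ∫ b, q a b ^ 2 ∂ν ∂ν - 1|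
          + 20 * √(l ^ 4 * ((Fintype.card ι : ℝ) ^ 2 * v₄ + (Fintype.card ι : ℝ) ^ 3 * w ^ 2))
          + 4 * √(l ^ 4 * (Fintype.card ι : ℝ) ^ 4 * g₂)
          + 2 * ε * l ^ 2 * (Fintype.card ι : ℝ) ^ 2 * ∫ a, ∫ b, q a b ^ 2 ∂ν ∂ν
          + 100 / ε *
            (l ^ 4 * ((Fintype.card ι : ℝ) ^ 2 * v₄ + (Fintype.card ι : ℝ) ^ 3 * w ^ 2))) := by
  set n : ℝ := (Fintype.card ι : ℝ) with hn
  have hn1 : 1 ≤ n := by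
    rw [hn]
    exact_mod_cast Fintype.card_pos
  set v := ∫ a, ∫ b, q a b ^ 2 ∂ν ∂ν with hv
  have hv0 : 0 ≤ v := integral_nonneg fun _ => integral_nonneg fun _ => sq_nonneg _
  have hv40 : 0 ≤ v₄ := le_trans
    (integral_nonneg fun _ => integral_nonneg fun _ => by positivity) hv₄
  have hg20 : 0 ≤ g₂ := le_trans
    (integral_nonneg fun _ => integral_nonneg fun _ => by positivity) hg₂
  set X := l ^ 4 * (n ^ 2 * v₄ + n ^ 3 * w ^ 2) with hX
  have hX0 : 0 ≤ X := by positivity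
  have hdeg' : ∀ b, ∫ a, q a b ∂ν = 0 := fun b => by simp_rw [fun a => hsymm b a, hdeg]
  have hw' : ∀ b, ∫ a, q a b ^ 2 ∂ν ≤ w := fun b => by simp_rw [fun a => hsymm b a, hw]
  have hw0 : 0 ≤ w := by
    have hne : Nonempty S := by
      by_contra h
      rw [not_nonempty_iff] at h
      have := measure_univ (μ := ν)
      simp [Set.univ_eq_empty_iff.2 h] at this
    exact le_trans (integral_nonneg fun _ => sq_nonneg _) (hw hne.some)
  -- the second moment of products sharing one index
  have hκ : ∀ {κ : Type _} [Fintype κ] [DecidableEq κ] {i j m : κ}, i ≠ j → i ≠ m → j ≠ m →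
      ∫ x : κ → S, (q (x i) (x m) * q (x j) (x m)) ^ 2 ∂(Measure.pi fun _ => ν) ≤ w ^ 2 := by
    intro κ _ _ i j m hij him hjm
    rw [integral_pi_three ν him.symm hjm.symm hij (f := fun c a b => (q a c * q b c) ^ 2)
      (by fun_prop)]
    have e : ∀ c, ∫ a, ∫ b, (q a c * q b c) ^ 2 ∂ν ∂ν = (∫ a, q a c ^ 2 ∂ν) ^ 2 := fun c => by
      simp_rw [mul_pow, integral_const_mul, integral_mul_const]
      ring
    simp_rw [e]
    calc _ ≤ ∫ _, w ^ 2 ∂ν := by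
          refine BddMeas.integral_mono (by fun_prop) (by fun_prop) fun c => ?_
          exact pow_le_pow_left₀ (integral_nonneg fun _ => sq_nonneg _) (hw' c) 2
      _ = w ^ 2 := by simp
  set R : ι → (ι → S) → ℝ := fun j x =>
    ∑ i, ∑ m, if i ≠ m ∧ i ≠ j ∧ m ≠ j then q (x i) (x j) * q (x m) (x j) else 0 with hR
  set Q : ι → (ι → S) → ℝ := fun j x => ∑ i, if i ≠ j then q (x i) (x j) ^ 2 else 0 with hQ
  have hRb : ∀ j, BddMeas (R j) := fun j => by fun_prop
  have hQb : ∀ j, BddMeas (Q j) := fun j => by fun_prop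
  -- For fixed j the products are degenerate in both free indices, so only pairs with equal support
  -- correlate. This gives order n² where a termwise bound would give n⁴.
  have hR2 : ∀ j, ∫ x, R j x ^ 2 ∂(Measure.pi fun _ => ν) ≤ 4 * n ^ 2 * w ^ 2 := by
    intro j
    set T : Finset (ι × ι) := Finset.univ.filter fun p => p.1 ≠ p.2 ∧ p.1 ≠ j ∧ p.2 ≠ j with hT
    have e : ∀ x, R j x = ∑ p ∈ T, q (x p.1) (x j) * q (x p.2) (x j) := fun x => by
      rw [hT, Finset.sum_filter, Fintype.sum_prod_type]
    simp_rw [e]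
    refine (integral_sq_sum_le_of_degenerate ν T (fun p => {p.1, p.2})
      (fun p x => q (x p.1) (x j) * q (x p.2) (x j)) (fun p => by fun_prop) ?_ ?_
      (V := w ^ 2) ?_ 4 fun a _ => card_filter_pair_le _ a).trans ?_
    · rintro ⟨i, m⟩ hp i' hi' x
      simp only [hT, Finset.mem_filter, Finset.mem_univ, true_and] at hp
      obtain ⟨him, hij, hmj⟩ := hp
      simp only [Finset.mem_insert, Finset.mem_singleton] at hi'
      rcases hi' with rfl | rfl
      · simp [Function.update_of_ne him.symm, Function.update_of_ne hij.symm, integral_mul_const,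
          hdeg']
      · simp [Function.update_of_ne him, Function.update_of_ne hmj.symm, integral_const_mul,
          hdeg']
    · rintro ⟨i, m⟩ hp ⟨i', m'⟩ _ z hz hz' x y
      simp only [hT, Finset.mem_filter, Finset.mem_univ, true_and] at hp
      obtain ⟨him, hij, hmj⟩ := hp
      have hzj : j ≠ z := by
        simp only [Finset.mem_insert, Finset.mem_singleton] at hz
        rcases hz with rfl | rfl
        · exact hij.symm
        · exact hmj.symm
      simp only [Finset.mem_insert, Finset.mem_singleton, not_or] at hz'
      simp [Function.update_of_ne (Ne.symm hz'.1), Function.update_of_ne (Ne.symm hz'.2),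
        Function.update_of_ne hzj]
    · rintro ⟨i, m⟩ hp
      simp only [hT, Finset.mem_filter, Finset.mem_univ, true_and] at hp
      exact hκ hp.1 hp.2.1 hp.2.2
    · have : (T.card : ℝ) ≤ n ^ 2 := by
        have : T.card ≤ Fintype.card ι ^ 2 :=
          (Finset.card_le_univ _).trans (by simp [Fintype.card_prod, sq])
        rw [hn]
        exact_mod_cast this
      calc (T.card : ℝ) * (((4 : ℕ) : ℝ) * w ^ 2) ≤ n ^ 2 * (((4 : ℕ) : ℝ) * w ^ 2) := by gcongr
        _ = _ := by push_cast; ring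
  have hQ2 : ∀ j, ∫ x, Q j x ^ 2 ∂(Measure.pi fun _ => ν) ≤ n * v₄ + n ^ 2 * w ^ 2 := by
    intro j
    have e : ∀ x, Q j x ^ 2 = (∑ i, if i ≠ j then q (x i) (x j) ^ 4 else 0)
        + ∑ i, ∑ m, if i ≠ m ∧ i ≠ j ∧ m ≠ j then (q (x i) (x j) * q (x m) (x j)) ^ 2 else 0 := by
      intro x
      rw [hQ, sq_sum_ne_eq (fun a b => q a b ^ 2) j x]
      simp only [mul_pow, ← pow_mul]
    simp_rw [e]
    rw [BddMeas.integral_add (by fun_prop) (by fun_prop),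
      integral_finsetSum _ fun i _ => BddMeas.integrable (by fun_prop) _,
      integral_finsetSum _ fun i _ => BddMeas.integrable (by fun_prop) _]
    have b1 : ∀ i, ∫ x : ι → S, (if i ≠ j then q (x i) (x j) ^ 4 else 0)
        ∂(Measure.pi fun _ => ν) ≤ v₄ := by
      intro i
      by_cases hij : i = j
      · simpa [hij] using hv40
      · simp only [ne_eq, hij, not_false_eq_true, if_true]
        rwa [integral_pi_two ν hij (f := fun a b => q a b ^ 4) (by fun_prop)]
    have b2 : ∀ i, ∫ x : ι → S, (∑ m, if i ≠ m ∧ i ≠ j ∧ m ≠ j then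
        (q (x i) (x j) * q (x m) (x j)) ^ 2 else 0) ∂(Measure.pi fun _ => ν) ≤ n * w ^ 2 := by
      intro i
      rw [integral_finsetSum _ fun i _ => BddMeas.integrable (by fun_prop) _]
      refine (Finset.sum_le_card_nsmul _ _ (w ^ 2) fun m _ => ?_).trans_eq (by simp [hn])
      by_cases h : i ≠ m ∧ i ≠ j ∧ m ≠ j
      · simp only [h, if_true, ne_eq, not_false_eq_true, and_self]
        exact hκ h.1 h.2.1 h.2.2
      · simp only [h, if_false, integral_zero]
        positivity
    calc _ ≤ (Finset.univ.card (α := ι)) • v₄ + (Finset.univ.card (α := ι)) • (n * w ^ 2) :=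
          add_le_add (Finset.sum_le_card_nsmul _ _ _ fun i _ => b1 i)
            (Finset.sum_le_card_nsmul _ _ _ fun i _ => b2 i)
      _ = _ := by
          simp only [Finset.card_univ, nsmul_eq_mul, ← hn]
          ring
  have hΔ2 : ∀ j, ∫ x : ι → S, (∑ i, if i ≠ j then q (x i) (x j) else 0) ^ 2
      ∂(Measure.pi fun _ => ν) ≤ n * v := by
    intro j
    set T : Finset ι := Finset.univ.filter fun i => i ≠ j with hT
    have e : ∀ x : ι → S, (∑ i, if i ≠ j then q (x i) (x j) else 0)
        = ∑ i ∈ T, q (x i) (x j) := fun x => by rw [hT, Finset.sum_filter]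
    simp_rw [e]
    refine (integral_sq_sum_le_of_degenerate ν T (fun i => {i})
      (fun i x => q (x i) (x j)) (fun p => by fun_prop) ?_ ?_ (V := v) ?_ 1 ?_).trans ?_
    · intro i hi z hz x
      simp only [hT, Finset.mem_filter, Finset.mem_univ, true_and] at hi
      simp only [Finset.mem_singleton] at hz
      subst hz
      simp [Function.update_of_ne (Ne.symm hi), hdeg']
    · intro i hi i' _ z hz hz' x y
      simp only [hT, Finset.mem_filter, Finset.mem_univ, true_and] at hi
      simp only [Finset.mem_singleton] at hz hz'
      subst hz
      simp [Function.update_of_ne (Ne.symm hi), Function.update_of_ne (Ne.symm hz')]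
    · intro i hi
      simp only [hT, Finset.mem_filter, Finset.mem_univ, true_and] at hi
      exact (integral_pi_two ν hi (f := fun a b => q a b ^ 2) (by fun_prop)).le
    · exact fun i _ => Finset.card_le_one.2 fun a ha b hb => by simp_all
    · have : (T.card : ℝ) ≤ n := by
        rw [hn]
        exact_mod_cast Finset.card_le_univ T
      simp only [Nat.cast_one, one_mul]
      gcongr
  -- the sum of squares
  set G : S → S → ℝ := fun a b => ∫ c, q a c * q b c ∂ν with hG
  have hGb : BddMeas (fun p : S × S => G p.1 p.2) :=
    BddMeas.integral (F := fun (p : S × S) c => q p.1 c * q p.2 c) (by fun_prop)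
  have hG0 : ∀ b, ∫ a, G a b ∂ν = 0 := fun b => by
    rw [hG, BddMeas.integral_comm (by fun_prop)]
    simp [integral_mul_const, hdeg']
  have hGs : ∀ a b, G b a = G a b := fun a b => by
    simp only [hG, mul_comm]
  have hG0' : ∀ a, ∫ b, G a b ∂ν = 0 := fun a => by simp_rw [fun b => hGs b a, hG0]
  -- Subtracting the contraction `G` centres the product in its shared variable; the result is
  -- degenerate in all three variables.
  set κ' : S → S → S → ℝ := fun a b c => q a c * q b c - G a b with hκ'
  have hκ'b : BddMeas (fun p : S × S × S => κ' p.1 p.2.1 p.2.2) := by fun_prop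
  have hS3 : ∫ x : ι → S, distinctSum₃ κ' x ^ 2 ∂(Measure.pi fun _ => ν) ≤ 27 * n ^ 3 * w ^ 2 := by
    refine (integral_sq_distinctSum₃_le ν hκ'b ?_ ?_ ?_).trans ?_
    · intro b c
      rw [hκ', BddMeas.integral_sub (by fun_prop) (by fun_prop), hG0, integral_mul_const, hdeg']
      simp
    · intro a c
      rw [hκ', BddMeas.integral_sub (by fun_prop) (by fun_prop), hG0', integral_const_mul, hdeg']
      simp
    · intro a b
      rw [hκ', BddMeas.integral_sub (by fun_prop) (by fun_prop)]
      simp [hG]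
    · rw [← hn]
      have : ∫ a, ∫ b, ∫ c, κ' a b c ^ 2 ∂ν ∂ν ∂ν ≤ w ^ 2 := by
        calc _ ≤ ∫ a, ∫ b, ∫ c, (q a c * q b c) ^ 2 ∂ν ∂ν ∂ν := by
              refine BddMeas.integral_mono (by fun_prop) (by fun_prop) fun a => ?_
              refine BddMeas.integral_mono (by fun_prop) (by fun_prop) fun b => ?_
              have : ∀ c, κ' a b c ^ 2 = (q a c * q b c) ^ 2 - 2 * G a b * (q a c * q b c)
                  + G a b ^ 2 := fun c => by simp only [hκ']; ring
              simp_rw [this]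
              rw [BddMeas.integral_add (by fun_prop) (by fun_prop),
                BddMeas.integral_sub (by fun_prop) (by fun_prop), integral_const_mul]
              change _ - 2 * G a b * G a b + _ ≤ _
              simp only [integral_const, probReal_univ, smul_eq_mul, one_mul]
              nlinarith [sq_nonneg (G a b)]
          _ = ∫ x : Fin 3 → S, (q (x 0) (x 2) * q (x 1) (x 2)) ^ 2 ∂(Measure.pi fun _ => ν) :=
              (integral_pi_three ν (by decide) (by decide) (by decide)
                (f := fun a b c => (q a c * q b c) ^ 2) (by fun_prop)).symm
          _ ≤ w ^ 2 := by
              rw [integral_pi_three ν (i := (2 : Fin 3)) (j := 0) (k := 1) (by decide) (by decide)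
                (by decide) (f := fun c a b => (q a c * q b c) ^ 2) (by fun_prop)]
              have e : ∀ c, ∫ a, ∫ b, (q a c * q b c) ^ 2 ∂ν ∂ν = (∫ a, q a c ^ 2 ∂ν) ^ 2 :=
                fun c => by
                  simp_rw [mul_pow, integral_const_mul, integral_mul_const]
                  ring
              simp_rw [e]
              calc _ ≤ ∫ _, w ^ 2 ∂ν := by
                    refine BddMeas.integral_mono (by fun_prop) (by fun_prop) fun c => ?_
                    exact pow_le_pow_left₀ (integral_nonneg fun _ => sq_nonneg _) (hw' c) 2
                _ = w ^ 2 := by simp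
      gcongr
  have hS2G : ∫ x : ι → S, distinctSum₂ G x ^ 2 ∂(Measure.pi fun _ => ν) ≤ 4 * n ^ 2 * g₂ := by
    refine (integral_sq_distinctSum₂_le ν hGb hG0 hG0').trans ?_
    rw [← hn]
    gcongr
  have hS2q : ∫ x : ι → S, (distinctSum₂ (fun a b => q a b ^ 2) x - n * (n - 1) * v) ^ 2
      ∂(Measure.pi fun _ => ν) ≤ 8 * (n ^ 2 * v₄ + n ^ 3 * w ^ 2) := by
    refine (integral_sq_distinctSum₂_sub_le (p := fun a b => q a b ^ 2) (by fun_prop)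
      (fun a b => by rw [hsymm])).trans ?_
    rw [← hn]
    have h1 : ∫ a, ∫ b, (q a b ^ 2) ^ 2 ∂ν ∂ν ≤ v₄ := by simpa only [← pow_mul] using hv₄
    have h2 : ∫ a, (∫ b, q a b ^ 2 ∂ν) ^ 2 ∂ν ≤ w ^ 2 := by
      calc _ ≤ ∫ _, w ^ 2 ∂ν := by
            refine BddMeas.integral_mono (by fun_prop) (by fun_prop) fun c => ?_
            exact pow_le_pow_left₀ (integral_nonneg fun _ => sq_nonneg _) (hw c) 2
        _ = w ^ 2 := by simp
    gcongr
  -- Exact expansion of the sum of squares: a diagonal part, which concentrates at its mean, a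
  -- degenerate cubic sum, and the degenerate sum of the contraction weighted by n − 2. Each is
  -- controlled in L² separately.
  have hsq : ∀ x : ι → S, ∑ j, (∑ i, if i ≠ j then q (x i) (x j) else 0) ^ 2
      = distinctSum₂ (fun a b => q a b ^ 2) x + (distinctSum₃ κ' x + (n - 2) * distinctSum₂ G x) := by
    intro x
    rw [← distinctSum₃_pair, ← distinctSum₃_add]
    simp_rw [sq_sum_ne_eq, Finset.sum_add_distrib]
    congr 1
    · rw [Finset.sum_comm]
      rfl
    · rw [Finset.sum_comm]
      unfold distinctSum₃
      refine Finset.sum_congr rfl fun i _ => ?_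
      rw [Finset.sum_comm]
      refine Finset.sum_congr rfl fun m _ => Finset.sum_congr rfl fun j _ => ?_
      simp only [hκ', sub_add_cancel]
  refine norm_charFun_sub_le ν (W := fun x : ι → S => l * distinctSum₂ q x)
    (Δ := fun j x => 2 * l * ∑ i, if i ≠ j then q (x i) (x j) else 0) (d := 2) two_pos
    (by fun_prop) (fun i => by fun_prop) ?_ ?_ ?_ t
  · intro x
    rw [← Finset.mul_sum, Finset.sum_comm, distinctSum₂]
    ring
  · intro j x y
    have e : ∀ z : ι → S, l * distinctSum₂ q z - 2 * l * (∑ i, if i ≠ j then q (z i) (z j) else 0)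
        = l * ∑ a, ∑ b, if a ≠ b ∧ a ≠ j ∧ b ≠ j then q (z a) (z b) else 0 := fun z => by
      rw [distinctSum₂_eq_add hsymm j z]
      ring
    rw [e, e]
    congr 1
    refine Finset.sum_congr rfl fun a _ => Finset.sum_congr rfl fun b _ => ?_
    by_cases h : a ≠ b ∧ a ≠ j ∧ b ≠ j
    · rw [if_pos h, if_pos h, Function.update_of_ne h.2.1, Function.update_of_ne h.2.2]
    · rw [if_neg h, if_neg h]
  · have hA : ∀ j : ι, ∫ x : ι → S, |∫ y, 2 * l * (∑ i, if i ≠ j then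
        q (Function.update x j y i) (Function.update x j y j) else 0) ∂ν|
        ∂(Measure.pi fun _ => ν) = 0 := fun j => by
      have : ∀ x : ι → S, ∫ y, 2 * l * (∑ i, if i ≠ j then
          q (Function.update x j y i) (Function.update x j y j) else 0) ∂ν = 0 := fun x => by
        have e : ∀ y, (∑ i, if i ≠ j then
            q (Function.update x j y i) (Function.update x j y j) else 0)
            = ∑ i, if i ≠ j then q (x i) y else 0 := fun y =>
          Finset.sum_congr rfl fun i _ => by
            by_cases h : i = j <;> simp [h]
        simp_rw [e]
        rw [integral_const_mul, integral_finsetSum _ fun i _ => BddMeas.integrable (by fun_prop) _,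
          Finset.sum_eq_zero fun i _ => ?_, mul_zero]
        by_cases h : i = j <;> simp [h, hdeg]
      simp only [this, abs_zero, integral_zero]
    have hB : ∫ x : ι → S, |(∑ j, (2 * l * ∑ i, if i ≠ j then q (x i) (x j) else 0) ^ 2) / 2 - 1|
        ∂(Measure.pi fun _ => ν) ≤ |2 * l ^ 2 * n * (n - 1) * v - 1| + 20 * √X
          + 4 * √(l ^ 4 * n ^ 4 * g₂) := by
      have e : ∀ x : ι → S,
          (∑ j, (2 * l * ∑ i, if i ≠ j then q (x i) (x j) else 0) ^ 2) / 2 - 1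
          = 2 * l ^ 2 * (distinctSum₂ (fun a b => q a b ^ 2) x - n * (n - 1) * v)
            + 2 * l ^ 2 * distinctSum₃ κ' x + 2 * l ^ 2 * (n - 2) * distinctSum₂ G x
            + (2 * l ^ 2 * n * (n - 1) * v - 1) := by
        intro x
        simp_rw [mul_pow (2 * l), ← Finset.mul_sum]
        rw [hsq]
        ring
      have i1 : ∫ x : ι → S, |2 * l ^ 2 * (distinctSum₂ (fun a b => q a b ^ 2) x
          - n * (n - 1) * v)| ∂(Measure.pi fun _ => ν) ≤ √(32 * X) := by
        refine BddMeas.integral_abs_le_sqrt (by fun_prop) ?_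
        simp_rw [mul_pow (2 * l ^ 2)]
        rw [integral_const_mul]
        calc _ ≤ (2 * l ^ 2) ^ 2 * (8 * (n ^ 2 * v₄ + n ^ 3 * w ^ 2)) := by gcongr
          _ = _ := by rw [hX]; ring
      have i2 : ∫ x : ι → S, |2 * l ^ 2 * distinctSum₃ κ' x| ∂(Measure.pi fun _ => ν)
          ≤ √(108 * X) := by
        refine BddMeas.integral_abs_le_sqrt (by fun_prop) ?_
        simp_rw [mul_pow (2 * l ^ 2)]
        rw [integral_const_mul]
        calc _ ≤ (2 * l ^ 2) ^ 2 * (27 * n ^ 3 * w ^ 2) := by gcongr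
          _ = 108 * (l ^ 4 * (0 + n ^ 3 * w ^ 2)) := by ring
          _ ≤ _ := by
            rw [hX]
            gcongr
            positivity
      have i3 : ∫ x : ι → S, |2 * l ^ 2 * (n - 2) * distinctSum₂ G x| ∂(Measure.pi fun _ => ν)
          ≤ 4 * √(l ^ 4 * n ^ 4 * g₂) := by
        have : 4 * √(l ^ 4 * n ^ 4 * g₂) = √(16 * (l ^ 4 * n ^ 4 * g₂)) := by
          rw [Real.sqrt_mul (by norm_num : (0 : ℝ) ≤ 16), show (16 : ℝ) = 4 ^ 2 by norm_num,
            Real.sqrt_sq (by norm_num)]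
        rw [this]
        refine BddMeas.integral_abs_le_sqrt (by fun_prop) ?_
        simp_rw [mul_pow (2 * l ^ 2 * (n - 2))]
        rw [integral_const_mul]
        have hn2 : (n - 2) ^ 2 ≤ n ^ 2 := by nlinarith
        calc _ ≤ (2 * l ^ 2 * (n - 2)) ^ 2 * (4 * n ^ 2 * g₂) := by gcongr
          _ = 16 * (l ^ 4 * n ^ 2 * g₂) * (n - 2) ^ 2 := by ring
          _ ≤ 16 * (l ^ 4 * n ^ 2 * g₂) * n ^ 2 := by gcongr
          _ = _ := by ring
      have s1 : √(32 * X) ≤ 6 * √X := by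
        rw [Real.sqrt_mul (by norm_num)]
        gcongr
        rw [Real.sqrt_le_left (by norm_num)]
        norm_num
      have s2 : √(108 * X) ≤ 11 * √X := by
        rw [Real.sqrt_mul (by norm_num)]
        gcongr
        rw [Real.sqrt_le_left (by norm_num)]
        norm_num
      calc _ ≤ ∫ x : ι → S, (|2 * l ^ 2 * (distinctSum₂ (fun a b => q a b ^ 2) x
            - n * (n - 1) * v)| + |2 * l ^ 2 * distinctSum₃ κ' x|
            + |2 * l ^ 2 * (n - 2) * distinctSum₂ G x| + |2 * l ^ 2 * n * (n - 1) * v - 1|)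
            ∂(Measure.pi fun _ => ν) := by
            refine BddMeas.integral_mono ?_ (by fun_prop) fun x => ?_
            · simp_rw [e]
              fun_prop
            · rw [e]
              refine (abs_add_le _ _).trans (add_le_add_left ?_ _)
              exact abs_add_three _ _ _
        _ ≤ √(32 * X) + √(108 * X) + 4 * √(l ^ 4 * n ^ 4 * g₂)
            + |2 * l ^ 2 * n * (n - 1) * v - 1| := by
            rw [BddMeas.integral_add (by fun_prop) (by fun_prop),
              BddMeas.integral_add (by fun_prop) (by fun_prop),
              BddMeas.integral_add (by fun_prop) (by fun_prop)]
            simp only [integral_const, probReal_univ, smul_eq_mul, one_mul]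
            linarith
        _ ≤ _ := by nlinarith [Real.sqrt_nonneg X]
    have hD : ∀ j : ι, ∫ x : ι → S, (2 * l * ∑ i, if i ≠ j then q (x i) (x j) else 0) ^ 2 *
        min 1 |2 * l * ∑ i, if i ≠ j then q (x i) (x j) else 0| ∂(Measure.pi fun _ => ν)
        ≤ ε * (4 * l ^ 2 * (n * v)) + 1 / ε * (32 * l ^ 4 * (n * v₄ + 5 * n ^ 2 * w ^ 2)) := by
      intro j
      calc _ ≤ ∫ x : ι → S, (ε * (4 * l ^ 2 * (∑ i, if i ≠ j then q (x i) (x j) else 0) ^ 2)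
            + 1 / ε * (32 * l ^ 4 * (Q j x ^ 2 + R j x ^ 2))) ∂(Measure.pi fun _ => ν) := by
            refine BddMeas.integral_mono (by fun_prop) (by fun_prop) fun x => ?_
            refine (sq_mul_min_le hε _).trans (add_le_add (le_of_eq (by ring)) ?_)
            gcongr
            -- The fourth power is the square of the diagonal part `Q` plus the degenerate
            -- off-diagonal part `R`, whose second moments are known.
            have := sq_sum_ne_eq q j x
            calc _ = 16 * l ^ 4 * ((∑ i, if i ≠ j then q (x i) (x j) else 0) ^ 2) ^ 2 := by ring
              _ = 16 * l ^ 4 * (Q j x + R j x) ^ 2 := by rw [this]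
              _ ≤ 16 * l ^ 4 * (2 * (Q j x ^ 2 + R j x ^ 2)) := by
                gcongr
                nlinarith [sq_nonneg (Q j x - R j x)]
              _ = _ := by ring
        _ ≤ _ := by
            rw [BddMeas.integral_add (by fun_prop) (by fun_prop), integral_const_mul,
              integral_const_mul, integral_const_mul, integral_const_mul,
              BddMeas.integral_add (by fun_prop) (by fun_prop)]
            have := hΔ2 j
            have h2 := add_le_add (hQ2 j) (hR2 j)
            have h3 : n * v₄ + n ^ 2 * w ^ 2 + 4 * n ^ 2 * w ^ 2 = n * v₄ + 5 * n ^ 2 * w ^ 2 := by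
              ring
            rw [h3] at h2
            gcongr
    have hD' := Finset.sum_le_sum fun j (_ : j ∈ Finset.univ) => hD j
    simp only [Finset.sum_const, Finset.card_univ, nsmul_eq_mul, ← hn] at hD'
    rw [Finset.sum_congr rfl fun i _ => hA i]
    simp only [Finset.sum_const_zero, zero_div, zero_add]
    have hfin : n * (ε * (4 * l ^ 2 * (n * v)) + 1 / ε * (32 * l ^ 4 * (n * v₄ + 5 * n ^ 2 * w ^ 2)))
        ≤ 2 * (2 * ε * l ^ 2 * n ^ 2 * v + 100 / ε * X) := by
      have : n * (32 * l ^ 4 * (n * v₄ + 5 * n ^ 2 * w ^ 2)) ≤ 200 * X := by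
        rw [hX]
        have a1 : 0 ≤ l ^ 4 * n ^ 2 * v₄ := by positivity
        have a2 : 0 ≤ l ^ 4 * n ^ 3 * w ^ 2 := by positivity
        nlinarith
      have h2 := mul_le_mul_of_nonneg_left this (by positivity : 0 ≤ 1 / ε)
      calc _ = 2 * (2 * ε * l ^ 2 * n ^ 2 * v)
            + 1 / ε * (n * (32 * l ^ 4 * (n * v₄ + 5 * n ^ 2 * w ^ 2))) := by ring
        _ ≤ 2 * (2 * ε * l ^ 2 * n ^ 2 * v) + 1 / ε * (200 * X) := by linarith
        _ = _ := by ring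
    have hD2 := (div_le_div_of_nonneg_right (hD'.trans hfin) (zero_le_two (α := ℝ)))
    rw [mul_div_cancel_left₀ _ (two_ne_zero)] at hD2
    linarith

end LowOrder

/-! ### Factorial moments of degrees; normal approximation for sparse triple sums. -/

section Sparse

/-- The falling factorial `N (N - 1) ⋯ (N - k + 1)`. -/
def fall : ℕ → ℝ → ℝ
  | 0, _ => 1
  | k + 1, N => N * fall k (N - 1)

theorem fall_nonneg (k n : ℕ) : 0 ≤ fall k n := by
  induction k generalizing n with
  | zero => simp [fall]
  | succ k ih =>
    cases n with
    | zero => simp [fall]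
    | succ m =>
      have := ih m
      simp only [fall, Nat.cast_add, Nat.cast_one, add_sub_cancel_right]
      positivity

/-- `fall` is nonnegative at natural numbers but not at all reals, so positivity arguments need a
neighbour count to be visibly natural. -/
theorem exists_nat_eq_sum {τ : Type*} (s : Finset τ) {b : τ → ℝ} (hb : ∀ i, b i = 0 ∨ b i = 1) :
    ∃ n : ℕ, ∑ i ∈ s, b i = n := by
  classical
  induction s using Finset.induction_on with
  | empty => exact ⟨0, by simp⟩
  | insert a s ha ih =>
    obtain ⟨n, hn⟩ := ih
    rw [Finset.sum_insert ha, hn]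
    rcases hb a with h | h
    · exact ⟨n, by rw [h, zero_add]⟩
    · exact ⟨n + 1, by rw [h]; push_cast; ring⟩

/-- If b i = 1, the erased sum is the full sum minus one; if b i = 0, the term is zero. Iterated,
this counts ordered tuples of distinct neighbours. -/
theorem fall_succ_sum {τ : Type*} [DecidableEq τ] (s : Finset τ) {b : τ → ℝ}
    (hb : ∀ i, b i = 0 ∨ b i = 1) (k : ℕ) :
    fall (k + 1) (∑ i ∈ s, b i) = ∑ i ∈ s, b i * fall k (∑ l ∈ s.erase i, b l) := by
  rw [fall, Finset.sum_mul]
  refine Finset.sum_congr rfl fun i hi => ?_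
  rw [← Finset.add_sum_erase s b hi]
  rcases hb i with h | h
  · simp [h]
  · rw [h, add_sub_cancel_left]

theorem BddMeas.fall {α : Type*} [MeasurableSpace α] (k : ℕ) {f : α → ℝ} (hf : BddMeas f) :
    BddMeas (fun x => fall k (f x)) := by
  induction k generalizing f with
  | zero => exact BddMeas.const 1
  | succ k ih => exact hf.mul (ih (hf.sub (BddMeas.const 1)))

variable {ι S : Type*} [Fintype ι] [DecidableEq ι] [MeasurableSpace S]
  {ν : Measure S} [IsProbabilityMeasure ν]

/-- Factorial moments of the number of neighbours of a vertex. -/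
theorem integral_fall_le {b : S → S → ℝ} (hb : BddMeas (fun p : S × S => b p.1 p.2))
    (hb01 : ∀ a c, b a c = 0 ∨ b a c = 1) {p : ℝ} (hp : ∀ c, ∫ a, b a c ∂ν ≤ p) (hp0 : 0 ≤ p)
    (j : ι) (k : ℕ) (s : Finset ι) (hj : j ∉ s) :
    ∫ x : ι → S, fall k (∑ i ∈ s, b (x i) (x j)) ∂(Measure.pi fun _ => ν) ≤ (s.card * p) ^ k := by
  induction k generalizing s with
  | zero => simp [fall]
  | succ k ih =>
    have hbm : ∀ t : Finset ι, BddMeas fun x : ι → S => fall k (∑ i ∈ t, b (x i) (x j)) :=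
      fun t => BddMeas.fall k (by fun_prop)
    -- Coordinate i enters only through its own indicator. Integrating it out costs a factor p, and
    -- the induction hypothesis applies to the erased set.
    have hterm : ∀ i ∈ s, ∫ x : ι → S, b (x i) (x j) * fall k (∑ l ∈ s.erase i, b (x l) (x j))
        ∂(Measure.pi fun _ => ν) ≤ p * (s.card * p) ^ k := by
      intro i hi
      have hbm' := hbm (s.erase i)
      have hij : j ≠ i := fun h => hj (h ▸ hi)
      rw [integral_update ν i (BddMeas.integrable (by fun_prop) _)]
      have e : ∀ (x : ι → S) y, ∑ l ∈ s.erase i, b (Function.update x i y l)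
          (Function.update x i y j) = ∑ l ∈ s.erase i, b (x l) (x j) := fun x y =>
        Finset.sum_congr rfl fun l hl => by
          rw [Function.update_of_ne (Finset.ne_of_mem_erase hl), Function.update_of_ne hij]
      simp_rw [e, Function.update_self, Function.update_of_ne hij, integral_mul_const]
      calc _ ≤ ∫ x : ι → S, p * fall k (∑ l ∈ s.erase i, b (x l) (x j))
            ∂(Measure.pi fun _ => ν) := by
            refine BddMeas.integral_mono (by fun_prop) (by fun_prop) fun x => ?_
            obtain ⟨m, hm⟩ := exists_nat_eq_sum (s.erase i) (b := fun l => b (x l) (x j))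
              fun l => hb01 _ _
            simp only [hm]
            exact mul_le_mul_of_nonneg_right (hp _) (fall_nonneg k m)
        _ ≤ p * ((s.erase i).card * p) ^ k := by
            rw [integral_const_mul]
            exact mul_le_mul_of_nonneg_left
              (ih (s.erase i) fun h => hj (Finset.mem_of_mem_erase h)) hp0
        _ ≤ p * (s.card * p) ^ k := by
            gcongr
            exact Finset.erase_subset i s
    have e : ∀ x : ι → S, fall (k + 1) (∑ i ∈ s, b (x i) (x j))
        = ∑ i ∈ s, b (x i) (x j) * fall k (∑ l ∈ s.erase i, b (x l) (x j)) := fun x =>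
      fall_succ_sum s (b := fun i => b (x i) (x j)) (fun i => hb01 _ _) k
    simp_rw [e]
    rw [integral_finsetSum _ fun i _ => BddMeas.integrable
      (BddMeas.mul (by fun_prop) (hbm (s.erase i))) _]
    refine (Finset.sum_le_card_nsmul _ _ _ hterm).trans_eq ?_
    rw [nsmul_eq_mul]
    ring

-- Each ordered pair represents the same unordered pair as itself and its swap, hence the factor 2.
-- What remains are products over different unordered pairs.
omit [Fintype ι] in
theorem sq_sum_sub_two_mul_eq (T : Finset (ι × ι)) (hswap : ∀ p ∈ T, p.swap ∈ T)
    (hne : ∀ p ∈ T, p.1 ≠ p.2) {f : ι × ι → ℝ} (hf : ∀ p, f p.swap = f p) :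
    (∑ p ∈ T, f p) ^ 2 - 2 * ∑ p ∈ T, f p ^ 2
      = ∑ p ∈ T, ∑ p' ∈ T, if p = p' ∨ p.swap = p' then 0 else f p * f p' := by
  rw [sq, Finset.sum_mul_sum, Finset.mul_sum, ← Finset.sum_sub_distrib]
  refine Finset.sum_congr rfl fun p hp => ?_
  have e : ∀ p', f p * f p' = (if p = p' ∨ p.swap = p' then 0 else f p * f p')
      + (if p = p' then f p ^ 2 else 0) + (if p.swap = p' then f p ^ 2 else 0) := by
    intro p'
    by_cases h1 : p = p'
    · subst h1
      have h2 : p.swap ≠ p := fun h => hne p hp (by rw [← h]; simp [← congrArg Prod.fst h])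
      simp [h2, sq]
    · by_cases h2 : p.swap = p'
      · subst h2
        simp [h1, hf, sq]
      · simp [h1, h2]
  rw [Finset.sum_congr rfl fun p' _ => e p', Finset.sum_add_distrib, Finset.sum_add_distrib]
  simp only [Finset.sum_ite_eq, hp, hswap p hp, if_true]
  ring

-- The right side is the same off-diagonal sum for the dominating function, so absolute values may
-- be taken term by term. When v is built from neighbour indicators, it is a polynomial in the
-- number of neighbours.
omit [Fintype ι] in
theorem abs_sq_sum_sub_le (T : Finset (ι × ι)) (hswap : ∀ p ∈ T, p.swap ∈ T)
    (hne : ∀ p ∈ T, p.1 ≠ p.2) {f v : ι × ι → ℝ} (hf : ∀ p, f p.swap = f p)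
    (hv : ∀ p, v p.swap = v p) (hfv : ∀ p, |f p| ≤ v p) :
    |(∑ p ∈ T, f p) ^ 2 - 2 * ∑ p ∈ T, f p ^ 2|
      ≤ (∑ p ∈ T, v p) ^ 2 - 2 * ∑ p ∈ T, v p ^ 2 := by
  rw [sq_sum_sub_two_mul_eq T hswap hne hf, sq_sum_sub_two_mul_eq T hswap hne hv]
  refine (Finset.abs_sum_le_sum_abs _ _).trans (Finset.sum_le_sum fun p _ => ?_)
  refine (Finset.abs_sum_le_sum_abs _ _).trans (Finset.sum_le_sum fun p' _ => ?_)
  split_ifs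
  · simp
  · rw [abs_mul]
    exact mul_le_mul (hfv p) (hfv p') (abs_nonneg _) ((abs_nonneg _).trans (hfv p))

/-- Ordered pairs of distinct indices different from `j`. -/
def pairsAvoiding (j : ι) : Finset (ι × ι) :=
  Finset.univ.filter fun p => p.1 ≠ p.2 ∧ p.1 ≠ j ∧ p.2 ≠ j

theorem mem_pairsAvoiding {j : ι} {p : ι × ι} :
    p ∈ pairsAvoiding j ↔ p.1 ≠ p.2 ∧ p.1 ≠ j ∧ p.2 ≠ j := by
  simp [pairsAvoiding]

theorem card_pairsAvoiding_le (j : ι) : (pairsAvoiding j).card ≤ Fintype.card ι ^ 2 :=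
  (Finset.card_le_univ _).trans (by simp [Fintype.card_prod, sq])

omit [MeasurableSpace S] in
theorem distinctSum₃_eq_sum_pairsAvoiding (k : S → S → S → ℝ) (x : ι → S) :
    distinctSum₃ k x = ∑ j, ∑ p ∈ pairsAvoiding j, k (x p.1) (x p.2) (x j) := by
  unfold distinctSum₃
  simp_rw [pairsAvoiding, Finset.sum_filter, Fintype.sum_prod_type]
  refine ((Finset.sum_congr rfl fun i _ => Finset.sum_comm).trans Finset.sum_comm).trans ?_
  refine Finset.sum_congr rfl fun j _ => Finset.sum_congr rfl fun i _ =>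
    Finset.sum_congr rfl fun m _ => if_congr ?_ rfl rfl
  tauto

/-- Symmetry makes the three positions of j contribute equally; this 3 is the d of
`norm_charFun_sub_le` for triple sums. -/
theorem distinctSum₃_eq_add {k : S → S → S → ℝ} (hk : SymmKernel k) (j : ι) (x : ι → S) :
    distinctSum₃ k x = (∑ a, ∑ b, ∑ c, if (a ≠ b ∧ a ≠ c ∧ b ≠ c) ∧ a ≠ j ∧ b ≠ j ∧ c ≠ j
        then k (x a) (x b) (x c) else 0)
      + 3 * ∑ p ∈ pairsAvoiding j, k (x p.1) (x p.2) (x j) := by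
  set u : ι → ι → ℝ := fun a b => if a ≠ b ∧ a ≠ j ∧ b ≠ j then k (x a) (x b) (x j) else 0 with hu
  have e : ∀ a b c, (if a ≠ b ∧ a ≠ c ∧ b ≠ c then k (x a) (x b) (x c) else 0)
      = (if (a ≠ b ∧ a ≠ c ∧ b ≠ c) ∧ a ≠ j ∧ b ≠ j ∧ c ≠ j then k (x a) (x b) (x c) else 0)
        + (if c = j then u a b else 0) + (if b = j then u a c else 0)
        + (if a = j then u b c else 0) := by
    intro a b c
    simp only [hu]
    by_cases ha : a = j
    · subst ha
      have hs : k (x a) (x b) (x c) = k (x b) (x c) (x a) := by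
        rw [← hk.swap₁₂, ← hk.swap₂₃]
      grind
    · by_cases hb : b = j
      · subst hb
        have hs : k (x a) (x b) (x c) = k (x a) (x c) (x b) := (hk.swap₂₃ _ _ _).symm
        grind
      · grind
  have hsum : ∑ p ∈ pairsAvoiding j, k (x p.1) (x p.2) (x j) = ∑ a, ∑ b, u a b := by
    rw [pairsAvoiding, Finset.sum_filter, Fintype.sum_prod_type]
  rw [hsum]
  unfold distinctSum₃
  rw [Finset.sum_congr rfl fun a _ => Finset.sum_congr rfl fun b _ =>
    Finset.sum_congr rfl fun c _ => e a b c]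
  simp only [Finset.sum_add_distrib, Finset.sum_ite_eq', Finset.mem_univ, if_true]
  have e2 : ∑ a, ∑ b, ∑ c, (if b = j then u a c else 0) = ∑ a, ∑ b, u a b := by
    refine Finset.sum_congr rfl fun a _ => ?_
    rw [Finset.sum_comm]
    simp
  have e3 : ∑ a, ∑ b, ∑ c, (if a = j then u b c else 0) = ∑ a, ∑ b, u a b := by
    rw [Finset.sum_comm]
    refine Finset.sum_congr rfl fun b _ => ?_
    rw [Finset.sum_comm]
    simp
  rw [e2, e3]
  ring

set_option maxHeartbeats 1000000 in
/-- Normal approximation for a sum over triples of a kernel that vanishes unless two of its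
arguments are neighbours of the third, with few neighbours on average. -/
theorem norm_charFun_distinctSum₃_le [Nonempty ι] {h : S → S → S → ℝ} (hk : SymmKernel h)
    (hmean : kmean ν h = 0) {b : S → S → ℝ} (hb : BddMeas (fun p : S × S => b p.1 p.2))
    (hb01 : ∀ a c, b a c = 0 ∨ b a c = 1) (hhb : ∀ u v w, |h u v w| ≤ b u w * b v w)
    {p l K v₂ Y ω : ℝ} (hp : ∀ c, ∫ a, b a c ∂ν ≤ p) (hp0 : 0 ≤ p)
    (hK : ∀ a, |proj₁ ν h a| ≤ K) (hv₂ : ∫ a, ∫ c, proj₂ ν h a c ^ 2 ∂ν ∂ν ≤ v₂)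
    (hY : (Fintype.card ι : ℝ) ^ 3 * ∫ u, ∫ v, ∫ w, (h u v w ^ 2) ^ 2 ∂ν ∂ν ∂ν
        + (Fintype.card ι : ℝ) ^ 4 *
          ∫ u, ∫ v, proj₂ ν (fun u v w => h u v w ^ 2) u v ^ 2 ∂ν ∂ν
        + (Fintype.card ι : ℝ) ^ 5 * ∫ u, proj₁ ν (fun u v w => h u v w ^ 2) u ^ 2 ∂ν ≤ Y)
    (hω : ω = ((Fintype.card ι : ℝ) * p) ^ 4 + 4 * ((Fintype.card ι : ℝ) * p) ^ 3)
    (hl : 0 ≤ l) (t : ℝ) :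
    ‖∫ x : ι → S, Complex.exp (((t * (l * distinctSum₃ h x) : ℝ) : ℂ) * Complex.I)
        ∂(Measure.pi fun _ => ν) - Complex.exp (-(t : ℂ) ^ 2 / 2)‖
      ≤ 2 * (1 + |t|) ^ 2 * |t| * Real.exp (t ^ 2 / 2) *
        ((Fintype.card ι : ℝ) * l * (√(4 * (Fintype.card ι : ℝ) ^ 2 * v₂)
            + 2 * (Fintype.card ι : ℝ) ^ 2 * K)
          + (|6 * l ^ 2 * ((Fintype.card ι : ℝ) * ((Fintype.card ι : ℝ) - 1) *
                ((Fintype.card ι : ℝ) - 2) * kmean ν (fun u v w => h u v w ^ 2)) - 1|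
            + 6 * l ^ 2 * √(6000 * Y) + 3 * l ^ 2 * (Fintype.card ι : ℝ) * ω)
          + 3 * (Fintype.card ι : ℝ) * l ^ 2 *
            ((1 + 6 * l) * ω + 12 * l * ((Fintype.card ι : ℝ) * p) ^ 2)) := by
  set n : ℝ := (Fintype.card ι : ℝ) with hn
  have hn1 : 1 ≤ n := by
    rw [hn]
    exact_mod_cast Fintype.card_pos
  have hhm := hk.bdd
  have hk2 : SymmKernel (fun u v w => h u v w ^ 2) :=
    ⟨by fun_prop, fun a c d => by rw [hk.swap₁₂], fun a c d => by rw [hk.swap₂₃]⟩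
  set u : ι → (ι → S) → ℝ := fun j x => ∑ q ∈ pairsAvoiding j, h (x q.1) (x q.2) (x j) with hu
  set H : ι → (ι → S) → ℝ := fun j x => ∑ q ∈ pairsAvoiding j, h (x q.1) (x q.2) (x j) ^ 2 with hH
  set N : ι → (ι → S) → ℝ := fun j x => ∑ i ∈ Finset.univ.erase j, b (x i) (x j) with hN
  have hub : ∀ j, BddMeas (u j) := fun j => by fun_prop
  have hHb : ∀ j, BddMeas (H j) := fun j => by fun_prop
  have hNb : ∀ j, BddMeas (N j) := fun j => by fun_prop
  have hNN : ∀ j x, ∃ m : ℕ, N j x = m := fun j x =>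
    exists_nat_eq_sum _ fun i => hb01 _ _
  have hbsq : ∀ a c, b a c ^ 2 = b a c := fun a c => by
    rcases hb01 a c with h | h <;> simp [h]
  have hb0 : ∀ a c, 0 ≤ b a c := fun a c => by
    rcases hb01 a c with h | h <;> simp [h]
  have hMsum : ∀ j (x : ι → S), ∑ q ∈ pairsAvoiding j, b (x q.1) (x j) * b (x q.2) (x j)
      = N j x * (N j x - 1) := by
    intro j x
    have e1 := sq_sum_ne_eq b j x
    simp only [hbsq] at e1
    have e2 : (∑ i, if i ≠ j then b (x i) (x j) else 0) = N j x := by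
      rw [hN, ← Finset.sum_filter, Finset.filter_ne']
    rw [e2] at e1
    rw [pairsAvoiding, Finset.sum_filter, Fintype.sum_prod_type]
    linarith
  set M : ι → (ι → S) → ℝ := fun j x => N j x * (N j x - 1) with hM
  have hMb : ∀ j, BddMeas (M j) := fun j => by fun_prop
  have hM0 : ∀ j x, 0 ≤ M j x := fun j x => by
    have := hMsum j x
    simp only [hM]
    rw [← this]
    exact Finset.sum_nonneg fun q _ => mul_nonneg (hb0 _ _) (hb0 _ _)
  have huM : ∀ j x, |u j x| ≤ M j x := fun j x => by
    refine (Finset.abs_sum_le_sum_abs _ _).trans ?_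
    simp only [hM, ← hMsum j x]
    exact Finset.sum_le_sum fun q _ => hhb _ _ _
  have hRle : ∀ j x, |u j x ^ 2 - 2 * H j x| ≤ M j x ^ 2 - 2 * M j x := by
    intro j x
    have := abs_sq_sum_sub_le (pairsAvoiding j)
      (fun q hq => by rw [mem_pairsAvoiding] at hq ⊢; exact ⟨hq.1.symm, hq.2.2, hq.2.1⟩)
      (fun q hq => (mem_pairsAvoiding.1 hq).1)
      (f := fun q => h (x q.1) (x q.2) (x j)) (v := fun q => b (x q.1) (x j) * b (x q.2) (x j))
      (fun q => hk.swap₁₂ _ _ _) (fun q => mul_comm _ _) (fun q => hhb _ _ _)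
    simp only [mul_pow, hbsq, hMsum] at this
    simpa only [hM, mul_pow] using this
  -- With M = N(N − 1), the difference M² − 2M equals N(N − 1)(N − 2)(N + 1). It vanishes unless N ≥
  -- 3, so for rare neighbours u² is nearly 2H.
  have hpoly : ∀ j x, M j x ^ 2 - 2 * M j x = fall 4 (N j x) + 4 * fall 3 (N j x) := fun j x => by
    simp only [hM, fall]
    ring
  have hpoly2 : ∀ j x, M j x = fall 2 (N j x) := fun j x => by
    simp only [hM, fall]
    ring
  have hMM0 : ∀ j x, 0 ≤ M j x ^ 2 - 2 * M j x := fun j x => (abs_nonneg _).trans (hRle j x)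
  have hcard : ∀ j : ι, ((Finset.univ.erase j).card : ℝ) ≤ n := fun j => by
    rw [hn]
    exact_mod_cast Finset.card_le_univ _
  have hfall : ∀ j k, ∫ x, fall k (N j x) ∂(Measure.pi fun _ => ν) ≤ (n * p) ^ k := fun j k => by
    refine (integral_fall_le hb hb01 hp hp0 j k _ (Finset.notMem_erase j _)).trans ?_
    have := hcard j
    gcongr
  have hEMM : ∀ j, ∫ x, (M j x ^ 2 - 2 * M j x) ∂(Measure.pi fun _ => ν) ≤ ω := fun j => by
    simp_rw [hpoly]
    have := BddMeas.fall 4 (hNb j)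
    have := BddMeas.fall 3 (hNb j)
    rw [BddMeas.integral_add (by fun_prop) (by fun_prop), integral_const_mul, hω]
    linarith [hfall j 4, hfall j 3]
  have hEM : ∀ j, ∫ x, M j x ∂(Measure.pi fun _ => ν) ≤ (n * p) ^ 2 := fun j => by
    simp_rw [hpoly2]
    exact hfall j 2
  have hω0 : 0 ≤ ω := by rw [hω]; positivity
  have hK0 : 0 ≤ K := by
    have hne : Nonempty S := by
      by_contra h
      rw [not_nonempty_iff] at h
      have := measure_univ (μ := ν)
      simp [Set.univ_eq_empty_iff.2 h] at this
    exact (abs_nonneg _).trans (hK hne.some)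
  refine norm_charFun_sub_le ν (W := fun x : ι → S => l * distinctSum₃ h x)
    (Δ := fun j x => 3 * l * u j x) (d := 3) (by norm_num)
    (by fun_prop) (fun i => by fun_prop) ?_ ?_ ?_ t
  · intro x
    rw [← Finset.mul_sum, distinctSum₃_eq_sum_pairsAvoiding]
    ring
  · intro j x y
    have e : ∀ z : ι → S, l * distinctSum₃ h z - 3 * l * u j z
        = l * ∑ a, ∑ b, ∑ c, if (a ≠ b ∧ a ≠ c ∧ b ≠ c) ∧ a ≠ j ∧ b ≠ j ∧ c ≠ j
        then h (z a) (z b) (z c) else 0 := fun z => by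
      rw [distinctSum₃_eq_add hk j z]
      simp only [hu]
      ring
    rw [e, e]
    congr 1
    refine Finset.sum_congr rfl fun a _ => Finset.sum_congr rfl fun c _ =>
      Finset.sum_congr rfl fun d _ => ?_
    by_cases hc : (a ≠ c ∧ a ≠ d ∧ c ≠ d) ∧ a ≠ j ∧ c ≠ j ∧ d ≠ j
    · rw [if_pos hc, if_pos hc, Function.update_of_ne hc.2.1, Function.update_of_ne hc.2.2.1,
        Function.update_of_ne hc.2.2.2]
    · rw [if_neg hc, if_neg hc]
  · have hp2 := hk.bdd_proj₂ (ν := ν)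
    have hp1 := hk.bdd_proj₁ (ν := ν)
    have hd2 := hk.bdd_deg₂ (ν := ν)
    have hA : ∀ j : ι, ∫ x : ι → S, |∫ y, 3 * l * u j (Function.update x j y) ∂ν|
        ∂(Measure.pi fun _ => ν) ≤ 3 * (l * (√(4 * n ^ 2 * v₂) + 2 * n ^ 2 * K)) := by
      intro j
      -- Zero mean lets the two-point projection be written as its degenerate part plus two
      -- one-point projections. The first sum is small in L² by orthogonality, the others are
      -- bounded uniformly by `K`.
      have e : ∀ x : ι → S, ∫ y, 3 * l * u j (Function.update x j y) ∂ν
          = 3 * l * (∑ q ∈ pairsAvoiding j, deg₂ ν h (x q.1) (x q.2)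
            + ∑ q ∈ pairsAvoiding j, (proj₁ ν h (x q.1) + proj₁ ν h (x q.2))) := by
        intro x
        have e1 : ∀ y, u j (Function.update x j y)
            = ∑ q ∈ pairsAvoiding j, h (x q.1) (x q.2) y := fun y =>
          Finset.sum_congr rfl fun q hq => by
            rw [mem_pairsAvoiding] at hq
            rw [Function.update_of_ne hq.2.1, Function.update_of_ne hq.2.2, Function.update_self]
        simp_rw [e1]
        rw [integral_const_mul, integral_finsetSum _ fun i _ => BddMeas.integrable (by fun_prop) _,
          ← Finset.sum_add_distrib]
        congr 1
        refine Finset.sum_congr rfl fun q _ => ?_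
        rw [integral_eq_proj₂, deg₂, hmean]
        ring
      have i1 : ∫ x : ι → S, |∑ q ∈ pairsAvoiding j, deg₂ ν h (x q.1) (x q.2)|
          ∂(Measure.pi fun _ => ν) ≤ √(4 * n ^ 2 * v₂) := by
        refine BddMeas.integral_abs_le_sqrt (by fun_prop) ?_
        have hv20 : 0 ≤ v₂ := le_trans
          (integral_nonneg fun _ => integral_nonneg fun _ => sq_nonneg _) hv₂
        refine (integral_sq_sum_le_of_degenerate ν (pairsAvoiding j) (fun q => {q.1, q.2})
          (fun q x => deg₂ ν h (x q.1) (x q.2)) (fun q => by fun_prop) ?_ ?_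
          (V := v₂) ?_ 4 fun a _ => card_filter_pair_le _ a).trans ?_
        · rintro ⟨i, m⟩ hq z hz x
          rw [mem_pairsAvoiding] at hq
          simp only [Finset.mem_insert, Finset.mem_singleton] at hz
          rcases hz with rfl | rfl
          · simp [Function.update_of_ne (Ne.symm hq.1), fun y => hk.deg₂_symm (ν := ν) (x m) y,
              hk.integral_deg₂]
          · simp [Function.update_of_ne hq.1, hk.integral_deg₂]
        · rintro a _ ⟨i, m⟩ _ z _ hz x y
          simp only [Finset.mem_insert, Finset.mem_singleton, not_or] at hz
          simp [Function.update_of_ne (Ne.symm hz.1), Function.update_of_ne (Ne.symm hz.2)]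
        · rintro ⟨i, m⟩ hq
          rw [mem_pairsAvoiding] at hq
          rw [integral_pi_two ν hq.1 (f := fun a c => deg₂ ν h a c ^ 2) (by fun_prop)]
          exact hk.integral_sq_deg₂_le.trans hv₂
        · have : ((pairsAvoiding j).card : ℝ) ≤ n ^ 2 := by
            rw [hn]
            exact_mod_cast card_pairsAvoiding_le j
          calc _ ≤ n ^ 2 * (((4 : ℕ) : ℝ) * v₂) := by gcongr
            _ = _ := by push_cast; ring
      have i2 : ∀ x : ι → S, |∑ q ∈ pairsAvoiding j, (proj₁ ν h (x q.1) + proj₁ ν h (x q.2))|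
          ≤ 2 * n ^ 2 * K := by
        intro x
        refine (Finset.abs_sum_le_sum_abs _ _).trans ?_
        refine (Finset.sum_le_card_nsmul _ _ (2 * K) fun q _ => ?_).trans ?_
        · exact (abs_add_le _ _).trans (by linarith [hK (x q.1), hK (x q.2)])
        · have : ((pairsAvoiding j).card : ℝ) ≤ n ^ 2 := by
            rw [hn]
            exact_mod_cast card_pairsAvoiding_le j
          rw [nsmul_eq_mul]
          calc _ ≤ n ^ 2 * (2 * K) := by gcongr
            _ = _ := by ring
      simp_rw [e, abs_mul, abs_of_nonneg hl, abs_of_nonneg (zero_le_three (α := ℝ))]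
      calc _ ≤ ∫ x : ι → S, 3 * l * (|∑ q ∈ pairsAvoiding j, deg₂ ν h (x q.1) (x q.2)|
            + 2 * n ^ 2 * K) ∂(Measure.pi fun _ => ν) := by
            refine BddMeas.integral_mono (by fun_prop) (by fun_prop) fun x => ?_
            have := abs_add_le (∑ q ∈ pairsAvoiding j, deg₂ ν h (x q.1) (x q.2))
              (∑ q ∈ pairsAvoiding j, (proj₁ ν h (x q.1) + proj₁ ν h (x q.2)))
            have := i2 x
            gcongr
            linarith
        _ ≤ _ := by
            rw [integral_const_mul, BddMeas.integral_add (by fun_prop) (by fun_prop)]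
            simp only [integral_const, probReal_univ, smul_eq_mul, one_mul]
            calc _ ≤ 3 * l * (√(4 * n ^ 2 * v₂) + 2 * n ^ 2 * K) := by gcongr
              _ = _ := by ring
    have hB : ∫ x : ι → S, |(∑ j, (3 * l * u j x) ^ 2) / 3 - 1| ∂(Measure.pi fun _ => ν)
        ≤ |6 * l ^ 2 * (n * (n - 1) * (n - 2) * kmean ν (fun u v w => h u v w ^ 2)) - 1|
          + 6 * l ^ 2 * √(6000 * Y) + 3 * l ^ 2 * n * ω := by
      set m₂ := n * (n - 1) * (n - 2) * kmean ν (fun u v w => h u v w ^ 2) with hm₂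
      have hHs : ∀ x, ∑ j, H j x = distinctSum₃ (fun u v w => h u v w ^ 2) x := fun x =>
        (distinctSum₃_eq_sum_pairsAvoiding (fun u v w => h u v w ^ 2) x).symm
      have i1 : ∫ x : ι → S, |distinctSum₃ (fun u v w => h u v w ^ 2) x - m₂|
          ∂(Measure.pi fun _ => ν) ≤ √(6000 * Y) := by
        refine BddMeas.integral_abs_le_sqrt (by fun_prop) ?_
        refine (hk2.integral_sq_distinctSum₃_sub_le (ν := ν) (ι := ι)).trans ?_
        rw [← hn]
        gcongr
      have i2 : ∀ j, ∫ x, |u j x ^ 2 - 2 * H j x| ∂(Measure.pi fun _ => ν) ≤ ω := fun j =>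
        (BddMeas.integral_mono (by fun_prop) (by fun_prop) (hRle j)).trans (hEMM j)
      calc _ ≤ ∫ x : ι → S, (6 * l ^ 2 * |distinctSum₃ (fun u v w => h u v w ^ 2) x - m₂|
            + |6 * l ^ 2 * m₂ - 1| + 3 * l ^ 2 * ∑ j, |u j x ^ 2 - 2 * H j x|)
            ∂(Measure.pi fun _ => ν) := by
            refine BddMeas.integral_mono ?_ (by fun_prop) fun x => ?_
            · have : BddMeas fun x : ι → S => (3 : ℝ)⁻¹ * (∑ j, (3 * l * u j x) ^ 2) - 1 := by
                fun_prop
              simpa only [div_eq_inv_mul] using this.abs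
            · have e : (∑ j, (3 * l * u j x) ^ 2) / 3 - 1
                  = 6 * l ^ 2 * (distinctSum₃ (fun u v w => h u v w ^ 2) x - m₂)
                    + (6 * l ^ 2 * m₂ - 1) + 3 * l ^ 2 * ∑ j, (u j x ^ 2 - 2 * H j x) := by
                simp_rw [mul_pow (3 * l), ← Finset.mul_sum]
                rw [Finset.sum_sub_distrib, ← Finset.mul_sum, hHs]
                ring
              rw [e]
              refine (abs_add_three _ _ _).trans ?_
              rw [abs_mul, abs_mul (3 * l ^ 2), abs_of_nonneg (by positivity : 0 ≤ 6 * l ^ 2),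
                abs_of_nonneg (by positivity : 0 ≤ 3 * l ^ 2)]
              gcongr
              exact Finset.abs_sum_le_sum_abs _ _
        _ ≤ _ := by
            rw [BddMeas.integral_add (by fun_prop) (by fun_prop),
              BddMeas.integral_add (by fun_prop) (by fun_prop), integral_const_mul,
              integral_const_mul, integral_finsetSum _ fun i _ => BddMeas.integrable (by fun_prop) _]
            have := Finset.sum_le_card_nsmul Finset.univ _ ω fun j _ => i2 j
            rw [nsmul_eq_mul, Finset.card_univ, ← hn] at this
            simp only [integral_const, probReal_univ, smul_eq_mul, one_mul]
            have c1 := mul_le_mul_of_nonneg_left this (by positivity : 0 ≤ 3 * l ^ 2)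
            have c2 := mul_le_mul_of_nonneg_left i1 (by positivity : 0 ≤ 6 * l ^ 2)
            linarith
    have hD : ∀ j : ι, ∫ x : ι → S, (3 * l * u j x) ^ 2 * min 1 |3 * l * u j x|
        ∂(Measure.pi fun _ => ν) ≤ 9 * l ^ 2 * ((1 + 6 * l) * ω + 12 * l * (n * p) ^ 2) := by
      intro j
      calc _ ≤ ∫ x : ι → S, 9 * l ^ 2 * ((1 + 6 * l) * (M j x ^ 2 - 2 * M j x) + 12 * l * M j x)
            ∂(Measure.pi fun _ => ν) := by
            refine BddMeas.integral_mono (by fun_prop) (by fun_prop) fun x => ?_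
            have h1 : u j x ^ 2 ≤ M j x ^ 2 := by
              rw [← sq_abs]
              exact pow_le_pow_left₀ (abs_nonneg _) (huM j x) 2
            have h2 : min 1 |3 * l * u j x| ≤ min 1 (3 * l * M j x) := by
              refine min_le_min le_rfl ?_
              rw [abs_mul, abs_of_nonneg (by positivity : 0 ≤ 3 * l)]
              exact mul_le_mul_of_nonneg_left (huM j x) (by positivity)
            have hm := hM0 j x
            -- M² is split as (M² − 2M) + 2M. The minimum is bounded by 1 on the first piece, which
            -- has small mean, and by 3 l M on the second.
            have h3 : M j x ^ 2 * min 1 (3 * l * M j x)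
                ≤ (1 + 6 * l) * (M j x ^ 2 - 2 * M j x) + 12 * l * M j x := by
              calc _ = (M j x ^ 2 - 2 * M j x) * min 1 (3 * l * M j x)
                    + 2 * M j x * min 1 (3 * l * M j x) := by ring
                _ ≤ (M j x ^ 2 - 2 * M j x) * 1 + 2 * M j x * (3 * l * M j x) :=
                    add_le_add (mul_le_mul_of_nonneg_left (min_le_left _ _) (hMM0 j x))
                      (mul_le_mul_of_nonneg_left (min_le_right _ _) (by positivity))
                _ = _ := by ring
            calc _ = 9 * l ^ 2 * (u j x ^ 2 * min 1 |3 * l * u j x|) := by ring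
              _ ≤ 9 * l ^ 2 * (M j x ^ 2 * min 1 (3 * l * M j x)) := by gcongr
              _ ≤ _ := by gcongr
        _ ≤ _ := by
            have hMb' : BddMeas fun x => M j x ^ 2 - 2 * M j x := by fun_prop
            rw [integral_const_mul, BddMeas.integral_add (by fun_prop) (by fun_prop),
              integral_const_mul, integral_const_mul]
            have := hEMM j
            have := hEM j
            gcongr
    have hA' := Finset.sum_le_card_nsmul Finset.univ _ _ fun j _ => hA j
    have hD' := Finset.sum_le_card_nsmul Finset.univ _ _ fun j _ => hD j
    rw [nsmul_eq_mul, Finset.card_univ, ← hn] at hA' hD'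
    have a1 := div_le_div_of_nonneg_right hA' (zero_le_three (α := ℝ))
    have a2 := div_le_div_of_nonneg_right hD' (zero_le_three (α := ℝ))
    have e1 : n * (3 * (l * (√(4 * n ^ 2 * v₂) + 2 * n ^ 2 * K))) / 3
        = n * l * (√(4 * n ^ 2 * v₂) + 2 * n ^ 2 * K) := by ring
    have e2 : n * (9 * l ^ 2 * ((1 + 6 * l) * ω + 12 * l * (n * p) ^ 2)) / 3
        = 3 * n * l ^ 2 * ((1 + 6 * l) * ω + 12 * l * (n * p) ^ 2) := by ring
    rw [e1] at a1
    rw [e2] at a2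
    linarith

end Sparse

/-! ### From the characteristic function of the numerator to the law of the ratio. -/

section Transfer

theorem tendstoInDistribution_of_charFun {Ω : ℕ → Type*} [∀ n, MeasurableSpace (Ω n)]
    {P : ∀ n, Measure (Ω n)} [∀ n, IsProbabilityMeasure (P n)] {Y : ∀ n, Ω n → ℝ}
    (hY : ∀ n, AEMeasurable (Y n) (P n))
    (h : ∀ t : ℝ, Tendsto (fun n => ∫ ω, Complex.exp (((t * Y n ω : ℝ) : ℂ) * Complex.I) ∂(P n))
      atTop (𝓝 (Complex.exp (-(t : ℂ) ^ 2 / 2)))) :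
    TendstoInDistribution Y atTop id P (gaussianReal 0 1) where
  forall_aemeasurable := hY
  tendsto := by
    refine ProbabilityMeasure.tendsto_iff_tendsto_charFun.2 fun t => ?_
    have e : ∀ n, charFun ((P n).map (Y n)) t
        = ∫ ω, Complex.exp (((t * Y n ω : ℝ) : ℂ) * Complex.I) ∂(P n) := fun n => by
      rw [charFun_apply_real, integral_map (hY n) (by fun_prop)]
      simp
    have e2 : charFun ((gaussianReal 0 1).map id) t = Complex.exp (-(t : ℂ) ^ 2 / 2) := by
      rw [Measure.map_id, charFun_gaussianReal]
      simp [neg_div]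
    have := h t
    simp_rw [← e] at this
    rw [← e2] at this
    exact this

theorem BddMeas.integral_abs_mul_le {α : Type*} [MeasurableSpace α] {P : Measure α}
    [IsProbabilityMeasure P] {f g : α → ℝ} (hf : BddMeas f) (hg : BddMeas g) {A B : ℝ}
    (hA : ∫ x, f x ^ 2 ∂P ≤ A) (hB : ∫ x, g x ^ 2 ∂P ≤ B) :
    ∫ x, |f x| * |g x| ∂P ≤ √(A * B) := by
  have hA0 : 0 ≤ A := (integral_nonneg fun _ => sq_nonneg _).trans hA
  refine Real.le_sqrt_of_sq_le ?_
  set a := ∫ x, f x ^ 2 ∂P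
  set b := ∫ x, g x ^ 2 ∂P
  set c := ∫ x, |f x| * |g x| ∂P with hc
  have hb0 : 0 ≤ b := integral_nonneg fun _ => sq_nonneg _
  have key : ∀ s : ℝ, 0 ≤ b * (s * s) + (2 * c) * s + a := fun s => by
    have e : ∫ x, (|f x| + s * |g x|) ^ 2 ∂P = b * (s * s) + (2 * c) * s + a := by
      have : ∀ x, (|f x| + s * |g x|) ^ 2 = f x ^ 2 + 2 * s * (|f x| * |g x|) + s ^ 2 * g x ^ 2 :=
        fun x => by rw [add_sq, mul_pow, sq_abs, sq_abs]; ring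
      simp_rw [this]
      rw [BddMeas.integral_add (by fun_prop) (by fun_prop),
        BddMeas.integral_add (by fun_prop) (by fun_prop), integral_const_mul, integral_const_mul]
      ring
    rw [← e]
    exact integral_nonneg fun _ => sq_nonneg _
  have := discrim_le_zero key
  rw [discrim] at this
  calc c ^ 2 ≤ a * b := by linarith
    _ ≤ A * B := by gcongr

/-- A quantitative Slutsky lemma. If D/m is within 1/2 of 1, the exponential is Lipschitz and
dividing by D/m at most doubles the error. Otherwise the left side is at most 2 ≤ 8 (D/m − 1)²,
which also covers a vanishing denominator. -/
theorem norm_cexp_ratio_sub_le {t b T D μ m W' : ℝ} (hm : 0 < m) :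
    ‖Complex.exp (((t * (b * (T / D - μ)) : ℝ) : ℂ) * Complex.I)
        - Complex.exp (((t * W' : ℝ) : ℂ) * Complex.I)‖
      ≤ |t| * (2 * (|b / m * (T - μ * D)| * |D / m - 1|) + |b / m * (T - μ * D) - W'|)
        + 8 * (D / m - 1) ^ 2 := by
  have h1 : ∀ a c : ℝ, ‖Complex.exp ((a : ℂ) * Complex.I) - Complex.exp ((c : ℂ) * Complex.I)‖
      ≤ |a - c| := fun a c => by
    have := Real.norm_exp_I_mul_ofReal_sub_one_le (x := a - c)
    have e : Complex.exp ((a : ℂ) * Complex.I) - Complex.exp ((c : ℂ) * Complex.I)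
        = Complex.exp ((c : ℂ) * Complex.I) *
          (Complex.exp (Complex.I * ((a - c : ℝ) : ℂ)) - 1) := by
      rw [mul_sub, ← Complex.exp_add, mul_one]
      congr 2
      push_cast
      ring
    rw [e, norm_mul, Complex.norm_exp_ofReal_mul_I, one_mul]
    exact this
  by_cases hX : |D / m - 1| ≤ 1 / 2
  · have hX' := abs_le.1 hX
    set X := D / m with hXd
    have hXpos : 0 < X := by linarith
    have hD : D = X * m := by rw [hXd]; field_simp
    have hD0 : D ≠ 0 := by rw [hD]; positivity
    set W := b / m * (T - μ * D) with hW
    have hY : b * (T / D - μ) = W / X := by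
      rw [hW, hD]
      field_simp
    refine (h1 _ _).trans ?_
    rw [← mul_sub, abs_mul, hY]
    have h2 : |W / X - W'| ≤ 2 * (|W| * |X - 1|) + |W - W'| := by
      have e : W / X - W' = - (W * (X - 1)) / X + (W - W') := by
        field_simp
        ring
      rw [e]
      refine (abs_add_le _ _).trans (add_le_add ?_ le_rfl)
      rw [abs_div, abs_neg, abs_mul, abs_of_pos hXpos, div_le_iff₀ hXpos]
      nlinarith [mul_nonneg (abs_nonneg W) (abs_nonneg (X - 1))]
    have := mul_le_mul_of_nonneg_left h2 (abs_nonneg t)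
    nlinarith [sq_nonneg (X - 1)]
  · push Not at hX
    have h2 : ‖Complex.exp (((t * (b * (T / D - μ)) : ℝ) : ℂ) * Complex.I)
        - Complex.exp (((t * W' : ℝ) : ℂ) * Complex.I)‖ ≤ 2 := by
      refine (norm_sub_le _ _).trans ?_
      rw [Complex.norm_exp_ofReal_mul_I, Complex.norm_exp_ofReal_mul_I]
      norm_num
    have h3 : (1 / 2 : ℝ) ^ 2 ≤ (D / m - 1) ^ 2 := by
      rw [← sq_abs (D / m - 1)]
      gcongr
    have : 0 ≤ |t| * (2 * (|b / m * (T - μ * D)| * |D / m - 1|) + |b / m * (T - μ * D) - W'|) := by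
      positivity
    linarith

variable {S : Type*} [MeasurableSpace S] {ν : Measure S} [IsProbabilityMeasure ν]

/-- Second moments suffice: by Cauchy–Schwarz, the product of the bounded numerator with the
vanishing fluctuation of the denominator tends to zero in L¹. -/
theorem tendstoInDistribution_of_ratio {Ω : ℕ → Type*} [∀ n, MeasurableSpace (Ω n)]
    {P : ∀ n, Measure (Ω n)} [∀ n, IsProbabilityMeasure (P n)] {V : ∀ n, Ω n → Fin n → S}
    (hV : ∀ n, HasLaw (V n) (Measure.pi fun _ => ν) (P n)) {Y : ∀ n, Ω n → ℝ}
    {T D W' : ∀ n, (Fin n → S) → ℝ} (hT : ∀ n, BddMeas (T n)) (hD : ∀ n, BddMeas (D n))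
    (hW' : ∀ n, BddMeas (W' n)) {b m μ : ℕ → ℝ} (hm : ∀ᶠ n in atTop, 0 < m n)
    (hY : ∀ n, Y n =ᵐ[P n] fun ω => b n * (T n (V n ω) / D n (V n ω) - μ n))
    {B : ℝ} (hB : ∀ᶠ n in atTop, ∫ x, (b n / m n * (T n x - μ n * D n x)) ^ 2
      ∂(Measure.pi fun _ : Fin n => ν) ≤ B)
    (hDm : Tendsto (fun n => ∫ x, (D n x / m n - 1) ^ 2 ∂(Measure.pi fun _ : Fin n => ν))
      atTop (𝓝 0))
    (hWW : Tendsto (fun n => ∫ x, (b n / m n * (T n x - μ n * D n x) - W' n x) ^ 2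
      ∂(Measure.pi fun _ : Fin n => ν)) atTop (𝓝 0))
    (hchar : ∀ t : ℝ, Tendsto (fun n => ∫ x, Complex.exp (((t * W' n x : ℝ) : ℂ) * Complex.I)
      ∂(Measure.pi fun _ : Fin n => ν)) atTop (𝓝 (Complex.exp (-(t : ℂ) ^ 2 / 2)))) :
    TendstoInDistribution Y atTop id P (gaussianReal 0 1) := by
  have hVm : ∀ n, AEMeasurable (V n) (P n) := fun n => (hV n).aemeasurable
  have hRm : ∀ n, Measurable fun x => b n * (T n x / D n x - μ n) := fun n =>
    (((hT n).measurable.div (hD n).measurable).sub_const _).const_mul _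
  refine tendstoInDistribution_of_charFun
    (fun n => ((hRm n).comp_aemeasurable (hVm n)).congr (hY n).symm) fun t => ?_
  have e : ∀ n, ∫ ω, Complex.exp (((t * Y n ω : ℝ) : ℂ) * Complex.I) ∂(P n)
      = ∫ x, Complex.exp (((t * (b n * (T n x / D n x - μ n)) : ℝ) : ℂ) * Complex.I)
        ∂(Measure.pi fun _ : Fin n => ν) := fun n => by
    rw [← (hV n).map_eq, integral_map (hVm n)]
    · refine integral_congr_ae ?_
      filter_upwards [hY n] with ω hω
      rw [hω]
    · have := hRm n
      exact Measurable.aestronglyMeasurable (by fun_prop)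
  simp_rw [e]
  refine (tendsto_iff_of_dist ?_).1 (hchar t)
  have hbound : Tendsto (fun n => |t| * (2 * √(B * ∫ x, (D n x / m n - 1) ^ 2
        ∂(Measure.pi fun _ : Fin n => ν))
      + √(∫ x, (b n / m n * (T n x - μ n * D n x) - W' n x) ^ 2
        ∂(Measure.pi fun _ : Fin n => ν)))
      + 8 * ∫ x, (D n x / m n - 1) ^ 2 ∂(Measure.pi fun _ : Fin n => ν)) atTop (𝓝 0) := by
    have h1 := ((hDm.const_mul B).sqrt.const_mul 2).add hWW.sqrt
    have h2 := (h1.const_mul |t|).add (hDm.const_mul 8)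
    simpa using h2
  refine squeeze_zero' (Eventually.of_forall fun n => dist_nonneg) ?_ hbound
  filter_upwards [hm, hB] with n hmn hBn
  have hTn := hT n
  have hDn := hD n
  have hWn := hW' n
  have hXb : BddMeas fun x => D n x / m n - 1 := by
    simp_rw [div_eq_mul_inv]
    fun_prop
  have hRn := hRm n
  have hWm := hWn.measurable
  have hint : ∀ f : (Fin n → S) → ℝ, Measurable f → Integrable
      (fun x => Complex.exp (((t * f x : ℝ) : ℂ) * Complex.I)) (Measure.pi fun _ : Fin n => ν) :=
    fun f hf => by
      refine Integrable.of_bound (C := 1) (Measurable.aestronglyMeasurable (by fun_prop)) ?_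
      exact Eventually.of_forall fun x => (Complex.norm_exp_ofReal_mul_I _).le
  rw [dist_comm, dist_eq_norm, ← integral_sub (hint _ hRn) (hint _ hWm)]
  refine (norm_integral_le_integral_norm _).trans ?_
  calc _ ≤ ∫ x, (|t| * (2 * (|b n / m n * (T n x - μ n * D n x)| * |D n x / m n - 1|)
        + |b n / m n * (T n x - μ n * D n x) - W' n x|) + 8 * (D n x / m n - 1) ^ 2)
        ∂(Measure.pi fun _ : Fin n => ν) := by
        refine integral_mono ((hint _ hRn).sub (hint _ hWm)).norm
          (BddMeas.integrable (by fun_prop) _) fun x => norm_cexp_ratio_sub_le hmn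
    _ = |t| * (2 * ∫ x, |b n / m n * (T n x - μ n * D n x)| * |D n x / m n - 1|
          ∂(Measure.pi fun _ : Fin n => ν)
        + ∫ x, |b n / m n * (T n x - μ n * D n x) - W' n x| ∂(Measure.pi fun _ : Fin n => ν))
        + 8 * ∫ x, (D n x / m n - 1) ^ 2 ∂(Measure.pi fun _ : Fin n => ν) := by
        rw [BddMeas.integral_add (by fun_prop) (by fun_prop), integral_const_mul,
          BddMeas.integral_add (by fun_prop) (by fun_prop), integral_const_mul,
          integral_const_mul]
    _ ≤ _ := by
        gcongr
        · exact BddMeas.integral_abs_mul_le (by fun_prop) hXb hBn le_rfl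
        · exact BddMeas.integral_abs_le_sqrt (by fun_prop) le_rfl

/-- Markov's inequality for a function `F` that is at least 1 on the bad event, either because D is
far from m or because T − μ D is large. -/
theorem tendsto_measure_ratio {Ω : ℕ → Type*} [∀ n, MeasurableSpace (Ω n)]
    {P : ∀ n, Measure (Ω n)} [∀ n, IsProbabilityMeasure (P n)] {V : ∀ n, Ω n → Fin n → S}
    (hV : ∀ n, HasLaw (V n) (Measure.pi fun _ => ν) (P n)) {C : ∀ n, Ω n → ℝ}
    {T D : ∀ n, (Fin n → S) → ℝ} (hT : ∀ n, BddMeas (T n)) (hD : ∀ n, BddMeas (D n))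
    {m μ : ℕ → ℝ} (hm : ∀ᶠ n in atTop, 0 < m n)
    (hC : ∀ n, C n =ᵐ[P n] fun ω => T n (V n ω) / D n (V n ω))
    (hDm : Tendsto (fun n => ∫ x, (D n x / m n - 1) ^ 2 ∂(Measure.pi fun _ : Fin n => ν))
      atTop (𝓝 0))
    (hL : Tendsto (fun n => ∫ x, (1 / m n * (T n x - μ n * D n x)) ^ 2
      ∂(Measure.pi fun _ : Fin n => ν)) atTop (𝓝 0))
    {a : ℝ} (hμ : Tendsto μ atTop (𝓝 a)) {ε : ℝ} (hε : 0 < ε) :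
    Tendsto (fun n => P n {ω | ε ≤ |C n ω - a|}) atTop (𝓝 0) := by
  have hVm : ∀ n, AEMeasurable (V n) (P n) := fun n => (hV n).aemeasurable
  have hbound : Tendsto (fun n => ENNReal.ofReal (4 * ∫ x, (D n x / m n - 1) ^ 2
      ∂(Measure.pi fun _ : Fin n => ν) + 16 / ε ^ 2 * ∫ x, (1 / m n * (T n x - μ n * D n x)) ^ 2
      ∂(Measure.pi fun _ : Fin n => ν))) atTop (𝓝 0) := by
    have h2 := ENNReal.tendsto_ofReal ((hDm.const_mul 4).add (hL.const_mul (16 / ε ^ 2)))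
    simpa using h2
  have hμε : ∀ᶠ n in atTop, |μ n - a| < ε / 2 := by
    have := Metric.tendsto_nhds.1 hμ (ε / 2) (by positivity)
    simpa only [Real.dist_eq] using this
  refine tendsto_of_tendsto_of_tendsto_of_le_of_le' tendsto_const_nhds hbound
    (Eventually.of_forall fun n => bot_le) ?_
  filter_upwards [hm, hμε] with n hmn hμn
  have hTn := hT n
  have hDn := hD n
  set F : (Fin n → S) → ℝ := fun x => 4 * (D n x / m n - 1) ^ 2
    + 16 / ε ^ 2 * (1 / m n * (T n x - μ n * D n x)) ^ 2 with hF
  have hXb : BddMeas fun x => D n x / m n - 1 := by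
    simp_rw [div_eq_mul_inv]
    fun_prop
  have hFb : BddMeas F := by fun_prop
  have hF0 : ∀ x, 0 ≤ F x := fun x => by positivity
  have hsub : ∀ᵐ ω ∂(P n), ε ≤ |C n ω - a| → 1 ≤ F (V n ω) := by
    filter_upwards [hC n] with ω hω h
    rw [hω] at h
    set x := V n ω
    by_cases hX : |D n x / m n - 1| ≤ 1 / 2
    · have hX' := abs_le.1 hX
      set X := D n x / m n with hXd
      have hXpos : 0 < X := by linarith
      have hDx : D n x = X * m n := by rw [hXd]; field_simp
      set L := 1 / m n * (T n x - μ n * D n x) with hL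
      have hY : T n x / D n x - a = L / X + (μ n - a) := by
        rw [hL, hDx]
        field_simp
        ring
      have h3 : ε / 2 ≤ |L / X| := by
        have := abs_add_le (L / X) (μ n - a)
        rw [← hY] at this
        linarith
      rw [abs_div, abs_of_pos hXpos, le_div_iff₀ hXpos] at h3
      have h4 : ε / 4 ≤ |L| := by nlinarith
      have h5 : (ε / 4) ^ 2 ≤ L ^ 2 := by
        rw [← sq_abs L]
        gcongr
      have h6 : 1 ≤ 16 / ε ^ 2 * L ^ 2 := by
        rw [div_mul_eq_mul_div, le_div_iff₀ (by positivity)]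
        linarith
      simp only [hF]
      rw [← hL, ← hXd]
      nlinarith [sq_nonneg (X - 1)]
    · push Not at hX
      have h3 : (1 / 2 : ℝ) ^ 2 ≤ (D n x / m n - 1) ^ 2 := by
        rw [← sq_abs (D n x / m n - 1)]
        gcongr
      have : 0 ≤ 16 / ε ^ 2 * (1 / m n * (T n x - μ n * D n x)) ^ 2 := by positivity
      simp only [hF]
      linarith
  have hle : P n {ω | ε ≤ |C n ω - a|} ≤ P n {ω | 1 ≤ F (V n ω)} :=
    measure_mono_ae (by filter_upwards [hsub] with ω hω using hω)
  refine hle.trans ?_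
  have hFi : Integrable (fun ω => F (V n ω)) (P n) := by
    have := hFb.integrable (Measure.pi fun _ : Fin n => ν)
    rw [← (hV n).map_eq] at this
    exact this.comp_aemeasurable (hVm n)
  have h1 := mul_meas_ge_le_integral_of_nonneg (μ := P n) (f := fun ω => F (V n ω))
    (Eventually.of_forall fun ω => hF0 _) hFi 1
  have h2 : ∫ ω, F (V n ω) ∂(P n) = ∫ x, F x ∂(Measure.pi fun _ : Fin n => ν) := by
    rw [← (hV n).map_eq, integral_map (hVm n) hFb.measurable.aestronglyMeasurable]
  have h3 : ∫ x, F x ∂(Measure.pi fun _ : Fin n => ν) = 4 * ∫ x, (D n x / m n - 1) ^ 2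
      ∂(Measure.pi fun _ : Fin n => ν) + 16 / ε ^ 2 * ∫ x, (1 / m n * (T n x - μ n * D n x)) ^ 2
      ∂(Measure.pi fun _ : Fin n => ν) := by
    simp only [hF]
    rw [BddMeas.integral_add (by fun_prop) (by fun_prop), integral_const_mul,
      integral_const_mul]
  rw [one_mul, h2, h3] at h1
  rw [← ofReal_measureReal]
  exact ENNReal.ofReal_le_ofReal h1

end Transfer

/-! ### Proximity on the circle. -/

section Near

/-- Indicator that two points of the line are at distance at most `r` modulo one. -/
noncomputable def near (r x y : ℝ) : ℝ := if |x - y - round (x - y)| ≤ r then 1 else 0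

theorem near_eq_zero_or_one (r x y : ℝ) : near r x y = 0 ∨ near r x y = 1 := by
  unfold near
  split_ifs <;> simp

theorem near_nonneg (r x y : ℝ) : 0 ≤ near r x y := by
  rcases near_eq_zero_or_one r x y with h | h <;> simp [h]

theorem near_le_one (r x y : ℝ) : near r x y ≤ 1 := by
  rcases near_eq_zero_or_one r x y with h | h <;> simp [h]

theorem abs_sub_round_neg (x : ℝ) : |-x - round (-x)| = |x - round x| := by
  apply le_antisymm
  · calc |-x - round (-x)| ≤ |-x - ((-round x : ℤ) : ℝ)| := round_le _ _
      _ = |x - round x| := by rw [← abs_neg]; congr 1; push_cast; ring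
  · calc |x - round x| ≤ |x - ((-round (-x) : ℤ) : ℝ)| := round_le _ _
      _ = |-x - round (-x)| := by rw [← abs_neg]; congr 1; push_cast; ring

theorem near_comm (r x y : ℝ) : near r y x = near r x y := by
  unfold near
  rw [← abs_sub_round_neg (x - y), neg_sub]

theorem near_add_one_right (r x y : ℝ) : near r x (y + 1) = near r x y := by
  unfold near
  have : x - (y + 1) = x - y - 1 := by ring
  rw [this, round_sub_one]
  push_cast
  rw [show x - y - 1 - ((round (x - y) : ℝ) - 1) = x - y - round (x - y) by ring]

theorem near_add_one_left (r x y : ℝ) : near r (x + 1) y = near r x y := by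
  rw [near_comm, near_add_one_right, near_comm]

theorem near_mono {r s : ℝ} (h : r ≤ s) (x y : ℝ) : near r x y ≤ near s x y := by
  unfold near
  split_ifs with h1 h2
  · exact le_rfl
  · exact absurd (h1.trans h) h2
  · norm_num
  · exact le_rfl

theorem near_mul_near_le (r s x y z : ℝ) : near r x z * near s z y ≤ near (r + s) x y := by
  unfold near
  split_ifs with h1 h2 h3 <;> norm_num
  apply h3
  calc |x - y - round (x - y)| ≤ |x - y - ((round (x - z) + round (z - y) : ℤ) : ℝ)| := round_le _ _
    _ = |(x - z - round (x - z)) + (z - y - round (z - y))| := by congr 1; push_cast; ring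
    _ ≤ r + s := (abs_add_le _ _).trans (add_le_add h1 h2)

/-- Below half a turn nothing wraps around, and circular distance is ordinary distance. -/
theorem near_add_eq {r x u v : ℝ} (h : |u - v| < 1 / 2) :
    near r (x + u) (x + v) = if |u - v| ≤ r then 1 else 0 := by
  unfold near
  have : round (u - v) = 0 := round_eq_zero_iff.2 ⟨by linarith [neg_abs_le (u - v)],
    (le_abs_self _).trans_lt h⟩
  rw [show x + u - (x + v) = u - v by ring, this]
  simp

@[fun_prop]
theorem bddMeas_near (r : ℝ) : BddMeas (fun p : ℝ × ℝ => near r p.1 p.2) := by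
  unfold near
  refine ⟨Measurable.ite (measurableSet_le ?_ measurable_const) measurable_const measurable_const,
    1, fun p => by split_ifs <;> simp⟩
  simp_rw [abs_sub_round_eq_min]
  fun_prop

/-- The rounding form is periodic on the whole line, which the translated integrals need. On the
unit interval it agrees with the minimum even at the ends, where the difference is ±1 and both sides
vanish. -/
theorem circDist_eq {x y : ℝ} (hx : x ∈ Set.Icc (0 : ℝ) 1) (hy : y ∈ Set.Icc (0 : ℝ) 1) :
    circDist x y = |x - y - round (x - y)| := by
  have key : ∀ t : ℝ, 0 ≤ t → t ≤ 1 → min t (1 - t) = |t - round t| := by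
    intro t h0 h1
    rw [abs_sub_round_eq_min]
    rcases h1.lt_or_eq with h | rfl
    · rw [Int.fract_eq_self.2 ⟨h0, h⟩]
    · simp
  unfold circDist
  obtain ⟨hx0, hx1⟩ := hx
  obtain ⟨hy0, hy1⟩ := hy
  rcases le_total 0 (x - y) with h | h
  · rw [abs_of_nonneg h, key _ h (by linarith)]
  · rw [abs_of_nonpos h, key _ (by linarith) (by linarith), abs_sub_round_neg]

theorem adj_eq_near {ι : Type*} {r : ℝ} {x : ι → ℝ} (hx : ∀ i, x i ∈ Set.Icc (0 : ℝ) 1) {i j : ι}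
    (hij : i ≠ j) : adj r x i j = near r (x i) (x j) := by
  classical
  unfold adj near
  rw [SimpleGraph.adjMatrix_apply, ← circDist_eq (hx i) (hx j)]
  exact if_congr ⟨fun h => h.2, fun h => ⟨hij, h⟩⟩ rfl rfl

end Near

/-! ### Periodic densities and integration against `near`. -/

/-- A positive periodic probability density with the Taylor bounds used below. -/
structure SmoothDensity (g g1 g2 : ℝ → ℝ) (c M : ℝ) : Prop where
  per : ∀ x, g (x + 1) = g x
  per1 : ∀ x, g1 (x + 1) = g1 x
  deriv : ∀ x, HasDerivAt g (g1 x) x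
  deriv1 : ∀ x, HasDerivAt g1 (g2 x) x
  cont2 : Continuous g2
  pos : 0 < c
  le : ∀ x, c ≤ g x
  one_le : 1 ≤ M
  bdd : ∀ x, |g x| ≤ M
  bdd1 : ∀ x, |g1 x| ≤ M
  bdd2 : ∀ x, |g2 x| ≤ M
  taylor : ∀ x u, |g (x + u) - g x - u * g1 x - u ^ 2 / 2 * g2 x| ≤ M * |u| ^ 3
  int : ∫ x in (0 : ℝ)..1, g x = 1

namespace SmoothDensity

variable {g g1 g2 : ℝ → ℝ} {c M : ℝ} (hg : SmoothDensity g g1 g2 c M)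
include hg

theorem continuous : Continuous g := continuous_iff_continuousAt.2 fun x => (hg.deriv x).continuousAt

theorem continuous1 : Continuous g1 :=
  continuous_iff_continuousAt.2 fun x => (hg.deriv1 x).continuousAt

theorem bddMeas : BddMeas g := ⟨hg.continuous.measurable, M, hg.bdd⟩

theorem bddMeas1 : BddMeas g1 := ⟨hg.continuous1.measurable, M, hg.bdd1⟩

theorem bddMeas2 : BddMeas g2 := ⟨hg.cont2.measurable, M, hg.bdd2⟩

theorem pos' (x : ℝ) : 0 < g x := hg.pos.trans_le (hg.le x)

omit hg in
theorem law_eq : law g = (volume.restrict (Set.Icc (0 : ℝ) 1)).withDensity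
    fun x => ENNReal.ofReal (g x) := by
  unfold law density
  rw [← withDensity_indicator measurableSet_Icc]
  congr 1
  ext x
  by_cases hx : x ∈ Set.Icc (0 : ℝ) 1 <;> simp [hx]

theorem integral_law (F : ℝ → ℝ) : ∫ x, F x ∂(law g) = ∫ x in (0 : ℝ)..1, F x * g x := by
  rw [law_eq, integral_withDensity_eq_integral_toReal_smul
    (by have := hg.continuous.measurable; fun_prop) (by simp),
    intervalIntegral.integral_of_le zero_le_one, integral_Icc_eq_integral_Ioc]
  refine integral_congr_ae (Eventually.of_forall fun x => ?_)
  simp only [smul_eq_mul, ENNReal.toReal_ofReal (hg.pos' x).le, mul_comm]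

theorem isProbabilityMeasure : IsProbabilityMeasure (law g) := by
  constructor
  rw [law_eq, withDensity_apply _ MeasurableSet.univ, Measure.restrict_univ,
    ← ofReal_integral_eq_lintegral_ofReal
      ((hg.bddMeas.integrable (volume.restrict (Set.Icc (0 : ℝ) 1))))
      (Eventually.of_forall fun x => (hg.pos' x).le),
    integral_Icc_eq_integral_Ioc, ← intervalIntegral.integral_of_le zero_le_one, hg.int,
    ENNReal.ofReal_one]

omit hg in
theorem ae_mem_Icc : ∀ᵐ x ∂(law g), x ∈ Set.Icc (0 : ℝ) 1 := by
  rw [law_eq]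
  exact (withDensity_absolutelyContinuous _ _).ae_le (ae_restrict_mem measurableSet_Icc)

/-- Periodicity recentres the unit window of integration at x; then r < 1/2 makes the indicator that
of the interval [−r, r]. -/
theorem integral_near_mul {r : ℝ} (hr0 : 0 ≤ r) (hr : r < 1 / 2) {φ : ℝ → ℝ}
    (hper : ∀ x, φ (x + 1) = φ x) (x : ℝ) :
    ∫ y, near r x y * φ y ∂(law g) = ∫ u in -r..r, φ (x + u) * g (x + u) := by
  rw [hg.integral_law]
  have hp : Function.Periodic (fun y => near r x y * φ y * g y) 1 := fun y => by
    simp only [near_add_one_right, hper, hg.per]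
  have h1 := hp.intervalIntegral_add_eq 0 (x - 1 / 2)
  rw [zero_add] at h1
  rw [h1]
  have h2 : ∫ y in (x - 1 / 2)..(x - 1 / 2 + 1), near r x y * φ y * g y
      = ∫ u in (-(1 / 2) : ℝ)..(1 / 2), near r x (x + u) * φ (x + u) * g (x + u) := by
    rw [intervalIntegral.integral_comp_add_left (fun y => near r x y * φ y * g y) x]
    congr 1; ring
  rw [h2, intervalIntegral.integral_of_le (by norm_num),
    intervalIntegral.integral_of_le (by linarith), ← integral_Icc_eq_integral_Ioc,
    ← integral_Icc_eq_integral_Ioc, integral_Icc_eq_integral_Ioo]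
  have h3 : ∫ u in Set.Ioo (-(1 / 2) : ℝ) (1 / 2), near r x (x + u) * φ (x + u) * g (x + u)
      = ∫ u in Set.Ioo (-(1 / 2) : ℝ) (1 / 2), (Set.Icc (-r) r).indicator
          (fun u => φ (x + u) * g (x + u)) u := by
    refine setIntegral_congr_fun measurableSet_Ioo fun u hu => ?_
    have e := near_add_eq (r := r) (x := x) (u := 0) (v := u)
      (by rw [zero_sub, abs_neg, abs_lt]; exact hu)
    rw [add_zero] at e
    simp only [e, zero_sub, abs_neg]
    by_cases h : |u| ≤ r
    · rw [if_pos h, Set.indicator_of_mem (s := Set.Icc (-r) r) (Set.mem_Icc.2 (abs_le.1 h))]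
      ring
    · rw [if_neg h, Set.indicator_of_notMem (s := Set.Icc (-r) r) (fun h' => h (abs_le.2 h'))]
      ring
  rw [h3, setIntegral_indicator measurableSet_Icc, Set.inter_eq_right.2]
  exact fun u hu => ⟨by linarith [hu.1], by linarith [hu.2]⟩

theorem integral_near_le {r : ℝ} (hr0 : 0 ≤ r) (hr : r < 1 / 2) (x : ℝ) :
    ∫ y, near r x y ∂(law g) ≤ 2 * M * r := by
  have h := hg.integral_near_mul hr0 hr (φ := fun _ => 1) (fun _ => rfl) x
  simp only [mul_one, one_mul] at h
  rw [h]
  have hb := intervalIntegral.norm_integral_le_of_norm_le_const (a := -r) (b := r)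
    (f := fun u => g (x + u)) (C := M) fun u _ => hg.bdd _
  rw [Real.norm_eq_abs, show r - -r = 2 * r by ring, abs_of_nonneg (by positivity : 0 ≤ 2 * r)] at hb
  linarith [le_abs_self (∫ u in -r..r, g (x + u))]

end SmoothDensity

/-! ### Short-range kernels: orders of magnitude of their projections. -/

/-- A symmetric kernel dominated by the indicator that the arguments are within `2 r`. -/
structure LocalKernel (r : ℝ) (k : ℝ → ℝ → ℝ → ℝ) : Prop extends SymmKernel k where
  abs_le : ∀ x y z, |k x y z| ≤ near (2 * r) x z * near (2 * r) y z

theorem near_sq (r x y : ℝ) : near r x y ^ 2 = near r x y := by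
  rcases near_eq_zero_or_one r x y with h | h <;> simp [h]

theorem LocalKernel.abs_le' {r : ℝ} {k : ℝ → ℝ → ℝ → ℝ} (hk : LocalKernel r k) (x y z : ℝ) :
    |k x y z| ≤ near (2 * r) x y * near (2 * r) x z := by
  rw [← hk.swap₁₂, ← hk.swap₂₃]
  refine (hk.abs_le _ _ _).trans (le_of_eq ?_)
  rw [near_comm _ x z, near_comm _ x y]

namespace LocalKernel

variable {g g1 g2 : ℝ → ℝ} {c M : ℝ} (hg : SmoothDensity g g1 g2 c M)
  {r : ℝ} {k : ℝ → ℝ → ℝ → ℝ} (hk : LocalKernel r k)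

include hg hk

/-- Each integration runs over a neighbourhood of mass O(r) and leaves the remaining indicator.
Hence the second moments of k, `proj₂`, `proj₁` are O(r²), O(r³), O(r⁴) for every such kernel; for
the centred kernel the last improves to O(r⁸). -/
theorem abs_proj₂_le (hr0 : 0 ≤ r) (hr : r < 1 / 8) (x y : ℝ) :
    |proj₂ (law g) k x y| ≤ 4 * M * r * near (2 * r) x y := by
  have := hg.isProbabilityMeasure
  have hb := hk.bdd
  unfold proj₂
  calc _ ≤ ∫ z, |k x y z| ∂(law g) := abs_integral_le_integral_abs
    _ ≤ ∫ z, near (2 * r) x y * near (2 * r) x z ∂(law g) :=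
        BddMeas.integral_mono (by fun_prop) (by fun_prop) fun z => hk.abs_le' x y z
    _ = near (2 * r) x y * ∫ z, near (2 * r) x z ∂(law g) := integral_const_mul _ _
    _ ≤ near (2 * r) x y * (2 * M * (2 * r)) := by
        gcongr
        · exact near_nonneg _ _ _
        · exact hg.integral_near_le (by linarith) (by linarith) x
    _ = _ := by ring

theorem abs_proj₁_le (hr0 : 0 ≤ r) (hr : r < 1 / 8) (x : ℝ) :
    |proj₁ (law g) k x| ≤ (4 * M * r) ^ 2 := by
  have := hg.isProbabilityMeasure
  have hb := hk.bdd_proj₂ (ν := law g)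
  have hM := hg.one_le
  unfold proj₁
  calc _ ≤ ∫ y, |proj₂ (law g) k x y| ∂(law g) := abs_integral_le_integral_abs
    _ ≤ ∫ y, 4 * M * r * near (2 * r) x y ∂(law g) :=
        BddMeas.integral_mono (by fun_prop) (by fun_prop) fun z => hk.abs_proj₂_le hg hr0 hr x z
    _ = 4 * M * r * ∫ z, near (2 * r) x z ∂(law g) := integral_const_mul _ _
    _ ≤ 4 * M * r * (2 * M * (2 * r)) := by
        gcongr
        exact hg.integral_near_le (by linarith) (by linarith) x
    _ = _ := by ring

theorem integral_sq_proj₁_le (hr0 : 0 ≤ r) (hr : r < 1 / 8) :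
    ∫ x, proj₁ (law g) k x ^ 2 ∂(law g) ≤ (4 * M * r) ^ 4 := by
  have := hg.isProbabilityMeasure
  have hb := hk.bdd_proj₁ (ν := law g)
  calc _ ≤ ∫ x, (4 * M * r) ^ 4 ∂(law g) := BddMeas.integral_mono (by fun_prop) (by fun_prop)
        fun x => by
          have := pow_le_pow_left₀ (abs_nonneg _) (hk.abs_proj₁_le hg hr0 hr x) 2
          rw [sq_abs] at this
          exact this.trans (le_of_eq (by ring))
    _ = _ := by simp

theorem integral_pow_proj₂_le (hr0 : 0 ≤ r) (hr : r < 1 / 8) {m : ℕ} (hm : Even m) (hm0 : m ≠ 0)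
    (x : ℝ) : ∫ y, proj₂ (law g) k x y ^ m ∂(law g) ≤ (4 * M * r) ^ (m + 1) := by
  have := hg.isProbabilityMeasure
  have hb := hk.bdd_proj₂ (ν := law g)
  have hM := hg.one_le
  calc _ ≤ ∫ y, (4 * M * r) ^ m * near (2 * r) x y ∂(law g) :=
        BddMeas.integral_mono (by fun_prop) (by fun_prop) fun y => by
          have := pow_le_pow_left₀ (abs_nonneg _) (hk.abs_proj₂_le hg hr0 hr x y) m
          rw [hm.pow_abs] at this
          refine this.trans (le_of_eq ?_)
          rw [mul_pow]
          congr 1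
          rcases near_eq_zero_or_one (2 * r) x y with h | h <;> simp [h, hm0]
    _ = (4 * M * r) ^ m * ∫ y, near (2 * r) x y ∂(law g) := integral_const_mul _ _
    _ ≤ (4 * M * r) ^ m * (2 * M * (2 * r)) := by
        gcongr
        exact hg.integral_near_le (by linarith) (by linarith) x
    _ = _ := by ring

theorem integral_sq_proj₂_le (hr0 : 0 ≤ r) (hr : r < 1 / 8) :
    ∫ x, ∫ y, proj₂ (law g) k x y ^ 2 ∂(law g) ∂(law g) ≤ (4 * M * r) ^ 3 := by
  have := hg.isProbabilityMeasure
  have hb := hk.bdd_proj₂ (ν := law g)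
  calc _ ≤ ∫ x, (4 * M * r) ^ 3 ∂(law g) := BddMeas.integral_mono (by fun_prop) (by fun_prop)
        fun x => hk.integral_pow_proj₂_le hg hr0 hr even_two two_ne_zero x
    _ = _ := by simp

theorem integral_sq_le (hr0 : 0 ≤ r) (hr : r < 1 / 8) :
    ∫ x, ∫ y, ∫ z, k x y z ^ 2 ∂(law g) ∂(law g) ∂(law g) ≤ (4 * M * r) ^ 2 := by
  have := hg.isProbabilityMeasure
  have hb := hk.bdd
  have hM := hg.one_le
  have h2 : ∀ x y z, k x y z ^ 2 ≤ near (2 * r) x y * near (2 * r) x z := fun x y z => by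
    rw [← sq_abs]
    refine (pow_le_pow_left₀ (abs_nonneg _) (hk.abs_le' x y z) 2).trans (le_of_eq ?_)
    rw [mul_pow, near_sq, near_sq]
  have h1 : ∀ x, ∫ z, near (2 * r) x z ∂(law g) ≤ 4 * M * r := fun x =>
    (hg.integral_near_le (by linarith) (by linarith) x).trans (le_of_eq (by ring))
  have h0 : ∀ x, 0 ≤ ∫ z, near (2 * r) x z ∂(law g) := fun x =>
    integral_nonneg fun _ => near_nonneg _ _ _
  calc _ ≤ ∫ x, ∫ y, ∫ z, near (2 * r) x y * near (2 * r) x z ∂(law g) ∂(law g) ∂(law g) :=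
        BddMeas.integral_mono (by fun_prop) (by fun_prop) fun x =>
          BddMeas.integral_mono (by fun_prop) (by fun_prop) fun y =>
            BddMeas.integral_mono (by fun_prop) (by fun_prop) fun z => h2 x y z
    _ = ∫ x, (∫ z, near (2 * r) x z ∂(law g)) * (∫ z, near (2 * r) x z ∂(law g)) ∂(law g) := by
        simp_rw [integral_const_mul, integral_mul_const]
    _ ≤ ∫ x, (4 * M * r) ^ 2 ∂(law g) := BddMeas.integral_mono (by fun_prop) (by fun_prop) fun x => by
        rw [sq]
        exact mul_le_mul (h1 x) (h1 x) (h0 x) (by positivity)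
    _ = _ := by simp

/-- `K` is kept apart from the generic bound r² because it will be of order r⁴; the non-local
correction then does not spoil the orders given by the local term. -/
theorem abs_deg₂_le (hr0 : 0 ≤ r) (hr : r < 1 / 8) (hmean : kmean (law g) k = 0) {K : ℝ}
    (hK : ∀ x, |proj₁ (law g) k x| ≤ K) (x y : ℝ) :
    |deg₂ (law g) k x y| ≤ 4 * M * r * near (2 * r) x y + 2 * K := by
  unfold deg₂
  rw [hmean, add_zero]
  have h1 := hk.abs_proj₂_le hg hr0 hr x y
  have h2 := hK x
  have h3 := hK y
  rw [_root_.abs_le] at h1 h2 h3 ⊢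
  constructor <;> linarith [h1.1, h1.2, h2.1, h2.2, h3.1, h3.2]

theorem integral_sq_deg₂_le (hr0 : 0 ≤ r) (hr : r < 1 / 8) (hmean : kmean (law g) k = 0) {K : ℝ}
    (hK : ∀ x, |proj₁ (law g) k x| ≤ K) (x : ℝ) :
    ∫ y, deg₂ (law g) k x y ^ 2 ∂(law g) ≤ 2 * (4 * M * r) ^ 3 + 8 * K ^ 2 := by
  have := hg.isProbabilityMeasure
  have hb := hk.bdd_deg₂ (ν := law g)
  have hM := hg.one_le
  calc _ ≤ ∫ y, (2 * (4 * M * r) ^ 2 * near (2 * r) x y + 8 * K ^ 2) ∂(law g) :=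
        BddMeas.integral_mono (by fun_prop) (by fun_prop) fun y => by
          rw [← sq_abs]
          refine (pow_le_pow_left₀ (abs_nonneg _) (hk.abs_deg₂_le hg hr0 hr hmean hK x y) 2).trans ?_
          have e := near_sq (2 * r) x y
          calc _ ≤ 2 * ((4 * M * r * near (2 * r) x y) ^ 2 + (2 * K) ^ 2) := add_sq_le
            _ = _ := by rw [mul_pow _ (near (2 * r) x y), e]; ring
    _ = 2 * (4 * M * r) ^ 2 * ∫ y, near (2 * r) x y ∂(law g) + 8 * K ^ 2 := by
        rw [BddMeas.integral_add (by fun_prop) (by fun_prop), integral_const_mul]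
        simp
    _ ≤ 2 * (4 * M * r) ^ 2 * (2 * M * (2 * r)) + 8 * K ^ 2 := by
        gcongr
        exact hg.integral_near_le (by linarith) (by linarith) x
    _ = _ := by ring

theorem integral_pow_four_deg₂_le (hr0 : 0 ≤ r) (hr : r < 1 / 8) (hmean : kmean (law g) k = 0)
    {K : ℝ} (hK : ∀ x, |proj₁ (law g) k x| ≤ K) :
    ∫ x, ∫ y, deg₂ (law g) k x y ^ 4 ∂(law g) ∂(law g) ≤ 8 * (4 * M * r) ^ 5 + 128 * K ^ 4 := by
  have := hg.isProbabilityMeasure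
  have hb := hk.bdd_deg₂ (ν := law g)
  have hM := hg.one_le
  have h1 : ∀ x, ∫ y, deg₂ (law g) k x y ^ 4 ∂(law g) ≤ 8 * (4 * M * r) ^ 5 + 128 * K ^ 4 := by
    intro x
    calc _ ≤ ∫ y, (8 * (4 * M * r) ^ 4 * near (2 * r) x y + 128 * K ^ 4) ∂(law g) :=
          BddMeas.integral_mono (by fun_prop) (by fun_prop) fun y => by
            rw [← (by decide : Even 4).pow_abs]
            refine (pow_le_pow_left₀ (abs_nonneg _)
              (hk.abs_deg₂_le hg hr0 hr hmean hK x y) 4).trans ?_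
            rcases near_eq_zero_or_one (2 * r) x y with h | h <;> rw [h]
            · nlinarith [sq_nonneg (K ^ 2)]
            · have h2 := add_sq_le (a := 4 * M * r * 1) (b := 2 * K)
              calc (4 * M * r * 1 + 2 * K) ^ 4 = ((4 * M * r * 1 + 2 * K) ^ 2) ^ 2 := by ring
                _ ≤ (2 * ((4 * M * r * 1) ^ 2 + (2 * K) ^ 2)) ^ 2 := by gcongr
                _ ≤ _ := by nlinarith [sq_nonneg ((4 * M * r) ^ 2 - (2 * K) ^ 2)]
      _ = 8 * (4 * M * r) ^ 4 * ∫ y, near (2 * r) x y ∂(law g) + 128 * K ^ 4 := by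
          rw [BddMeas.integral_add (by fun_prop) (by fun_prop), integral_const_mul]
          simp
      _ ≤ 8 * (4 * M * r) ^ 4 * (2 * M * (2 * r)) + 128 * K ^ 4 := by
          gcongr
          exact hg.integral_near_le (by linarith) (by linarith) x
      _ = _ := by ring
  calc _ ≤ ∫ x, (8 * (4 * M * r) ^ 5 + 128 * K ^ 4) ∂(law g) :=
        BddMeas.integral_mono (by fun_prop) (by fun_prop) h1
    _ = _ := by simp

/-- The local parts around x and y overlap only if x and y are within 4 r, so the contraction is of
order r³ on a set of measure O(r). Its squared norm O(r⁷) is small against the square r⁶ of the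
variance scale, as the quadratic limit theorem requires. -/
theorem integral_sq_contraction_deg₂_le (hr0 : 0 ≤ r) (hr : r < 1 / 8)
    (hmean : kmean (law g) k = 0) {K : ℝ} (hK : ∀ x, |proj₁ (law g) k x| ≤ K) :
    ∫ x, ∫ y, (∫ z, deg₂ (law g) k x z * deg₂ (law g) k y z ∂(law g)) ^ 2 ∂(law g) ∂(law g)
      ≤ 4 * (4 * M * r) ^ 7 + 2 * (4 * (4 * M * r) ^ 2 * K + 4 * K ^ 2) ^ 2 := by
  have := hg.isProbabilityMeasure
  have hb := hk.bdd_deg₂ (ν := law g)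
  have hM := hg.one_le
  have hK0 : 0 ≤ K := (abs_nonneg _).trans (hK 0)
  set B := 4 * M * r with hB
  have hB0 : 0 ≤ B := by positivity
  have hn : ∀ x, ∫ y, near (2 * r) x y ∂(law g) ≤ B := fun x =>
    (hg.integral_near_le (by linarith) (by linarith) x).trans (le_of_eq (by ring))
  have h1 : ∀ x y, |∫ z, deg₂ (law g) k x z * deg₂ (law g) k y z ∂(law g)|
      ≤ B ^ 3 * near (4 * r) x y + (4 * B ^ 2 * K + 4 * K ^ 2) := by
    intro x y
    calc _ ≤ ∫ z, |deg₂ (law g) k x z * deg₂ (law g) k y z| ∂(law g) :=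
          abs_integral_le_integral_abs
      _ ≤ ∫ z, (B ^ 2 * near (4 * r) x y * near (2 * r) x z + 2 * B * K * near (2 * r) x z
            + 2 * B * K * near (2 * r) y z + 4 * K ^ 2) ∂(law g) :=
          BddMeas.integral_mono (by fun_prop) (by fun_prop) fun z => by
            rw [abs_mul]
            have a1 := hk.abs_deg₂_le hg hr0 hr hmean hK x z
            have a2 := hk.abs_deg₂_le hg hr0 hr hmean hK y z
            have a3 := near_mul_near_le (2 * r) (2 * r) x y z
            rw [near_comm _ y z, show 2 * r + 2 * r = 4 * r by ring] at a3
            have a4 : near (2 * r) x z * near (2 * r) y z ≤ near (4 * r) x y * near (2 * r) x z := by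
              rcases near_eq_zero_or_one (2 * r) x z with h | h <;> rw [h] at a3 ⊢ <;> linarith
            have := near_nonneg (2 * r) x z
            have := near_nonneg (2 * r) y z
            refine (mul_le_mul a1 a2 (abs_nonneg _) (by positivity)).trans ?_
            have := mul_le_mul_of_nonneg_left a4 (sq_nonneg B)
            rw [← hB]
            nlinarith
      _ = B ^ 2 * near (4 * r) x y * ∫ z, near (2 * r) x z ∂(law g)
            + 2 * B * K * ∫ z, near (2 * r) x z ∂(law g)
            + 2 * B * K * ∫ z, near (2 * r) y z ∂(law g) + 4 * K ^ 2 := by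
          rw [BddMeas.integral_add (by fun_prop) (by fun_prop),
            BddMeas.integral_add (by fun_prop) (by fun_prop),
            BddMeas.integral_add (by fun_prop) (by fun_prop), integral_const_mul,
            integral_const_mul, integral_const_mul]
          simp
      _ ≤ B ^ 2 * near (4 * r) x y * B + 2 * B * K * B + 2 * B * K * B + 4 * K ^ 2 := by
          have := near_nonneg (4 * r) x y
          gcongr <;> exact hn _
      _ = _ := by ring
  set L := 4 * B ^ 2 * K + 4 * K ^ 2
  have h2 : ∀ x y, (∫ z, deg₂ (law g) k x z * deg₂ (law g) k y z ∂(law g)) ^ 2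
      ≤ 2 * B ^ 6 * near (4 * r) x y + 2 * L ^ 2 := fun x y => by
    rw [← sq_abs]
    refine (pow_le_pow_left₀ (abs_nonneg _) (h1 x y) 2).trans ?_
    calc _ ≤ 2 * ((B ^ 3 * near (4 * r) x y) ^ 2 + L ^ 2) := add_sq_le
      _ = _ := by rw [mul_pow _ (near (4 * r) x y), near_sq]; ring
  have h3 : ∀ x, ∫ y, (∫ z, deg₂ (law g) k x z * deg₂ (law g) k y z ∂(law g)) ^ 2 ∂(law g)
      ≤ 4 * B ^ 7 + 2 * L ^ 2 := by
    intro x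
    calc _ ≤ ∫ y, (2 * B ^ 6 * near (4 * r) x y + 2 * L ^ 2) ∂(law g) :=
          BddMeas.integral_mono (by fun_prop) (by fun_prop) fun y => h2 x y
      _ = 2 * B ^ 6 * ∫ y, near (4 * r) x y ∂(law g) + 2 * L ^ 2 := by
          rw [BddMeas.integral_add (by fun_prop) (by fun_prop), integral_const_mul]
          simp
      _ ≤ 2 * B ^ 6 * (2 * M * (4 * r)) + 2 * L ^ 2 := by
          gcongr
          exact hg.integral_near_le (by linarith) (by linarith) x
      _ = _ := by rw [hB]; ring
  calc _ ≤ ∫ x, (4 * B ^ 7 + 2 * L ^ 2) ∂(law g) :=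
        BddMeas.integral_mono (by fun_prop) (by fun_prop) h3
    _ = _ := by simp

end LocalKernel

/-! ### The triangle and path kernels. -/

section Kernels

/-- The indicator of a triangle. -/
noncomputable def tri (r x y z : ℝ) : ℝ := near r x y * near r x z * near r y z

/-- A third of the number of paths of length two on three points. -/
noncomputable def path (r x y z : ℝ) : ℝ :=
  (near r x y * near r x z + near r x y * near r y z + near r x z * near r y z) / 3

/-- The centred kernel `tri - m * path`. -/
noncomputable def ker (m r x y z : ℝ) : ℝ := tri r x y z - m * path r x y z

theorem tri_nonneg (r x y z : ℝ) : 0 ≤ tri r x y z :=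
  mul_nonneg (mul_nonneg (near_nonneg _ _ _) (near_nonneg _ _ _)) (near_nonneg _ _ _)

theorem path_nonneg (r x y z : ℝ) : 0 ≤ path r x y z := by
  have h1 := near_nonneg r x y
  have h2 := near_nonneg r x z
  have h3 := near_nonneg r y z
  unfold path
  positivity

theorem tri_le_path (r x y z : ℝ) : tri r x y z ≤ path r x y z := by
  unfold tri path
  rcases near_eq_zero_or_one r x y with h | h <;> rcases near_eq_zero_or_one r x z with h' | h' <;>
    rcases near_eq_zero_or_one r y z with h'' | h'' <;> rw [h, h', h''] <;> norm_num

/-- Any two vertices of a path of length two are within 2 r by the triangle inequality; hence the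
doubled radius in `LocalKernel`. -/
theorem path_le {r : ℝ} (hr : 0 ≤ r) (x y z : ℝ) :
    path r x y z ≤ near (2 * r) x z * near (2 * r) y z := by
  have m : ∀ a b, near r a b ≤ near (2 * r) a b := near_mono (by linarith)
  have t : ∀ a b d, near r a d * near r d b ≤ near (2 * r) a b := fun a b d => by
    have := near_mul_near_le r r a b d
    rwa [← two_mul] at this
  have e1 : near r x y * near r x z ≤ near (2 * r) x z * near (2 * r) y z := by
    have h1 := t y z x
    rw [near_comm r x y] at h1
    have h2 := m x z
    rcases near_eq_zero_or_one r x z with h | h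
    · rw [h, mul_zero]
      exact mul_nonneg (near_nonneg _ _ _) (near_nonneg _ _ _)
    · rw [h] at h2
      rwa [le_antisymm (near_le_one _ _ _) h2, one_mul]
  have e2 : near r x y * near r y z ≤ near (2 * r) x z * near (2 * r) y z := by
    have h1 := t x z y
    have h2 := m y z
    rcases near_eq_zero_or_one r y z with h | h
    · rw [h, mul_zero]
      exact mul_nonneg (near_nonneg _ _ _) (near_nonneg _ _ _)
    · rw [h] at h2
      rwa [le_antisymm (near_le_one _ _ _) h2, mul_one]
  have e3 : near r x z * near r y z ≤ near (2 * r) x z * near (2 * r) y z :=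
    mul_le_mul (m _ _) (m _ _) (near_nonneg _ _ _) (near_nonneg _ _ _)
  unfold path
  linarith

theorem bddMeas_tri (r : ℝ) : BddMeas (fun p : ℝ × ℝ × ℝ => tri r p.1 p.2.1 p.2.2) := by
  unfold tri
  fun_prop

theorem bddMeas_path (r : ℝ) : BddMeas (fun p : ℝ × ℝ × ℝ => path r p.1 p.2.1 p.2.2) := by
  unfold path
  simp_rw [div_eq_mul_inv]
  fun_prop

theorem localKernel_tri {r : ℝ} (hr : 0 ≤ r) : LocalKernel r (tri r) where
  bdd := bddMeas_tri r
  swap₁₂ a b d := by simp only [tri, near_comm r a b]; ring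
  swap₂₃ a b d := by simp only [tri, near_comm r b d]; ring
  abs_le x y z := by
    rw [abs_of_nonneg (tri_nonneg _ _ _ _)]
    exact (tri_le_path _ _ _ _).trans (path_le hr _ _ _)

theorem localKernel_path {r : ℝ} (hr : 0 ≤ r) : LocalKernel r (path r) where
  bdd := bddMeas_path r
  swap₁₂ a b d := by simp only [path, near_comm r a b]; ring
  swap₂₃ a b d := by simp only [path, near_comm r b d]; ring
  abs_le x y z := by
    rw [abs_of_nonneg (path_nonneg _ _ _ _)]
    exact path_le hr _ _ _

theorem localKernel_ker {r m : ℝ} (hr : 0 ≤ r) (hm0 : 0 ≤ m) (hm1 : m ≤ 1) :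
    LocalKernel r (ker m r) where
  bdd := by
    have := bddMeas_tri r
    have := bddMeas_path r
    unfold ker
    fun_prop
  swap₁₂ a b d := by
    simp only [ker, (localKernel_tri hr).swap₁₂ a b, (localKernel_path hr).swap₁₂ a b]
  swap₂₃ a b d := by
    simp only [ker, (localKernel_tri hr).swap₂₃ a b, (localKernel_path hr).swap₂₃ a b]
  abs_le x y z := by
    refine le_trans ?_ (path_le hr x y z)
    have h1 := tri_nonneg r x y z
    have h2 := tri_le_path r x y z
    have h3 := path_nonneg r x y z
    unfold ker
    rw [abs_le]
    constructor <;> nlinarith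

theorem LocalKernel.sq {r : ℝ} {k : ℝ → ℝ → ℝ → ℝ} (hk : LocalKernel r k) :
    LocalKernel r (fun x y z => k x y z ^ 2) where
  bdd := by
    have := hk.bdd
    fun_prop
  swap₁₂ a b d := by simp only [hk.swap₁₂ a b]
  swap₂₃ a b d := by simp only [hk.swap₂₃ a b]
  abs_le x y z := by
    rw [abs_pow]
    refine (pow_le_pow_left₀ (abs_nonneg _) (hk.abs_le x y z) 2).trans (le_of_eq ?_)
    rw [mul_pow, near_sq, near_sq]

/-- The kernel takes three values: 0 with at most one edge, −m/3 with two edges (`path` = 1/3), and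
1 − m on a triangle (`tri` = `path` = 1). The two coefficients are fitted to the last two cases. -/
theorem ker_sq (m r x y z : ℝ) :
    ker m r x y z ^ 2 = (1 - 2 * m + 2 / 3 * m ^ 2) * tri r x y z + m ^ 2 / 3 * path r x y z := by
  unfold ker tri path
  rcases near_eq_zero_or_one r x y with h | h <;> rcases near_eq_zero_or_one r x z with h' | h' <;>
    rcases near_eq_zero_or_one r y z with h'' | h'' <;> rw [h, h', h''] <;> ring

end Kernels

/-! ### Polynomial integrals and planar integrals between two curves. -/

section Calculus

theorem integral_quadratic (a b c0 c1 c2 : ℝ) :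
    ∫ v in a..b, (c0 + c1 * v + c2 * v ^ 2)
      = c0 * (b - a) + c1 * ((b ^ 2 - a ^ 2) / 2) + c2 * ((b ^ 3 - a ^ 3) / 3) := by
  rw [intervalIntegral.integral_add
      (Continuous.intervalIntegrable (by fun_prop) _ _)
      (Continuous.intervalIntegrable (by fun_prop) _ _),
    intervalIntegral.integral_add
      (Continuous.intervalIntegrable (by fun_prop) _ _)
      (Continuous.intervalIntegrable (by fun_prop) _ _),
    intervalIntegral.integral_const_mul, intervalIntegral.integral_const_mul, integral_pow,
    integral_id]
  simp
  ring

theorem integral_cubic (a b c0 c1 c2 c3 : ℝ) :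
    ∫ v in a..b, (c0 + c1 * v + c2 * v ^ 2 + c3 * v ^ 3)
      = c0 * (b - a) + c1 * ((b ^ 2 - a ^ 2) / 2) + c2 * ((b ^ 3 - a ^ 3) / 3)
        + c3 * ((b ^ 4 - a ^ 4) / 4) := by
  rw [intervalIntegral.integral_add
      (Continuous.intervalIntegrable (by fun_prop) _ _)
      (Continuous.intervalIntegrable (by fun_prop) _ _), integral_quadratic,
    intervalIntegral.integral_const_mul, integral_pow]
  norm_num

theorem continuous_integral_between {F : ℝ → ℝ → ℝ} (hF : Continuous (Function.uncurry F))
    {lo hi : ℝ → ℝ} (hlo : Continuous lo) (hhi : Continuous hi) :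
    Continuous fun u => ∫ v in lo u..hi u, F u v := by
  have e : ∀ u, ∫ v in lo u..hi u, F u v = (∫ v in (0 : ℝ)..hi u, F u v) - ∫ v in (0 : ℝ)..lo u, F u v :=
    fun u => by
      have hc : Continuous (F u) := hF.comp (by fun_prop : Continuous fun v : ℝ => (u, v))
      rw [intervalIntegral.integral_interval_sub_left (hc.intervalIntegrable _ _)
        (hc.intervalIntegrable _ _)]
  simp_rw [e]
  exact (intervalIntegral.continuous_parametric_intervalIntegral_of_continuous hF hhi).sub
    (intervalIntegral.continuous_parametric_intervalIntegral_of_continuous hF hlo)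

theorem abs_integral_between_sub_le {F Q : ℝ → ℝ → ℝ} (hF : Continuous (Function.uncurry F))
    (hQ : Continuous (Function.uncurry Q)) {lo hi : ℝ → ℝ} (hlo : Continuous lo)
    (hhi : Continuous hi) {a b E L : ℝ} (hab : a ≤ b) (hE0 : 0 ≤ E)
    (hle : ∀ u ∈ Set.Icc a b, lo u ≤ hi u) (hL : ∀ u ∈ Set.Icc a b, hi u - lo u ≤ L)
    (hE : ∀ u ∈ Set.Icc a b, ∀ v ∈ Set.Icc (lo u) (hi u), |F u v - Q u v| ≤ E) :
    |(∫ u in a..b, ∫ v in lo u..hi u, F u v) - ∫ u in a..b, ∫ v in lo u..hi u, Q u v|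
      ≤ E * L * (b - a) := by
  rw [← intervalIntegral.integral_sub
    ((continuous_integral_between hF hlo hhi).intervalIntegrable _ _)
    ((continuous_integral_between hQ hlo hhi).intervalIntegrable _ _)]
  have h1 : ∀ u ∈ Set.uIoc a b, ‖(∫ v in lo u..hi u, F u v) - ∫ v in lo u..hi u, Q u v‖ ≤ E * L := by
    intro u hu
    rw [Set.uIoc_of_le hab] at hu
    have hu' : u ∈ Set.Icc a b := ⟨hu.1.le, hu.2⟩
    have hcF : Continuous (F u) := hF.comp (by fun_prop : Continuous fun v : ℝ => (u, v))
    have hcQ : Continuous (Q u) := hQ.comp (by fun_prop : Continuous fun v : ℝ => (u, v))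
    rw [← intervalIntegral.integral_sub (hcF.intervalIntegrable _ _) (hcQ.intervalIntegrable _ _)]
    have h2 := intervalIntegral.norm_integral_le_of_norm_le_const (a := lo u) (b := hi u)
      (f := fun v => F u v - Q u v) (C := E) fun v hv => by
        rw [Set.uIoc_of_le (hle u hu')] at hv
        exact hE u hu' v ⟨hv.1.le, hv.2⟩
    refine h2.trans ?_
    rw [abs_of_nonneg (by linarith [hle u hu'])]
    exact mul_le_mul_of_nonneg_left (hL u hu') hE0
  have h3 := intervalIntegral.norm_integral_le_of_norm_le_const h1
  rwa [Real.norm_eq_abs, abs_of_nonneg (by linarith : 0 ≤ b - a)] at h3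

end Calculus

/-! ### Expansion of the one-point projections to order r⁴. -/

namespace SmoothDensity

variable {g g1 g2 : ℝ → ℝ} {c M : ℝ} (hg : SmoothDensity g g1 g2 c M)
include hg

/-- The product of two Taylor polynomials, cut at total degree two and arranged by powers of v so
that the inner integral is an `integral_quadratic`. The errors add up to 1 + 5/2 + 1/2 + 1/2 + 1/4 ≤
5. -/
theorem abs_mul_sub_le {s : ℝ} (hs : s ≤ 1) (x : ℝ) {u v : ℝ} (hu : |u| ≤ s) (hv : |v| ≤ s) :
    |g (x + u) * g (x + v) - ((g x ^ 2 + g x * g1 x * u + g x * g2 x / 2 * u ^ 2)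
      + (g x * g1 x + g1 x ^ 2 * u) * v + g x * g2 x / 2 * v ^ 2)| ≤ 5 * M ^ 2 * s ^ 3 := by
  have hs0 : 0 ≤ s := (abs_nonneg _).trans hu
  have hM := hg.one_le
  have hM0 : 0 ≤ M := by linarith
  set A := g x + u * g1 x + u ^ 2 / 2 * g2 x with hA
  set B := g x + v * g1 x + v ^ 2 / 2 * g2 x with hB
  have t : ∀ w, |w| ≤ s → |g (x + w) - (g x + w * g1 x + w ^ 2 / 2 * g2 x)| ≤ M * s ^ 3 :=
    fun w hw => by
      have h := hg.taylor x w
      rw [show g (x + w) - g x - w * g1 x - w ^ 2 / 2 * g2 x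
        = g (x + w) - (g x + w * g1 x + w ^ 2 / 2 * g2 x) by ring] at h
      refine h.trans ?_
      gcongr
  have h1 := t u hu
  have h2 := t v hv
  rw [← hA] at h1
  rw [← hB] at h2
  have hu2 : |u ^ 2| ≤ s ^ 2 := by rw [abs_pow]; gcongr
  have hv2 : |v ^ 2| ≤ s ^ 2 := by rw [abs_pow]; gcongr
  have hA' : |A| ≤ 5 / 2 * M := by
    have a1 : |u * g1 x| ≤ 1 * M := by
      rw [abs_mul]
      exact mul_le_mul (hu.trans hs) (hg.bdd1 x) (abs_nonneg _) (by norm_num)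
    have a2 : |u ^ 2 / 2 * g2 x| ≤ 1 / 2 * M := by
      rw [abs_mul, abs_div, abs_two]
      refine mul_le_mul ?_ (hg.bdd2 x) (abs_nonneg _) (by norm_num)
      have : s ^ 2 ≤ 1 := pow_le_one₀ hs0 hs
      linarith
    have := abs_add_three (g x) (u * g1 x) (u ^ 2 / 2 * g2 x)
    rw [hA]
    linarith [hg.bdd x]
  have e : g (x + u) * g (x + v) - ((g x ^ 2 + g x * g1 x * u + g x * g2 x / 2 * u ^ 2)
      + (g x * g1 x + g1 x ^ 2 * u) * v + g x * g2 x / 2 * v ^ 2)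
      = (g (x + u) - A) * g (x + v) + A * (g (x + v) - B)
        + (u * v ^ 2 / 2 * (g1 x * g2 x) + u ^ 2 * v / 2 * (g1 x * g2 x)
          + u ^ 2 * v ^ 2 / 4 * (g2 x * g2 x)) := by
    rw [hA, hB]
    ring
  have m12 : |g1 x * g2 x| ≤ M ^ 2 := by
    rw [abs_mul, sq]
    exact mul_le_mul (hg.bdd1 x) (hg.bdd2 x) (abs_nonneg _) hM0
  have m22 : |g2 x * g2 x| ≤ M ^ 2 := by
    rw [abs_mul, sq]
    exact mul_le_mul (hg.bdd2 x) (hg.bdd2 x) (abs_nonneg _) hM0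
  have b1 : |(g (x + u) - A) * g (x + v)| ≤ M * s ^ 3 * M := by
    rw [abs_mul]
    exact mul_le_mul h1 (hg.bdd _) (abs_nonneg _) (by positivity)
  have b2 : |A * (g (x + v) - B)| ≤ 5 / 2 * M * (M * s ^ 3) := by
    rw [abs_mul]
    exact mul_le_mul hA' h2 (abs_nonneg _) (by positivity)
  have b3 : |u * v ^ 2 / 2 * (g1 x * g2 x)| ≤ s ^ 3 / 2 * M ^ 2 := by
    rw [abs_mul, abs_div, abs_mul, abs_two]
    refine mul_le_mul ?_ m12 (abs_nonneg _) (by positivity)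
    have := mul_le_mul hu hv2 (abs_nonneg _) hs0
    nlinarith
  have b4 : |u ^ 2 * v / 2 * (g1 x * g2 x)| ≤ s ^ 3 / 2 * M ^ 2 := by
    rw [abs_mul, abs_div, abs_mul, abs_two]
    refine mul_le_mul ?_ m12 (abs_nonneg _) (by positivity)
    have := mul_le_mul hu2 hv (abs_nonneg _) (by positivity)
    nlinarith
  have b5 : |u ^ 2 * v ^ 2 / 4 * (g2 x * g2 x)| ≤ s ^ 3 / 4 * M ^ 2 := by
    rw [abs_mul, abs_div, abs_mul, abs_of_pos (by norm_num : (0 : ℝ) < 4)]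
    refine mul_le_mul ?_ m22 (abs_nonneg _) (by positivity)
    have := mul_le_mul hu2 hv2 (abs_nonneg _) (by positivity)
    have h3 : s ^ 3 * s ≤ s ^ 3 * 1 := by gcongr
    nlinarith
  rw [e]
  have a1 := abs_add_three ((g (x + u) - A) * g (x + v)) (A * (g (x + v) - B))
    (u * v ^ 2 / 2 * (g1 x * g2 x) + u ^ 2 * v / 2 * (g1 x * g2 x)
          + u ^ 2 * v ^ 2 / 4 * (g2 x * g2 x))
  have a2 := abs_add_three (u * v ^ 2 / 2 * (g1 x * g2 x)) (u ^ 2 * v / 2 * (g1 x * g2 x))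
    (u ^ 2 * v ^ 2 / 4 * (g2 x * g2 x))
  have : 0 ≤ M ^ 2 * s ^ 3 := by positivity
  linarith

/-- 320 is the product of 5 · 2³ (pointwise error at scale 2 r), 4 (inner length over r) and 2
(outer length over r). -/
theorem abs_integral_between_mul_sub_le {r : ℝ} (hr0 : 0 ≤ r) (hr : r ≤ 1 / 2) (x : ℝ)
    {lo hi : ℝ → ℝ} (hlo : Continuous lo) (hhi : Continuous hi)
    (hle : ∀ u ∈ Set.Icc (-r) r, -(2 * r) ≤ lo u ∧ lo u ≤ hi u ∧ hi u ≤ 2 * r) :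
    |(∫ u in -r..r, ∫ v in lo u..hi u, g (x + u) * g (x + v))
      - ∫ u in -r..r, ∫ v in lo u..hi u, ((g x ^ 2 + g x * g1 x * u + g x * g2 x / 2 * u ^ 2)
        + (g x * g1 x + g1 x ^ 2 * u) * v + g x * g2 x / 2 * v ^ 2)| ≤ 320 * M ^ 2 * r ^ 5 := by
  have hc := hg.continuous
  refine (abs_integral_between_sub_le (F := fun u v => g (x + u) * g (x + v))
    (Q := fun u v => (g x ^ 2 + g x * g1 x * u + g x * g2 x / 2 * u ^ 2)
        + (g x * g1 x + g1 x ^ 2 * u) * v + g x * g2 x / 2 * v ^ 2) (E := 5 * M ^ 2 * (2 * r) ^ 3)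
    (L := 4 * r) (by unfold Function.uncurry; fun_prop) (by unfold Function.uncurry; fun_prop)
    hlo hhi (by linarith) (by positivity) (fun u hu => (hle u hu).2.1)
    (fun u hu => by linarith [(hle u hu).1, (hle u hu).2.2]) fun u hu v hv => ?_).trans
      (le_of_eq (by ring))
  refine hg.abs_mul_sub_le (by linarith) x (abs_le.2 ⟨by linarith [hu.1], by linarith [hu.2]⟩)
    (abs_le.2 ⟨by linarith [hv.1, (hle u hu).1], by linarith [hv.2, (hle u hu).2.2]⟩)

omit hg in
theorem integral_ite_eq {r u : ℝ} (hu : u ∈ Set.Icc (-r) r) (φ : ℝ → ℝ) :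
    ∫ v in -r..r, (if |u - v| ≤ r then 1 else 0) * φ v
      = ∫ v in max (-r) (u - r)..min r (u + r), φ v := by
  have hr0 : -r ≤ r := hu.1.trans hu.2
  have h1 : max (-r) (u - r) ≤ min r (u + r) := by
    rw [max_le_iff, le_min_iff, le_min_iff]
    obtain ⟨h1, h2⟩ := hu
    refine ⟨⟨?_, ?_⟩, ?_, ?_⟩ <;> linarith
  rw [intervalIntegral.integral_of_le hr0, intervalIntegral.integral_of_le h1,
    ← integral_Icc_eq_integral_Ioc, ← integral_Icc_eq_integral_Ioc]
  have h2 : Set.Icc (max (-r) (u - r)) (min r (u + r)) = Set.Icc (-r) r ∩ Set.Icc (u - r) (u + r) := by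
    rw [Set.Icc_inter_Icc]
  rw [h2, ← setIntegral_indicator measurableSet_Icc]
  refine setIntegral_congr_fun measurableSet_Icc fun v _ => ?_
  by_cases h : |u - v| ≤ r
  · have h' := abs_le.1 h
    rw [Set.indicator_of_mem (s := Set.Icc (u - r) (u + r)) ⟨by linarith, by linarith⟩]
    simp [h]
  · rw [Set.indicator_of_notMem (s := Set.Icc (u - r) (u + r))
      (fun h' => h (abs_le.2 ⟨by linarith [h'.2], by linarith [h'.1]⟩))]
    simp [h]

/-- r < 1/4 keeps |u − v| below 1/2, so the third side of the triangle is measured without wrapping.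
-/
theorem proj₁_tri_eq {r : ℝ} (hr0 : 0 ≤ r) (hr : r < 1 / 4) (x : ℝ) :
    proj₁ (law g) (tri r) x
      = ∫ u in -r..r, ∫ v in max (-r) (u - r)..min r (u + r), g (x + u) * g (x + v) := by
  have e1 : ∀ y, proj₂ (law g) (tri r) x y
      = near r x y * ∫ z, near r x z * near r y z ∂(law g) := fun y => by
    unfold proj₂ tri
    rw [← integral_const_mul]
    congr 1
    ext z
    ring
  unfold proj₁
  simp_rw [e1]
  rw [hg.integral_near_mul hr0 (by linarith) (fun y => by simp only [near_add_one_left])]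
  refine intervalIntegral.integral_congr fun u hu => ?_
  rw [Set.uIcc_of_le (by linarith)] at hu
  rw [hg.integral_near_mul hr0 (by linarith) (fun y => by rw [near_add_one_right]),
    intervalIntegral.integral_const_mul, ← integral_ite_eq hu, mul_comm]
  congr 1
  refine intervalIntegral.integral_congr fun v hv => ?_
  rw [Set.uIcc_of_le (by linarith)] at hv
  rw [near_add_eq (abs_lt.2 ⟨by linarith [hu.1, hv.2], by linarith [hu.2, hv.1]⟩)]

/-- The mean degree at `x`. -/
noncomputable def _root_.RGG.degree (g : ℝ → ℝ) (r x : ℝ) : ℝ := ∫ y, near r x y ∂(law g)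

theorem degree_eq {r : ℝ} (hr0 : 0 ≤ r) (hr : r < 1 / 2) (x : ℝ) :
    degree g r x = ∫ u in -r..r, g (x + u) := by
  have := hg.integral_near_mul hr0 hr (φ := fun _ => 1) (fun _ => rfl) x
  simpa [degree] using this

/-- Paths centred at x range over a square. Paths centred at either other vertex give the
parallelogram |u|, |v − u| ≤ r, the same integral twice after exchanging the order of integration.
-/
theorem proj₁_path_eq {r : ℝ} (hr0 : 0 ≤ r) (hr : r < 1 / 4) (x : ℝ) :
    proj₁ (law g) (path r) x
      = ((∫ u in -r..r, ∫ v in -r..r, g (x + u) * g (x + v))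
        + 2 * ∫ u in -r..r, ∫ v in (u - r)..(u + r), g (x + u) * g (x + v)) / 3 := by
  have := hg.isProbabilityMeasure
  have hd : ∀ y, ∫ z, near r y z ∂(law g) = degree g r y := fun y => rfl
  have hdb : BddMeas (degree g r) := by
    unfold degree
    fun_prop
  have hE : ∀ y, proj₂ (law g) (path r) x y
      = (near r x y * degree g r x + near r x y * degree g r y
        + ∫ z, near r x z * near r y z ∂(law g)) / 3 := fun y => by
    unfold proj₂ path
    rw [integral_div, BddMeas.integral_add (by fun_prop) (by fun_prop),
      BddMeas.integral_add (by fun_prop) (by fun_prop), integral_const_mul, integral_const_mul,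
      hd, hd]
  have hA : ∫ y, near r x y * degree g r x ∂(law g)
      = ∫ u in -r..r, ∫ v in -r..r, g (x + u) * g (x + v) := by
    simp_rw [intervalIntegral.integral_const_mul]
    rw [integral_mul_const, hd, ← hg.degree_eq hr0 (by linarith), intervalIntegral.integral_mul_const,
      ← hg.degree_eq hr0 (by linarith)]
  have hB : ∫ y, near r x y * degree g r y ∂(law g)
      = ∫ u in -r..r, ∫ v in (u - r)..(u + r), g (x + u) * g (x + v) := by
    rw [hg.integral_near_mul hr0 (by linarith) (fun y => by simp only [degree, near_add_one_left])]
    refine intervalIntegral.integral_congr fun u _ => ?_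
    rw [hg.degree_eq hr0 (by linarith), intervalIntegral.integral_const_mul, mul_comm]
    congr 1
    have := intervalIntegral.integral_comp_add_left (a := -r) (b := r) (fun v => g (x + v)) u
    simp only [← add_assoc] at this
    rw [this]
    congr 1
  have hC : ∫ y, ∫ z, near r x z * near r y z ∂(law g) ∂(law g)
      = ∫ y, near r x y * degree g r y ∂(law g) := by
    rw [BddMeas.integral_comm (by fun_prop)]
    congr 1
    ext z
    rw [integral_const_mul]
    simp only [degree, near_comm r z]
  unfold proj₁
  simp_rw [hE]
  rw [integral_div, BddMeas.integral_add (by fun_prop) (by fun_prop),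
    BddMeas.integral_add (by fun_prop) (by fun_prop), hC, hA, hB]
  ring

/-- The hexagon has area 3 r², ∫ u² = ∫ v² = 5 r⁴/6, ∫ u v = 5 r⁴/12, and its first moments vanish
by symmetry. It is cut at u = 0, where the active bounds on v change. -/
theorem abs_proj₁_tri_sub_le {r : ℝ} (hr0 : 0 ≤ r) (hr : r < 1 / 4) (x : ℝ) :
    |proj₁ (law g) (tri r) x - (3 * r ^ 2 * g x ^ 2
      + r ^ 4 * (5 / 6 * (g x * g2 x) + 5 / 12 * g1 x ^ 2))| ≤ 320 * M ^ 2 * r ^ 5 := by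
  rw [hg.proj₁_tri_eq hr0 hr]
  have h := hg.abs_integral_between_mul_sub_le hr0 (by linarith) x
    (lo := fun u => max (-r) (u - r)) (hi := fun u => min r (u + r)) (by fun_prop) (by fun_prop)
    fun u hu => by
      obtain ⟨h1, h2⟩ := hu
      refine ⟨?_, ?_, ?_⟩
      · exact le_max_of_le_left (by linarith)
      · rw [max_le_iff, le_min_iff, le_min_iff]
        refine ⟨⟨?_, ?_⟩, ?_, ?_⟩ <;> linarith
      · exact min_le_of_left_le (by linarith)
  have hcont : Continuous fun u => ∫ v in max (-r) (u - r)..min r (u + r),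
      ((g x ^ 2 + g x * g1 x * u + g x * g2 x / 2 * u ^ 2)
        + (g x * g1 x + g1 x ^ 2 * u) * v + g x * g2 x / 2 * v ^ 2) :=
    continuous_integral_between (F := fun u v =>
      ((g x ^ 2 + g x * g1 x * u + g x * g2 x / 2 * u ^ 2)
        + (g x * g1 x + g1 x ^ 2 * u) * v + g x * g2 x / 2 * v ^ 2))
      (by unfold Function.uncurry; fun_prop) (by fun_prop) (by fun_prop)
  have hQ : ∫ u in -r..r, ∫ v in max (-r) (u - r)..min r (u + r),
      ((g x ^ 2 + g x * g1 x * u + g x * g2 x / 2 * u ^ 2)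
        + (g x * g1 x + g1 x ^ 2 * u) * v + g x * g2 x / 2 * v ^ 2)
      = 3 * r ^ 2 * g x ^ 2 + r ^ 4 * (5 / 6 * (g x * g2 x) + 5 / 12 * g1 x ^ 2) := by
    rw [← intervalIntegral.integral_add_adjacent_intervals (b := 0)
      (hcont.intervalIntegrable _ _) (hcont.intervalIntegrable _ _)]
    set α := g x ^ 2
    set β := g x * g1 x
    set γ := g x * g2 x / 2 with hγ
    set δ := g1 x ^ 2
    have hlow : ∫ u in -r..0, ∫ v in max (-r) (u - r)..min r (u + r),
        ((α + β * u + γ * u ^ 2) + (β + δ * u) * v + γ * v ^ 2)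
        = ∫ u in -r..0, ((2 * r * α + 2 * γ * r ^ 3 / 3) + (3 * r * β + α + γ * r ^ 2) * u
          + (3 * r * γ + 3 / 2 * β + δ * r) * u ^ 2 + (4 / 3 * γ + δ / 2) * u ^ 3) := by
      refine intervalIntegral.integral_congr fun u hu => ?_
      rw [Set.uIcc_of_le (by linarith)] at hu
      rw [integral_quadratic, max_eq_left (by linarith [hu.2]), min_eq_right (by linarith [hu.2])]
      ring
    have hhigh : ∫ u in (0 : ℝ)..r, ∫ v in max (-r) (u - r)..min r (u + r),
        ((α + β * u + γ * u ^ 2) + (β + δ * u) * v + γ * v ^ 2)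
        = ∫ u in (0 : ℝ)..r, ((2 * r * α + 2 * γ * r ^ 3 / 3) + (3 * r * β - α - γ * r ^ 2) * u
          + (3 * r * γ - 3 / 2 * β + δ * r) * u ^ 2 + (-(4 / 3 * γ) - δ / 2) * u ^ 3) := by
      refine intervalIntegral.integral_congr fun u hu => ?_
      rw [Set.uIcc_of_le (by linarith)] at hu
      rw [integral_quadratic, max_eq_right (by linarith [hu.1]), min_eq_left (by linarith [hu.1])]
      ring
    rw [hlow, hhigh, integral_cubic, integral_cubic]
    have : g x * g2 x = 2 * γ := by rw [hγ]; ring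
    rw [this]
    ring
  rwa [hQ] at h

/-- Square and parallelogram both have area 4 r². The square has ∫ u² = ∫ v² = 4 r⁴/3 and ∫ u v = 0;
the parallelogram has ∫ u² = ∫ u v = 4 r⁴/3 and ∫ v² = 8 r⁴/3. They are averaged with weights 1/3
and 2/3. -/
theorem abs_proj₁_path_sub_le {r : ℝ} (hr0 : 0 ≤ r) (hr : r < 1 / 4) (x : ℝ) :
    |proj₁ (law g) (path r) x - (4 * r ^ 2 * g x ^ 2
      + r ^ 4 * (16 / 9 * (g x * g2 x) + 8 / 9 * g1 x ^ 2))| ≤ 320 * M ^ 2 * r ^ 5 := by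
  rw [hg.proj₁_path_eq hr0 hr]
  have h1 := hg.abs_integral_between_mul_sub_le hr0 (by linarith) x
    (lo := fun _ => -r) (hi := fun _ => r) (by fun_prop) (by fun_prop)
    fun u hu => ⟨by linarith, by linarith, by linarith⟩
  have h2 := hg.abs_integral_between_mul_sub_le hr0 (by linarith) x
    (lo := fun u => u - r) (hi := fun u => u + r) (by fun_prop) (by fun_prop)
    fun u hu => ⟨by linarith [hu.1], by linarith, by linarith [hu.2]⟩
  set α := g x ^ 2
  set β := g x * g1 x
  set γ := g x * g2 x / 2 with hγ
  set δ := g1 x ^ 2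
  have e1 : ∫ u in -r..r, ∫ v in -r..r, ((α + β * u + γ * u ^ 2) + (β + δ * u) * v + γ * v ^ 2)
      = 4 * r ^ 2 * α + 8 / 3 * γ * r ^ 4 := by
    simp_rw [integral_quadratic]
    have : ∀ u : ℝ, (α + β * u + γ * u ^ 2) * (r - -r) + (β + δ * u) * ((r ^ 2 - (-r) ^ 2) / 2)
        + γ * ((r ^ 3 - (-r) ^ 3) / 3)
        = (2 * r * α + 2 / 3 * γ * r ^ 3) + 2 * r * β * u + 2 * r * γ * u ^ 2 := fun u => by ring
    simp_rw [this]
    rw [integral_quadratic]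
    ring
  have e2 : ∫ u in -r..r, ∫ v in (u - r)..(u + r),
      ((α + β * u + γ * u ^ 2) + (β + δ * u) * v + γ * v ^ 2)
      = 4 * r ^ 2 * α + 4 * γ * r ^ 4 + 4 / 3 * δ * r ^ 4 := by
    simp_rw [integral_quadratic]
    have : ∀ u : ℝ, (α + β * u + γ * u ^ 2) * (u + r - (u - r))
        + (β + δ * u) * (((u + r) ^ 2 - (u - r) ^ 2) / 2) + γ * (((u + r) ^ 3 - (u - r) ^ 3) / 3)
        = (2 * r * α + 2 / 3 * γ * r ^ 3) + 4 * r * β * u + (4 * r * γ + 2 * r * δ) * u ^ 2 :=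
      fun u => by ring
    simp_rw [this]
    rw [integral_quadratic]
    ring
  rw [e1] at h1
  rw [e2] at h2
  have : g x * g2 x = 2 * γ := by rw [hγ]; ring
  rw [this]
  rw [abs_le] at h1 h2 ⊢
  constructor <;> linarith [h1.1, h1.2, h2.1, h2.2]

end SmoothDensity

/-! ### The ratio μ and the centred kernel. -/

/-- The ratio of the probability of a triangle to that of a path of length two. -/
noncomputable def triRatio (g : ℝ → ℝ) (r : ℝ) : ℝ :=
  kmean (law g) (tri r) / kmean (law g) (path r)

/-- The centred clustering kernel. -/
noncomputable def centKer (g : ℝ → ℝ) (r : ℝ) : ℝ → ℝ → ℝ → ℝ := ker (triRatio g r) r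

namespace SmoothDensity

variable {g g1 g2 : ℝ → ℝ} {c M : ℝ} (hg : SmoothDensity g g1 g2 c M)
include hg

omit hg in
theorem Ef2_eq : Ef2 g = ∫ x, g x ^ 2 ∂(law g) := by
  unfold Ef2
  refine integral_congr_ae ?_
  filter_upwards [ae_mem_Icc (g := g)] with x hx
  rw [density, Set.indicator_of_mem hx]

theorem deriv_eq : _root_.deriv g = g1 := funext fun x => (hg.deriv x).deriv

theorem iteratedDeriv_two_eq : iteratedDeriv 2 g = g2 := by
  rw [iteratedDeriv_succ, iteratedDeriv_one, hg.deriv_eq]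
  exact funext fun x => (hg.deriv1 x).deriv

theorem cf_eq : cf g = (∫ x, g1 x ^ 2 ∂(law g)) / Ef2 g := by
  rw [cf, hg.deriv_eq]

theorem sigma1Sq_eq : sigma1Sq g
    = ∫ x, (-3 * cf g * g x ^ 2 - 2 * g x * g2 x - g1 x ^ 2) ^ 2 ∂(law g) := by
  unfold sigma1Sq
  refine integral_congr_ae ?_
  filter_upwards [ae_mem_Icc (g := g)] with x hx
  rw [density, Set.indicator_of_mem hx, hg.deriv_eq, hg.iteratedDeriv_two_eq]

theorem sq_le_Ef2 : c ^ 2 ≤ Ef2 g := by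
  have := hg.isProbabilityMeasure
  have hb := hg.bddMeas
  rw [Ef2_eq]
  calc c ^ 2 = ∫ _, c ^ 2 ∂(law g) := by simp
    _ ≤ _ := BddMeas.integral_mono (by fun_prop) (by fun_prop) fun x =>
        pow_le_pow_left₀ hg.pos.le (hg.le x) 2

theorem Ef2_pos : 0 < Ef2 g := (pow_pos hg.pos 2).trans_le hg.sq_le_Ef2

theorem Ef2_le : Ef2 g ≤ M ^ 2 := by
  have := hg.isProbabilityMeasure
  have hb := hg.bddMeas
  rw [Ef2_eq]
  calc _ ≤ ∫ _, M ^ 2 ∂(law g) := BddMeas.integral_mono (by fun_prop) (by fun_prop) fun x => by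
        rw [← sq_abs]
        exact pow_le_pow_left₀ (abs_nonneg _) (hg.bdd x) 2
    _ = _ := by simp

/-- The derivative of g² g' integrates to zero over a period. This is what reduces E[f f''] to
E[(f')²] and makes c_f appear. -/
theorem integral_mul_second_deriv :
    ∫ x, g x * g2 x ∂(law g) = -2 * ∫ x, g1 x ^ 2 ∂(law g) := by
  have hc := hg.continuous
  have hc1 := hg.continuous1
  have hc2 := hg.cont2
  rw [hg.integral_law, hg.integral_law]
  have h := intervalIntegral.integral_eq_sub_of_hasDerivAt (a := 0) (b := 1)
    (f := fun x => g x ^ 2 * g1 x) (f' := fun x => 2 * (g1 x ^ 2 * g x) + g x * g2 x * g x)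
    (fun x _ => by
      have := ((hg.deriv x).pow 2).mul (hg.deriv1 x)
      convert! this using 1
      simp
      ring) (Continuous.intervalIntegrable (by fun_prop) _ _)
  rw [intervalIntegral.integral_add (Continuous.intervalIntegrable (by fun_prop) _ _)
    (Continuous.intervalIntegrable (by fun_prop) _ _), intervalIntegral.integral_const_mul] at h
  have e0 := hg.per 0
  have e1 := hg.per1 0
  rw [zero_add] at e0 e1
  rw [e0, e1, sub_self] at h
  linarith

theorem abs_sub_le_of_abs_le {x u : ℝ} (hu : |u| ≤ 1) : |g (x + u) - g x| ≤ 3 * M * |u| := by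
  have h := hg.taylor x u
  have hM := hg.one_le
  have h1 : |u * g1 x| ≤ |u| * M := by
    rw [abs_mul]
    exact mul_le_mul_of_nonneg_left (hg.bdd1 x) (abs_nonneg _)
  have h2 : |u ^ 2 / 2 * g2 x| ≤ |u| * M := by
    rw [abs_mul]
    refine mul_le_mul ?_ (hg.bdd2 x) (abs_nonneg _) (abs_nonneg _)
    rw [abs_div, abs_pow, abs_two]
    nlinarith [abs_nonneg u]
  have h3 : M * |u| ^ 3 ≤ M * |u| := by
    have : |u| ^ 3 ≤ |u| := by
      calc |u| ^ 3 = |u| * |u| ^ 2 := by ring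
        _ ≤ |u| * 1 := by gcongr; exact pow_le_one₀ (abs_nonneg _) hu
        _ = |u| := mul_one _
    gcongr
  have e : g (x + u) - g x = (g (x + u) - g x - u * g1 x - u ^ 2 / 2 * g2 x) + u * g1 x
    + u ^ 2 / 2 * g2 x := by ring
  rw [e]
  refine (abs_add_three _ _ _).trans ?_
  linarith

theorem abs_degree_sub_le {r : ℝ} (hr0 : 0 ≤ r) (hr : r < 1 / 2) (x : ℝ) :
    |degree g r x - 2 * r * g x| ≤ 6 * M * r ^ 2 := by
  have hc := hg.continuous
  have hM := hg.one_le
  rw [hg.degree_eq hr0 hr]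
  have e : (∫ u in -r..r, g (x + u)) - 2 * r * g x = ∫ u in -r..r, (g (x + u) - g x) := by
    rw [intervalIntegral.integral_sub (Continuous.intervalIntegrable (by fun_prop) _ _)
      (Continuous.intervalIntegrable (by fun_prop) _ _)]
    simp only [intervalIntegral.integral_const, smul_eq_mul]
    ring
  rw [e]
  have h := intervalIntegral.norm_integral_le_of_norm_le_const (a := -r) (b := r)
    (f := fun u => g (x + u) - g x) (C := 3 * M * r) fun u hu => by
      rw [Set.uIoc_of_le (by linarith)] at hu
      have hu' : |u| ≤ r := abs_le.2 ⟨hu.1.le, hu.2⟩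
      exact (hg.abs_sub_le_of_abs_le (by linarith)).trans (by gcongr)
  rw [Real.norm_eq_abs, show r - -r = 2 * r by ring, abs_of_nonneg (by positivity : 0 ≤ 2 * r)] at h
  linarith

omit hg in
theorem kmean_tri_nonneg (r : ℝ) : 0 ≤ kmean (law g) (tri r) :=
  integral_nonneg fun _ => integral_nonneg fun _ => integral_nonneg fun _ => tri_nonneg _ _ _ _

theorem kmean_tri_le {r : ℝ} : kmean (law g) (tri r) ≤ kmean (law g) (path r) := by
  have := hg.isProbabilityMeasure
  have h1 := bddMeas_tri r
  have h2 := bddMeas_path r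
  unfold kmean proj₁ proj₂
  exact BddMeas.integral_mono (by fun_prop) (by fun_prop) fun x =>
    BddMeas.integral_mono (by fun_prop) (by fun_prop) fun y =>
      BddMeas.integral_mono (by fun_prop) (by fun_prop) fun z => tri_le_path r x y z

theorem triRatio_nonneg (r : ℝ) : 0 ≤ triRatio g r :=
  div_nonneg (kmean_tri_nonneg r) ((kmean_tri_nonneg r).trans hg.kmean_tri_le)

theorem triRatio_le_one (r : ℝ) : triRatio g r ≤ 1 :=
  div_le_one_of_le₀ hg.kmean_tri_le ((kmean_tri_nonneg r).trans hg.kmean_tri_le)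

theorem localKernel_centKer {r : ℝ} (hr : 0 ≤ r) : LocalKernel r (centKer g r) :=
  localKernel_ker hr (hg.triRatio_nonneg r) (hg.triRatio_le_one r)

theorem proj₁_ker (m r x : ℝ) : proj₁ (law g) (ker m r) x
    = proj₁ (law g) (tri r) x - m * proj₁ (law g) (path r) x := by
  have := hg.isProbabilityMeasure
  have h1 := bddMeas_tri r
  have h2 := bddMeas_path r
  unfold proj₁ proj₂ ker
  rw [← integral_const_mul, ← BddMeas.integral_sub (by fun_prop) (by fun_prop)]
  congr 1
  ext y
  rw [← integral_const_mul, ← BddMeas.integral_sub (by fun_prop) (by fun_prop)]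

/-- True by the choice of the ratio. If the path mean is zero, so is the triangle mean, and the
convention 0/0 = 0 is harmless. -/
theorem kmean_centKer {r : ℝ} (hr : 0 ≤ r) : kmean (law g) (centKer g r) = 0 := by
  have := hg.isProbabilityMeasure
  have h1 := (localKernel_tri hr).bdd_proj₁ (ν := law g)
  have h2 := (localKernel_path hr).bdd_proj₁ (ν := law g)
  unfold kmean centKer
  simp_rw [hg.proj₁_ker]
  rw [BddMeas.integral_sub (by fun_prop) (by fun_prop), integral_const_mul, integral_proj₁,
    integral_proj₁, triRatio]
  rcases eq_or_ne (kmean (law g) (path r)) 0 with h | h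
  · have := kmean_tri_nonneg (g := g) r
    have := hg.kmean_tri_le (r := r)
    rw [h] at this ⊢
    linarith
  · field_simp
    ring

theorem kmean_centKer_sq (r : ℝ) :
    kmean (law g) (fun x y z => centKer g r x y z ^ 2)
      = (1 - 2 * triRatio g r + 2 / 3 * triRatio g r ^ 2) * kmean (law g) (tri r)
        + triRatio g r ^ 2 / 3 * kmean (law g) (path r) := by
  have := hg.isProbabilityMeasure
  have h1 := bddMeas_tri r
  have h2 := bddMeas_path r
  unfold centKer
  simp_rw [ker_sq]
  generalize triRatio g r = m
  unfold kmean proj₁ proj₂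
  rw [← integral_const_mul, ← integral_const_mul, ← BddMeas.integral_add (by fun_prop) (by fun_prop)]
  congr 1
  ext x
  rw [← integral_const_mul, ← integral_const_mul, ← BddMeas.integral_add (by fun_prop) (by fun_prop)]
  congr 1
  ext y
  rw [← integral_const_mul, ← integral_const_mul, ← BddMeas.integral_add (by fun_prop) (by fun_prop)]

/-- Integration of a pointwise approximation of a projection. -/
theorem abs_kmean_sub_le {k : ℝ → ℝ → ℝ → ℝ} (hk : SymmKernel k) {f : ℝ → ℝ}
    (hf : BddMeas f) {E : ℝ} (h : ∀ x, |proj₁ (law g) k x - f x| ≤ E) :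
    |kmean (law g) k - ∫ x, f x ∂(law g)| ≤ E := by
  have := hg.isProbabilityMeasure
  have h1 := hk.bdd_proj₁ (ν := law g)
  rw [← integral_proj₁, ← BddMeas.integral_sub (by fun_prop) (by fun_prop)]
  calc _ ≤ ∫ x, |proj₁ (law g) k x - f x| ∂(law g) := abs_integral_le_integral_abs
    _ ≤ ∫ x, E ∂(law g) := BddMeas.integral_mono (by fun_prop) (by fun_prop) h
    _ = E := by simp

theorem abs_lin_le {a b : ℝ} (ha : |a| ≤ 2) (hb : |b| ≤ 1) (x : ℝ) :
    |a * (g x * g2 x) + b * g1 x ^ 2| ≤ 3 * M ^ 2 := by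
  have hM := hg.one_le
  have h1 : |g x * g2 x| ≤ M ^ 2 := by
    rw [abs_mul, sq]
    exact mul_le_mul (hg.bdd x) (hg.bdd2 x) (abs_nonneg _) (by linarith)
  have h2 : |g1 x ^ 2| ≤ M ^ 2 := by
    rw [abs_pow]
    exact pow_le_pow_left₀ (abs_nonneg _) (hg.bdd1 x) 2
  refine (abs_add_le _ _).trans ?_
  rw [abs_mul, abs_mul b]
  have h3 := mul_le_mul ha h1 (abs_nonneg _) (by norm_num)
  have h4 := mul_le_mul hb h2 (abs_nonneg _) (by norm_num)
  linarith

theorem abs_kmean_tri_sub_le {r : ℝ} (hr0 : 0 ≤ r) (hr : r < 1 / 4) :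
    |kmean (law g) (tri r) - 3 * r ^ 2 * Ef2 g| ≤ 323 * M ^ 2 * r ^ 4 := by
  have hb := hg.bddMeas
  have h := hg.abs_kmean_sub_le (localKernel_tri hr0).toSymmKernel
    (f := fun x => 3 * r ^ 2 * g x ^ 2) (E := 323 * M ^ 2 * r ^ 4) (by fun_prop) fun x => by
      have h1 := hg.abs_proj₁_tri_sub_le hr0 hr x
      have h2 := hg.abs_lin_le (a := 5 / 6) (b := 5 / 12) (by norm_num [abs_of_pos])
        (by norm_num [abs_of_pos]) x
      have h3 : M ^ 2 * r ^ 5 ≤ M ^ 2 * r ^ 4 := by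
        gcongr 1
        exact pow_le_pow_of_le_one hr0 (by linarith) (by norm_num)
      have h4 : r ^ 4 * |5 / 6 * (g x * g2 x) + 5 / 12 * g1 x ^ 2| ≤ r ^ 4 * (3 * M ^ 2) := by
        gcongr
      have h5 : |r ^ 4 * (5 / 6 * (g x * g2 x) + 5 / 12 * g1 x ^ 2)| ≤ r ^ 4 * (3 * M ^ 2) := by
        rwa [abs_mul, abs_of_nonneg (by positivity : 0 ≤ r ^ 4)]
      rw [abs_le] at h1 h5 ⊢
      constructor <;> linarith [h1.1, h1.2, h5.1, h5.2]
  rwa [integral_const_mul, ← Ef2_eq] at h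

theorem abs_kmean_path_sub_le {r : ℝ} (hr0 : 0 ≤ r) (hr : r < 1 / 4) :
    |kmean (law g) (path r) - 4 * r ^ 2 * Ef2 g| ≤ 323 * M ^ 2 * r ^ 4 := by
  have hb := hg.bddMeas
  have h := hg.abs_kmean_sub_le (localKernel_path hr0).toSymmKernel
    (f := fun x => 4 * r ^ 2 * g x ^ 2) (E := 323 * M ^ 2 * r ^ 4) (by fun_prop) fun x => by
      have h1 := hg.abs_proj₁_path_sub_le hr0 hr x
      have h2 := hg.abs_lin_le (a := 16 / 9) (b := 8 / 9) (by norm_num [abs_of_pos])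
        (by norm_num [abs_of_pos]) x
      have h3 : M ^ 2 * r ^ 5 ≤ M ^ 2 * r ^ 4 := by
        gcongr 1
        exact pow_le_pow_of_le_one hr0 (by linarith) (by norm_num)
      have h4 : r ^ 4 * |16 / 9 * (g x * g2 x) + 8 / 9 * g1 x ^ 2| ≤ r ^ 4 * (3 * M ^ 2) := by
        gcongr
      have h5 : |r ^ 4 * (16 / 9 * (g x * g2 x) + 8 / 9 * g1 x ^ 2)| ≤ r ^ 4 * (3 * M ^ 2) := by
        rwa [abs_mul, abs_of_nonneg (by positivity : 0 ≤ r ^ 4)]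
      rw [abs_le] at h1 h5 ⊢
      constructor <;> linarith [h1.1, h1.2, h5.1, h5.2]
  rwa [integral_const_mul, ← Ef2_eq] at h

theorem exists_abs_triRatio_sub_le : ∃ C r₀ : ℝ, 0 < C ∧ 0 < r₀ ∧ r₀ < 1 / 8 ∧
    ∀ r, 0 < r → r ≤ r₀ → 2 * c ^ 2 * r ^ 2 ≤ kmean (law g) (path r) ∧
      |triRatio g r - 3 / 4| ≤ C * r ^ 2 := by
  have hM := hg.one_le
  have hc := hg.pos
  -- 13 M r ≤ c gives 323 M² r² ≤ 2 · 13² M² r² ≤ 2 c², so the error in the path mean uses up at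
  -- most half of 4 r² c².
  refine ⟨323 * M ^ 2 / c ^ 2, min (1 / 16) (c / (13 * M)), by positivity, by positivity, ?_, ?_⟩
  · exact (min_le_left _ _).trans_lt (by norm_num)
  intro r hr0 hr
  have hr1 : r ≤ 1 / 16 := hr.trans (min_le_left _ _)
  have hr2 : r ≤ c / (13 * M) := hr.trans (min_le_right _ _)
  rw [le_div_iff₀ (by positivity)] at hr2
  have hr3 : (r * (13 * M)) ^ 2 ≤ c ^ 2 := pow_le_pow_left₀ (by positivity) hr2 2
  have h1 := hg.abs_kmean_tri_sub_le hr0.le (by linarith)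
  have h2 := hg.abs_kmean_path_sub_le hr0.le (by linarith)
  have hF := hg.sq_le_Ef2
  set ET := kmean (law g) (tri r)
  set ES := kmean (law g) (path r)
  set F := Ef2 g
  have hES : 2 * c ^ 2 * r ^ 2 ≤ ES := by
    have a1 := (abs_le.1 h2).1
    have a2 : c ^ 2 * r ^ 2 ≤ F * r ^ 2 := by gcongr
    have a3 : (r * (13 * M)) ^ 2 * r ^ 2 ≤ c ^ 2 * r ^ 2 := by gcongr
    nlinarith
  refine ⟨hES, ?_⟩
  have hES0 : 0 < ES := lt_of_lt_of_le (by positivity) hES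
  have e : triRatio g r - 3 / 4 = (ET - 3 / 4 * ES) / ES := by
    have e' : triRatio g r = ET / ES := rfl
    rw [e']
    field_simp
  rw [e, abs_div, abs_of_pos hES0, div_le_iff₀ hES0]
  have a1 : |ET - 3 / 4 * ES| ≤ 2 * (323 * M ^ 2 * r ^ 4) := by
    rw [abs_le] at h1 h2 ⊢
    have : 0 ≤ 323 * M ^ 2 * r ^ 4 := by positivity
    constructor <;> linarith [h1.1, h1.2, h2.1, h2.2]
  refine a1.trans ?_
  calc 2 * (323 * M ^ 2 * r ^ 4) = 323 * M ^ 2 / c ^ 2 * r ^ 2 * (2 * c ^ 2 * r ^ 2) := by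
        field_simp
    _ ≤ _ := by gcongr

end SmoothDensity

/-! ### Asymptotics of the projections of the centred kernel. -/

namespace SmoothDensity

variable {g g1 g2 : ℝ → ℝ} {c M : ℝ} (hg : SmoothDensity g g1 g2 c M)
include hg

/-- With κ = μ − 3/4, the expansions leave −4κ r² g² − r⁴ (g g''/2 + g'²/4) + O(r⁵). Integrating,
the zero mean and `integral_mul_second_deriv` force 4κ = (3/4) c_f r² + O(r³); inserting this yields
the function inside σ₁. No direct higher-order expansion of μ is needed. -/
theorem exists_abs_proj₁_centKer_sub_le : ∃ C r₀ : ℝ, 0 < C ∧ 0 < r₀ ∧ r₀ < 1 / 8 ∧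
    ∀ r, 0 < r → r ≤ r₀ → ∀ x, |proj₁ (law g) (centKer g r) x
      - r ^ 4 / 4 * (-3 * cf g * g x ^ 2 - 2 * g x * g2 x - g1 x ^ 2)| ≤ C * r ^ 5 := by
  have := hg.isProbabilityMeasure
  have hgb := hg.bddMeas
  have hgb1 := hg.bddMeas1
  have hgb2 := hg.bddMeas2
  obtain ⟨C, r₀, hC, hr₀, hr₀1, h⟩ := hg.exists_abs_triRatio_sub_le
  have hM := hg.one_le
  have hF0 := hg.Ef2_pos
  set K := C * (3 * M ^ 2) + 640 * M ^ 2 with hK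
  refine ⟨K * (1 + M ^ 2 / Ef2 g), r₀, by positivity, hr₀, hr₀1, fun r hr0 hr => ?_⟩
  obtain ⟨-, hm⟩ := h r hr0 hr
  have hr1 : r ≤ 1 := by linarith
  have hm0 := hg.triRatio_nonneg r
  have hm1 := hg.triRatio_le_one r
  have hsymm := (hg.localKernel_centKer hr0.le).toSymmKernel
  have hmean := hg.kmean_centKer hr0.le
  have hproj : ∀ x, proj₁ (law g) (centKer g r) x
    = proj₁ (law g) (tri r) x - triRatio g r * proj₁ (law g) (path r) x := hg.proj₁_ker _ r
  set m := triRatio g r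
  set κ := m - 3 / 4 with hκ
  have key : ∀ x, |proj₁ (law g) (centKer g r) x - (-4 * κ * r ^ 2 * g x ^ 2
      - r ^ 4 * (1 / 2 * (g x * g2 x) + 1 / 4 * g1 x ^ 2))| ≤ K * r ^ 5 := fun x => by
    have h1 := hg.abs_proj₁_tri_sub_le hr0.le (by linarith) x
    have h2 := hg.abs_proj₁_path_sub_le hr0.le (by linarith) x
    have h3 := hg.abs_lin_le (a := 16 / 9) (b := 8 / 9) (by norm_num [abs_of_pos])
        (by norm_num [abs_of_pos]) x
    rw [hproj]
    set e1 := proj₁ (law g) (tri r) x - (3 * r ^ 2 * g x ^ 2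
      + r ^ 4 * (5 / 6 * (g x * g2 x) + 5 / 12 * g1 x ^ 2)) with he1
    set e2 := proj₁ (law g) (path r) x - (4 * r ^ 2 * g x ^ 2
      + r ^ 4 * (16 / 9 * (g x * g2 x) + 8 / 9 * g1 x ^ 2)) with he2
    set π' := 16 / 9 * (g x * g2 x) + 8 / 9 * g1 x ^ 2 with hπ
    have e : proj₁ (law g) (tri r) x - m * proj₁ (law g) (path r) x
        - (-4 * κ * r ^ 2 * g x ^ 2 - r ^ 4 * (1 / 2 * (g x * g2 x) + 1 / 4 * g1 x ^ 2))
        = e1 - m * e2 - κ * r ^ 4 * π' := by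
      rw [he1, he2, hπ, hκ]
      ring
    rw [e]
    have a1 : |m * e2| ≤ 1 * (320 * M ^ 2 * r ^ 5) := by
      rw [abs_mul, abs_of_nonneg hm0]
      exact mul_le_mul hm1 h2 (abs_nonneg _) zero_le_one
    have a2 : |κ * r ^ 4 * π'| ≤ C * r ^ 2 * r ^ 4 * (3 * M ^ 2) := by
      rw [abs_mul, abs_mul, abs_of_nonneg (by positivity : 0 ≤ r ^ 4)]
      gcongr
    have a3 : C * r ^ 2 * r ^ 4 * (3 * M ^ 2) ≤ C * (3 * M ^ 2) * r ^ 5 := by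
      have : r ^ 6 ≤ r ^ 5 := pow_le_pow_of_le_one hr0.le hr1 (by norm_num)
      calc _ = C * (3 * M ^ 2) * r ^ 6 := by ring
        _ ≤ _ := by gcongr
    rw [hK]
    rw [abs_le] at h1 a1 a2 ⊢
    constructor <;> linarith [h1.1, h1.2, a1.1, a1.2, a2.1, a2.2]
  have hint := hg.abs_kmean_sub_le hsymm (by fun_prop) key
  rw [hmean, BddMeas.integral_sub (by fun_prop) (by fun_prop), integral_const_mul,
    integral_const_mul, BddMeas.integral_add (by fun_prop) (by fun_prop), integral_const_mul,
    integral_const_mul, ← Ef2_eq, hg.integral_mul_second_deriv] at hint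
  intro x
  have hcf := hg.cf_eq
  rw [eq_div_iff hF0.ne'] at hcf
  rw [← hcf] at hint
  set F := Ef2 g
  have e : -4 * κ * r ^ 2 * F - r ^ 4 * (1 / 2 * (-2 * (cf g * F)) + 1 / 4 * (cf g * F))
      = F * (-4 * κ * r ^ 2 + 3 / 4 * r ^ 4 * cf g) := by ring
  rw [e, zero_sub, abs_neg, abs_mul, abs_of_pos hF0, mul_comm, ← le_div_iff₀ hF0] at hint
  have b1 : |(-4 * κ * r ^ 2 + 3 / 4 * r ^ 4 * cf g) * g x ^ 2| ≤ K * r ^ 5 / F * M ^ 2 := by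
    rw [abs_mul]
    refine mul_le_mul hint ?_ (abs_nonneg _) (by positivity)
    rw [abs_pow]
    exact pow_le_pow_left₀ (abs_nonneg _) (hg.bdd x) 2
  have b2 := key x
  have e2 : K * (1 + M ^ 2 / F) * r ^ 5 = K * r ^ 5 + K * r ^ 5 / F * M ^ 2 := by
    field_simp
  have e3 : proj₁ (law g) (centKer g r) x
      - r ^ 4 / 4 * (-3 * cf g * g x ^ 2 - 2 * g x * g2 x - g1 x ^ 2)
      = (proj₁ (law g) (centKer g r) x - (-4 * κ * r ^ 2 * g x ^ 2
        - r ^ 4 * (1 / 2 * (g x * g2 x) + 1 / 4 * g1 x ^ 2)))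
        + (-4 * κ * r ^ 2 + 3 / 4 * r ^ 4 * cf g) * g x ^ 2 := by ring
  rw [e2, e3]
  exact (abs_add_le _ _).trans (add_le_add b2 b1)

theorem exists_integral_sq_proj₁_centKer : ∃ C r₀ : ℝ, 0 < C ∧ 0 < r₀ ∧ r₀ < 1 / 8 ∧
    ∀ r, 0 < r → r ≤ r₀ → (∀ x, |proj₁ (law g) (centKer g r) x| ≤ C * r ^ 4) ∧
      |∫ x, proj₁ (law g) (centKer g r) x ^ 2 ∂(law g) - r ^ 8 / 16 * sigma1Sq g| ≤ C * r ^ 9 := by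
  have := hg.isProbabilityMeasure
  have hgb := hg.bddMeas
  have hgb1 := hg.bddMeas1
  have hgb2 := hg.bddMeas2
  obtain ⟨C, r₀, hC, hr₀, hr₀1, h⟩ := hg.exists_abs_proj₁_centKer_sub_le
  set ψ : ℝ → ℝ := fun x => -3 * cf g * g x ^ 2 - 2 * g x * g2 x - g1 x ^ 2 with hψ
  have hψb : BddMeas ψ := by fun_prop
  obtain ⟨B, hB⟩ := hψb.bdd
  have hB0 : 0 ≤ B := (abs_nonneg _).trans (hB 0)
  refine ⟨(C + B) + C * (C + 2 * B), r₀, by positivity, hr₀, hr₀1, fun r hr0 hr => ?_⟩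
  have hr1 : r ≤ 1 := by linarith
  have hp : BddMeas (proj₁ (law g) (centKer g r)) :=
    (hg.localKernel_centKer hr0.le).bdd_proj₁
  have h1 := h r hr0 hr
  set p := proj₁ (law g) (centKer g r)
  have h45 : r ^ 5 ≤ r ^ 4 := pow_le_pow_of_le_one hr0.le hr1 (by norm_num)
  have hψr : ∀ x, |r ^ 4 / 4 * ψ x| ≤ r ^ 4 / 4 * B := fun x => by
    rw [abs_mul, abs_of_nonneg (by positivity : 0 ≤ r ^ 4 / 4)]
    gcongr
    exact hB x
  have hpx : ∀ x, |p x| ≤ (C + B) * r ^ 4 := fun x => by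
    have e : p x = (p x - r ^ 4 / 4 * ψ x) + r ^ 4 / 4 * ψ x := by ring
    rw [e]
    refine (abs_add_le _ _).trans ((add_le_add (h1 x) (hψr x)).trans ?_)
    have : C * r ^ 5 ≤ C * r ^ 4 := by gcongr
    nlinarith [pow_pos hr0 4]
  refine ⟨fun x => (hpx x).trans ?_, ?_⟩
  · have : 0 ≤ C * (C + 2 * B) * r ^ 4 := by positivity
    linarith
  have e : ∫ x, p x ^ 2 ∂(law g) - r ^ 8 / 16 * sigma1Sq g
      = ∫ x, (p x - r ^ 4 / 4 * ψ x) * (p x + r ^ 4 / 4 * ψ x) ∂(law g) := by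
    rw [hg.sigma1Sq_eq, ← integral_const_mul, ← BddMeas.integral_sub (by fun_prop) (by fun_prop)]
    congr 1
    ext x
    simp only [hψ]
    ring
  rw [e]
  have h2 : ∀ x, |(p x - r ^ 4 / 4 * ψ x) * (p x + r ^ 4 / 4 * ψ x)|
      ≤ ((C + B) + C * (C + 2 * B)) * r ^ 9 := fun x => by
    have hs : |p x + r ^ 4 / 4 * ψ x| ≤ (C + B) * r ^ 4 + r ^ 4 / 4 * B :=
      (abs_add_le _ _).trans (add_le_add (hpx x) (hψr x))
    have h3 : |p x + r ^ 4 / 4 * ψ x| ≤ (C + 2 * B) * r ^ 4 := by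
      refine hs.trans ?_
      nlinarith [pow_pos hr0 4]
    rw [abs_mul]
    refine (mul_le_mul (h1 x) h3 (abs_nonneg _) (by positivity)).trans ?_
    have : 0 ≤ (C + B) * r ^ 9 := by positivity
    linarith
  calc _ ≤ ∫ x, |(p x - r ^ 4 / 4 * ψ x) * (p x + r ^ 4 / 4 * ψ x)| ∂(law g) :=
        abs_integral_le_integral_abs
    _ ≤ ∫ x, ((C + B) + C * (C + 2 * B)) * r ^ 9 ∂(law g) :=
        BddMeas.integral_mono (by fun_prop) (by fun_prop) h2
    _ = _ := by simp

/-- At μ = 3/4 the coefficients in `ker_sq` are −1/8 and 3/16, so the mean is (−3/8 + 3/4) r² E f².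
-/
theorem exists_kmean_centKer_sq : ∃ C r₀ : ℝ, 0 < C ∧ 0 < r₀ ∧ r₀ < 1 / 8 ∧
    ∀ r, 0 < r → r ≤ r₀ → |kmean (law g) (fun x y z => centKer g r x y z ^ 2)
      - 3 / 8 * r ^ 2 * Ef2 g| ≤ C * r ^ 3 := by
  obtain ⟨C, r₀, hC, hr₀, hr₀1, h⟩ := hg.exists_abs_triRatio_sub_le
  have hM := hg.one_le
  have hF := hg.Ef2_le
  have hF0 := hg.Ef2_pos
  refine ⟨646 * M ^ 2 + 6 * C * M ^ 2, r₀, by positivity, hr₀, hr₀1, fun r hr0 hr => ?_⟩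
  obtain ⟨-, hm⟩ := h r hr0 hr
  have hm0 := hg.triRatio_nonneg r
  have hm1 := hg.triRatio_le_one r
  have h1 := hg.abs_kmean_tri_sub_le hr0.le (by linarith)
  have h2 := hg.abs_kmean_path_sub_le hr0.le (by linarith)
  rw [hg.kmean_centKer_sq]
  set m := triRatio g r
  set F := Ef2 g
  set ET := kmean (law g) (tri r)
  set ES := kmean (law g) (path r)
  have e : (1 - 2 * m + 2 / 3 * m ^ 2) * ET + m ^ 2 / 3 * ES - 3 / 8 * r ^ 2 * F
      = (1 - 2 * m + 2 / 3 * m ^ 2) * (ET - 3 * r ^ 2 * F)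
        + m ^ 2 / 3 * (ES - 4 * r ^ 2 * F) + r ^ 2 * F * (m - 3 / 4) * (-7 / 2 + 10 / 3 * m) := by
    ring
  have a1 : |(1 - 2 * m + 2 / 3 * m ^ 2) * (ET - 3 * r ^ 2 * F)| ≤ 1 * (323 * M ^ 2 * r ^ 4) := by
    rw [abs_mul]
    refine mul_le_mul ?_ h1 (abs_nonneg _) zero_le_one
    rw [abs_le]
    constructor <;> nlinarith
  have a2 : |m ^ 2 / 3 * (ES - 4 * r ^ 2 * F)| ≤ 1 * (323 * M ^ 2 * r ^ 4) := by
    rw [abs_mul]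
    refine mul_le_mul ?_ h2 (abs_nonneg _) zero_le_one
    rw [abs_le]
    constructor <;> nlinarith
  have a3 : |r ^ 2 * F * (m - 3 / 4) * (-7 / 2 + 10 / 3 * m)| ≤ r ^ 2 * M ^ 2 * (C * r ^ 2) * 6 := by
    rw [abs_mul, abs_mul, abs_of_nonneg (by positivity : 0 ≤ r ^ 2 * F)]
    refine mul_le_mul (mul_le_mul (by gcongr) hm (abs_nonneg _) (by positivity)) ?_ (abs_nonneg _)
      (by positivity)
    rw [abs_le]
    constructor <;> linarith
  have h34 : (646 * M ^ 2 + 6 * C * M ^ 2) * r ^ 4 ≤ (646 * M ^ 2 + 6 * C * M ^ 2) * r ^ 3 := by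
    gcongr 1
    exact pow_le_pow_of_le_one hr0.le (by linarith) (by norm_num)
  rw [e]
  refine (abs_add_three _ _ _).trans ?_
  linarith

/-- Both arcs of radius r contain the arc of radius 5 r/6 about the midpoint of their centres, whose
mass is about (5/3) r g. -/
theorem le_integral_near_mul_near {r x d : ℝ} (hr0 : 0 < r) (hr : r < 1 / 8) (hd : |d| ≤ r / 3) :
    5 / 3 * r * g x - 6 * M * r ^ 2 ≤ ∫ z, near r x z * near r (x + d) z ∂(law g) := by
  have := hg.isProbabilityMeasure
  have hM := hg.one_le
  have h1 : degree g (5 / 6 * r) (x + d / 2) ≤ ∫ z, near r x z * near r (x + d) z ∂(law g) := by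
    refine BddMeas.integral_mono (by fun_prop) (by fun_prop) fun z => ?_
    have hd2 : |d / 2| ≤ r / 6 := by
      rw [abs_div, abs_two]
      linarith
    have n1 : near (1 / 6 * r) x (x + d / 2) = 1 := by
      have e := near_add_eq (r := 1 / 6 * r) (x := x) (u := 0) (v := d / 2)
        (by rw [zero_sub, abs_neg]; linarith)
      rw [add_zero, zero_sub, abs_neg, if_pos (by linarith)] at e
      exact e
    have n2 : near (1 / 6 * r) (x + d) (x + d / 2) = 1 := by
      have e := near_add_eq (r := 1 / 6 * r) (x := x) (u := d) (v := d / 2)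
        (by rw [show d - d / 2 = d / 2 by ring]; linarith)
      rw [show d - d / 2 = d / 2 by ring, if_pos (by linarith)] at e
      exact e
    have a1 := near_mul_near_le (1 / 6 * r) (5 / 6 * r) x z (x + d / 2)
    have a2 := near_mul_near_le (1 / 6 * r) (5 / 6 * r) (x + d) z (x + d / 2)
    rw [n1, one_mul, show 1 / 6 * r + 5 / 6 * r = r by ring] at a1
    rw [n2, one_mul, show 1 / 6 * r + 5 / 6 * r = r by ring] at a2
    rcases near_eq_zero_or_one (5 / 6 * r) (x + d / 2) z with h | h
    · rw [h]
      exact mul_nonneg (near_nonneg _ _ _) (near_nonneg _ _ _)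
    · rw [h] at a1 a2 ⊢
      nlinarith
  refine le_trans ?_ h1
  have h2 := (abs_le.1 (hg.abs_degree_sub_le (r := 5 / 6 * r) (by linarith) (by linarith)
    (x + d / 2))).1
  have hd2 : |d / 2| ≤ r / 6 := by
    rw [abs_div, abs_two]
    linarith
  have h3 := (abs_le.1 (hg.abs_sub_le_of_abs_le (x := x) (u := d / 2) (by linarith))).1
  have h4 : 3 * M * |d / 2| ≤ 3 * M * (r / 6) := by gcongr
  have h5 : g x - M * r / 2 ≤ g (x + d / 2) := by linarith
  have h6 : 2 * (5 / 6 * r) * (g x - M * r / 2) ≤ 2 * (5 / 6 * r) * g (x + d / 2) := by gcongr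
  have h7 : 0 ≤ M * r ^ 2 := by positivity
  nlinarith

theorem proj₂_centKer_eq (r x y : ℝ) : proj₂ (law g) (centKer g r) x y
    = near r x y * ∫ z, near r x z * near r y z ∂(law g)
      - triRatio g r / 3 * (near r x y * degree g r x + near r x y * degree g r y
        + ∫ z, near r x z * near r y z ∂(law g)) := by
  have := hg.isProbabilityMeasure
  unfold proj₂ centKer degree
  rw [← integral_const_mul, ← integral_const_mul, ← integral_const_mul,
    ← BddMeas.integral_add (by fun_prop) (by fun_prop),
    ← BddMeas.integral_add (by fun_prop) (by fun_prop), ← integral_const_mul,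
    ← BddMeas.integral_sub (by fun_prop) (by fun_prop)]
  congr 1
  ext z
  unfold ker tri path
  ring

omit hg in
theorem proj₂_centKer_add_intCast (r x y : ℝ) (n : ℤ) :
    proj₂ (law g) (centKer g r) x (y + n) = proj₂ (law g) (centKer g r) x y := by
  have h : Function.Periodic (fun y => proj₂ (law g) (centKer g r) x y) 1 := fun y => by
    simp only [proj₂, centKer, ker, tri, path, near_add_one_left, near_add_one_right]
  have := h.int_mul n y
  simpa using this

/-- Pairs within r/3 suffice. For them the projection is at least r g (5/3 − 17 μ/9) − O(r²), and at
μ = 3/4 the bracket is 1/4; lowering it to 1/10 absorbs the errors. Such pairs have probability of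
order r, whence r² · r. -/
theorem exists_le_integral_sq_proj₂_centKer : ∃ C r₀ : ℝ, 0 < C ∧ 0 < r₀ ∧ r₀ < 1 / 8 ∧
    ∀ r, 0 < r → r ≤ r₀ →
      C * r ^ 3 ≤ ∫ x, ∫ y, proj₂ (law g) (centKer g r) x y ^ 2 ∂(law g) ∂(law g) := by
  have := hg.isProbabilityMeasure
  obtain ⟨C, r₀, hC, hr₀, hr₀1, h⟩ := hg.exists_abs_triRatio_sub_le
  have hM := hg.one_le
  have hc := hg.pos
  refine ⟨(c / 10) ^ 2 * (c / 3), min r₀ (min (1 / (68 * (C + 1))) (c / (300 * M))), by positivity,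
    by positivity, (min_le_left _ _).trans_lt hr₀1, fun r hr0 hr => ?_⟩
  have hr1 : r ≤ r₀ := hr.trans (min_le_left _ _)
  have hr2 : r ≤ 1 / (68 * (C + 1)) := hr.trans ((min_le_right _ _).trans (min_le_left _ _))
  have hr3 : r ≤ c / (300 * M) := hr.trans ((min_le_right _ _).trans (min_le_right _ _))
  rw [le_div_iff₀ (by positivity)] at hr2 hr3
  obtain ⟨-, hm⟩ := h r hr0 hr1
  have hm0 := hg.triRatio_nonneg r
  have hm1 := hg.triRatio_le_one r
  have hm2 : triRatio g r ≤ 3 / 4 + 1 / 68 := by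
    have h1 := (abs_le.1 hm).2
    have h2 : C * r ^ 2 ≤ 1 / 68 := by
      have : C * r ^ 2 ≤ (C + 1) * r := by nlinarith
      linarith
    linarith
  have hdeg : ∀ x, |degree g r x - 2 * r * g x| ≤ 6 * M * r ^ 2 := fun x =>
    hg.abs_degree_sub_le hr0.le (by linarith) x
  have key : ∀ x d, |d| ≤ r / 3 → c / 10 * r ≤ proj₂ (law g) (centKer g r) x (x + d) := by
    intro x d hd
    rw [hg.proj₂_centKer_eq]
    have n1 : near r x (x + d) = 1 := by
      have e := near_add_eq (r := r) (x := x) (u := 0) (v := d)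
        (by rw [zero_sub, abs_neg]; linarith)
      rw [add_zero, zero_sub, abs_neg, if_pos (by linarith)] at e
      exact e
    have ht := hg.le_integral_near_mul_near (x := x) hr0 (by linarith) hd
    have hd1 := (abs_le.1 (hdeg x)).2
    have hd2 := (abs_le.1 (hdeg (x + d))).2
    have hgd := (abs_le.1 (hg.abs_sub_le_of_abs_le (x := x) (u := d) (by linarith))).2
    have h4 : 3 * M * |d| ≤ 3 * M * (r / 3) := by gcongr
    have h5 : g (x + d) ≤ g x + M * r := by linarith
    have h6 : 2 * r * g (x + d) ≤ 2 * r * (g x + M * r) := by gcongr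
    set t := ∫ z, near r x z * near r (x + d) z ∂(law g)
    set m := triRatio g r
    rw [n1, one_mul, one_mul, one_mul]
    have b1 : (1 - m / 3) * (5 / 3 * r * g x - 6 * M * r ^ 2) ≤ (1 - m / 3) * t := by
      apply mul_le_mul_of_nonneg_left ht
      linarith
    have b2 : m / 3 * (degree g r x + degree g r (x + d))
        ≤ m / 3 * (4 * r * g x + 14 * M * r ^ 2) := by
      apply mul_le_mul_of_nonneg_left _ (by linarith)
      linarith
    have hgx := hg.le x
    have hM2 : 0 ≤ M * r ^ 2 := by positivity
    have b3 : m * (M * r ^ 2) ≤ M * r ^ 2 := by nlinarith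
    have b4 : m * (r * g x) ≤ (3 / 4 + 1 / 68) * (r * g x) := by
      have : 0 ≤ r * g x := mul_nonneg hr0.le (hc.le.trans hgx)
      gcongr
    have b5 : r * c ≤ r * g x := by gcongr
    have b6 : r * (r * (300 * M)) ≤ r * c := by gcongr
    have b7 : 0 ≤ m * (M * r ^ 2) := by positivity
    nlinarith
  have hpt : ∀ x y, (c / 10 * r) ^ 2 * near (r / 3) x y ≤ proj₂ (law g) (centKer g r) x y ^ 2 := by
    intro x y
    unfold near
    split_ifs with hn
    · rw [mul_one]
      -- Points on opposite sides of the seam 0 ∼ 1 are brought together by shifting y by an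
      -- integer.
      have h1 := key x (y - x + round (x - y)) (by
        rw [← abs_neg]
        refine le_trans (le_of_eq ?_) hn
        congr 1
        ring)
      rw [show x + (y - x + (round (x - y) : ℝ)) = y + ((round (x - y) : ℤ) : ℝ) by ring,
        proj₂_centKer_add_intCast] at h1
      exact pow_le_pow_left₀ (by positivity) h1 2
    · rw [mul_zero]
      positivity
  have hb := (hg.localKernel_centKer hr0.le).bdd_proj₂ (ν := law g)
  have hdl : ∀ x, c / 3 * r ≤ ∫ y, near (r / 3) x y ∂(law g) := fun x => by
    have h1 := (abs_le.1 (hg.abs_degree_sub_le (r := r / 3) (by linarith) (by linarith) x)).1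
    have h2 : r * c ≤ r * g x := by gcongr; exact hg.le x
    have h3 : r * (r * (300 * M)) ≤ r * c := by gcongr
    unfold degree at h1
    nlinarith
  calc (c / 10) ^ 2 * (c / 3) * r ^ 3 = ∫ x, (c / 10 * r) ^ 2 * (c / 3 * r) ∂(law g) := by
        rw [integral_const]
        simp
        ring
    _ ≤ ∫ x, (c / 10 * r) ^ 2 * ∫ y, near (r / 3) x y ∂(law g) ∂(law g) := by
        refine BddMeas.integral_mono (by fun_prop) (by fun_prop) fun x => ?_
        gcongr
        exact hdl x
    _ ≤ _ := by
        refine BddMeas.integral_mono (by fun_prop) (by fun_prop) fun x => ?_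
        rw [← integral_const_mul]
        exact BddMeas.integral_mono (by fun_prop) (by fun_prop) (hpt x)

/-- By rotation invariance the projection is a constant, and its mean is zero. -/
theorem proj₁_centKer_eq_zero_of_const (h1 : ∀ x, g x = 1) {r : ℝ} (hr0 : 0 ≤ r) (hr : r < 1 / 8)
    (x : ℝ) : proj₁ (law g) (centKer g r) x = 0 := by
  have := hg.isProbabilityMeasure
  have e : ∀ x, proj₁ (law g) (centKer g r) x = proj₁ (law g) (centKer g r) 0 := fun x => by
    have h := hg.proj₁_ker (triRatio g r) r
    rw [show centKer g r = ker (triRatio g r) r from rfl, h, h, hg.proj₁_tri_eq hr0 (by linarith),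
      hg.proj₁_tri_eq hr0 (by linarith), hg.proj₁_path_eq hr0 (by linarith),
      hg.proj₁_path_eq hr0 (by linarith)]
    simp only [h1]
  have h := hg.kmean_centKer hr0
  unfold kmean at h
  simp_rw [e] at h
  rw [e]
  simpa using h

end SmoothDensity

/-! ### Taylor bounds from differentiability and periodicity. -/

section Smooth

/-- Mean value inequality on the segment from 0 to u. Three applications give the third-order Taylor
bound, without the factorial, which is not needed. -/
theorem abs_le_mul_of_hasDerivAt {φ φ' : ℝ → ℝ} (h : ∀ u, HasDerivAt φ (φ' u) u) (h0 : φ 0 = 0)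
    {K : ℝ} (hK : 0 ≤ K) {m : ℕ} (hb : ∀ u, |φ' u| ≤ K * |u| ^ m) (u : ℝ) :
    |φ u| ≤ K * |u| ^ (m + 1) := by
  have h1 := Convex.norm_image_sub_le_of_norm_hasDerivWithin_le (s := Set.uIcc 0 u)
    (f := φ) (f' := φ') (C := K * |u| ^ m) (fun x _ => (h x).hasDerivWithinAt)
    (fun x hx => by
      refine (hb x).trans ?_
      have : |x| ≤ |u| := by
        have := Set.abs_sub_left_of_mem_uIcc hx
        simpa using this
      gcongr)
    (convex_uIcc _ _) Set.left_mem_uIcc Set.right_mem_uIcc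
  simpa [h0, pow_succ, mul_assoc] using h1

theorem periodic_deriv {f : ℝ → ℝ} (h : ∀ x, f (x + 1) = f x) (x : ℝ) :
    deriv f (x + 1) = deriv f x := by
  rw [← deriv_comp_add_const]
  simp_rw [h]

theorem exists_bound_of_periodic {f : ℝ → ℝ} (h : ∀ x, f (x + 1) = f x) (hc : Continuous f) :
    ∃ K, ∀ x, |f x| ≤ K := by
  have h1 : Function.Periodic f 1 := h
  obtain ⟨K, hK⟩ := (h1.isBounded_of_continuous one_ne_zero hc).exists_norm_le
  exact ⟨K, fun x => hK _ ⟨x, rfl⟩⟩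

theorem exists_smoothDensity {g : ℝ → ℝ} (hper : Function.Periodic g 1)
    (hpos : ∃ c : ℝ, 0 < c ∧ ∀ x, c ≤ g x)
    (hdiff : ∀ k : ℕ, k < 4 → Differentiable ℝ (iteratedDeriv k g))
    (hint : ∫ x in (0 : ℝ)..1, g x = 1) :
    ∃ c M, SmoothDensity g (deriv g) (deriv (deriv g)) c M := by
  obtain ⟨c, hc, hcg⟩ := hpos
  have d0 : Differentiable ℝ g := by simpa using hdiff 0 (by norm_num)
  have d1 : Differentiable ℝ (deriv g) := by simpa using hdiff 1 (by norm_num)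
  have d2 : Differentiable ℝ (deriv (deriv g)) := by
    simpa [iteratedDeriv_succ] using hdiff 2 (by norm_num)
  have d3 : Differentiable ℝ (deriv (deriv (deriv g))) := by
    simpa [iteratedDeriv_succ] using hdiff 3 (by norm_num)
  have p0 : ∀ x, g (x + 1) = g x := hper
  have p1 := periodic_deriv p0
  have p2 := periodic_deriv p1
  have p3 := periodic_deriv p2
  obtain ⟨K0, h0⟩ := exists_bound_of_periodic p0 d0.continuous
  obtain ⟨K1, h1⟩ := exists_bound_of_periodic p1 d1.continuous
  obtain ⟨K2, h2⟩ := exists_bound_of_periodic p2 d2.continuous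
  obtain ⟨K3, h3⟩ := exists_bound_of_periodic p3 d3.continuous
  have k0 : 0 ≤ K0 := (abs_nonneg _).trans (h0 0)
  have k1 : 0 ≤ K1 := (abs_nonneg _).trans (h1 0)
  have k2 : 0 ≤ K2 := (abs_nonneg _).trans (h2 0)
  have k3 : 0 ≤ K3 := (abs_nonneg _).trans (h3 0)
  refine ⟨c, 1 + K0 + K1 + K2 + K3, p0, p1, fun x => (d0 x).hasDerivAt,
    fun x => (d1 x).hasDerivAt, d2.continuous, hc, hcg, by linarith,
    fun x => (h0 x).trans (by linarith), fun x => (h1 x).trans (by linarith),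
    fun x => (h2 x).trans (by linarith), fun x u => ?_, hint⟩
  have hadd : ∀ {f : ℝ → ℝ} (_ : Differentiable ℝ f) (u : ℝ),
      HasDerivAt (fun u => f (x + u)) (deriv f (x + u)) u := fun hf u =>
    HasDerivAt.comp_const_add x u (hf _).hasDerivAt
  have t2 : ∀ u, |deriv (deriv g) (x + u) - deriv (deriv g) x| ≤ K3 * |u| ^ 1 :=
    abs_le_mul_of_hasDerivAt (fun u => (hadd d2 u).sub_const _) (by simp) k3
      (fun u => by simpa using h3 (x + u))
  have t1 : ∀ u, |deriv g (x + u) - deriv g x - u * deriv (deriv g) x| ≤ K3 * |u| ^ 2 :=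
    abs_le_mul_of_hasDerivAt (fun u => by
      have := ((hadd d1 u).sub_const (deriv g x)).sub
        ((hasDerivAt_id u).mul_const (deriv (deriv g) x))
      convert! this using 1
      simp) (by simp) k3 t2
  have t0 : |g (x + u) - g x - u * deriv g x - u ^ 2 / 2 * deriv (deriv g) x| ≤ K3 * |u| ^ 3 :=
    abs_le_mul_of_hasDerivAt
      (φ := fun u => g (x + u) - g x - u * deriv g x - u ^ 2 / 2 * deriv (deriv g) x)
      (φ' := fun u => deriv g (x + u) - deriv g x - u * deriv (deriv g) x) (fun u => by
      have := (((hadd d0 u).sub_const (g x)).sub ((hasDerivAt_id u).mul_const (deriv g x))).sub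
        ((((hasDerivAt_id u).pow 2).div_const 2).mul_const (deriv (deriv g) x))
      convert! this using 1
      simp) (by simp) k3 t1 u
  refine t0.trans ?_
  gcongr
  linarith

end Smooth

/-! ### The clustering coefficient as a ratio of triple sums. -/

section Clustering

variable {ι : Type*} [Fintype ι] [DecidableEq ι]

/-- Relabelling indices moves the centre of the path to any vertex. Averaging the three choices
gives the symmetric kernel that Hoeffding's decomposition requires. -/
theorem distinctSum₃_path (r : ℝ) (x : ι → ℝ) :
    distinctSum₃ (fun a b c => near r a b * near r b c) x = distinctSum₃ (path r) x := by
  set k : ℝ → ℝ → ℝ → ℝ := fun a b c => near r a b * near r b c with hk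
  have e1 : distinctSum₃ (fun a b c => near r a b * near r a c) x = distinctSum₃ k x := by
    rw [← distinctSum₃_swap k]
    simp only [hk, near_comm r _ _]
  have e2 : distinctSum₃ (fun a b c => near r a c * near r b c) x = distinctSum₃ k x := by
    rw [← distinctSum₃_swap' k]
    congr 1
    ext a b c
    simp only [hk]
    rw [near_comm r b c]
  have e : path r = fun a b c => 1 / 3 * (near r a b * near r a c + k a b c
      + near r a c * near r b c) := by
    ext a b c
    simp only [path, hk]
    ring
  rw [e, distinctSum₃_const_mul, distinctSum₃_add, distinctSum₃_add, e1, e2]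
  ring

theorem clustering_eq {r : ℝ} {x : ι → ℝ} (hx : ∀ i, x i ∈ Set.Icc (0 : ℝ) 1) :
    clustering (adj r x) = distinctSum₃ (tri r) x / distinctSum₃ (path r) x := by
  rw [← distinctSum₃_path]
  unfold clustering distinctSum₃ tri
  congr 1
  · refine Finset.sum_congr rfl fun i _ => Finset.sum_congr rfl fun j _ =>
      Finset.sum_congr rfl fun k _ => ?_
    split_ifs with h
    · rw [adj_eq_near hx h.1, adj_eq_near hx h.2.2, adj_eq_near hx h.2.1.symm, near_comm r (x i)]
      ring
    · rfl
  · refine Finset.sum_congr rfl fun i _ => Finset.sum_congr rfl fun j _ =>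
      Finset.sum_congr rfl fun k _ => ?_
    split_ifs with h
    · rw [adj_eq_near hx h.1, adj_eq_near hx h.2.2]
    · rfl

theorem distinctSum₃_ker (m r : ℝ) (x : ι → ℝ) :
    distinctSum₃ (ker m r) x = distinctSum₃ (tri r) x - m * distinctSum₃ (path r) x := by
  have e : ker m r = fun a b c => tri r a b c + (-m) * path r a b c := by
    ext a b c
    simp only [ker]
    ring
  rw [e, distinctSum₃_add, distinctSum₃_const_mul]
  ring

end Clustering

/-! ### μ, h and σ₂² in terms of the kernels. -/

namespace SmoothDensity

variable {g g1 g2 : ℝ → ℝ} {c M : ℝ} (hg : SmoothDensity g g1 g2 c M)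
include hg

theorem ae_forall_mem_Icc {ι : Type*} [Fintype ι] :
    ∀ᵐ x ∂(Measure.pi fun _ : ι => law g), ∀ i, x i ∈ Set.Icc (0 : ℝ) 1 := by
  have := hg.isProbabilityMeasure
  rw [ae_all_iff]
  intro i
  exact (Measure.tendsto_eval_ae_ae (μ := fun _ : ι => law g) (i := i)).eventually
    (ae_mem_Icc (g := g))

theorem integral_path₁_eq (r : ℝ) :
    ∫ x, ∫ y, ∫ z, near r x y * near r x z ∂(law g) ∂(law g) ∂(law g)
      = kmean (law g) (path r) := by
  have := hg.isProbabilityMeasure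
  have hdb : BddMeas (degree g r) := by
    unfold degree
    fun_prop
  have hd : ∀ y, ∫ z, near r y z ∂(law g) = degree g r y := fun y => rfl
  have e1 : ∫ x, ∫ y, near r x y * degree g r y ∂(law g) ∂(law g)
      = ∫ x, ∫ y, near r x y * degree g r x ∂(law g) ∂(law g) := by
    rw [BddMeas.integral_comm (by fun_prop)]
    simp only [near_comm r]
  have e2 : ∫ x, ∫ y, ∫ z, near r x z * near r y z ∂(law g) ∂(law g) ∂(law g)
      = ∫ x, ∫ y, near r x y * degree g r y ∂(law g) ∂(law g) := by
    congr 1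
    ext x
    rw [BddMeas.integral_comm (by fun_prop)]
    congr 1
    ext z
    rw [integral_const_mul, ← hd]
    simp only [near_comm r z]
  unfold kmean proj₁ proj₂ path
  simp_rw [integral_div]
  have e3 : ∀ x y, ∫ z, (near r x y * near r x z + near r x y * near r y z
      + near r x z * near r y z) ∂(law g) = near r x y * degree g r x + near r x y * degree g r y
      + ∫ z, near r x z * near r y z ∂(law g) := fun x y => by
    rw [BddMeas.integral_add (by fun_prop) (by fun_prop),
      BddMeas.integral_add (by fun_prop) (by fun_prop), integral_const_mul, integral_const_mul,
      hd, hd]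
  have e4 : ∀ x, ∫ y, (near r x y * degree g r x + near r x y * degree g r y
      + ∫ z, near r x z * near r y z ∂(law g)) ∂(law g)
      = ∫ y, near r x y * degree g r x ∂(law g) + ∫ y, near r x y * degree g r y ∂(law g)
        + ∫ y, ∫ z, near r x z * near r y z ∂(law g) ∂(law g) := fun x => by
    rw [BddMeas.integral_add (by fun_prop) (by fun_prop),
      BddMeas.integral_add (by fun_prop) (by fun_prop)]
  simp_rw [e3, e4]
  rw [BddMeas.integral_add (by fun_prop) (by fun_prop),
    BddMeas.integral_add (by fun_prop) (by fun_prop), e2, e1]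
  simp_rw [integral_const_mul, hd]
  ring

theorem mu_eq (r : ℝ) : mu g r = triRatio g r := by
  have := hg.isProbabilityMeasure
  unfold mu triRatio iidLaw
  congr 1
  · rw [← integral_proj₁]
    refine Eq.trans ?_ (integral_pi_three (law g) (ι := Fin 3) (i := 0) (j := 1) (k := 2)
      (by decide) (by decide) (by decide) (bddMeas_tri r))
    refine integral_congr_ae ?_
    filter_upwards [hg.ae_forall_mem_Icc] with x hx
    rw [adj_eq_near hx (by decide), adj_eq_near hx (by decide), adj_eq_near hx (by decide), tri]
  · rw [← hg.integral_path₁_eq]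
    refine Eq.trans ?_ (integral_pi_three (law g) (ι := Fin 3) (i := 0) (j := 1) (k := 2)
      (f := fun a b c => near r a b * near r a c) (by decide) (by decide) (by decide) (by fun_prop))
    refine integral_congr_ae ?_
    filter_upwards [hg.ae_forall_mem_Icc] with x hx
    rw [adj_eq_near hx (by decide), adj_eq_near hx (by decide)]

theorem hKernel_eq {ι : Type*} {r : ℝ} {x : ι → ℝ} (hx : ∀ i, x i ∈ Set.Icc (0 : ℝ) 1)
    {i j k : ι} (hij : i ≠ j) (hik : i ≠ k) (hjk : j ≠ k) :
    hKernel g r x i j k = centKer g r (x i) (x j) (x k) := by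
  unfold hKernel centKer ker tri path
  rw [adj_eq_near hx hij, adj_eq_near hx hik, adj_eq_near hx hjk, hg.mu_eq]
  ring

/-- Given the first two points, the third and fourth are independent and identically distributed, so
the conditional mean of the product is a square. -/
theorem sigma2Sq_eq {r : ℝ} (hr : 0 ≤ r) :
    sigma2Sq g r = ∫ x, ∫ y, proj₂ (law g) (centKer g r) x y ^ 2 ∂(law g) ∂(law g) := by
  have := hg.isProbabilityMeasure
  have hk := hg.localKernel_centKer hr
  have hb := hk.bdd
  have hb2 := hk.bdd_proj₂ (ν := law g)
  unfold sigma2Sq iidLaw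
  have e1 : ∫ x, hKernel g r x 0 1 2 * hKernel g r x 0 1 3 ∂(Measure.pi fun _ : Fin 4 => law g)
      = ∫ x : Fin 4 → ℝ, centKer g r (x 0) (x 1) (x 2) * centKer g r (x 0) (x 1) (x 3)
        ∂(Measure.pi fun _ : Fin 4 => law g) := by
    refine integral_congr_ae ?_
    filter_upwards [hg.ae_forall_mem_Icc] with x hx
    rw [hg.hKernel_eq hx (by decide) (by decide) (by decide),
      hg.hKernel_eq hx (by decide) (by decide) (by decide)]
  rw [e1, integral_update (law g) 3 (BddMeas.integrable (by fun_prop) _)]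
  have e2 : ∀ x : Fin 4 → ℝ, ∫ y, centKer g r (Function.update x 3 y 0) (Function.update x 3 y 1)
      (Function.update x 3 y 2) * centKer g r (Function.update x 3 y 0)
      (Function.update x 3 y 1) (Function.update x 3 y 3) ∂(law g)
      = centKer g r (x 0) (x 1) (x 2) * proj₂ (law g) (centKer g r) (x 0) (x 1) := fun x => by
    simp only [Function.update_self, Function.update_of_ne (by decide : (0 : Fin 4) ≠ 3),
      Function.update_of_ne (by decide : (1 : Fin 4) ≠ 3),
      Function.update_of_ne (by decide : (2 : Fin 4) ≠ 3)]
    exact integral_const_mul _ _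
  simp_rw [e2]
  rw [integral_pi_three (law g) (ι := Fin 4) (i := 0) (j := 1) (k := 2)
    (f := fun a b d => centKer g r a b d * proj₂ (law g) (centKer g r) a b)
    (by decide) (by decide) (by decide) (by fun_prop)]
  simp_rw [integral_mul_const, integral_eq_proj₂, ← sq]

end SmoothDensity

/-! ### Variances of the triple sums, concentration of the denominator, and the common limit
statement. -/

namespace SmoothDensity

variable {g g1 g2 : ℝ → ℝ} {c M : ℝ} (hg : SmoothDensity g g1 g2 c M)
include hg

section Variance

variable {n : ℕ} (hn : 1 ≤ n) {r : ℝ} (hr0 : 0 ≤ r) (hr : r < 1 / 8)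
include hn hr0 hr

theorem integral_sq_distinctSum₃_sub_le {k : ℝ → ℝ → ℝ → ℝ} (hk : LocalKernel r k) :
    ∫ x : Fin n → ℝ, (distinctSum₃ k x - (n : ℝ) * ((n : ℝ) - 1) * ((n : ℝ) - 2) *
        kmean (law g) k) ^ 2 ∂(Measure.pi fun _ => law g)
      ≤ 12000 * ((n : ℝ) ^ 3 * (4 * M * r) ^ 2 + (n : ℝ) ^ 5 * (4 * M * r) ^ 4) := by
  have := hg.isProbabilityMeasure
  have : Nonempty (Fin n) := ⟨⟨0, hn⟩⟩
  have hM := hg.one_le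
  have h := hk.integral_sq_distinctSum₃_sub_le (ν := law g) (ι := Fin n)
  rw [Fintype.card_fin] at h
  refine h.trans ?_
  have h1 := hk.integral_sq_proj₁_le hg hr0 hr
  have h2 := hk.integral_sq_proj₂_le hg hr0 hr
  have h3 := hk.integral_sq_le hg hr0 hr
  set B := 4 * M * r with hB
  have hB0 : 0 ≤ B := by positivity
  have hN : (1 : ℝ) ≤ n := by exact_mod_cast hn
  calc _ ≤ 6000 * ((n : ℝ) ^ 3 * B ^ 2 + (n : ℝ) ^ 4 * B ^ 3 + (n : ℝ) ^ 5 * B ^ 4) := by gcongr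
    _ ≤ _ := by
      -- This square absorbs the middle term: 2 n⁴ B³ ≤ n³ B² + n⁵ B⁴.
      have : 0 ≤ (n : ℝ) ^ 3 * B ^ 2 * (n * B - 1) ^ 2 := by positivity
      have : 0 ≤ (n : ℝ) ^ 3 * B ^ 2 := by positivity
      have : 0 ≤ (n : ℝ) ^ 5 * B ^ 4 := by positivity
      nlinarith

theorem integral_sq_centKer_le {p : ℝ}
    (hp : ∫ x, proj₁ (law g) (centKer g r) x ^ 2 ∂(law g) ≤ p) :
    ∫ x : Fin n → ℝ, distinctSum₃ (centKer g r) x ^ 2 ∂(Measure.pi fun _ => law g)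
      ≤ 6000 * ((n : ℝ) ^ 3 * (4 * M * r) ^ 2 + (n : ℝ) ^ 4 * (4 * M * r) ^ 3 + (n : ℝ) ^ 5 * p) := by
  have := hg.isProbabilityMeasure
  have : Nonempty (Fin n) := ⟨⟨0, hn⟩⟩
  have hk := hg.localKernel_centKer hr0
  have h := hk.integral_sq_distinctSum₃_sub_le (ν := law g) (ι := Fin n)
  rw [Fintype.card_fin, hg.kmean_centKer hr0] at h
  simp only [mul_zero, sub_zero] at h
  refine h.trans ?_
  have h2 := hk.integral_sq_proj₂_le hg hr0 hr
  have h3 := hk.integral_sq_le hg hr0 hr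
  gcongr

-- What Hoeffding's decomposition leaves once the linear part is removed; used when the linear part
-- dominates.
omit hn in
theorem integral_sq_centKer_sub_sum_le :
    ∫ x : Fin n → ℝ, (distinctSum₃ (centKer g r) x - 3 * ((n : ℝ) - 1) * ((n : ℝ) - 2) *
        ∑ i, proj₁ (law g) (centKer g r) (x i)) ^ 2 ∂(Measure.pi fun _ => law g)
      ≤ 3456 * (n : ℝ) ^ 3 * (4 * M * r) ^ 2 + 72 * ((n : ℝ) * ((n : ℝ) - 2)) ^ 2 * (4 * M * r) ^ 3 := by
  have := hg.isProbabilityMeasure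
  have hk := hg.localKernel_centKer hr0
  have b2 := hk.bdd_deg₂ (ν := law g)
  have b3 := hk.bdd_deg₃ (ν := law g)
  have h2 := hk.integral_sq_proj₂_le hg hr0 hr
  have h3 := hk.integral_sq_le hg hr0 hr
  have i3 := hk.integral_sq_distinctSum₃_deg₃_le (ν := law g) (ι := Fin n)
  have i2 := hk.integral_sq_distinctSum₂_deg₂_le (ν := law g) (ι := Fin n)
  rw [Fintype.card_fin] at i2 i3
  have hpt : ∀ x : Fin n → ℝ, (distinctSum₃ (centKer g r) x - 3 * ((n : ℝ) - 1) * ((n : ℝ) - 2) *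
        ∑ i, proj₁ (law g) (centKer g r) (x i)) ^ 2
      ≤ 2 * distinctSum₃ (deg₃ (law g) (centKer g r)) x ^ 2
        + 18 * ((n : ℝ) - 2) ^ 2 * distinctSum₂ (deg₂ (law g) (centKer g r)) x ^ 2 := fun x => by
    have h := distinctSum₃_hoeffding (law g) (centKer g r) x
    rw [hg.kmean_centKer hr0, Fintype.card_fin] at h
    simp only [sub_zero, mul_zero, add_zero] at h
    rw [h]
    have := add_sq_le (a := distinctSum₃ (deg₃ (law g) (centKer g r)) x)
      (b := 3 * ((n : ℝ) - 2) * distinctSum₂ (deg₂ (law g) (centKer g r)) x)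
    refine le_trans (le_of_eq ?_) (this.trans (le_of_eq ?_)) <;> ring
  have hk1 := hk.bdd_proj₁ (ν := law g)
  have hkb := hk.bdd
  have hb1 : BddMeas fun x : Fin n → ℝ => distinctSum₃ (centKer g r) x := hkb.distinctSum₃
  have hb2 : BddMeas fun x : Fin n → ℝ => distinctSum₃ (deg₃ (law g) (centKer g r)) x :=
    b3.distinctSum₃
  have hb3 : BddMeas fun x : Fin n → ℝ => distinctSum₂ (deg₂ (law g) (centKer g r)) x :=
    b2.distinctSum₂
  refine (BddMeas.integral_mono (by fun_prop) (by fun_prop) hpt).trans ?_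
  rw [BddMeas.integral_add (by fun_prop) (by fun_prop), integral_const_mul, integral_const_mul]
  calc _ ≤ 2 * (1728 * (n : ℝ) ^ 3 * (4 * M * r) ^ 2)
        + 18 * ((n : ℝ) - 2) ^ 2 * (4 * (n : ℝ) ^ 2 * (4 * M * r) ^ 3) := by
        gcongr
        · exact i3.trans (by gcongr)
        · exact i2.trans (by gcongr)
    _ = _ := by ring

-- What is left once the quadratic part is removed; the linear variance is kept as the parameter
-- `p`, since its smallness has two different sources.
omit hn in
theorem integral_sq_centKer_sub_distinctSum₂_le {p : ℝ}
    (hp : ∫ x, proj₁ (law g) (centKer g r) x ^ 2 ∂(law g) ≤ p) :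
    ∫ x : Fin n → ℝ, (distinctSum₃ (centKer g r) x - 3 * ((n : ℝ) - 2) *
        distinctSum₂ (deg₂ (law g) (centKer g r)) x) ^ 2 ∂(Measure.pi fun _ => law g)
      ≤ 3456 * (n : ℝ) ^ 3 * (4 * M * r) ^ 2 + 18 * (((n : ℝ) - 1) * ((n : ℝ) - 2)) ^ 2 * (n * p) := by
  have := hg.isProbabilityMeasure
  have hk := hg.localKernel_centKer hr0
  have b2 := hk.bdd_deg₂ (ν := law g)
  have b3 := hk.bdd_deg₃ (ν := law g)
  have h3 := hk.integral_sq_le hg hr0 hr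
  have i3 := hk.integral_sq_distinctSum₃_deg₃_le (ν := law g) (ι := Fin n)
  have i1 := hk.integral_sq_sum_proj₁_le (ν := law g) (ι := Fin n)
  rw [Fintype.card_fin] at i1 i3
  simp only [hg.kmean_centKer hr0, sub_zero] at i1
  have hpt : ∀ x : Fin n → ℝ, (distinctSum₃ (centKer g r) x - 3 * ((n : ℝ) - 2) *
        distinctSum₂ (deg₂ (law g) (centKer g r)) x) ^ 2
      ≤ 2 * distinctSum₃ (deg₃ (law g) (centKer g r)) x ^ 2
        + 18 * (((n : ℝ) - 1) * ((n : ℝ) - 2)) ^ 2 *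
          (∑ i, proj₁ (law g) (centKer g r) (x i)) ^ 2 := fun x => by
    have h := distinctSum₃_hoeffding (law g) (centKer g r) x
    rw [hg.kmean_centKer hr0, Fintype.card_fin] at h
    simp only [sub_zero, mul_zero, add_zero] at h
    rw [h]
    have := add_sq_le (a := distinctSum₃ (deg₃ (law g) (centKer g r)) x)
      (b := 3 * ((n : ℝ) - 1) * ((n : ℝ) - 2) * ∑ i, proj₁ (law g) (centKer g r) (x i))
    refine le_trans (le_of_eq ?_) (this.trans (le_of_eq ?_)) <;> ring
  have hk1 := hk.bdd_proj₁ (ν := law g)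
  have hkb := hk.bdd
  have hb1 : BddMeas fun x : Fin n → ℝ => distinctSum₃ (centKer g r) x := hkb.distinctSum₃
  have hb2 : BddMeas fun x : Fin n → ℝ => distinctSum₃ (deg₃ (law g) (centKer g r)) x :=
    b3.distinctSum₃
  have hb3 : BddMeas fun x : Fin n → ℝ => distinctSum₂ (deg₂ (law g) (centKer g r)) x :=
    b2.distinctSum₂
  refine (BddMeas.integral_mono (by fun_prop) (by fun_prop) hpt).trans ?_
  rw [BddMeas.integral_add (by fun_prop) (by fun_prop), integral_const_mul, integral_const_mul]
  calc _ ≤ 2 * (1728 * (n : ℝ) ^ 3 * (4 * M * r) ^ 2)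
        + 18 * (((n : ℝ) - 1) * ((n : ℝ) - 2)) ^ 2 * ((n : ℝ) * p) := by
        gcongr
        · exact i3.trans (by gcongr)
        · exact i1.trans (by gcongr)
    _ = _ := by ring

end Variance

section Limits

variable {r : ℕ → ℝ} (hr : Tendsto r atTop (𝓝 0)) (hpos : ∀ᶠ n in atTop, 0 < r n)

omit hg in
theorem eventually_cast_pos : ∀ᶠ n : ℕ in atTop, (0 : ℝ) < n := by
  filter_upwards [eventually_gt_atTop 0] with n hn
  exact_mod_cast hn

omit hg in
theorem tendsto_one_sub_div (a : ℝ) : Tendsto (fun n : ℕ => 1 - a / (n : ℝ)) atTop (𝓝 1) := by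
  have := (tendsto_const_div_atTop_nhds_zero_nat a).const_sub 1
  simpa using this

-- The two terms are of order (n³ r²)⁻¹ and n⁻¹, which is where the condition n³ r² → ∞ enters.
include hpos in
theorem tendsto_variance_div (h32 : Tendsto (fun n : ℕ => (n : ℝ) ^ 3 * r n ^ 2) atTop atTop) :
    Tendsto (fun n : ℕ => ((n : ℝ) ^ 3 * (4 * M * r n) ^ 2 + (n : ℝ) ^ 5 * (4 * M * r n) ^ 4)
      / (4 * (n : ℝ) ^ 3 * r n ^ 2 * Ef2 g) ^ 2) atTop (𝓝 0) := by
  have hF := hg.Ef2_pos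
  have h1 := ((h32.inv_tendsto_atTop).const_mul (M ^ 2 / Ef2 g ^ 2)).add
    ((tendsto_const_div_atTop_nhds_zero_nat 1).const_mul (16 * M ^ 4 / Ef2 g ^ 2))
  simp only [mul_zero, add_zero] at h1
  refine h1.congr' ?_
  filter_upwards [hpos, eventually_cast_pos] with n hn hn'
  simp only [Pi.inv_apply]
  field_simp
  ring

include hr hpos in
theorem tendsto_integral_sq_path (h32 : Tendsto (fun n : ℕ => (n : ℝ) ^ 3 * r n ^ 2) atTop atTop) :
    Tendsto (fun n : ℕ => ∫ x : Fin n → ℝ, (distinctSum₃ (path (r n)) x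
      / (4 * (n : ℝ) ^ 3 * r n ^ 2 * Ef2 g) - 1) ^ 2 ∂(Measure.pi fun _ => law g))
      atTop (𝓝 0) := by
  have := hg.isProbabilityMeasure
  have hF := hg.Ef2_pos
  have hM := hg.one_le
  have hES : Tendsto (fun n => kmean (law g) (path (r n)) / (4 * r n ^ 2 * Ef2 g)) atTop (𝓝 1) := by
    rw [tendsto_iff_norm_sub_tendsto_zero]
    have hb : Tendsto (fun n => 323 * M ^ 2 / (4 * Ef2 g) * r n ^ 2) atTop (𝓝 0) := by
      have := (hr.pow 2).const_mul (323 * M ^ 2 / (4 * Ef2 g))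
      simpa using this
    refine squeeze_zero' (Eventually.of_forall fun n => norm_nonneg _) ?_ hb
    filter_upwards [hpos, hr.eventually_lt_const (by norm_num : (0 : ℝ) < 1 / 4)] with n hn hn'
    have h := hg.abs_kmean_path_sub_le hn.le hn'
    have e : kmean (law g) (path (r n)) / (4 * r n ^ 2 * Ef2 g) - 1
        = (kmean (law g) (path (r n)) - 4 * r n ^ 2 * Ef2 g) / (4 * r n ^ 2 * Ef2 g) := by
      field_simp
    rw [Real.norm_eq_abs, e, abs_div, abs_of_pos (by positivity : 0 < 4 * r n ^ 2 * Ef2 g),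
      div_le_iff₀ (by positivity)]
    refine h.trans (le_of_eq ?_)
    field_simp
  have hlim : Tendsto (fun n : ℕ => 2 * (12000 * (((n : ℝ) ^ 3 * (4 * M * r n) ^ 2
      + (n : ℝ) ^ 5 * (4 * M * r n) ^ 4) / (4 * (n : ℝ) ^ 3 * r n ^ 2 * Ef2 g) ^ 2))
      + 2 * ((1 - 1 / (n : ℝ)) * (1 - 2 / (n : ℝ))
        * (kmean (law g) (path (r n)) / (4 * r n ^ 2 * Ef2 g)) - 1) ^ 2) atTop (𝓝 0) := by
    have h1 := ((hg.tendsto_variance_div hpos h32).const_mul 12000).const_mul 2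
    have h2 := (((((tendsto_one_sub_div 1).mul (tendsto_one_sub_div 2)).mul hES).sub_const 1).pow
      2).const_mul 2
    simpa using h1.add h2
  refine squeeze_zero' (Eventually.of_forall fun n => integral_nonneg fun _ => sq_nonneg _) ?_ hlim
  filter_upwards [hpos, hr.eventually_lt_const (by norm_num : (0 : ℝ) < 1 / 8),
    eventually_ge_atTop 1] with n hn hn8 hn1
  have hN : (0 : ℝ) < n := by exact_mod_cast hn1
  have hk := localKernel_path hn.le
  have h := hg.integral_sq_distinctSum₃_sub_le hn1 hn.le hn8 hk
  set E := kmean (law g) (path (r n))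
  set m := 4 * (n : ℝ) ^ 3 * r n ^ 2 * Ef2 g with hm
  have hm0 : 0 < m := by positivity
  set d := (n : ℝ) * ((n : ℝ) - 1) * ((n : ℝ) - 2) * E with hd
  have hkb := hk.bdd
  have hb1 : BddMeas fun x : Fin n → ℝ => distinctSum₃ (path (r n)) x := hkb.distinctSum₃
  have hpt : ∀ x : Fin n → ℝ, (distinctSum₃ (path (r n)) x / m - 1) ^ 2
      ≤ 2 * (m⁻¹ ^ 2 * (distinctSum₃ (path (r n)) x - d) ^ 2) + 2 * (d / m - 1) ^ 2 := fun x => by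
    have := add_sq_le (a := m⁻¹ * (distinctSum₃ (path (r n)) x - d)) (b := d / m - 1)
    refine le_trans (le_of_eq ?_) (this.trans (le_of_eq ?_))
    · field_simp
      ring
    · ring
  have e : d / m = (1 - 1 / (n : ℝ)) * (1 - 2 / (n : ℝ)) * (E / (4 * r n ^ 2 * Ef2 g)) := by
    rw [hd, hm]
    field_simp
  refine (BddMeas.integral_mono (by simp_rw [div_eq_inv_mul]; fun_prop) (by fun_prop) hpt).trans ?_
  rw [BddMeas.integral_add (by fun_prop) (by fun_prop), integral_const_mul, integral_const_mul,
    integral_const, probReal_univ, one_smul, e]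
  gcongr 2 * ?_ + _
  rw [mul_div_assoc', div_eq_inv_mul, ← inv_pow]
  gcongr

-- The generic short-range variance bound is enough here. No cancellation in `proj₁` is used, so the
-- limit 3/4 does not depend on the regime.
include hr hpos in
theorem tendsto_integral_sq_centKer_div
    (h32 : Tendsto (fun n : ℕ => (n : ℝ) ^ 3 * r n ^ 2) atTop atTop) :
    Tendsto (fun n : ℕ => ∫ x : Fin n → ℝ, (1 / (4 * (n : ℝ) ^ 3 * r n ^ 2 * Ef2 g) *
      distinctSum₃ (centKer g (r n)) x) ^ 2 ∂(Measure.pi fun _ => law g))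
      atTop (𝓝 0) := by
  have := hg.isProbabilityMeasure
  have hF := hg.Ef2_pos
  have hlim := (hg.tendsto_variance_div hpos h32).const_mul 12000
  rw [mul_zero] at hlim
  refine squeeze_zero' (Eventually.of_forall fun n => integral_nonneg fun _ => sq_nonneg _) ?_ hlim
  filter_upwards [hpos, hr.eventually_lt_const (by norm_num : (0 : ℝ) < 1 / 8),
    eventually_ge_atTop 1] with n hn hn8 hn1
  have h := hg.integral_sq_distinctSum₃_sub_le hn1 hn.le hn8 (hg.localKernel_centKer hn.le)
  rw [hg.kmean_centKer hn.le] at h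
  simp only [mul_zero, sub_zero] at h
  have e : ∀ x : Fin n → ℝ, (1 / (4 * (n : ℝ) ^ 3 * r n ^ 2 * Ef2 g) *
      distinctSum₃ (centKer g (r n)) x) ^ 2 = ((4 * (n : ℝ) ^ 3 * r n ^ 2 * Ef2 g) ^ 2)⁻¹ *
      distinctSum₃ (centKer g (r n)) x ^ 2 := fun x => by rw [mul_pow, one_div, inv_pow]
  simp_rw [e]
  rw [integral_const_mul, mul_div_assoc', div_eq_inv_mul]
  gcongr

include hr hpos in
theorem tendsto_triRatio : Tendsto (fun n => triRatio g (r n)) atTop (𝓝 (3 / 4)) := by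
  obtain ⟨C, r₀, hC, hr₀, -, h⟩ := hg.exists_abs_triRatio_sub_le
  rw [tendsto_iff_norm_sub_tendsto_zero]
  have hb : Tendsto (fun n => C * r n ^ 2) atTop (𝓝 0) := by
    have := (hr.pow 2).const_mul C
    simpa using this
  refine squeeze_zero' (Eventually.of_forall fun n => norm_nonneg _) ?_ hb
  filter_upwards [hpos, hr.eventually_le_const hr₀] with n hn hn'
  exact (h (r n) hn hn').2

end Limits

section Clustering

variable {r : ℕ → ℝ} (hr : Tendsto r atTop (𝓝 0))
  {Ω : ℕ → Type*} [∀ n, MeasurableSpace (Ω n)] {P : ∀ n, Measure (Ω n)}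
  [∀ n, IsProbabilityMeasure (P n)] {X : ∀ n, Fin n → Ω n → ℝ}
  (hX_law : ∀ n i, HasLaw (X n i) (law g) (P n)) (hX_indep : ∀ n, iIndepFun (X n) (P n))
  {C : ∀ n, Ω n → ℝ} (hC : ∀ n ω, C n ω = clustering (adj (r n) fun i => X n i ω))

omit [∀ n, IsProbabilityMeasure (P n)] in
include hX_law hX_indep in
theorem hasLaw_positions (n : ℕ) :
    HasLaw (fun ω i => X n i ω) (Measure.pi fun _ : Fin n => law g) (P n) := by
  have := hg.isProbabilityMeasure
  exact (hX_indep n).hasLaw_pi (hX_law n)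

omit [∀ n, IsProbabilityMeasure (P n)] in
include hX_law hX_indep hC in
theorem ae_clustering_eq (n : ℕ) : C n =ᵐ[P n] fun ω =>
    distinctSum₃ (tri (r n)) (fun i => X n i ω) / distinctSum₃ (path (r n)) (fun i => X n i ω) := by
  have hlaw := hg.hasLaw_positions hX_law hX_indep n
  have h := hg.ae_forall_mem_Icc (ι := Fin n)
  rw [← hlaw.map_eq] at h
  filter_upwards [ae_of_ae_map hlaw.aemeasurable h] with ω hω
  rw [hC, clustering_eq hω]

include hr hX_law hX_indep hC

theorem tendsto_measure_clustering (hpos : ∀ᶠ n in atTop, 0 < r n)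
    (h32 : Tendsto (fun n : ℕ => (n : ℝ) ^ 3 * r n ^ 2) atTop atTop) {ε : ℝ} (hε : 0 < ε) :
    Tendsto (fun n => P n {ω | ε ≤ |C n ω - 3 / 4|}) atTop (𝓝 0) := by
  have := hg.isProbabilityMeasure
  have hF := hg.Ef2_pos
  refine tendsto_measure_ratio (hg.hasLaw_positions hX_law hX_indep)
    (T := fun n => distinctSum₃ (tri (r n))) (D := fun n => distinctSum₃ (path (r n)))
    (m := fun n => 4 * (n : ℝ) ^ 3 * r n ^ 2 * Ef2 g) (μ := fun n => triRatio g (r n))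
    (fun n => (bddMeas_tri _).distinctSum₃) (fun n => (bddMeas_path _).distinctSum₃) ?_
    (hg.ae_clustering_eq hX_law hX_indep hC) (hg.tendsto_integral_sq_path hr hpos h32) ?_
    (hg.tendsto_triRatio hr hpos) hε
  · filter_upwards [hpos, eventually_cast_pos] with n hn hn'
    positivity
  · simp_rw [← distinctSum₃_ker]
    exact hg.tendsto_integral_sq_centKer_div hr hpos h32

/-- Common end of the three regimes: `l` is the normalisation divided by the limit of the
denominator, and `W'` is the dominating statistic. -/
theorem tendstoInDistribution_clustering (hpos : ∀ᶠ n in atTop, 0 < r n)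
    (h32 : Tendsto (fun n : ℕ => (n : ℝ) ^ 3 * r n ^ 2) atTop atTop) {b l : ℕ → ℝ}
    (hl : ∀ᶠ n in atTop, b n / (4 * (n : ℝ) ^ 3 * r n ^ 2 * Ef2 g) = l n)
    {W' : ∀ n, (Fin n → ℝ) → ℝ} (hW' : ∀ n, BddMeas (W' n)) {B : ℝ}
    (hB : ∀ᶠ n in atTop, l n ^ 2 * ∫ x : Fin n → ℝ, distinctSum₃ (centKer g (r n)) x ^ 2
      ∂(Measure.pi fun _ => law g) ≤ B)
    (hWW : Tendsto (fun n => ∫ x : Fin n → ℝ, (l n * distinctSum₃ (centKer g (r n)) x - W' n x) ^ 2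
      ∂(Measure.pi fun _ => law g)) atTop (𝓝 0))
    (hchar : ∀ t : ℝ, Tendsto (fun n => ∫ x, Complex.exp (((t * W' n x : ℝ) : ℂ) * Complex.I)
      ∂(Measure.pi fun _ : Fin n => law g)) atTop (𝓝 (Complex.exp (-(t : ℂ) ^ 2 / 2)))) :
    TendstoInDistribution (fun (n : ℕ) ω => b n * (C n ω - mu g (r n))) atTop id P
      (gaussianReal 0 1) := by
  have := hg.isProbabilityMeasure
  have hF := hg.Ef2_pos
  refine tendstoInDistribution_of_ratio (hg.hasLaw_positions hX_law hX_indep)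
    (T := fun n => distinctSum₃ (tri (r n))) (D := fun n => distinctSum₃ (path (r n)))
    (m := fun n => 4 * (n : ℝ) ^ 3 * r n ^ 2 * Ef2 g) (μ := fun n => triRatio g (r n)) (b := b)
    (B := B) (fun n => (bddMeas_tri _).distinctSum₃) (fun n => (bddMeas_path _).distinctSum₃) hW' ?_
    (fun n => ?_) ?_ (hg.tendsto_integral_sq_path hr hpos h32) ?_ hchar
  · filter_upwards [hpos, eventually_cast_pos] with n hn hn'
    positivity
  · filter_upwards [hg.ae_clustering_eq hX_law hX_indep hC n] with ω hω
    rw [hω, hg.mu_eq]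
  · filter_upwards [hB, hl] with n hn hln
    simp_rw [← distinctSum₃_ker, hln, mul_pow]
    rw [integral_const_mul]
    exact hn
  · refine hWW.congr' ?_
    filter_upwards [hl] with n hln
    simp_rw [← distinctSum₃_ker, hln]
    rfl

end Clustering

end SmoothDensity

theorem tendsto_of_norm_sub_le {u : ℕ → ℂ} {a : ℂ} {K : ℝ} {δ : ℕ → ℝ}
    (h : ∀ᶠ n in atTop, ‖u n - a‖ ≤ K * δ n) (hδ : Tendsto δ atTop (𝓝 0)) :
    Tendsto u atTop (𝓝 a) := by
  rw [tendsto_iff_norm_sub_tendsto_zero]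
  have := hδ.const_mul K
  rw [mul_zero] at this
  exact squeeze_zero' (Eventually.of_forall fun n => norm_nonneg _) h this

theorem tendsto_inv_sqrt_cast : Tendsto (fun n : ℕ => (√(n : ℝ))⁻¹) atTop (𝓝 0) :=
  tendsto_inv_atTop_zero.comp (Real.tendsto_sqrt_atTop.comp tendsto_natCast_atTop_atTop)

/-! ### Dense regime: the linear part dominates. -/

namespace SmoothDensity

variable {g g1 g2 : ℝ → ℝ} {c M : ℝ} (hg : SmoothDensity g g1 g2 c M)
  {r : ℕ → ℝ} (hr0 : ∀ n, 0 ≤ r n) (hr : Tendsto r atTop (𝓝 0)) (hpos : ∀ᶠ n in atTop, 0 < r n)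

include hg hr0 in
theorem bddMeas_proj₁_centKer (n : ℕ) : BddMeas (proj₁ (law g) (centKer g (r n))) := by
  have := hg.isProbabilityMeasure
  exact (hg.localKernel_centKer (hr0 n)).bdd_proj₁

include hg hr0 in
theorem integral_sq_proj₁_centKer_le {n : ℕ} {B : ℝ}
    (h : ∀ x, |proj₁ (law g) (centKer g (r n)) x| ≤ B) :
    ∫ x, proj₁ (law g) (centKer g (r n)) x ^ 2 ∂(law g) ≤ B ^ 2 := by
  have := hg.isProbabilityMeasure
  have hb := hg.bddMeas_proj₁_centKer hr0 n
  calc _ ≤ ∫ x, B ^ 2 ∂(law g) := by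
        refine BddMeas.integral_mono (by fun_prop) (by fun_prop) fun x => ?_
        rw [← sq_abs]
        exact pow_le_pow_left₀ (abs_nonneg _) (h x) 2
    _ = _ := by simp

section Dense

include hg hr0 hr hpos

/-- The supremum and the standard deviation of `proj₁` are both of order r⁴, so each normalised
summand is O(n^{-1/2}) uniformly. The variance is asymptotically 9 n⁵ l² · r⁸ σ₁²/16 with l the
normalising factor, which is 1. -/
theorem tendsto_charFun_dense (hs : 0 < sigma1Sq g) {s : ℕ → ℝ}
    (hs' : ∀ᶠ n : ℕ in atTop, s n = 3 * ((n : ℝ) - 1) * ((n : ℝ) - 2) *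
      (4 * √(n : ℝ) / (3 * (n : ℝ) ^ 3 * r n ^ 4 * √(sigma1Sq g)))) (t : ℝ) :
    Tendsto (fun n => ∫ x, Complex.exp (((t * (s n * ∑ i, proj₁ (law g) (centKer g (r n)) (x i)) : ℝ)
      : ℂ) * Complex.I) ∂(Measure.pi fun _ : Fin n => law g)) atTop
      (𝓝 (Complex.exp (-(t : ℂ) ^ 2 / 2))) := by
  have := hg.isProbabilityMeasure
  obtain ⟨C, r₀, hC, hr₀, hr₀8, h⟩ := hg.exists_integral_sq_proj₁_centKer
  set S := sigma1Sq g
  set I : ℕ → ℝ := fun n => ∫ x, proj₁ (law g) (centKer g (r n)) x ^ 2 ∂(law g) with hI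
  have hτlim : Tendsto (fun n : ℕ => (n : ℝ) * s n ^ 2 * I n) atTop (𝓝 1) := by
    have h1 : Tendsto (fun n => 16 * I n / (r n ^ 8 * S)) atTop (𝓝 1) := by
      rw [tendsto_iff_norm_sub_tendsto_zero]
      have hb : Tendsto (fun n => 16 * C / S * r n) atTop (𝓝 0) := by
        have := hr.const_mul (16 * C / S)
        simpa using this
      refine squeeze_zero' (Eventually.of_forall fun n => norm_nonneg _) ?_ hb
      filter_upwards [hpos, hr.eventually_le_const hr₀] with n hn hn'
      have h2 := (h (r n) hn hn').2
      have e : 16 * I n / (r n ^ 8 * S) - 1 = (I n - r n ^ 8 / 16 * S) * (16 / (r n ^ 8 * S)) := by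
        field_simp
      rw [Real.norm_eq_abs, e, abs_mul, abs_of_pos (by positivity : 0 < 16 / (r n ^ 8 * S))]
      calc _ ≤ C * r n ^ 9 * (16 / (r n ^ 8 * S)) := by gcongr
        _ = _ := by field_simp
    have h2 := (((tendsto_one_sub_div 1).mul (tendsto_one_sub_div 2)).pow 2).mul h1
    simp only [mul_one, one_pow] at h2
    refine h2.congr' ?_
    filter_upwards [hpos, eventually_cast_pos, hs'] with n hn hN hsn
    rw [hsn]
    have q1 : √(n : ℝ) ^ 2 = n := Real.sq_sqrt hN.le
    have q2 : √S ^ 2 = S := Real.sq_sqrt hs.le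
    have e : (n : ℝ) * (3 * ((n : ℝ) - 1) * ((n : ℝ) - 2) *
        (4 * √(n : ℝ) / (3 * (n : ℝ) ^ 3 * r n ^ 4 * √S))) ^ 2 * I n
        = (n : ℝ) * (((n : ℝ) - 1) * ((n : ℝ) - 2)) ^ 2 * 16 * √(n : ℝ) ^ 2
          / ((n : ℝ) ^ 6 * r n ^ 8 * √S ^ 2) * I n := by
      field_simp
      ring
    rw [e, q1, q2]
    field_simp
  have hηlim : Tendsto (fun n : ℕ => 4 * C / √S * (√(n : ℝ))⁻¹) atTop (𝓝 0) := by
    have := tendsto_inv_sqrt_cast.const_mul (4 * C / √S)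
    simpa using this
  have hδ : Tendsto (fun n : ℕ => |(n : ℝ) * s n ^ 2 * I n - 1|
      + 4 * C / √S * (√(n : ℝ))⁻¹ * √((n : ℝ) * s n ^ 2 * I n)
      + (n : ℝ) * s n ^ 2 * I n * (4 * C / √S * (√(n : ℝ))⁻¹)) atTop (𝓝 0) := by
    have := ((hτlim.sub_const 1).abs.add (hηlim.mul hτlim.sqrt)).add (hτlim.mul hηlim)
    simpa using this
  refine tendsto_of_norm_sub_le (K := 2 * (1 + |t|) ^ 2 * |t| * Real.exp (t ^ 2 / 2)) ?_ hδ
  filter_upwards [hpos, hr.eventually_le_const hr₀, eventually_ge_atTop 1, hs'] with n hn hn' hn1 hsn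
  have hN : (1 : ℝ) ≤ n := by exact_mod_cast hn1
  refine norm_charFun_sum_le (hg.bddMeas_proj₁_centKer hr0 n) (hg.kmean_centKer (hr0 n)) (fun a => ?_)
    (by rw [Fintype.card_fin]) t
  have h2 := (h (r n) hn hn').1 a
  have h3 : |s n| ≤ 3 * (n : ℝ) ^ 2 *
      (4 * √(n : ℝ) / (3 * (n : ℝ) ^ 3 * r n ^ 4 * √S)) := by
    rw [hsn, abs_mul, abs_of_nonneg (a := 4 * √(n : ℝ) / _) (by positivity)]
    gcongr
    rw [abs_le]
    constructor <;> nlinarith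
  have hq : √(n : ℝ) ≠ 0 := by positivity
  have q1 : √(n : ℝ) * √(n : ℝ) = n := Real.mul_self_sqrt (by linarith)
  rw [abs_mul]
  calc _ ≤ 3 * (n : ℝ) ^ 2 * (4 * √(n : ℝ) / (3 * (n : ℝ) ^ 3 * r n ^ 4 * √S)) * (C * r n ^ 4) :=
        mul_le_mul h3 h2 (abs_nonneg _) (by positivity)
    _ = 4 * C / √S * (√(n : ℝ) / n) := by field_simp
    _ = 4 * C / √S * (√(n : ℝ))⁻¹ := by
        congr 1
        rw [Real.sqrt_div_self]

variable {Ω : ℕ → Type*} [∀ n, MeasurableSpace (Ω n)] {P : ∀ n, Measure (Ω n)}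
  [∀ n, IsProbabilityMeasure (P n)] {X : ∀ n, Fin n → Ω n → ℝ}
  (hX_law : ∀ n i, HasLaw (X n i) (law g) (P n)) (hX_indep : ∀ n, iIndepFun (X n) (P n))
  {C : ∀ n, Ω n → ℝ} (hC : ∀ n ω, C n ω = clustering (adj (r n) fun i => X n i ω))
include hX_law hX_indep hC

theorem tendstoInDistribution_dense (hs : 0 < sigma1Sq g)
    (h5 : Tendsto (fun n : ℕ => (n : ℝ) * r n ^ 5) atTop atTop)
    (h32 : Tendsto (fun n : ℕ => (n : ℝ) ^ 3 * r n ^ 2) atTop atTop) :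
    TendstoInDistribution
        (fun (n : ℕ) ω => 16 * √(n : ℝ) * Ef2 g / (3 * r n ^ 2 * √(sigma1Sq g)) *
          (C n ω - mu g (r n))) atTop id P (gaussianReal 0 1) := by
  have := hg.isProbabilityMeasure
  have hF := hg.Ef2_pos
  have hM := hg.one_le
  obtain ⟨K, r₀, hK, hr₀, hr₀8, h⟩ := hg.exists_integral_sq_proj₁_centKer
  set S := sigma1Sq g
  have hy := h5.inv_tendsto_atTop
  set l : ℕ → ℝ := fun n => 4 * √(n : ℝ) / (3 * (n : ℝ) ^ 3 * r n ^ 4 * √S) with hl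
  have hl2 : ∀ᶠ n : ℕ in atTop, l n ^ 2 = 16 / (9 * (n : ℝ) ^ 5 * r n ^ 8 * S) := by
    filter_upwards [hpos, eventually_cast_pos] with n hn hN
    have q1 : √(n : ℝ) ^ 2 = n := Real.sq_sqrt hN.le
    have q2 : √S ^ 2 = S := Real.sq_sqrt hs.le
    have e : l n ^ 2 = 16 * √(n : ℝ) ^ 2 / (9 * (n : ℝ) ^ 6 * r n ^ 8 * √S ^ 2) := by
      rw [hl]
      ring
    rw [e, q1, q2]
    field_simp
  refine hg.tendstoInDistribution_clustering hr hX_law hX_indep hC hpos h32 (l := l)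
    (W' := fun n x => 3 * ((n : ℝ) - 1) * ((n : ℝ) - 2) * l n *
      ∑ i, proj₁ (law g) (centKer g (r n)) (x i)) ?_ ?_
    (B := 32000 / (3 * S) * K ^ 2 + 1) ?_ ?_
    (hg.tendsto_charFun_dense hr0 hr hpos hs (Eventually.of_forall fun n => rfl))
  · filter_upwards [hpos, eventually_cast_pos] with n hn hN
    rw [hl]
    field_simp
    norm_num
  · intro n
    have := hg.bddMeas_proj₁_centKer hr0 n
    fun_prop
  -- Relative to the linear variance, the cubic and quadratic ones are of order (n r⁵)⁻² r⁴ and (n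
  -- r⁵)⁻¹.
  · have hlim : Tendsto (fun n : ℕ => 32000 / (3 * S) * (16 * M ^ 2 * (((n : ℝ) * r n ^ 5)⁻¹ ^ 2
        * r n ^ 4) + 64 * M ^ 3 * ((n : ℝ) * r n ^ 5)⁻¹ + K ^ 2)) atTop
        (𝓝 (32000 / (3 * S) * K ^ 2)) := by
      have := (((((hy.pow 2).mul (hr.pow 4)).const_mul (16 * M ^ 2)).add
        (hy.const_mul (64 * M ^ 3))).add_const (K ^ 2)).const_mul (32000 / (3 * S))
      simpa using this
    filter_upwards [hlim.eventually_le_const (lt_add_one _), hpos, hr.eventually_le_const hr₀,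
      eventually_ge_atTop 1, hl2] with n hle hn hn' hn1 hln
    have hN : (0 : ℝ) < n := by exact_mod_cast hn1
    have h1 := h (r n) hn hn'
    have hp := hg.integral_sq_proj₁_centKer_le hr0 h1.1
    have h2 := hg.integral_sq_centKer_le hn1 hn.le (by linarith) hp
    calc _ ≤ l n ^ 2 * _ := mul_le_mul_of_nonneg_left h2 (sq_nonneg _)
      _ = _ := by
        rw [hln]
        field_simp
        ring
      _ ≤ _ := hle
  · have hlim : Tendsto (fun n : ℕ => 16 / (9 * S) * (3456 * (16 * M ^ 2 * (((n : ℝ) * r n ^ 5)⁻¹ ^ 2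
        * r n ^ 4)) + 72 * (64 * M ^ 3 * ((n : ℝ) * r n ^ 5)⁻¹))) atTop (𝓝 0) := by
      have := (((((hy.pow 2).mul (hr.pow 4)).const_mul (16 * M ^ 2)).const_mul 3456).add
        ((hy.const_mul (64 * M ^ 3)).const_mul 72)).const_mul (16 / (9 * S))
      simpa using this
    refine squeeze_zero' (Eventually.of_forall fun n => integral_nonneg fun _ => sq_nonneg _) ?_ hlim
    filter_upwards [hpos, hr.eventually_le_const hr₀, eventually_ge_atTop 1, hl2] with n hn hn' hn1 hln
    have hN : (1 : ℝ) ≤ n := by exact_mod_cast hn1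
    have h2 := hg.integral_sq_centKer_sub_sum_le (n := n) hn.le (by linarith)
    have e : ∀ x : Fin n → ℝ, (l n * distinctSum₃ (centKer g (r n)) x
        - 3 * ((n : ℝ) - 1) * ((n : ℝ) - 2) * l n * ∑ i, proj₁ (law g) (centKer g (r n)) (x i)) ^ 2
        = l n ^ 2 * (distinctSum₃ (centKer g (r n)) x - 3 * ((n : ℝ) - 1) * ((n : ℝ) - 2) *
          ∑ i, proj₁ (law g) (centKer g (r n)) (x i)) ^ 2 := fun x => by ring
    simp_rw [e]
    rw [integral_const_mul]
    have hq : ((n : ℝ) * ((n : ℝ) - 2)) ^ 2 ≤ (n : ℝ) ^ 4 := by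
      have : ((n : ℝ) - 2) ^ 2 ≤ (n : ℝ) ^ 2 := by nlinarith
      rw [mul_pow]
      calc _ ≤ (n : ℝ) ^ 2 * (n : ℝ) ^ 2 := by gcongr
        _ = _ := by ring
    calc _ ≤ l n ^ 2 * (3456 * (n : ℝ) ^ 3 * (4 * M * r n) ^ 2
          + 72 * (n : ℝ) ^ 4 * (4 * M * r n) ^ 3) := by
          refine mul_le_mul_of_nonneg_left (h2.trans ?_) (sq_nonneg _)
          gcongr
      _ = _ := by
        rw [hln]
        field_simp
        ring

end Dense

end SmoothDensity

/-! ### Intermediate regime: the quadratic part dominates. -/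

namespace SmoothDensity

variable {g g1 g2 : ℝ → ℝ} {c M : ℝ} (hg : SmoothDensity g g1 g2 c M)
  {r : ℕ → ℝ} (hr0 : ∀ n, 0 ≤ r n) (hr : Tendsto r atTop (𝓝 0)) (hpos : ∀ᶠ n in atTop, 0 < r n)

include hg hr0 hr hpos

-- With variance scale v of order r³, the error terms of the quadratic limit theorem are v₄/(n² v²)
-- = O(1/(n² r)), w²/(n v²) = O(1/n) and, for the contraction, O(r). The hypothesis on `proj₁` makes
-- v − 2p, the second moment of `deg₂`, asymptotic to v.
set_option maxHeartbeats 1000000 in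
theorem tendsto_charFun_intermediate
    (hnr : Tendsto (fun n : ℕ => (n : ℝ) * r n) atTop atTop)
    (hp : Tendsto (fun n : ℕ => (n : ℝ) * (∫ x, proj₁ (law g) (centKer g (r n)) x ^ 2 ∂(law g))
      / r n ^ 3) atTop (𝓝 0)) {l : ℕ → ℝ}
    (hl : ∀ᶠ n : ℕ in atTop, l n ^ 2 = ((n : ℝ) - 2) ^ 2 / (2 * (n : ℝ) ^ 4 *
      ∫ x, ∫ y, proj₂ (law g) (centKer g (r n)) x y ^ 2 ∂(law g) ∂(law g))) (t : ℝ) :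
    Tendsto (fun n => ∫ x, Complex.exp (((t * (l n * distinctSum₂ (deg₂ (law g) (centKer g (r n))) x)
      : ℝ) : ℂ) * Complex.I) ∂(Measure.pi fun _ : Fin n => law g)) atTop
      (𝓝 (Complex.exp (-(t : ℂ) ^ 2 / 2))) := by
  have := hg.isProbabilityMeasure
  have hM := hg.one_le
  obtain ⟨K, r₁, hK, hr₁, hr₁8, h1⟩ := hg.exists_integral_sq_proj₁_centKer
  obtain ⟨D, r₂, hD, hr₂, hr₂8, h2⟩ := hg.exists_le_integral_sq_proj₂_centKer
  obtain ⟨v, hv⟩ : ∃ v : ℕ → ℝ, ∀ n, ∫ x, ∫ y, proj₂ (law g) (centKer g (r n)) x y ^ 2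
    ∂(law g) ∂(law g) = v n := ⟨_, fun _ => rfl⟩
  obtain ⟨p, hpdef⟩ : ∃ p : ℕ → ℝ, ∀ n, ∫ x, proj₁ (law g) (centKer g (r n)) x ^ 2 ∂(law g) = p n :=
    ⟨_, fun _ => rfl⟩
  simp only [hv] at hl
  simp only [hpdef] at hp
  have hp0 : ∀ n, 0 ≤ p n := fun n => hpdef n ▸ integral_nonneg fun _ => sq_nonneg _
  have hv0' : ∀ n, 0 ≤ v n := fun n =>
    hv n ▸ integral_nonneg fun _ => integral_nonneg fun _ => sq_nonneg _
  set A₄ := 8 * (4 * M) ^ 5 + 128 * K ^ 4 with hA₄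
  set A₂ := 2 * (4 * M) ^ 3 + 8 * K ^ 2 with hA₂
  set A₇ := 4 * (4 * M) ^ 7 + 2 * (64 * M ^ 2 * K + 4 * K ^ 2) ^ 2 with hA₇
  set Xb : ℕ → ℝ := fun n => A₄ / (4 * D ^ 2) * (((n : ℝ) * r n)⁻¹ * (1 / (n : ℝ)))
    + A₂ ^ 2 / (4 * D ^ 2) * (1 / (n : ℝ)) with hXb
  have h1n := tendsto_const_div_atTop_nhds_zero_nat (1 : ℝ)
  have hXlim : Tendsto Xb atTop (𝓝 0) := by
    have := ((hnr.inv_tendsto_atTop.mul h1n).const_mul (A₄ / (4 * D ^ 2))).add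
      (h1n.const_mul (A₂ ^ 2 / (4 * D ^ 2)))
    simp only [mul_zero, add_zero] at this
    exact this
  have hpv : Tendsto (fun n => p n / v n) atTop (𝓝 0) := by
    have hb := hp.const_mul (1 / D)
    rw [mul_zero] at hb
    refine squeeze_zero' (Eventually.of_forall fun n => div_nonneg (hp0 n) (hv0' n)) ?_ hb
    filter_upwards [hpos, hr.eventually_le_const hr₂, eventually_ge_atTop 1] with n hn hn' hn1
    have hN : (1 : ℝ) ≤ n := by exact_mod_cast hn1
    have hvn := (h2 (r n) hn hn').trans_eq (hv n)
    calc p n / v n ≤ p n / (D * r n ^ 3) := div_le_div_of_nonneg_left (hp0 n) (by positivity) hvn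
      _ ≤ (n * p n) / (D * r n ^ 3) := by
          gcongr
          nlinarith [hp0 n]
      _ = _ := by field_simp
  have hδ : Tendsto (fun n : ℕ => |(1 - 2 / (n : ℝ)) ^ 2 * (1 - 1 / (n : ℝ)) * (1 - 2 * (p n / v n)) - 1|
      + 20 * √(Xb n) + 4 * √(A₇ / (4 * D ^ 2) * r n) + √(Xb n) + 100 * √(Xb n)) atTop (𝓝 0) := by
    have e1 := (((((tendsto_one_sub_div 2).pow 2).mul (tendsto_one_sub_div 1)).mul
      ((hpv.const_mul 2).const_sub 1)).sub_const 1).abs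
    have e2 := hXlim.sqrt
    have e3 := (hr.const_mul (A₇ / (4 * D ^ 2))).sqrt
    have := (((e1.add (e2.const_mul 20)).add (e3.const_mul 4)).add e2).add (e2.const_mul 100)
    simpa using this
  refine tendsto_of_norm_sub_le (K := 2 * (1 + |t|) ^ 2 * |t| * Real.exp (t ^ 2 / 2)) ?_ hδ
  filter_upwards [hpos, hr.eventually_le_const hr₁, hr.eventually_le_const hr₂, eventually_ge_atTop 1,
    hl] with n hn hn₁ hn₂ hn1 hln
  have hN : (1 : ℝ) ≤ n := by exact_mod_cast hn1
  have : Nonempty (Fin n) := ⟨⟨0, hn1⟩⟩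
  have hρ8 : r n < 1 / 8 := by linarith
  have hρ1 : r n ≤ 1 := by linarith
  have hk := hg.localKernel_centKer (hr0 n)
  have hmean := hg.kmean_centKer (hr0 n)
  have hK1 := (h1 (r n) hn hn₁).1
  have hvn : D * r n ^ 3 ≤ v n := (h2 (r n) hn hn₂).trans_eq (hv n)
  have hv0 : 0 < v n := lt_of_lt_of_le (by positivity) hvn
  have hpow : ∀ i j : ℕ, i ≤ j → r n ^ j ≤ r n ^ i := fun i j hij =>
    pow_le_pow_of_le_one hn.le hρ1 hij
  have b₂ : ∀ a, ∫ b, deg₂ (law g) (centKer g (r n)) a b ^ 2 ∂(law g) ≤ A₂ * r n ^ 3 := fun a => by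
    refine (hk.integral_sq_deg₂_le hg hn.le hρ8 hmean hK1 a).trans ?_
    have := mul_le_mul_of_nonneg_left (hpow 3 8 (by norm_num)) (by positivity : 0 ≤ 8 * K ^ 2)
    calc _ = 2 * (4 * M) ^ 3 * r n ^ 3 + 8 * K ^ 2 * r n ^ 8 := by ring
      _ ≤ 2 * (4 * M) ^ 3 * r n ^ 3 + 8 * K ^ 2 * r n ^ 3 := by linarith
      _ = _ := by ring
  have b₄ : ∫ a, ∫ b, deg₂ (law g) (centKer g (r n)) a b ^ 4 ∂(law g) ∂(law g) ≤ A₄ * r n ^ 5 := by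
    refine (hk.integral_pow_four_deg₂_le hg hn.le hρ8 hmean hK1).trans ?_
    have := mul_le_mul_of_nonneg_left (hpow 5 16 (by norm_num)) (by positivity : 0 ≤ 128 * K ^ 4)
    calc _ = 8 * (4 * M) ^ 5 * r n ^ 5 + 128 * K ^ 4 * r n ^ 16 := by ring
      _ ≤ 8 * (4 * M) ^ 5 * r n ^ 5 + 128 * K ^ 4 * r n ^ 5 := by linarith
      _ = _ := by ring
  have b₇ : ∫ a, ∫ b, (∫ d, deg₂ (law g) (centKer g (r n)) a d * deg₂ (law g) (centKer g (r n)) b d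
      ∂(law g)) ^ 2 ∂(law g) ∂(law g) ≤ A₇ * r n ^ 7 := by
    refine (hk.integral_sq_contraction_deg₂_le hg hn.le hρ8 hmean hK1).trans ?_
    have e1 : 4 * (4 * M * r n) ^ 2 * (K * r n ^ 4) + 4 * (K * r n ^ 4) ^ 2
        ≤ (64 * M ^ 2 * K + 4 * K ^ 2) * r n ^ 6 := by
      have := mul_le_mul_of_nonneg_left (hpow 6 8 (by norm_num)) (by positivity : 0 ≤ 4 * K ^ 2)
      calc _ = 64 * M ^ 2 * K * r n ^ 6 + 4 * K ^ 2 * r n ^ 8 := by ring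
        _ ≤ 64 * M ^ 2 * K * r n ^ 6 + 4 * K ^ 2 * r n ^ 6 := by linarith
        _ = _ := by ring
    have e2 := pow_le_pow_left₀ (by positivity) e1 2
    have e3 := mul_le_mul_of_nonneg_left (hpow 7 12 (by norm_num))
      (by positivity : 0 ≤ 2 * (64 * M ^ 2 * K + 4 * K ^ 2) ^ 2)
    calc _ ≤ 4 * (4 * M) ^ 7 * r n ^ 7 + 2 * ((64 * M ^ 2 * K + 4 * K ^ 2) * r n ^ 6) ^ 2 := by
          linarith
      _ = 4 * (4 * M) ^ 7 * r n ^ 7 + 2 * (64 * M ^ 2 * K + 4 * K ^ 2) ^ 2 * r n ^ 12 := by ring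
      _ ≤ 4 * (4 * M) ^ 7 * r n ^ 7 + 2 * (64 * M ^ 2 * K + 4 * K ^ 2) ^ 2 * r n ^ 7 := by linarith
      _ = _ := by ring
  have hX0 : 0 < Xb n := by positivity
  -- The choice ε = √X balances the two Lindeberg terms, ε and X/ε up to constants.
  have main := norm_charFun_distinctSum₂_le (ν := law g) (ι := Fin n) (l := l n) hk.bdd_deg₂
    (fun a b => hk.deg₂_symm a b) (fun a => hk.integral_deg₂ a) b₂ b₄ b₇ (Real.sqrt_pos.2 hX0) t
  rw [Fintype.card_fin] at main
  refine main.trans ?_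
  have hV := hk.integral_sq_deg₂ (ν := law g)
  rw [hmean, hv, hpdef] at hV
  set V := ∫ a, ∫ b, deg₂ (law g) (centKer g (r n)) a b ^ 2 ∂(law g) ∂(law g) with hVdef
  have hV' : V = v n - 2 * p n := by rw [hV]; ring
  have hVle : V ≤ v n := by rw [hV']; linarith [hp0 n]
  have hV0 : 0 ≤ V := integral_nonneg fun _ => integral_nonneg fun _ => sq_nonneg _
  have hn2 : ((n : ℝ) - 2) ^ 2 ≤ (n : ℝ) ^ 2 := by nlinarith
  have hl2v : l n ^ 2 ≤ 1 / (2 * (n : ℝ) ^ 2 * v n) := by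
    rw [hln]
    calc _ ≤ (n : ℝ) ^ 2 / (2 * (n : ℝ) ^ 4 * v n) := by gcongr
      _ = _ := by field_simp
  have hl2 : l n ^ 2 ≤ 1 / (2 * (n : ℝ) ^ 2 * (D * r n ^ 3)) := by
    refine hl2v.trans ?_
    gcongr
  have hl4 : l n ^ 4 ≤ 1 / (4 * (n : ℝ) ^ 4 * D ^ 2 * r n ^ 6) := by
    calc l n ^ 4 = (l n ^ 2) ^ 2 := by ring
      _ ≤ (1 / (2 * (n : ℝ) ^ 2 * (D * r n ^ 3))) ^ 2 := by gcongr
      _ = _ := by ring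
  have hX : l n ^ 4 * ((n : ℝ) ^ 2 * (A₄ * r n ^ 5) + (n : ℝ) ^ 3 * (A₂ * r n ^ 3) ^ 2) ≤ Xb n := by
    calc _ ≤ 1 / (4 * (n : ℝ) ^ 4 * D ^ 2 * r n ^ 6)
          * ((n : ℝ) ^ 2 * (A₄ * r n ^ 5) + (n : ℝ) ^ 3 * (A₂ * r n ^ 3) ^ 2) := by gcongr
      _ = _ := by
          simp only [hXb]
          field_simp
  have hG : l n ^ 4 * (n : ℝ) ^ 4 * (A₇ * r n ^ 7) ≤ A₇ / (4 * D ^ 2) * r n := by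
    calc _ ≤ 1 / (4 * (n : ℝ) ^ 4 * D ^ 2 * r n ^ 6) * (n : ℝ) ^ 4 * (A₇ * r n ^ 7) := by gcongr
      _ = _ := by field_simp
  gcongr ?_ * (?_ + ?_ + ?_ + ?_ + ?_)
  · refine le_of_eq (congrArg _ ?_)
    rw [hln, hV']
    field_simp
  · gcongr
  · gcongr
  · calc _ ≤ 2 * √(Xb n) * (1 / (2 * (n : ℝ) ^ 2 * v n)) * (n : ℝ) ^ 2 * v n := by gcongr
      _ = _ := by field_simp
  · calc _ ≤ 100 / √(Xb n) * Xb n := by gcongr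
      _ = 100 * (Xb n / √(Xb n)) := by ring
      _ = _ := by rw [Real.div_sqrt]

theorem isTheta_sigma2Sq : (fun n => sigma2Sq g (r n)) =Θ[atTop] fun n => r n ^ 3 := by
  have hM := hg.one_le
  obtain ⟨D, r₂, hD, hr₂, hr₂8, h2⟩ := hg.exists_le_integral_sq_proj₂_centKer
  constructor
  · refine IsBigO.of_bound ((4 * M) ^ 3) ?_
    filter_upwards [hpos, hr.eventually_le_const hr₂] with n hn hn'
    have h := (hg.localKernel_centKer (hr0 n)).integral_sq_proj₂_le hg hn.le (by linarith)
    have h0 := h2 (r n) hn hn'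
    rw [hg.sigma2Sq_eq (hr0 n), Real.norm_eq_abs, Real.norm_eq_abs,
      abs_of_nonneg (le_trans (by positivity) h0), abs_of_pos (by positivity : 0 < r n ^ 3)]
    linarith
  · refine IsBigO.of_bound (1 / D) ?_
    filter_upwards [hpos, hr.eventually_le_const hr₂] with n hn hn'
    have h0 := h2 (r n) hn hn'
    rw [hg.sigma2Sq_eq (hr0 n), Real.norm_eq_abs, Real.norm_eq_abs,
      abs_of_nonneg (le_trans (by positivity) h0), abs_of_pos (by positivity : 0 < r n ^ 3),
      one_div, ← div_eq_inv_mul, le_div_iff₀ hD]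
    linarith

/-- The quantity is the ratio of the linear to the quadratic variance scale: O(n r⁵) in general, and
eventually zero for the uniform density. -/
theorem tendsto_cast_mul_integral_sq_proj₁_div
    (h : Tendsto (fun n : ℕ => (n : ℝ) * r n ^ 5) atTop (𝓝 0) ∨ ∀ x, g x = 1) :
    Tendsto (fun n : ℕ => (n : ℝ) * (∫ x, proj₁ (law g) (centKer g (r n)) x ^ 2 ∂(law g))
      / r n ^ 3) atTop (𝓝 0) := by
  have := hg.isProbabilityMeasure
  rcases h with h | h
  · obtain ⟨K, r₁, hK, hr₁, hr₁8, h1⟩ := hg.exists_integral_sq_proj₁_centKer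
    have hb := h.const_mul (K ^ 2)
    rw [mul_zero] at hb
    refine squeeze_zero' ?_ ?_ hb
    · filter_upwards [hpos] with n hn
      have : 0 ≤ ∫ x, proj₁ (law g) (centKer g (r n)) x ^ 2 ∂(law g) :=
        integral_nonneg fun _ => sq_nonneg _
      positivity
    · filter_upwards [hpos, hr.eventually_le_const hr₁, eventually_cast_pos] with n hn hn' hN
      have hp := hg.integral_sq_proj₁_centKer_le hr0 (h1 (r n) hn hn').1
      calc _ ≤ (n : ℝ) * (K * r n ^ 4) ^ 2 / r n ^ 3 := by gcongr
        _ = _ := by field_simp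
  · refine tendsto_const_nhds.congr' ?_
    filter_upwards [hr.eventually_lt_const (by norm_num : (0 : ℝ) < 1 / 8)] with n hn
    simp_rw [hg.proj₁_centKer_eq_zero_of_const h (hr0 n) hn]
    simp

variable {Ω : ℕ → Type*} [∀ n, MeasurableSpace (Ω n)] {P : ∀ n, Measure (Ω n)}
  [∀ n, IsProbabilityMeasure (P n)] {X : ∀ n, Fin n → Ω n → ℝ}
  (hX_law : ∀ n i, HasLaw (X n i) (law g) (P n)) (hX_indep : ∀ n, iIndepFun (X n) (P n))
  {C : ∀ n, Ω n → ℝ} (hC : ∀ n ω, C n ω = clustering (adj (r n) fun i => X n i ω))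
include hX_law hX_indep hC

theorem tendstoInDistribution_intermediate
    (hnr : Tendsto (fun n : ℕ => (n : ℝ) * r n) atTop atTop)
    (h32 : Tendsto (fun n : ℕ => (n : ℝ) ^ 3 * r n ^ 2) atTop atTop)
    (hp : Tendsto (fun n : ℕ => (n : ℝ) * (∫ x, proj₁ (law g) (centKer g (r n)) x ^ 2 ∂(law g))
      / r n ^ 3) atTop (𝓝 0)) :
    TendstoInDistribution
      (fun (n : ℕ) ω => 2 * √2 * (n : ℝ) * r n ^ 2 * Ef2 g / (3 * √(sigma2Sq g (r n))) *
        (C n ω - mu g (r n))) atTop id P (gaussianReal 0 1) := by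
  have := hg.isProbabilityMeasure
  have hF := hg.Ef2_pos
  have hM := hg.one_le
  obtain ⟨D, r₂, hD, hr₂, hr₂8, h2⟩ := hg.exists_le_integral_sq_proj₂_centKer
  have hy := hnr.inv_tendsto_atTop
  obtain ⟨v, hv⟩ : ∃ v : ℕ → ℝ, ∀ n, ∫ x, ∫ y, proj₂ (law g) (centKer g (r n)) x y ^ 2
    ∂(law g) ∂(law g) = v n := ⟨_, fun _ => rfl⟩
  obtain ⟨p, hpdef⟩ : ∃ p : ℕ → ℝ, ∀ n, ∫ x, proj₁ (law g) (centKer g (r n)) x ^ 2 ∂(law g) = p n :=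
    ⟨_, fun _ => rfl⟩
  have hp' := hp
  simp only [hpdef] at hp'
  have hp0 : ∀ n, 0 ≤ p n := fun n => hpdef n ▸ integral_nonneg fun _ => sq_nonneg _
  -- The stated normalisation divided by 4 n³ r² E f². A sum over ordered pairs has variance about 2
  -- n² v, and 9 n² l² · 2 n² v = 1.
  set l : ℕ → ℝ := fun n => √2 / (6 * (n : ℝ) ^ 2 * √(v n)) with hl
  have hvpos : ∀ᶠ n in atTop, 0 < v n ∧ D * r n ^ 3 ≤ v n := by
    filter_upwards [hpos, hr.eventually_le_const hr₂] with n hn hn'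
    have := (h2 (r n) hn hn').trans_eq (hv n)
    exact ⟨lt_of_lt_of_le (by positivity) this, this⟩
  have hl2 : ∀ᶠ n : ℕ in atTop, l n ^ 2 = 1 / (18 * (n : ℝ) ^ 4 * v n) := by
    filter_upwards [hvpos, eventually_cast_pos] with n hn hN
    have q2 : √(v n) ^ 2 = v n := Real.sq_sqrt hn.1.le
    have q3 : √(2 : ℝ) ^ 2 = 2 := Real.sq_sqrt (by norm_num)
    have e : l n ^ 2 = √2 ^ 2 / (36 * (n : ℝ) ^ 4 * √(v n) ^ 2) := by
      simp only [hl]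
      ring
    have hvn := hn.1
    rw [e, q2, q3]
    field_simp
    norm_num
  have hl2' : ∀ᶠ n : ℕ in atTop, l n ^ 2 ≤ 1 / (18 * (n : ℝ) ^ 4 * (D * r n ^ 3)) := by
    filter_upwards [hvpos, eventually_cast_pos, hl2, hpos] with n hn hN hln hrn
    rw [hln]
    have := hn.2
    gcongr
  refine hg.tendstoInDistribution_clustering hr hX_law hX_indep hC hpos h32 (l := l)
    (W' := fun n x => 3 * ((n : ℝ) - 2) * l n * distinctSum₂ (deg₂ (law g) (centKer g (r n))) x)
    ?_ ?_ (B := 6000 / (18 * D) * (64 * M ^ 3) + 1) ?_ ?_ (hg.tendsto_charFun_intermediate hr0 hr hpos hnr hp ?_)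
  · filter_upwards [hpos, eventually_cast_pos, hvpos] with n hn hN hvn
    have hvn := hvn.1
    rw [hg.sigma2Sq_eq (hr0 n), hv]
    simp only [hl]
    field_simp
    norm_num
  · intro n
    have hb : BddMeas fun x : Fin n → ℝ => distinctSum₂ (deg₂ (law g) (centKer g (r n))) x :=
      ((hg.localKernel_centKer (hr0 n)).bdd_deg₂).distinctSum₂
    fun_prop
  · have hlim : Tendsto (fun n : ℕ => 6000 / (18 * D) * (16 * M ^ 2 * ((n : ℝ) * r n)⁻¹
        + 64 * M ^ 3 + (n : ℝ) * p n / r n ^ 3)) atTop (𝓝 (6000 / (18 * D) * (64 * M ^ 3))) := by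
      have := (((hy.const_mul (16 * M ^ 2)).add_const (64 * M ^ 3)).add hp').const_mul
        (6000 / (18 * D))
      simp only [mul_zero, zero_add, add_zero] at this
      exact this
    filter_upwards [hlim.eventually_le_const (lt_add_one _), hpos, hr.eventually_le_const hr₂,
      eventually_ge_atTop 1, hl2'] with n hle hn hn' hn1 hln
    have hN : (0 : ℝ) < n := by exact_mod_cast hn1
    have h2 := hg.integral_sq_centKer_le hn1 hn.le (by linarith) (hpdef n).le
    have hpn := hp0 n
    calc _ ≤ 1 / (18 * (n : ℝ) ^ 4 * (D * r n ^ 3)) * _ :=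
          mul_le_mul hln h2 (integral_nonneg fun _ => sq_nonneg _) (by positivity)
      _ = _ := by
        field_simp
        ring
      _ ≤ _ := hle
  · have hlim : Tendsto (fun n : ℕ => 1 / (18 * D) * (3456 * (16 * M ^ 2) * ((n : ℝ) * r n)⁻¹
        + 18 * ((n : ℝ) * p n / r n ^ 3))) atTop (𝓝 0) := by
      have := ((hy.const_mul (3456 * (16 * M ^ 2))).add (hp'.const_mul 18)).const_mul (1 / (18 * D))
      simp only [mul_zero, add_zero] at this
      exact this
    refine squeeze_zero' (Eventually.of_forall fun n => integral_nonneg fun _ => sq_nonneg _) ?_ hlim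
    filter_upwards [hpos, hr.eventually_le_const hr₂, eventually_ge_atTop 1, hl2'] with n hn hn' hn1 hln
    have hN : (1 : ℝ) ≤ n := by exact_mod_cast hn1
    have h2 := hg.integral_sq_centKer_sub_distinctSum₂_le (n := n) hn.le (by linarith)
      (hpdef n).le
    have e : ∀ x : Fin n → ℝ, (l n * distinctSum₃ (centKer g (r n)) x
        - 3 * ((n : ℝ) - 2) * l n * distinctSum₂ (deg₂ (law g) (centKer g (r n))) x) ^ 2
        = l n ^ 2 * (distinctSum₃ (centKer g (r n)) x - 3 * ((n : ℝ) - 2) *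
          distinctSum₂ (deg₂ (law g) (centKer g (r n))) x) ^ 2 := fun x => by ring
    simp_rw [e]
    rw [integral_const_mul]
    have hq : (((n : ℝ) - 1) * ((n : ℝ) - 2)) ^ 2 ≤ (n : ℝ) ^ 4 := by
      have h1 : ((n : ℝ) - 2) ^ 2 ≤ (n : ℝ) ^ 2 := by nlinarith
      have h2 : ((n : ℝ) - 1) ^ 2 ≤ (n : ℝ) ^ 2 := by nlinarith
      rw [mul_pow]
      calc _ ≤ (n : ℝ) ^ 2 * (n : ℝ) ^ 2 := by gcongr
        _ = _ := by ring
    have hpn := hp0 n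
    calc _ ≤ 1 / (18 * (n : ℝ) ^ 4 * (D * r n ^ 3)) * (3456 * (n : ℝ) ^ 3 * (4 * M * r n) ^ 2
          + 18 * (n : ℝ) ^ 4 * ((n : ℝ) * p n)) := by
          refine mul_le_mul hln (h2.trans ?_) (integral_nonneg fun _ => sq_nonneg _) (by positivity)
          gcongr
      _ = _ := by
        field_simp
        ring
  · filter_upwards [hl2, hvpos, eventually_cast_pos] with n hln hvn hN
    have hvn := hvn.1
    rw [mul_pow, mul_pow, hln, hv]
    field_simp
    ring

end SmoothDensity

/-! ### Sparse regime: the full triple sum. -/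

namespace SmoothDensity

variable {g g1 g2 : ℝ → ℝ} {c M : ℝ} (hg : SmoothDensity g g1 g2 c M)
  {r : ℕ → ℝ} (hr0 : ∀ n, 0 ≤ r n) (hr : Tendsto r atTop (𝓝 0)) (hpos : ∀ᶠ n in atTop, 0 < r n)

include hg hr hpos

theorem tendsto_kmean_centKer_sq_div :
    Tendsto (fun n => 8 / (3 * Ef2 g) * (kmean (law g) (fun x y z => centKer g (r n) x y z ^ 2)
      / r n ^ 2)) atTop (𝓝 1) := by
  obtain ⟨K, r₀, hK, hr₀, hr₀8, h⟩ := hg.exists_kmean_centKer_sq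
  have hF := hg.Ef2_pos
  rw [tendsto_iff_norm_sub_tendsto_zero]
  have hb := hr.const_mul (8 / (3 * Ef2 g) * K)
  rw [mul_zero] at hb
  refine squeeze_zero' (Eventually.of_forall fun n => norm_nonneg _) ?_ hb
  filter_upwards [hpos, hr.eventually_le_const hr₀] with n hn hn'
  have h2 := h (r n) hn hn'
  set k := kmean (law g) (fun x y z => centKer g (r n) x y z ^ 2)
  have e : 8 / (3 * Ef2 g) * (k / r n ^ 2) - 1
      = (k - 3 / 8 * r n ^ 2 * Ef2 g) * (8 / (3 * Ef2 g * r n ^ 2)) := by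
    field_simp
  rw [Real.norm_eq_abs, e, abs_mul, abs_of_pos (by positivity : 0 < 8 / (3 * Ef2 g * r n ^ 2))]
  calc _ ≤ K * r n ^ 3 * (8 / (3 * Ef2 g * r n ^ 2)) := by gcongr
    _ = _ := by field_simp

include hr0

-- The whole kernel is used rather than its degenerate part because it is dominated by products of
-- neighbour indicators. The variance 6 n³ l² E h² tends to 1 since E h² is asymptotic to (3/8) r² E
-- f², and the errors vanish with n r, 1/n and (n³ r²)⁻¹.
set_option maxHeartbeats 1000000 in
theorem tendsto_charFun_sparse (hnr : Tendsto (fun n : ℕ => (n : ℝ) * r n) atTop (𝓝 0))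
    (h32 : Tendsto (fun n : ℕ => (n : ℝ) ^ 3 * r n ^ 2) atTop atTop) {l : ℕ → ℝ}
    (hl : ∀ n : ℕ, l n = √(4 / (9 * Ef2 g) * ((n : ℝ) ^ 3 * r n ^ 2)⁻¹)) (t : ℝ) :
    Tendsto (fun n => ∫ x, Complex.exp (((t * (l n * distinctSum₃ (centKer g (r n)) x) : ℝ) : ℂ)
      * Complex.I) ∂(Measure.pi fun _ : Fin n => law g)) atTop
      (𝓝 (Complex.exp (-(t : ℂ) ^ 2 / 2))) := by
  have := hg.isProbabilityMeasure
  have hM := hg.one_le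
  have hF := hg.Ef2_pos
  obtain ⟨K, r₁, hK, hr₁, hr₁8, h1⟩ := hg.exists_integral_sq_proj₁_centKer
  obtain ⟨k, hk2⟩ : ∃ k : ℕ → ℝ, ∀ n, kmean (law g) (fun x y z => centKer g (r n) x y z ^ 2) = k n :=
    ⟨_, fun _ => rfl⟩
  have hklim := hg.tendsto_kmean_centKer_sq_div hr hpos
  simp only [hk2] at hklim
  set F := Ef2 g
  obtain ⟨a, ha⟩ : ∃ a : ℝ, a = 4 / (9 * F) := ⟨_, rfl⟩
  have ha0 : 0 < a := by rw [ha]; positivity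
  rw [← ha] at hl
  have hy : Tendsto (fun n : ℕ => ((n : ℝ) ^ 3 * r n ^ 2)⁻¹) atTop (𝓝 0) := h32.inv_tendsto_atTop
  have h1n := tendsto_const_div_atTop_nhds_zero_nat (1 : ℝ)
  have hl0 : ∀ n, 0 ≤ l n := fun n => by rw [hl]; positivity
  have hl2 : ∀ n : ℕ, l n ^ 2 = a * ((n : ℝ) ^ 3 * r n ^ 2)⁻¹ := fun n => by
    rw [hl, Real.sq_sqrt (by positivity)]
  have hllim : Tendsto l atTop (𝓝 0) := by
    have := (hy.const_mul a).sqrt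
    simp only [mul_zero, Real.sqrt_zero] at this
    exact this.congr fun n => (hl n).symm
  set y : ℕ → ℝ := fun n => ((n : ℝ) ^ 3 * r n ^ 2)⁻¹ with hydef
  set w : ℕ → ℝ := fun n => (n : ℝ) * r n with hw
  -- `T₅` equals 3 l² n ω for p = 4 M r: the contribution of vertices with at least three
  -- neighbours.
  set T₅ : ℕ → ℝ := fun n => 3 * a * (256 * M ^ 4 * w n ^ 2 + 256 * M ^ 3 * w n) with hT₅
  have hT₅lim : Tendsto T₅ atTop (𝓝 0) := by
    have := (((hnr.pow 2).const_mul (256 * M ^ 4)).add (hnr.const_mul (256 * M ^ 3))).const_mul (3 * a)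
    simpa using this
  set Q : ℕ → ℝ := fun n => 16 * M ^ 2 * y n + 64 * M ^ 3 * (y n * w n) + 256 * M ^ 4 * (1 / (n : ℝ))
    with hQ
  have hQlim : Tendsto Q atTop (𝓝 0) := by
    have := ((hy.const_mul (16 * M ^ 2)).add ((hy.mul hnr).const_mul (64 * M ^ 3))).add
      (h1n.const_mul (256 * M ^ 4))
    simp only [mul_zero, add_zero] at this
    exact this
  have hδ : Tendsto (fun n : ℕ => (√(256 * a * M ^ 3 * w n) + √(4 * a * K ^ 2 * (w n ^ 3 * r n ^ 3)))
      + (|(1 - 1 / (n : ℝ)) * (1 - 2 / (n : ℝ)) * (8 / (3 * F) * (k n / r n ^ 2)) - 1|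
        + √(216000 * a ^ 2 * Q n) + T₅ n)
      + (T₅ n * (1 + 6 * l n) + 576 * a * M ^ 2 * l n)) atTop (𝓝 0) := by
    have e1 := (hnr.const_mul (256 * a * M ^ 3)).sqrt
    have e2 := (((hnr.pow 3).mul (hr.pow 3)).const_mul (4 * a * K ^ 2)).sqrt
    have e3 := ((((tendsto_one_sub_div 1).mul (tendsto_one_sub_div 2)).mul hklim).sub_const 1).abs
    have e4 := (hQlim.const_mul (216000 * a ^ 2)).sqrt
    have e5 := hT₅lim.mul ((hllim.const_mul 6).const_add 1)
    have e6 := hllim.const_mul (576 * a * M ^ 2)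
    have := ((e1.add e2).add ((e3.add e4).add hT₅lim)).add (e5.add e6)
    simpa using this
  refine tendsto_of_norm_sub_le (K := 2 * (1 + |t|) ^ 2 * |t| * Real.exp (t ^ 2 / 2)) ?_ hδ
  filter_upwards [hpos, hr.eventually_le_const hr₁, eventually_ge_atTop 1] with n hn hn₁ hn1
  have hN : (1 : ℝ) ≤ n := by exact_mod_cast hn1
  have : Nonempty (Fin n) := ⟨⟨0, hn1⟩⟩
  have hρ8 : r n < 1 / 8 := by linarith
  have hk := hg.localKernel_centKer (hr0 n)
  have c1 := hk.sq.integral_sq_proj₁_le hg hn.le hρ8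
  have c2 := hk.sq.integral_sq_proj₂_le hg hn.le hρ8
  have c3 := hk.sq.integral_sq_le hg hn.le hρ8
  have hY : (n : ℝ) ^ 3 * ∫ u, ∫ v, ∫ w, (centKer g (r n) u v w ^ 2) ^ 2 ∂(law g) ∂(law g) ∂(law g)
      + (n : ℝ) ^ 4 * ∫ u, ∫ v, proj₂ (law g) (fun u v w => centKer g (r n) u v w ^ 2) u v ^ 2
        ∂(law g) ∂(law g)
      + (n : ℝ) ^ 5 * ∫ u, proj₁ (law g) (fun u v w => centKer g (r n) u v w ^ 2) u ^ 2 ∂(law g)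
      ≤ (n : ℝ) ^ 3 * (4 * M * r n) ^ 2 + (n : ℝ) ^ 4 * (4 * M * r n) ^ 3
        + (n : ℝ) ^ 5 * (4 * M * r n) ^ 4 := by
    gcongr
  have hnear : ∀ c, ∫ a, near (2 * r n) a c ∂(law g) ≤ 4 * M * r n := fun c => by
    have e : (fun a => near (2 * r n) a c) = near (2 * r n) c := funext fun a => near_comm _ c a
    rw [e]
    exact (hg.integral_near_le (by linarith) (by linarith) c).trans (le_of_eq (by ring))
  have main := norm_charFun_distinctSum₃_le (ν := law g) (ι := Fin n) (l := l n) (b := near (2 * r n))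
    (Y := (n : ℝ) ^ 3 * (4 * M * r n) ^ 2 + (n : ℝ) ^ 4 * (4 * M * r n) ^ 3
        + (n : ℝ) ^ 5 * (4 * M * r n) ^ 4) hk.toSymmKernel
    (hg.kmean_centKer (hr0 n)) (bddMeas_near (2 * r n))
    (near_eq_zero_or_one (2 * r n)) hk.abs_le (p := 4 * M * r n) hnear (by positivity) (h1 (r n) hn hn₁).1 (hk.integral_sq_proj₂_le hg hn.le hρ8)
    (by rw [Fintype.card_fin]; exact hY) rfl (hl0 n) t
  rw [Fintype.card_fin, hk2] at main
  refine main.trans ?_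
  have hN0 : (0 : ℝ) < n := by linarith
  have hω : 3 * l n ^ 2 * (n : ℝ) * (((n : ℝ) * (4 * M * r n)) ^ 4 + 4 * ((n : ℝ) * (4 * M * r n)) ^ 3)
      = T₅ n := by
    simp only [hl2, hT₅, hw]
    field_simp
    ring
  have hsq : ∀ {u s : ℝ}, 0 ≤ u → u ^ 2 = s → u ≤ √s := fun hu h => by
    rw [← h, Real.sqrt_sq hu]
  rw [mul_add ((n : ℝ) * l n)]
  gcongr ?_ * ((?_ + ?_) + (?_ + ?_ + ?_) + ?_)
  · have := hl0 n
    refine hsq (by positivity) ?_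
    rw [mul_pow, mul_pow, hl2, Real.sq_sqrt (by positivity)]
    simp only [hw]
    field_simp
    ring
  · have := hl0 n
    refine hsq (by positivity) ?_
    rw [mul_pow, mul_pow, hl2]
    simp only [hw]
    field_simp
    ring
  · refine le_of_eq (congrArg _ ?_)
    rw [hl2, ha]
    field_simp
    ring
  · refine hsq (by positivity) ?_
    rw [mul_pow, mul_pow, Real.sq_sqrt (by positivity), hl2]
    simp only [hQ, hydef, hw]
    field_simp
    ring
  · exact hω.le
  · have e : 3 * (n : ℝ) * l n ^ 2 * ((n : ℝ) * (4 * M * r n)) ^ 2 = 48 * a * M ^ 2 := by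
      rw [hl2]
      field_simp
      ring
    calc _ = 3 * l n ^ 2 * (n : ℝ) * (((n : ℝ) * (4 * M * r n)) ^ 4
            + 4 * ((n : ℝ) * (4 * M * r n)) ^ 3) * (1 + 6 * l n)
          + 12 * l n * (3 * (n : ℝ) * l n ^ 2 * ((n : ℝ) * (4 * M * r n)) ^ 2) := by ring
      _ = T₅ n * (1 + 6 * l n) + 12 * l n * (48 * a * M ^ 2) := by rw [hω, e]
      _ ≤ _ := le_of_eq (by ring)

variable {Ω : ℕ → Type*} [∀ n, MeasurableSpace (Ω n)] {P : ∀ n, Measure (Ω n)}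
  [∀ n, IsProbabilityMeasure (P n)] {X : ∀ n, Fin n → Ω n → ℝ}
  (hX_law : ∀ n i, HasLaw (X n i) (law g) (P n)) (hX_indep : ∀ n, iIndepFun (X n) (P n))
  {C : ∀ n, Ω n → ℝ} (hC : ∀ n ω, C n ω = clustering (adj (r n) fun i => X n i ω))
include hX_law hX_indep hC

theorem tendstoInDistribution_sparse
    (hnr : Tendsto (fun n : ℕ => (n : ℝ) * r n) atTop (𝓝 0))
    (h32 : Tendsto (fun n : ℕ => (n : ℝ) ^ 3 * r n ^ 2) atTop atTop) :
    TendstoInDistribution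
      (fun (n : ℕ) ω => 8 * (n : ℝ) * √(n : ℝ) * r n * √(Ef2 g) / 3 * (C n ω - mu g (r n)))
      atTop id P (gaussianReal 0 1) := by
  have := hg.isProbabilityMeasure
  have hF := hg.Ef2_pos
  have hM := hg.one_le
  obtain ⟨K, r₁, hK, hr₁, hr₁8, h1⟩ := hg.exists_integral_sq_proj₁_centKer
  obtain ⟨l, hl⟩ : ∃ l : ℕ → ℝ, ∀ n : ℕ, l n = √(4 / (9 * Ef2 g) * ((n : ℝ) ^ 3 * r n ^ 2)⁻¹) :=
    ⟨_, fun _ => rfl⟩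
  have hl2 : ∀ n : ℕ, l n ^ 2 = 4 / (9 * Ef2 g) * ((n : ℝ) ^ 3 * r n ^ 2)⁻¹ := fun n => by
    rw [hl, Real.sq_sqrt (by positivity)]
  refine hg.tendstoInDistribution_clustering hr hX_law hX_indep hC hpos h32 (l := l)
    (W' := fun n x => l n * distinctSum₃ (centKer g (r n)) x) ?_ ?_
    (B := 8000 / (3 * Ef2 g) * (16 * M ^ 2) + 1) ?_ ?_
    (hg.tendsto_charFun_sparse hr0 hr hpos hnr h32 hl)
  · filter_upwards [hpos, eventually_cast_pos] with n hn hN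
    have q1 : √(n : ℝ) ^ 2 = n := Real.sq_sqrt hN.le
    have q2 : √(Ef2 g) ^ 2 = Ef2 g := Real.sq_sqrt hF.le
    rw [hl, eq_comm, Real.sqrt_eq_iff_mul_self_eq (by positivity) (by positivity), ← pow_two]
    have e : (8 * (n : ℝ) * √(n : ℝ) * r n * √(Ef2 g) / 3 / (4 * (n : ℝ) ^ 3 * r n ^ 2 * Ef2 g)) ^ 2
        = (8 * (n : ℝ) * r n / 3 / (4 * (n : ℝ) ^ 3 * r n ^ 2 * Ef2 g)) ^ 2
          * (√(n : ℝ) ^ 2 * √(Ef2 g) ^ 2) := by ring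
    rw [e, q1, q2]
    field_simp
    norm_num
  · intro n
    have hkb := (hg.localKernel_centKer (hr0 n)).bdd
    have hb : BddMeas fun x : Fin n → ℝ => distinctSum₃ (centKer g (r n)) x := hkb.distinctSum₃
    fun_prop
  · have hlim : Tendsto (fun n : ℕ => 8000 / (3 * Ef2 g) * (16 * M ^ 2 + 64 * M ^ 3 * ((n : ℝ) * r n)
        + K ^ 2 * (((n : ℝ) * r n) ^ 2 * r n ^ 4))) atTop (𝓝 (8000 / (3 * Ef2 g) * (16 * M ^ 2))) := by
      have := (((hnr.const_mul (64 * M ^ 3)).const_add (16 * M ^ 2)).add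
        (((hnr.pow 2).mul (hr.pow 4)).const_mul (K ^ 2))).const_mul (8000 / (3 * Ef2 g))
      simpa using this
    filter_upwards [hlim.eventually_le_const (lt_add_one _), hpos, hr.eventually_le_const hr₁,
      eventually_ge_atTop 1] with n hle hn hn' hn1
    have hN : (0 : ℝ) < n := by exact_mod_cast hn1
    have hp := hg.integral_sq_proj₁_centKer_le hr0 (h1 (r n) hn hn').1
    have h2 := hg.integral_sq_centKer_le hn1 hn.le (by linarith) hp
    calc _ ≤ l n ^ 2 * _ := mul_le_mul_of_nonneg_left h2 (sq_nonneg _)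
      _ = _ := by
        rw [hl2]
        field_simp
        ring
      _ ≤ _ := hle
  -- The approximating statistic is the normalised sum itself, so the difference is identically
  -- zero.
  · simp

end SmoothDensity

end RGG

/-! ### Relations between the growth conditions, and assembly. -/

theorem RGG.tendsto_cube_mul_sq_of_mul {r : ℕ → ℝ}
    (h : Tendsto (fun n : ℕ => (n : ℝ) * r n) atTop atTop) :
    Tendsto (fun n : ℕ => (n : ℝ) ^ 3 * r n ^ 2) atTop atTop := by
  refine ((h.atTop_mul_atTop₀ h).atTop_mul_atTop₀ tendsto_natCast_atTop_atTop).congr fun n => ?_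
  ring

theorem RGG.tendsto_mul_of_mul_pow_five {r : ℕ → ℝ} (hr : ∀ n, r n ∈ Set.Icc (0 : ℝ) (1 / 2))
    (h : Tendsto (fun n : ℕ => (n : ℝ) * r n ^ 5) atTop atTop) :
    Tendsto (fun n : ℕ => (n : ℝ) * r n) atTop atTop := by
  refine tendsto_atTop_mono (fun n => ?_) h
  have := pow_le_of_le_one (hr n).1 (by linarith [(hr n).2]) (by norm_num : 5 ≠ 0)
  gcongr

/-- A radius r n = 0 is allowed for individual n, but the expansions divide by powers of r; the
growth condition excludes it eventually. -/
theorem RGG.eventually_pos_of_tendsto {r : ℕ → ℝ} (hr : ∀ n, 0 ≤ r n)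
    (h : Tendsto (fun n : ℕ => (n : ℝ) ^ 3 * r n ^ 2) atTop atTop) : ∀ᶠ n in atTop, 0 < r n := by
  filter_upwards [h.eventually_gt_atTop 0] with n hn
  refine (hr n).lt_of_ne fun h0 => ?_
  simp [← h0] at hn

theorem theorem1
    (g : ℝ → ℝ)
    (hg_per : Function.Periodic g 1)
    (hg_pos : ∃ c : ℝ, 0 < c ∧ ∀ x, c ≤ g x)
    (hg_diff : ∀ k : ℕ, k < 4 → Differentiable ℝ (iteratedDeriv k g))
    (hg_bdd : ∃ M : ℝ, ∀ x, |iteratedDeriv 4 g x| ≤ M)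
    (hg_int : ∫ x in (0 : ℝ)..1, g x = 1)
    (r : ℕ → ℝ)
    (hr_mem : ∀ n, r n ∈ Set.Icc (0 : ℝ) (1 / 2))
    (hr_lim : Tendsto r atTop (𝓝 0))
    {Ω : ℕ → Type*} [∀ n, MeasurableSpace (Ω n)]
    (P : ∀ n, Measure (Ω n)) [∀ n, IsProbabilityMeasure (P n)]
    (X : ∀ n, Fin n → Ω n → ℝ)
    (hX_law : ∀ n i, HasLaw (X n i) (RGG.law g) (P n))
    (hX_indep : ∀ n, iIndepFun (X n) (P n))
    (C : ∀ n, Ω n → ℝ)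
    (hC : ∀ n ω, C n ω = RGG.clustering (RGG.adj (r n) fun i => X n i ω)) :
    -- (I) dense regime
    (Tendsto (fun n : ℕ => (n : ℝ) * r n ^ 5) atTop atTop →
      0 < RGG.sigma1Sq g →
      TendstoInDistribution
        (fun (n : ℕ) ω => 16 * √(n : ℝ) * RGG.Ef2 g / (3 * r n ^ 2 * √(RGG.sigma1Sq g)) *
          (C n ω - RGG.mu g (r n)))
        atTop id P (gaussianReal 0 1)) ∧
    -- (II) intermediate regime
    (Tendsto (fun n : ℕ => (n : ℝ) * r n) atTop atTop →
      ((fun n => RGG.sigma2Sq g (r n)) =Θ[atTop] fun n => r n ^ 3) ∧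
      ((Tendsto (fun n : ℕ => (n : ℝ) * r n ^ 5) atTop (𝓝 0) ∨ ∀ x, g x = 1) →
        TendstoInDistribution
          (fun (n : ℕ) ω => 2 * √2 * (n : ℝ) * r n ^ 2 * RGG.Ef2 g /
            (3 * √(RGG.sigma2Sq g (r n))) * (C n ω - RGG.mu g (r n)))
          atTop id P (gaussianReal 0 1))) ∧
    -- (III) sparse regime
    (Tendsto (fun n : ℕ => (n : ℝ) * r n) atTop (𝓝 0) →
      Tendsto (fun n : ℕ => (n : ℝ) ^ 3 * r n ^ 2) atTop atTop →
      TendstoInDistribution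
        (fun (n : ℕ) ω => 8 * (n : ℝ) * √(n : ℝ) * r n * √(RGG.Ef2 g) / 3 *
          (C n ω - RGG.mu g (r n)))
        atTop id P (gaussianReal 0 1)) ∧
    -- convergence in probability; the condition holds in each of the three regimes
    (Tendsto (fun n : ℕ => (n : ℝ) ^ 3 * r n ^ 2) atTop atTop →
      ∀ ε : ℝ, 0 < ε →
        Tendsto (fun n => P n {ω | ε ≤ |C n ω - 3 / 4|}) atTop (𝓝 0)) := by

  have hr0 : ∀ n, 0 ≤ r n := fun n => (hr_mem n).1
  obtain ⟨c, M, hg⟩ := RGG.exists_smoothDensity hg_per hg_pos hg_diff hg_int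
  refine ⟨fun h5 hs => ?_, fun hnr => ?_, fun hnr h32 => ?_, fun h32 ε hε => ?_⟩
  · have h32 := RGG.tendsto_cube_mul_sq_of_mul (RGG.tendsto_mul_of_mul_pow_five hr_mem h5)
    exact hg.tendstoInDistribution_dense hr0 hr_lim (RGG.eventually_pos_of_tendsto hr0 h32)
      hX_law hX_indep hC hs h5 h32
  · have h32 := RGG.tendsto_cube_mul_sq_of_mul hnr
    have hpos := RGG.eventually_pos_of_tendsto hr0 h32
    exact ⟨hg.isTheta_sigma2Sq hr0 hr_lim hpos, fun h =>
      hg.tendstoInDistribution_intermediate hr0 hr_lim hpos hX_law hX_indep hC hnr h32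
        (hg.tendsto_cast_mul_integral_sq_proj₁_div hr0 hr_lim hpos h)⟩
  · exact hg.tendstoInDistribution_sparse hr0 hr_lim (RGG.eventually_pos_of_tendsto hr0 h32)
      hX_law hX_indep hC hnr h32
  · exact hg.tendsto_measure_clustering hr_lim hX_law hX_indep hC
      (RGG.eventually_pos_of_tendsto hr0 h32) h32 hε
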